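/- **Theorem (Trace formula).** Let $k$ be a finite field with $q$ elements, let $X$ be a connected projective scheme over $k$, smooth of dimension $1$, let $Y\subset X$ be a non-empty affine open subscheme, and let $R=\Gamma(Y,\mathcal O_X)$. Let $K$ be the function field of $X$, let $K_\infty=\prod_{x\in X\setminus Y}K_x$ be the product of the completions of $K$ at the points of $X\setminus Y$, and let $\|\cdot\|$ on $K_\infty$ be the maximum of the normalized absolute values of the $K_x$. The ring $R$ is embedded diagonally in $K_\infty$. Let $M$ be a finitely generated projective $R$-module and $\tau_M\colon M\to M$ an additive map with $\tau_M(rm)=r^q\tau_M(m)$ for all $r\in R$, $m\in M$. Let $\|\cdot\|$ be a non-archimedean norm on the $K_\infty$-module $M\otimes_RK_\infty$, i.e. a map to $\mathbf R_{\ge0}$ with $\|v\|=0$ iff $v=0$, $\|v+w\|\le\max(\|v\|,\|w\|)$ and $\|\lambda v\|\le\|\lambda\|\,\|v\|$ for $\lambda\in K_\infty$ (if $K_\infty$ is a field the last condition amounts to $\|\lambda v\|=\|\lambda\|\,\|v\|$), and equip $V=M\otimes_R(K_\infty/R)$ with the quotient norm. Let $R\{\tau\}$ be the twisted polynomial ring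 with $\tau r=r^q\tau$. It acts $k$-linearly on $M/\mathfrak mM$ for every maximal ideal $\mathfrak m\subset R$, with $\tau$ acting by the map induced by $\tau_M$, and on $V$, with $\tau$ acting by $m\otimes f\mapsto\tau_M(m)\otimes f^q$. Let $\Theta=\sum_{n}\theta_nZ^n\in R\{\tau\}[[Z]]\,\tau Z$, where $Z$ is a central variable. A *nucleus* of a continuous $k$-linear endomorphism $\phi$ of $V$ is an open subspace $U\subset V$ with $\phi(U)\subset U$ for which there is a real $c$ with $0<c<1$ and $\|\phi(v)\|\le c\|v\|$ for all $v\in U$; $\phi$ is *locally contracting* if such an inequality holds on some open subspace. Then every $\theta_n$ acts on $V$ as a (continuous) locally contracting endomorphism; for every $N$ the $\theta_n$ with $n<N$ have a common nucleus, all their common nuclei have finite codimension in $V$, and there is a unique power series $$D=\det_{k[[Z]]}(1+\Theta\mid V)\in k[[Z]]$$ which for every $N$, and every common nucleus $U$ of the $\theta_n$ with $n<N$, is congruent modulo $Z^N$ to the determinant of $1+\sum_{n<N}\theta_nZ^n$ on $(V/U)\otimes_kk[[Z]]/Z^N$. Moreover $D$ is invertible, and the product over all maximal ideals $\mathfrak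 m$ of $R$ $$\prod_{\mathfrak m}\det_{k[[Z]]}\bigl(1+\Theta\mid M/\mathfrak mM\bigr)$$ converges in $k[[Z]]$ (for the $Z$-adic topology, independently of the order of the factors) to $\det_{k[[Z]]}(1+\Theta\mid V)^{-1}$. -/

import Mathlib

open AlgebraicGeometry CategoryTheory TensorProduct PowerSeries
open scoped PowerSeries.WithPiTopology

universe u v

noncomputable section

namespace TraceFormula

/-! ### Nuclear endomorphisms and their determinants -/

section Determinants

variable {k : Type*} [Field k] {V : Type*} [AddCommGroup V] [Module k V]

/-- For a finite-dimensional `V`: the determinant over `k[[Z]]` of `1 + ∑_{n < N} φₙ Zⁿ`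
acting on `k[[Z]] ⊗ V`, where `Φ = ∑ φₙ Zⁿ`. -/
def truncDet (N : ℕ) (Φ : (Module.End k V)⟦X⟧) : k⟦X⟧ :=
  LinearMap.det ((1 : Module.End k⟦X⟧ (k⟦X⟧ ⊗[k] V)) +
    ∑ n ∈ Finset.range N, (X : k⟦X⟧) ^ n • (coeff n Φ).baseChange k⟦X⟧)

/-- For a finite-dimensional `V`: the determinant over `k[[Z]]` of `1 + Φ` acting on `V[[Z]]`,
i.e. the power series which for every `N` is congruent modulo `Z^N` to `truncDet N Φ`. -/
def finDet (Φ : (Module.End k V)⟦X⟧) : k⟦X⟧ :=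
  PowerSeries.mk fun n => coeff n (truncDet (n + 1) Φ)

/-- The endomorphism of `V/U` induced by `φ` when `φ(U) ⊆ U` (and `0` otherwise). -/
def quotEnd (U : Submodule k V) (φ : Module.End k V) : Module.End k (V ⧸ U) :=
  open Classical in if h : U ≤ U.comap φ then U.mapQ U φ h else 0

/-- The power series of endomorphisms of `V/U` induced coefficientwise by `Φ`. -/
def quotSeries (U : Submodule k V) (Φ : (Module.End k V)⟦X⟧) : (Module.End k (V ⧸ U))⟦X⟧ :=
  PowerSeries.mk fun n => quotEnd U (coeff n Φ)

/- `ν : V → ℝ` is the norm of a normed `k`-vector space `V`. -/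
variable (ν : V → ℝ)

/-- `U` is an open subspace of `(V, ν)`. -/
def IsOpenSubspace (U : Submodule k V) : Prop :=
  ∃ ε : ℝ, 0 < ε ∧ ∀ v, ν v < ε → v ∈ U

/-- `φ` is continuous for the metric `ν (v - w)`. -/
def IsContinuousEnd (φ : Module.End k V) : Prop :=
  ∀ v, ∀ ε : ℝ, 0 < ε → ∃ δ : ℝ, 0 < δ ∧ ∀ w, ν (w - v) < δ → ν (φ w - φ v) < ε

/-- `φ` contracts `U` by a constant factor `c < 1`. -/
def ContractsOn (φ : Module.End k V) (U : Submodule k V) : Prop :=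
  ∃ c : ℝ, 0 < c ∧ c < 1 ∧ ∀ v ∈ U, ν (φ v) ≤ c * ν v

/-- A continuous endomorphism is locally contracting if it contracts some open subspace. -/
def IsLocallyContracting (φ : Module.End k V) : Prop :=
  IsContinuousEnd ν φ ∧ ∃ U : Submodule k V, IsOpenSubspace ν U ∧ ContractsOn ν φ U

/-- A nucleus of `φ`: an open subspace, contracted by `φ` and mapped into itself by `φ`. -/
structure IsNucleus (φ : Module.End k V) (U : Submodule k V) : Prop where
  isOpen : IsOpenSubspace ν U
  contracts : ContractsOn ν φ U
  map_mem : ∀ v ∈ U, φ v ∈ U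

/-- `Φ = ∑ φₙ Zⁿ` is nuclear if every `φₙ` is locally contracting. -/
def IsNuclear (Φ : (Module.End k V)⟦X⟧) : Prop :=
  ∀ n, IsLocallyContracting ν (coeff n Φ)

/-- `U` is a common nucleus of the coefficients `φₙ` with `n < N`. For `N = 0` the condition is
only that `U` is an open subspace. -/
def IsCommonNucleus (Φ : (Module.End k V)⟦X⟧) (N : ℕ) (U : Submodule k V) : Prop :=
  IsOpenSubspace ν U ∧ ∀ n < N, IsNucleus ν (coeff n Φ) U

/-- `D` is the determinant `det_{k[[Z]]}(1 + Φ | V)`: the endomorphism `Φ` of `V[[Z]]` is nuclear,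
and for every `N` there are common nuclei `U` of the `φₙ` with `n < N`, all of them are of finite
codimension in `V`, and for each of them `D` is congruent modulo `Z^N` to the determinant of
`1 + Φ` on `(V/U)[[Z]]/Z^N`. -/
structure IsFredholmDet (Φ : (Module.End k V)⟦X⟧) (D : k⟦X⟧) : Prop where
  nuclear : IsNuclear ν Φ
  exists_nucleus : ∀ N, ∃ U : Submodule k V, IsCommonNucleus ν Φ N U
  finite_codim : ∀ N U, IsCommonNucleus ν Φ N U → FiniteDimensional k (V ⧸ U)
  congr_det : ∀ N U, IsCommonNucleus ν Φ N U →
    (X : k⟦X⟧) ^ N ∣ D - truncDet N (quotSeries U Φ)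

/-- The determinant is unique. -/
theorem IsFredholmDet.unique {Φ : (Module.End k V)⟦X⟧} {D D' : k⟦X⟧}
    (h : IsFredholmDet ν Φ D) (h' : IsFredholmDet ν Φ D') : D = D' := by
  ext n
  obtain ⟨U, hU⟩ := h.exists_nucleus (n + 1)
  have h1 : (X : k⟦X⟧) ^ (n + 1) ∣ D - D' := by
    have := dvd_sub (h.congr_det _ U hU) (h'.congr_det _ U hU)
    rwa [sub_sub_sub_cancel_right] at this
  have h2 := (X_pow_dvd_iff.1 h1) n (Nat.lt_succ_self n)
  rw [map_sub] at h2
  exact sub_eq_zero.1 h2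

end Determinants

/-! ### Twisted polynomials and `q`-semilinear maps -/

section Twisted

variable (k : Type*) [Field k] [Fintype k] (R : Type*) [CommRing R] [Algebra k R]

/-- The endomorphism `r ↦ r ^ q` of the `k`-algebra `R`, where `q = #k`. -/
def qFrob : R →+* R := (FiniteField.frobeniusAlgHom k R : R →+* R)

/-- The action of `ℕ` on `R` through powers of `r ↦ r ^ q`. -/
@[reducible]
def qAction : MulSemiringAction (Multiplicative ℕ) R :=
  MulSemiringAction.compHom R (powersHom (R →+* R) (qFrob k R))

/-- The twisted polynomial ring `R{τ}`, with `τ r = r ^ q τ`. -/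
def TwistedPoly : Type _ := let _ := k; SkewPolynomial R

instance : Ring (TwistedPoly k R) :=
  letI := qAction k R
  inferInstanceAs (Ring (SkewPolynomial R))

/-- The constants `R → R{τ}`. -/
def TwistedPoly.C : R →+* TwistedPoly k R :=
  letI := qAction k R
  SkewPolynomial.CRingHom

/-- The element `τ` of `R{τ}`. -/
def TwistedPoly.tau : TwistedPoly k R := (SkewPolynomial.X : SkewPolynomial R)

theorem TwistedPoly.tau_mul_C (r : R) :
    tau k R * C k R r = C k R (r ^ Fintype.card k) * tau k R := by
  let := qAction k R
  have h1 := SkewPolynomial.monomial_mul_monomial 1 0 (1 : R) r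
  have h2 := SkewPolynomial.monomial_mul_monomial 0 1 (r ^ Fintype.card k) (1 : R)
  refine h1.trans (Eq.trans ?_ h2.symm)
  have h3 : (⇑(SkewPolynomial.φ : R →+* R))^[1] r = r ^ Fintype.card k := by
    rw [SkewPolynomial.φ_iterate_apply]
    rfl
  rw [h3]
  simp

variable {k R}
variable {V : Type*} [AddCommGroup V] [Module R V] [Module k V] [IsScalarTower k R V]

/-- A `q`-semilinear endomorphism of an `R`-module, as a `k`-linear endomorphism. -/
def tauEnd (τ : V →ₛₗ[qFrob k R] V) : Module.End k V where
  toFun := τ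
  map_add' := τ.map_add
  map_smul' c x := by
    rw [← algebraMap_smul R c x, τ.map_smulₛₗ]
    simp [qFrob]

theorem tauEnd_pow_comm (τ : V →ₛₗ[qFrob k R] V) (n : ℕ) (r : R) :
    Module.toModuleEnd k V ((qFrob k R ^ n) r) * tauEnd τ ^ n =
      tauEnd τ ^ n * Module.toModuleEnd k V r := by
  induction n generalizing r with
  | zero => simp
  | succ n ih =>
    rw [pow_succ (tauEnd τ), mul_assoc,
      show tauEnd τ * Module.toModuleEnd k V r =
        Module.toModuleEnd k V (qFrob k R r) * tauEnd τ from
        LinearMap.ext fun v => τ.map_smulₛₗ r v,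
      ← mul_assoc, ← mul_assoc, ← ih, pow_succ (qFrob k R)]
    rfl

theorem tauEnd_apply (τ : V →ₛₗ[qFrob k R] V) (v : V) : tauEnd τ v = τ v := rfl

/-- The action `R{τ} → End_k(V)`, `∑ rᵢ τⁱ ↦ ∑ rᵢ τ_Vⁱ`, given by a `q`-semilinear
endomorphism `τ_V` of an `R`-module `V`. -/
def twistedAction (τ : V →ₛₗ[qFrob k R] V) : TwistedPoly k R →+* Module.End k V :=
  letI := qAction k R
  SkewMonoidAlgebra.liftNCRingHom (Module.toModuleEnd k V)
    (powersHom (Module.End k V) (tauEnd τ)) fun {r n} => tauEnd_pow_comm τ n.toAdd r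

theorem twistedAction_C (τ : V →ₛₗ[qFrob k R] V) (r : R) (v : V) :
    twistedAction τ (TwistedPoly.C k R r) v = r • v := by
  let := qAction k R
  have h : twistedAction τ (TwistedPoly.C k R r) = _ :=
    SkewMonoidAlgebra.liftNC_single
      ((Module.toModuleEnd k V : R →+* Module.End k V) : R →+ Module.End k V)
      (powersHom (Module.End k V) (tauEnd τ)) 1 r
  rw [h, map_one, mul_one]
  rfl

theorem twistedAction_tau (τ : V →ₛₗ[qFrob k R] V) (v : V) :
    twistedAction τ (TwistedPoly.tau k R) v = τ v := by
  let := qAction k R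
  have h : twistedAction τ (TwistedPoly.tau k R) = _ :=
    SkewMonoidAlgebra.liftNC_single
      ((Module.toModuleEnd k V : R →+* Module.End k V) : R →+ Module.End k V)
      (powersHom (Module.End k V) (tauEnd τ)) (Multiplicative.ofAdd 1) 1
  rw [h]
  change (1 : R) • (tauEnd τ ^ 1) v = τ v
  rw [one_smul, pow_one, tauEnd_apply]

/-- The action of `R{τ}[[Z]]` on `V[[Z]]`. -/
def seriesAction (τ : V →ₛₗ[qFrob k R] V) : (TwistedPoly k R)⟦X⟧ →+* (Module.End k V)⟦X⟧ :=
  PowerSeries.map (twistedAction τ)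

/-- The `q`-semilinear endomorphism of `V / I V` induced by `τ`. -/
def tauModIdeal (τ : V →ₛₗ[qFrob k R] V) (I : Ideal R) :
    (V ⧸ (I • ⊤ : Submodule R V)) →ₛₗ[qFrob k R] (V ⧸ (I • ⊤ : Submodule R V)) :=
  Submodule.mapQ _ _ τ (by
    rw [Submodule.smul_le]
    intro r hr v _
    rw [Submodule.mem_comap, τ.map_smulₛₗ]
    exact Submodule.smul_mem_smul (I.pow_mem_of_mem hr _ Fintype.card_pos) trivial)

section Coker

variable (k R)
variable (B : Type*) [CommRing B] [Algebra R B]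

/-- `B / R`, for an `R`-algebra `B`. -/
abbrev Coker : Type _ := B ⧸ LinearMap.range (Algebra.linearMap R B)

/-- The map `f ↦ f ^ q` on an `R`-algebra `B`. -/
def algFrob : B →ₛₗ[qFrob k R] B :=
  letI : Algebra k B := Algebra.compHom B (algebraMap k R)
  { toFun := fun f => f ^ Fintype.card k
    map_add' := (FiniteField.frobeniusAlgHom k B).map_add
    map_smul' := fun r f => by
      rw [Algebra.smul_def, Algebra.smul_def, mul_pow, ← map_pow]
      rfl }

/-- The map `f ↦ f ^ q` on `B / R`. -/
def cokerFrob : Coker R B →ₛₗ[qFrob k R] Coker R B :=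
  Submodule.mapQ _ _ (algFrob k R B) (by
    rintro _ ⟨r, rfl⟩
    exact ⟨r ^ Fintype.card k, map_pow (algebraMap R B) r _⟩)

variable {k R}

/-- The map `m ⊗ f ↦ τ(m) ⊗ f ^ q` on `V ⊗ B / R`. -/
def tauCoker (τ : V →ₛₗ[qFrob k R] V) :
    (V ⊗[R] Coker R B) →ₛₗ[qFrob k R] (V ⊗[R] Coker R B) :=
  TensorProduct.map τ (cokerFrob k R B)

end Coker

end Twisted

/-! ### Norms -/

section Norms

variable {R : Type*} [CommRing R] {B : Type*} [CommRing B] [Algebra R B]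
  {M : Type*} [AddCommGroup M] [Module R M]

/-- Multiplication by `b : B` on `M ⊗ B`. -/
def mulTensor (b : B) : M ⊗[R] B →ₗ[R] M ⊗[R] B :=
  LinearMap.lTensor M (LinearMap.mulLeft R b)

/-- A (non-archimedean) norm on the `B`-module `M ⊗ B`, where `B` is a finite product of fields
`B_x` with absolute values and `absB` is the maximum of these. -/
structure IsTensorNorm (absB : B → ℝ) (N : M ⊗[R] B → ℝ) : Prop where
  nonneg : ∀ v, 0 ≤ N v
  eq_zero_iff : ∀ v, N v = 0 ↔ v = 0
  add_le_max : ∀ v w, N (v + w) ≤ max (N v) (N w)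
  smul_le : ∀ (b : B) (v), N (mulTensor b v) ≤ absB b * N v

/-- The quotient norm on `M ⊗ B / R` induced by a norm on `M ⊗ B`. -/
def quotientNorm (N : M ⊗[R] B → ℝ) (w : M ⊗[R] Coker R B) : ℝ :=
  sInf (N '' {v | LinearMap.lTensor M
    (Submodule.mkQ (LinearMap.range (Algebra.linearMap R B))) v = w})

end Norms

/-! ### The curve -/

section Places

variable {K : Type*} [Field K] (A : ValuationSubring K) [IsDiscreteValuationRing A]

/-- The completion of `K` at a discrete valuation ring `A` of `K`. -/
abbrev Completion : Type _ := (IsDiscreteValuationRing.maximalIdeal A).adicCompletion K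

/-- The normalized absolute value on the completion: a uniformizer has absolute value
`1 / #κ`, where `κ` is the residue field. -/
def normAbs (f : Completion A) : ℝ :=
  open Classical in
  if f = 0 then 0
  else (Nat.card (IsLocalRing.ResidueField A) : ℝ) ^ WithZero.log (Valued.v f)

end Places

section Curve

variable {k : Type u} [Field k] {X : Scheme.{u}}

/-- The ring of regular functions on the open subscheme `Y` of the `k`-scheme `X`
(with structure morphism `f`). -/
def CoordRing (_f : X ⟶ Spec (.of k)) (Y : X.Opens) : Type u := Γ(X, Y)

variable (f : X ⟶ Spec (.of k)) (Y : X.Opens)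

instance : CommRing (CoordRing f Y) := inferInstanceAs (CommRing Γ(X, Y))

instance : Algebra k (CoordRing f Y) :=
  ((Scheme.ΓSpecIso (.of k)).inv ≫ f.appLE ⊤ Y le_top).hom.toAlgebra

instance [IrreducibleSpace X] [Nonempty Y] : Algebra (CoordRing f Y) X.functionField :=
  inferInstanceAs (Algebra Γ(X, Y) X.functionField)

/-- The points of `X \ Y`, each given by its local ring as a discrete valuation ring of the
function field. (On a connected smooth curve the local ring at each point of `X \ Y` is a discrete
valuation ring, and it determines the point if the curve is separated.) -/
def PlacesOutside [AlgebraicGeometry.IsIntegral X] : Type u :=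
  {A : ValuationSubring X.functionField // IsDiscreteValuationRing A ∧
    ∃ x : X, x ∉ Y ∧
      (A : Set X.functionField) = Set.range (algebraMap (X.presheaf.stalk x) X.functionField)}

instance [AlgebraicGeometry.IsIntegral X] (x : PlacesOutside Y) : IsDiscreteValuationRing x.1 :=
  x.2.1

variable [AlgebraicGeometry.IsIntegral X]

/-- The product `K_∞` of the completions `K_x` for `x ∈ X \ Y`. -/
def KInfty : Type u := (x : PlacesOutside Y) → Completion x.1

instance : CommRing (KInfty Y) := inferInstanceAs (CommRing ((x : PlacesOutside Y) → Completion x.1))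

instance [Nonempty Y] : Algebra (CoordRing f Y) (KInfty Y) :=
  inferInstanceAs (Algebra (CoordRing f Y) ((x : PlacesOutside Y) → Completion x.1))

/-- The absolute value on `K_∞`: the maximum of the normalized absolute values. -/
def absKInfty (g : KInfty Y) : ℝ := ⨆ x : PlacesOutside Y, normAbs x.1 (g x)

end Curve

end TraceFormula

end

noncomputable section

namespace TraceFormula

/-! ### Determinants of power series of endomorphisms -/

section SeriesDet

variable {k : Type*} [Field k]

/-! Noether normalization gives `t ∈ R` such that `R` is finite over `k[t]`, so `M` is free over
`k[t]` with a basis `e_1, …, e_d`. The elements of `R{τ}τ` become sums of terms `a τ^i` with `i ≥ 1`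
and polynomial matrices `a`, and hence act on the vectors of Laurent polynomials `k[t, 1/t]^d`. This
auxiliary space sees both sides of the formula: it contains `M`, and `t^n e_i ↦ e_i ⊗ [t^n]` maps it
to a dense subspace of `V`, killing `M`.

Laurent polynomials have two finite quotients: reduction modulo `t^L - 1` with `L = q^(K!) - 1`, and
the coefficients of `t^(-J), …, t^0`. For large `K` and `J` the determinants of `1 + Θ` on them are
inverse to each other modulo `Z^N` (`exists_dvd_sdet_cyc_mul_sdet_tail_sub_one`). By
multiplicativity (`IsUnipotentSeries.induction`) it is enough to treat enough series `1 + c E_ij t^m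
τ^d Z^n`, and such an operator moves monomials by `x ↦ q^d x + m`. If `i = j` and `q^d - 1` divides
`m`, then on `ℤ/L` the `s`-th iterate has `q^(ds) - 1` fixed points, which gives the determinant
`1/(1 + c Z^n)` because `q = 0` in `k`; on the exponents `-J, …, 0` there is one fixed point and no
other cycle, which gives `1 + c Z^n`. Otherwise no short cycles exist and both determinants are 1.

Now `M / (t^L - 1)M` is the first quotient, and the second is an extension of `V / U` by `M / tM`
for a common nucleus `U` (`dvd_sdet_tail_sub_mul`). So the determinants on `M / (t^L - 1)M`, on `M /
tM` and on `V` multiply to 1 modulo `Z^N`. As `t (t^L - 1) = t^(q^(K!)) - t`, the Chinese remainder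
theorem, and the fact that `τ` shifts the filtration by powers of an ideal, turn the first two into
the product of the local factors at the maximal ideals containing `t^(q^(K!)) - t`
(`exists_idealDet_eq_prod`). At any other maximal ideal `t^(q^d) - t` is invertible for all relevant
`d`, so every `q^d`-semilinear map is a commutator and the local factor is 1 modulo `Z^N`
(`exists_dvd_idealDet_sub_one`).

The determinant on `V` exists because a smaller nucleus only adds a part on which the operators
shift a finite filtration (`dvd_sdet_quotSeries_sub_of_le`). The analytic input is: the norm of `M ⊗
K_∞` bounds coordinates (by compactness), so `τ` is bounded by a `q`-th power and contracts near
zero; `R[1/t]` is dense in `K_∞`; `R` is discrete in it.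

Geometrically, the valuation rings of the function field not containing `R` are exactly the local
rings at `X ∖ Y`, by the valuative criteria and smoothness (`exists_place_eq`,
`exists_notMem_of_range_stalk_eq`). They are finite in number with finite residue fields because `R`
has finite rank over `k[t]`. -/

theorem dvd_sub_trans {N : ℕ} {a b c : k⟦X⟧} (h : (X : k⟦X⟧) ^ N ∣ a - b)
    (h' : (X : k⟦X⟧) ^ N ∣ b - c) : (X : k⟦X⟧) ^ N ∣ a - c := by
  simpa using dvd_add h h'

theorem dvd_sub_symm {N : ℕ} {a b : k⟦X⟧} (h : (X : k⟦X⟧) ^ N ∣ a - b) :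
    (X : k⟦X⟧) ^ N ∣ b - a := (dvd_sub_comm).1 h

theorem dvd_sub_mul {N : ℕ} {a b a' b' : k⟦X⟧} (h : (X : k⟦X⟧) ^ N ∣ a - b)
    (h' : (X : k⟦X⟧) ^ N ∣ a' - b') : (X : k⟦X⟧) ^ N ∣ a * a' - b * b' := by
  have : a * a' - b * b' = (a - b) * a' + b * (a' - b') := by ring
  rw [this]
  exact dvd_add (h.mul_right _) (h'.mul_left _)

theorem dvd_sub_iff_coeff {N : ℕ} {a b : k⟦X⟧} :
    (X : k⟦X⟧) ^ N ∣ a - b ↔ ∀ n < N, coeff n a = coeff n b := by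
  rw [X_pow_dvd_iff]
  simp [sub_eq_zero]

/-- Determinants commute with reduction modulo `a`, under which the two matrices coincide. -/
theorem dvd_det_sub_det {R ι : Type*} [CommRing R] [Fintype ι] [DecidableEq ι] {a : R}
    {A B : Matrix ι ι R} (h : ∀ i j, a ∣ A i j - B i j) : a ∣ A.det - B.det := by
  rw [← Ideal.Quotient.eq_zero_iff_dvd, map_sub, sub_eq_zero, RingHom.map_det, RingHom.map_det]
  congr 1
  ext i j
  simpa [sub_eq_zero] using (Ideal.Quotient.eq_zero_iff_dvd a _).2 (h i j)

variable {V : Type*} [AddCommGroup V] [Module k V]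
  {V' : Type*} [AddCommGroup V'] [Module k V'] {V'' : Type*} [AddCommGroup V''] [Module k V'']

/-- The matrix over `k[[X]]` of a power series of endomorphisms. -/
def seriesMatrix {ι : Type*} [Fintype ι] [DecidableEq ι] (b : Module.Basis ι k V)
    (Φ : (Module.End k V)⟦X⟧) : Matrix ι ι k⟦X⟧ :=
  Matrix.of fun i j => PowerSeries.mk fun n => LinearMap.toMatrix b b (coeff n Φ) i j

section Matrix

variable {ι : Type*} [Fintype ι] [DecidableEq ι] (b : Module.Basis ι k V)

theorem coeff_seriesMatrix (Φ : (Module.End k V)⟦X⟧) (i j : ι) (n : ℕ) :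
    coeff n (seriesMatrix b Φ i j) = LinearMap.toMatrix b b (coeff n Φ) i j := by
  simp [seriesMatrix]

theorem seriesMatrix_one : seriesMatrix b 1 = 1 := by
  ext i j n
  rw [coeff_seriesMatrix, coeff_one]
  split_ifs with h
  · rw [LinearMap.toMatrix_one, Matrix.one_apply, Matrix.one_apply]
    split_ifs <;> simp [h]
  · rw [map_zero, Matrix.one_apply]
    split_ifs <;> simp [coeff_one, h]

theorem seriesMatrix_add (Φ Ψ : (Module.End k V)⟦X⟧) :
    seriesMatrix b (Φ + Ψ) = seriesMatrix b Φ + seriesMatrix b Ψ := by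
  ext i j n
  simp [coeff_seriesMatrix]

theorem seriesMatrix_zero : seriesMatrix b 0 = 0 := by
  ext i j n
  simp [coeff_seriesMatrix]

theorem seriesMatrix_mul (Φ Ψ : (Module.End k V)⟦X⟧) :
    seriesMatrix b (Φ * Ψ) = seriesMatrix b Φ * seriesMatrix b Ψ := by
  ext i j n
  rw [coeff_seriesMatrix, coeff_mul, map_sum, Matrix.sum_apply, Matrix.mul_apply, map_sum]
  simp_rw [coeff_mul, LinearMap.toMatrix_mul, Matrix.mul_apply, coeff_seriesMatrix]
  rw [Finset.sum_comm]

theorem seriesMatrix_pow (Φ : (Module.End k V)⟦X⟧) (m : ℕ) :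
    seriesMatrix b (Φ ^ m) = seriesMatrix b Φ ^ m := by
  induction m with
  | zero => simp [seriesMatrix_one]
  | succ m ih => rw [pow_succ, pow_succ, seriesMatrix_mul, ih]

end Matrix

/-- A change of basis conjugates the matrix by constant matrices. -/
theorem det_seriesMatrix_eq {ι ι' : Type*} [Fintype ι] [DecidableEq ι] [Fintype ι'] [DecidableEq ι']
    (b : Module.Basis ι k V) (b' : Module.Basis ι' k V) (Φ : (Module.End k V)⟦X⟧) :
    (seriesMatrix b Φ).det = (seriesMatrix b' Φ).det := by
  have h1 : (b.toMatrix b').map (PowerSeries.C (R := k)) * (b'.toMatrix b).map (PowerSeries.C (R := k)) = 1 := by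
    rw [← Matrix.map_mul, Module.Basis.toMatrix_mul_toMatrix_flip]
    simp
  have h2 : (b'.toMatrix b).map (PowerSeries.C (R := k)) * (b.toMatrix b').map (PowerSeries.C (R := k)) = 1 := by
    rw [← Matrix.map_mul, Module.Basis.toMatrix_mul_toMatrix_flip]
    simp
  have h : seriesMatrix b Φ = (b.toMatrix b').map (PowerSeries.C (R := k)) * seriesMatrix b' Φ *
      (b'.toMatrix b).map (PowerSeries.C (R := k)) := by
    ext i j n
    have h3 := basis_toMatrix_mul_linearMap_toMatrix_mul_basis_toMatrix b b' b b' (coeff n Φ)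
    rw [coeff_seriesMatrix, ← h3]
    simp only [Matrix.mul_apply, map_sum, Matrix.map_apply, coeff_mul_C, coeff_C_mul,
      coeff_seriesMatrix]
  rw [h]
  exact Matrix.det_conj_of_mul_eq_one h1 h2

/-- The determinant over `k[[X]]` of a power series of endomorphisms of a finite-dimensional
space. -/
def sdet [FiniteDimensional k V] (Φ : (Module.End k V)⟦X⟧) : k⟦X⟧ :=
  (seriesMatrix (Module.finBasis k V) Φ).det

theorem sdet_eq_det [FiniteDimensional k V] {ι : Type*} [Fintype ι] [DecidableEq ι]
    (b : Module.Basis ι k V) (Φ : (Module.End k V)⟦X⟧) : sdet Φ = (seriesMatrix b Φ).det :=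
  det_seriesMatrix_eq _ _ _

section FiniteDimensional

variable [FiniteDimensional k V] [FiniteDimensional k V'] [FiniteDimensional k V'']

theorem sdet_one : sdet (1 : (Module.End k V)⟦X⟧) = 1 := by
  rw [sdet, seriesMatrix_one, Matrix.det_one]

theorem sdet_mul (Φ Ψ : (Module.End k V)⟦X⟧) : sdet (Φ * Ψ) = sdet Φ * sdet Ψ := by
  rw [sdet, seriesMatrix_mul, Matrix.det_mul, sdet, sdet]

theorem sdet_one_add_mul_comm (Φ Ψ : (Module.End k V)⟦X⟧) :
    sdet (1 + Φ * Ψ) = sdet (1 + Ψ * Φ) := by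
  simp only [sdet, seriesMatrix_add, seriesMatrix_one, seriesMatrix_mul]
  exact Matrix.det_one_add_mul_comm _ _

theorem dvd_sdet_sub_sdet {N : ℕ} {Φ Ψ : (Module.End k V)⟦X⟧}
    (h : ∀ n < N, coeff n Φ = coeff n Ψ) : (X : k⟦X⟧) ^ N ∣ sdet Φ - sdet Ψ := by
  refine dvd_det_sub_det fun i j => dvd_sub_iff_coeff.2 fun n hn => ?_
  rw [coeff_seriesMatrix, coeff_seriesMatrix, h n hn]

/-- Over the reduced ring `k⟦X⟧` the characteristic polynomial of the nilpotent matrix `-A` is a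
pure power of the variable; its value at 1 is the determinant of `1 + A`. -/
theorem sdet_one_add_of_isNilpotent {Φ : (Module.End k V)⟦X⟧} (h : IsNilpotent Φ) :
    sdet (1 + Φ) = 1 := by
  obtain ⟨m, hm⟩ := h
  set A := seriesMatrix (Module.finBasis k V) Φ with hA
  have hn : IsNilpotent (-A) := by
    refine IsNilpotent.neg ⟨m, ?_⟩
    rw [hA, ← seriesMatrix_pow, hm, seriesMatrix_zero]
  have h1 := sub_eq_zero.1 (Matrix.isNilpotent_charpoly_sub_pow_of_isNilpotent hn).eq_zero
  have h2 := Matrix.eval_charpoly (-A) 1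
  rw [h1] at h2
  rw [sdet, seriesMatrix_add, seriesMatrix_one, ← hA]
  simpa using h2.symm

/-- If the coefficients `φₙ` with `n < N` shift a finite filtration, then `1 + Φ` has
determinant `1` modulo `X^N`. -/
theorem dvd_sdet_one_add_sub_one {N : ℕ} {Φ : (Module.End k V)⟦X⟧} (S : ℕ → Submodule k V)
    (L : ℕ) (h0 : S 0 = ⊤) (hL : S L = ⊥)
    (hS : ∀ i, ∀ n < N, ∀ v ∈ S i, coeff n Φ v ∈ S (i + 1)) :
    (X : k⟦X⟧) ^ N ∣ sdet (1 + Φ) - 1 := by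
  -- Only the coefficients below `N` respect the filtration. Dropping the others makes the series
  -- nilpotent and leaves the determinant unchanged modulo `X ^ N`.
  set Ψ : (Module.End k V)⟦X⟧ := PowerSeries.mk fun n => if n < N then coeff n Φ else 0 with hΨ
  have hΨS : ∀ n i, ∀ v ∈ S i, coeff n Ψ v ∈ S (i + 1) := by
    intro n i v hv
    rw [hΨ, coeff_mk]
    split_ifs with hn
    · exact hS i n hn v hv
    · exact zero_mem _
  have hpow : ∀ i n v, coeff n (Ψ ^ i) v ∈ S i := by
    intro i
    induction i with
    | zero => intro n v; simp [h0]
    | succ i ih =>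
      intro n v
      rw [pow_succ', coeff_mul, LinearMap.sum_apply]
      exact sum_mem fun p _ => hΨS _ _ _ (ih _ _)
  have hnil : IsNilpotent Ψ := by
    refine ⟨L, PowerSeries.ext fun n => LinearMap.ext fun v => ?_⟩
    have := hpow L n v
    rw [hL, Submodule.mem_bot] at this
    simp [this]
  rw [← sdet_one_add_of_isNilpotent hnil]
  refine dvd_sdet_sub_sdet fun n hn => ?_
  simp [hΨ, hn]

/-- A splitting of `π` gives a basis adapted to the exact sequence, in which the matrix of `Φ` is
block triangular modulo `X ^ N` with diagonal blocks given by `Φ'` and `Φ''`. -/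
theorem dvd_sdet_exact {N : ℕ} (i : V' →ₗ[k] V) (hi : Function.Injective i) (π : V →ₗ[k] V'')
    (hπ : Function.Surjective π) (hex : Function.Exact i π)
    {Φ' : (Module.End k V')⟦X⟧} {Φ : (Module.End k V)⟦X⟧} {Φ'' : (Module.End k V'')⟦X⟧}
    (h' : ∀ n < N, ∀ v, coeff n Φ (i v) = i (coeff n Φ' v))
    (h'' : ∀ n < N, ∀ v, π (coeff n Φ v) = coeff n Φ'' (π v)) :
    (X : k⟦X⟧) ^ N ∣ sdet Φ - sdet Φ' * sdet Φ'' := by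
  obtain ⟨s, hs⟩ := LinearMap.exists_rightInverse_of_surjective π (LinearMap.range_eq_top.2 hπ)
  have hs' : ∀ v, π (s v) = v := fun v => LinearMap.congr_fun hs v
  have hπi : ∀ v, π (i v) = 0 := fun v => (hex (i v)).2 ⟨v, rfl⟩
  let e : (V' × V'') ≃ₗ[k] V := LinearEquiv.ofBijective (i.coprod s) (by
    refine ⟨(injective_iff_map_eq_zero _).2 ?_, fun v => ?_⟩
    · rintro ⟨a, b⟩ hab
      rw [LinearMap.coprod_apply] at hab
      have hb : b = 0 := by simpa [hs', hπi] using congrArg π hab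
      subst hb
      have ha : a = 0 := hi (by simpa using hab)
      rw [ha]; rfl
    · obtain ⟨a, ha⟩ := (hex (v - s (π v))).1 (by rw [map_sub, hs', sub_self])
      exact ⟨(a, π v), by rw [LinearMap.coprod_apply, ha]; simp⟩)
  have he : ∀ a b, e (a, b) = i a + s b := fun a b => rfl
  have he1 : ∀ v, (e.symm (i v)) = (v, 0) := fun v => by
    rw [LinearEquiv.symm_apply_eq, he]; simp
  have he2 : ∀ v, (e.symm v).2 = π v := fun v => by
    obtain ⟨⟨a, b⟩, rfl⟩ := e.surjective v
    rw [e.symm_apply_apply, he, map_add, hπi, hs', zero_add]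
  let b' := Module.finBasis k V'
  let b'' := Module.finBasis k V''
  let b := (b'.prod b'').map e
  -- The block triangular matrix takes its upper right block from `Φ` itself, so nothing has to be
  -- known about that block.
  rw [sdet_eq_det b, sdet_eq_det b', sdet_eq_det b'',
    ← Matrix.det_fromBlocks_zero₂₁ _ (seriesMatrix b Φ).toBlocks₁₂]
  refine dvd_det_sub_det fun x y => dvd_sub_iff_coeff.2 fun n hn => ?_
  rcases x with x | x <;> rcases y with y | y
  · simp only [Matrix.fromBlocks_apply₁₁, coeff_seriesMatrix, LinearMap.toMatrix_apply]
    simp [b, he, h' n hn, he1]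
  · rfl
  · simp only [Matrix.fromBlocks_apply₂₁, coeff_seriesMatrix, LinearMap.toMatrix_apply]
    simp [b, he, h' n hn, he1]
  · simp only [Matrix.fromBlocks_apply₂₂, coeff_seriesMatrix, LinearMap.toMatrix_apply]
    simp [b, he, he2, h'' n hn, hs']

theorem dvd_sdet_sub_sdet_of_equiv {N : ℕ} (e : V ≃ₗ[k] V')
    {Φ : (Module.End k V)⟦X⟧} {Φ' : (Module.End k V')⟦X⟧}
    (h : ∀ n < N, ∀ v, e (coeff n Φ v) = coeff n Φ' (e v)) :
    (X : k⟦X⟧) ^ N ∣ sdet Φ - sdet Φ' := by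
  let b := Module.finBasis k V
  rw [sdet_eq_det b, sdet_eq_det (b.map e)]
  refine dvd_det_sub_det fun x y => dvd_sub_iff_coeff.2 fun n hn => ?_
  simp only [coeff_seriesMatrix, LinearMap.toMatrix_apply]
  simp [← h n hn]

/-- Determinants on two quotients of the same space with the same kernel agree. -/
theorem dvd_sdet_sub_sdet_of_ker_eq {N : ℕ} {W : Type*} [AddCommGroup W] [Module k W]
    (π : W →ₗ[k] V) (π' : W →ₗ[k] V') (hπ : Function.Surjective π) (hπ' : Function.Surjective π')
    (hker : LinearMap.ker π = LinearMap.ker π') {Ψ : (Module.End k W)⟦X⟧}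
    {Φ : (Module.End k V)⟦X⟧} {Φ' : (Module.End k V')⟦X⟧}
    (h : ∀ n < N, ∀ w, π (coeff n Ψ w) = coeff n Φ (π w))
    (h' : ∀ n < N, ∀ w, π' (coeff n Ψ w) = coeff n Φ' (π' w)) :
    (X : k⟦X⟧) ^ N ∣ sdet Φ - sdet Φ' := by
  let e : V ≃ₗ[k] V' := (π.quotKerEquivOfSurjective hπ).symm.trans
    ((Submodule.quotEquivOfEq _ _ hker).trans (π'.quotKerEquivOfSurjective hπ'))
  have he : ∀ w, e (π w) = π' w := by
    intro w
    have : (π.quotKerEquivOfSurjective hπ).symm (π w) = (LinearMap.ker π).mkQ w := by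
      rw [LinearEquiv.symm_apply_eq]; rfl
    simp only [e, LinearEquiv.trans_apply, this]
    rfl
  refine dvd_sdet_sub_sdet_of_equiv e fun n hn v => ?_
  obtain ⟨w, rfl⟩ := hπ v
  rw [← h n hn, he, he, h' n hn]

theorem dvd_truncDet_sub_sdet (N : ℕ) (Φ : (Module.End k V)⟦X⟧) :
    (X : k⟦X⟧) ^ N ∣ truncDet N Φ - sdet (1 + Φ) := by
  let b := Module.finBasis k V
  rw [truncDet, ← LinearMap.det_toMatrix (Algebra.TensorProduct.basis k⟦X⟧ b), sdet_eq_det b]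
  refine dvd_det_sub_det fun i j => dvd_sub_iff_coeff.2 fun n hn => ?_
  simp only [map_add, map_sum, map_smul, LinearMap.toMatrix_one, LinearMap.toMatrix_baseChange,
    seriesMatrix_add, seriesMatrix_one, Matrix.add_apply, Matrix.sum_apply, Matrix.smul_apply,
    Matrix.map_apply, coeff_seriesMatrix, smul_eq_mul, PowerSeries.algebraMap_apply,
    Algebra.algebraMap_self, RingHom.id_apply]
  congr 1
  rw [Finset.sum_eq_single_of_mem n (Finset.mem_range.2 hn)]
  · simp
  · intro m _ hm
    rw [coeff_X_pow_mul']
    split_ifs with hmn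
    · rw [coeff_C, if_neg (by omega)]
    · rfl

theorem finDet_eq_sdet (Φ : (Module.End k V)⟦X⟧) : finDet Φ = sdet (1 + Φ) := by
  ext n
  rw [finDet, coeff_mk]
  exact dvd_sub_iff_coeff.1 (dvd_truncDet_sub_sdet (n + 1) Φ) n (Nat.lt_succ_self n)

end FiniteDimensional

end SeriesDet

/-! ### Groups of power series with coefficients in a filtration -/

section Generation

variable {E : Type*} [Ring E] (F : ℕ → AddSubgroup E)

/-- The power series `1 + ∑ θₙ Xⁿ` with `θₙ ∈ F n` for `n ≥ 1`. -/
def IsUnipotentSeries (u : E⟦X⟧) : Prop :=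
  coeff 0 u = 1 ∧ ∀ n, 1 ≤ n → coeff n u ∈ F n

variable {F}

theorem IsUnipotentSeries.one : IsUnipotentSeries F 1 :=
  ⟨by simp, fun n hn => by rw [coeff_one, if_neg (by omega)]; exact zero_mem _⟩

theorem IsUnipotentSeries.mul (hF : ∀ i j, 1 ≤ i → 1 ≤ j → ∀ x ∈ F i, ∀ y ∈ F j, x * y ∈ F (i + j))
    {u v : E⟦X⟧} (hu : IsUnipotentSeries F u) (hv : IsUnipotentSeries F v) :
    IsUnipotentSeries F (u * v) := by
  refine ⟨by rw [coeff_mul]; simp [hu.1, hv.1], fun n hn => ?_⟩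
  rw [coeff_mul]
  refine sum_mem fun p hp => ?_
  have hp := Finset.HasAntidiagonal.mem_antidiagonal.1 hp
  rcases Nat.eq_zero_or_pos p.1 with h1 | h1
  · rw [h1, hu.1, one_mul, show p.2 = n by omega]
    exact hv.2 n hn
  rcases Nat.eq_zero_or_pos p.2 with h2 | h2
  · rw [h2, hv.1, mul_one, show p.1 = n by omega]
    exact hu.2 n hn
  rw [← hp]
  exact hF _ _ h1 h2 _ (hu.2 _ h1) _ (hv.2 _ h2)

/-- Division of unipotent series. -/
theorem IsUnipotentSeries.exists_mul_eq
    (hF : ∀ i j, 1 ≤ i → 1 ≤ j → ∀ x ∈ F i, ∀ y ∈ F j, x * y ∈ F (i + j))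
    {u v : E⟦X⟧} (hu : IsUnipotentSeries F u) (hv : IsUnipotentSeries F v) :
    ∃ w, IsUnipotentSeries F w ∧ v * w = u := by
  have hv1 : constantCoeff v = ((1 : Eˣ) : E) := by
    rw [← coeff_zero_eq_constantCoeff_apply, hv.1, Units.val_one]
  set w := v.invOfUnit 1 * u with hw
  have hvw : v * w = u := by rw [hw, ← mul_assoc, mul_invOfUnit v 1 hv1, one_mul]
  have h0 : coeff 0 w = 1 := by
    have := congrArg (coeff 0) hvw
    rw [coeff_mul] at this
    simpa [hu.1, hv.1, -coeff_zero_eq_constantCoeff] using this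
  -- The equation `v * w = u` determines the coefficients of `w` recursively: the one of index `n`
  -- is that of `u` minus products that lie in `F n` by induction.
  refine ⟨w, ⟨h0, fun n => ?_⟩, hvw⟩
  induction n using Nat.strong_induction_on with
  | _ n ih =>
    intro hn
    have hmem : (0, n) ∈ Finset.HasAntidiagonal.antidiagonal n := by simp
    have h1 := congrArg (coeff n) hvw
    rw [coeff_mul, ← Finset.add_sum_erase _ _ hmem, hv.1, one_mul] at h1
    rw [eq_sub_of_add_eq h1]
    refine sub_mem (hu.2 n hn) (sum_mem fun p hp => ?_)
    obtain ⟨hp1, hp2⟩ := Finset.mem_erase.1 hp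
    have hp2 := Finset.HasAntidiagonal.mem_antidiagonal.1 hp2
    have hp3 : 1 ≤ p.1 := by
      rcases Nat.eq_zero_or_pos p.1 with h | h
      · exact absurd (Prod.ext h (by simpa [h] using hp2)) hp1
      · exact h
    rcases Nat.eq_zero_or_pos p.2 with h2 | h2
    · rw [h2, h0, mul_one, show p.1 = n by omega]
      exact hv.2 n hn
    · rw [← hp2]
      exact hF _ _ hp3 h2 _ (hv.2 _ hp3) _ (ih p.2 (by omega) h2)

/-- A multiplicative property of unipotent series which only depends on the coefficients of
index `< N` holds for all of them if it holds for enough series `1 + g Xⁿ + ⋯`. -/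
theorem IsUnipotentSeries.induction
    (hF : ∀ i j, 1 ≤ i → 1 ≤ j → ∀ x ∈ F i, ∀ y ∈ F j, x * y ∈ F (i + j))
    (G : ℕ → Set E) (hG : ∀ n, 1 ≤ n → ∀ x ∈ F n, x ∈ AddSubmonoid.closure (G n))
    (N : ℕ) (P : E⟦X⟧ → Prop)
    (hP : ∀ u, IsUnipotentSeries F u → (∀ n < N, coeff n u = coeff n (1 : E⟦X⟧)) → P u)
    (hmul : ∀ u v, IsUnipotentSeries F u → IsUnipotentSeries F v → P u → P v → P (u * v))
    (hgen : ∀ n, 1 ≤ n → n < N → ∀ g ∈ G n, ∃ u, IsUnipotentSeries F u ∧ P u ∧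
      (∀ m < n, coeff m u = coeff m (1 : E⟦X⟧)) ∧ coeff n u = g)
    {u : E⟦X⟧} (hu : IsUnipotentSeries F u) : P u := by
  -- Leading coefficients add under multiplication, so those attained by series with property `P`
  -- form an additive monoid. It contains `G n`, hence `F n`.
  have key : ∀ n, 1 ≤ n → n < N → ∀ x ∈ F n, ∃ u, IsUnipotentSeries F u ∧ P u ∧
      (∀ m < n, coeff m u = coeff m (1 : E⟦X⟧)) ∧ coeff n u = x := by
    intro n hn hnN x hx
    replace hx := hG n hn x hx
    induction hx using AddSubmonoid.closure_induction with
    | mem g hg => exact hgen n hn hnN g hg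
    | zero =>
      exact ⟨1, .one, hP 1 .one fun _ _ => rfl, fun _ _ => rfl,
        by rw [coeff_one, if_neg (by omega)]⟩
    | add x y _ _ hx hy =>
      obtain ⟨u, hu, hPu, hu0, hun⟩ := hx
      obtain ⟨v, hv, hPv, hv0, hvn⟩ := hy
      have hlow : ∀ w : E⟦X⟧, (∀ m < n, coeff m w = coeff m (1 : E⟦X⟧)) →
          ∃ w', w = 1 + X ^ n * w' := by
        intro w hw
        obtain ⟨w', hw'⟩ := (X_pow_dvd_iff (φ := w - 1) (n := n)).2 fun m hm => by
          rw [map_sub, hw m hm, sub_self]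
        exact ⟨w', by rw [← hw']; abel⟩
      obtain ⟨u', rfl⟩ := hlow u hu0
      obtain ⟨v', rfl⟩ := hlow v hv0
      refine ⟨_, hu.mul hF hv, hmul _ _ hu hv hPu hPv, ?_⟩
      have hprod : (1 + X ^ n * u') * (1 + X ^ n * v') =
          1 + X ^ n * (u' + v' + u' * (X ^ n * v')) := by
        simp only [mul_add, add_mul, mul_one, one_mul, mul_assoc]
        abel
      rw [hprod]
      have h1 : coeff n (1 : E⟦X⟧) = 0 := by rw [coeff_one, if_neg (by omega)]
      refine ⟨fun m hm => by rw [map_add, coeff_X_pow_mul', if_neg (by omega), add_zero], ?_⟩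
      rw [map_add, h1, zero_add, coeff_X_pow_mul', if_pos le_rfl, Nat.sub_self] at hun hvn ⊢
      have h2 : coeff 0 (u' * (X ^ n * v')) = 0 := by
        rw [coeff_mul]
        simp [coeff_X_pow_mul', show n ≠ 0 by omega]
      rw [map_add, map_add, hun, hvn, h2, add_zero]
  -- Successive approximation: dividing by a series with property `P` and the same leading
  -- coefficient makes `u` agree with 1 one index further, until no coefficient below `N` is left.
  have main : ∀ j, ∀ u, IsUnipotentSeries F u →
      (∀ m < N - j, coeff m u = coeff m (1 : E⟦X⟧)) → P u := by
    intro j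
    induction j with
    | zero => exact fun u hu h => hP u hu h
    | succ j ih =>
      intro u hu h
      by_cases hj : N ≤ j + 1
      · refine ih u hu fun m hm => ?_
        rw [show m = 0 by omega, hu.1]
        simp
      obtain ⟨v, hv, hPv, hv0, hvn⟩ := key (N - (j + 1)) (by omega) (by omega) _ (hu.2 _ (by omega))
      obtain ⟨w, hw, rfl⟩ := hu.exists_mul_eq hF hv
      refine hmul _ _ hv hw hPv (ih w hw fun m => ?_)
      induction m using Nat.strong_induction_on with
      | _ m ihm =>
        intro hm
        rcases Nat.eq_zero_or_pos m with rfl | hm0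
        · rw [hw.1]; simp
        have hcoef : coeff m (v * w) = coeff m v + coeff m w := by
          have hmem : (0, m) ∈ Finset.HasAntidiagonal.antidiagonal m := by simp
          have hmem' : (m, 0) ∈ (Finset.HasAntidiagonal.antidiagonal m).erase (0, m) := by
            simp; omega
          rw [coeff_mul, ← Finset.add_sum_erase _ _ hmem, ← Finset.add_sum_erase _ _ hmem',
            Finset.sum_eq_zero, hv.1, hw.1, one_mul, mul_one, add_zero, add_comm]
          intro p hp
          simp only [Finset.mem_erase, Finset.HasAntidiagonal.mem_antidiagonal, ne_eq] at hp
          obtain ⟨hp1, hp2, hp3⟩ := hp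
          have h1 : p.1 ≠ 0 := fun h => hp2 (Prod.ext h (by simpa [h] using hp3))
          have h2 : p.2 ≠ 0 := fun h => hp1 (Prod.ext (by simpa [h] using hp3) h)
          rw [ihm p.2 (by omega) (by omega), coeff_one, if_neg h2, mul_zero]
        rcases Nat.lt_or_ge m (N - (j + 1)) with hlt | hge
        · have := h m hlt
          rw [hcoef, hv0 m hlt, coeff_one, if_neg (by omega), zero_add] at this
          rw [this, coeff_one, if_neg (by omega)]
        · obtain rfl : m = N - (j + 1) := by omega
          rw [hcoef] at hvn
          rw [coeff_one, if_neg (by omega)]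
          simpa using hvn
  exact main N u hu fun m hm => absurd hm (by omega)

end Generation

end TraceFormula

namespace TraceFormula

/-! ### Determinants of monomial matrices -/

section MonomialMatrix

open scoped Polynomial in
-- Jacobi's formula: differentiating the Leibniz expansion gives one determinant per column, and a
-- determinant with a replaced column is expressed through the adjugate by Cramer's rule.
theorem derivative_det_eq_trace {R n : Type*} [CommRing R] [Fintype n] [DecidableEq n]
    (M : Matrix n n R[X]) :
    Polynomial.derivative M.det = (M.adjugate * M.map Polynomial.derivative).trace := by
  have h1 : Polynomial.derivative M.det =
      ∑ i, (M.updateCol i fun j => Polynomial.derivative (M j i)).det := by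
    simp only [Matrix.det_apply', map_sum, Polynomial.derivative_mul, Polynomial.derivative_intCast, zero_mul, zero_add,
      Polynomial.derivative_prod_finset, Finset.mul_sum]
    rw [Finset.sum_comm]
    refine Finset.sum_congr rfl fun i _ => Finset.sum_congr rfl fun σ _ => ?_
    rw [← Finset.mul_prod_erase _ _ (Finset.mem_univ i)]
    congr 1
    rw [mul_comm]
    congr 1
    · simp
    · refine Finset.prod_congr rfl fun j hj => ?_
      rw [Matrix.updateCol_ne (Finset.ne_of_mem_erase hj)]
  rw [h1, Matrix.trace]
  refine Finset.sum_congr rfl fun i _ => ?_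
  rw [← Matrix.cramer_apply, Matrix.cramer_eq_adjugate_mulVec, Matrix.diag_apply,
    Matrix.mul_apply]
  rfl

open scoped Polynomial in
/-- A determinant with the traces of the full shift on `Q` letters, up to one fixed point. -/
theorem X_pow_dvd_charpolyRev {α : Type*} [Fintype α] [DecidableEq α] (P : Matrix α α ℤ) (Q : ℤ)
    (N : ℕ) (hP : ∀ s, 1 ≤ s → s ≤ N → (P ^ s).trace = Q ^ s - 1) :
    (Polynomial.X : ℤ[X]) ^ (N + 1) ∣ P.charpolyRev * (1 - Polynomial.X) - (1 - Polynomial.C Q * Polynomial.X) := by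
  set u := P.charpolyRev with hu
  set A : Matrix α α ℤ[X] := P.map Polynomial.C with hA
  set M : Matrix α α ℤ[X] := 1 - (Polynomial.X : ℤ[X]) • A with hM
  -- The truncated geometric series inverts `1 - XP` modulo `X ^ N`. With Jacobi's formula it turns
  -- the traces of the powers of `P` into the logarithmic derivative of `u`.
  set G : Matrix α α ℤ[X] := ∑ s ∈ Finset.range N, ((Polynomial.X : ℤ[X]) • A) ^ s with hG
  have hdet : M.det = u := rfl
  have hMG : M * G = 1 - ((Polynomial.X : ℤ[X]) • A) ^ N := mul_neg_geom_sum _ _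
  have hadj : u • G = M.adjugate - M.adjugate * ((Polynomial.X : ℤ[X]) • A) ^ N := by
    have := congrArg (M.adjugate * ·) hMG
    simp only [← mul_assoc, Matrix.adjugate_mul, hdet, mul_sub, mul_one] at this
    simpa using this
  have hder : M.map Polynomial.derivative = -A := by
    refine Matrix.ext fun i j => ?_
    simp only [hM, hA, Matrix.map_apply, Matrix.sub_apply, Matrix.smul_apply, Matrix.neg_apply,
      Polynomial.derivative_sub, smul_eq_mul, Polynomial.derivative_mul, Polynomial.derivative_X, Polynomial.derivative_C, mul_zero, add_zero,
      one_mul, Matrix.one_apply]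
    split_ifs <;> simp
  have hu' : Polynomial.derivative u = -(M.adjugate * A).trace := by
    rw [← hdet, derivative_det_eq_trace, hder, mul_neg, Matrix.trace_neg]
  have hpow : ∀ s, ((Polynomial.X : ℤ[X]) • A) ^ s * A = (Polynomial.X : ℤ[X]) ^ s • (P ^ (s + 1)).map Polynomial.C := by
    intro s
    rw [smul_pow, smul_mul_assoc, ← pow_succ, hA]
    congr 1
    exact (map_pow (Polynomial.C : ℤ →+* ℤ[X]).mapMatrix P (s + 1)).symm
  have htr : ∀ s, (((Polynomial.X : ℤ[X]) • A) ^ s * A).trace = Polynomial.X ^ s * Polynomial.C ((P ^ (s + 1)).trace) := by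
    intro s
    rw [hpow, Matrix.trace_smul, smul_eq_mul]
    congr 1
    simp [Matrix.trace]
  -- This is `u'/u ≡ -∑ tr(P^(s+1)) X^s`, with the prescribed traces inserted.
  have h1 : (Polynomial.X : ℤ[X]) ^ N ∣ Polynomial.derivative u +
      u * ∑ s ∈ Finset.range N, Polynomial.X ^ s * (Polynomial.C Q ^ (s + 1) - 1) := by
    have h2 : u * ∑ s ∈ Finset.range N, Polynomial.X ^ s * (Polynomial.C Q ^ (s + 1) - 1) = (u • G * A).trace := by
      rw [smul_mul_assoc, Matrix.trace_smul, smul_eq_mul, hG, Finset.sum_mul, Matrix.trace_sum]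
      congr 1
      refine Finset.sum_congr rfl fun s hs => ?_
      have := Finset.mem_range.1 hs
      rw [htr, hP (s + 1) (by omega) (by omega)]
      simp
    rw [h2, hadj, sub_mul, Matrix.trace_sub, hu', mul_assoc, hpow, mul_smul_comm,
      Matrix.trace_smul, smul_eq_mul]
    exact ⟨-(M.adjugate * (P ^ (N + 1)).map Polynomial.C).trace, by ring⟩
  have hsplit : ∑ s ∈ Finset.range N, (Polynomial.X : ℤ[X]) ^ s * (Polynomial.C Q ^ (s + 1) - 1) =
      Polynomial.C Q * ∑ s ∈ Finset.range N, (Polynomial.C Q * Polynomial.X) ^ s - ∑ s ∈ Finset.range N, Polynomial.X ^ s := by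
    rw [Finset.mul_sum, ← Finset.sum_sub_distrib]
    exact Finset.sum_congr rfl fun s _ => by ring
  set w := u * (1 - Polynomial.X) with hw
  -- The differential equation of `1 - QX`, obtained by summing both geometric series. Its solution
  -- is determined up to degree `N` by the constant coefficient.
  have hode : (Polynomial.X : ℤ[X]) ^ N ∣ (1 - Polynomial.C Q * Polynomial.X) * Polynomial.derivative w + Polynomial.C Q * w := by
    have e1 := mul_neg_geom_sum (Polynomial.C Q * Polynomial.X : ℤ[X]) N
    have e2 := mul_neg_geom_sum (Polynomial.X : ℤ[X]) N
    rw [hsplit] at h1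
    have hder : Polynomial.derivative w = Polynomial.derivative u * (1 - Polynomial.X) - u := by
      rw [hw, Polynomial.derivative_mul]; simp; ring
    set S1 := ∑ s ∈ Finset.range N, (Polynomial.C Q * Polynomial.X : ℤ[X]) ^ s
    set S2 := ∑ s ∈ Finset.range N, (Polynomial.X : ℤ[X]) ^ s
    obtain ⟨c, hc⟩ := h1
    refine ⟨(1 - Polynomial.C Q * Polynomial.X) * (1 - Polynomial.X) * c + u * ((1 - Polynomial.X) * Polynomial.C Q * Polynomial.C Q ^ N - (1 - Polynomial.C Q * Polynomial.X)), ?_⟩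
    rw [hder, hw]
    linear_combination (1 - Polynomial.C Q * Polynomial.X) * (1 - Polynomial.X) * hc + (-u * Polynomial.C Q * (1 - Polynomial.X)) * e1 +
      (u * (1 - Polynomial.C Q * Polynomial.X)) * e2
  have hw0 : w.coeff 0 = 1 := by
    have : u.coeff 0 = 1 := by
      rw [hu, Polynomial.coeff_zero_eq_eval_zero, Matrix.eval_charpolyRev]
    simp [hw, mul_sub, this]
  -- The factor `n - 1` kills every coefficient from degree 2 on. Solving for the coefficient of
  -- degree `n + 1` needs `n + 1 ≠ 0`, so the argument is made over `ℤ` and specialised to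
  -- characteristic `p` afterwards.
  have hrec : ∀ n < N, (n + 1 : ℤ) * w.coeff (n + 1) = Q * (n - 1) * w.coeff n := by
    intro n hn
    have := (Polynomial.X_pow_dvd_iff.1 hode) n hn
    rw [sub_mul, one_mul, mul_assoc, Polynomial.coeff_add, Polynomial.coeff_sub, Polynomial.coeff_C_mul, Polynomial.coeff_C_mul,
      Polynomial.coeff_derivative] at this
    rcases n with _ | n
    · simp only [Polynomial.coeff_X_mul_zero] at this
      push_cast at this ⊢
      linarith
    · rw [Polynomial.coeff_X_mul, Polynomial.coeff_derivative] at this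
      push_cast at this ⊢
      linarith
  have hw1 : 0 < N → w.coeff 1 = -Q := by
    intro hN
    have := hrec 0 hN
    rw [hw0] at this
    push_cast at this
    simpa using this
  have hw2 : ∀ n, 2 ≤ n → n ≤ N → w.coeff n = 0 := by
    intro n hn hnN
    induction n, hn using Nat.le_induction with
    | base =>
      have := hrec 1 (by omega)
      push_cast at this
      simpa using this
    | succ n hn ih =>
      have := hrec n (by omega)
      rw [ih (by omega), mul_zero] at this
      rcases mul_eq_zero.1 this with h | h
      · omega
      · exact h
  rw [Polynomial.X_pow_dvd_iff]
  intro n hn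
  rcases n with _ | _ | n
  · simp [hw0]
  · simp [Polynomial.coeff_one, hw1 (by omega)]
  · rw [Polynomial.coeff_sub, hw2 _ (by omega) (by omega)]
    simp [-eq_intCast, Polynomial.coeff_one]

variable {R α : Type*} [CommRing R] [Fintype α] [DecidableEq α]

/-- The matrix of `e_x ↦ c e_{f x}`, for a partially defined map `f`. -/
def monomialMatrix (f : α → Option α) (c : R) : Matrix α α R :=
  Matrix.of fun y x => if f x = some y then c else 0

/-- In the Leibniz expansion the identity gives the product. The term of `σ ≠ 1` vanishes unless `f`
agrees with `σ` on the moved points; these then form cycles of `f`, of length at least `N` by `hf`,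
and each moved point contributes a factor `a`. -/
theorem pow_dvd_det_one_add_sub_prod (f : α → Option α) (N : ℕ)
    (hf : ∀ (x : ℕ → α) (s : ℕ), 0 < s → s < N → (∀ i, f (x i) = some (x (i + 1))) →
      x s = x 0 → x 1 = x 0) (a c : R) :
    a ^ N ∣ (1 + a • monomialMatrix f c).det -
      ∏ x, (1 + if f x = some x then a * c else 0) := by
  have h1 : (∏ x, (1 + if f x = some x then a * c else 0)) =
      ((Equiv.Perm.sign (1 : Equiv.Perm α) : ℤ) : R) *
        ∏ x, (1 + a • monomialMatrix f c) ((1 : Equiv.Perm α) x) x := by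
    simp [monomialMatrix]
  rw [h1, Matrix.det_apply', ← Finset.add_sum_erase _ _ (Finset.mem_univ (1 : Equiv.Perm α)),
    add_sub_cancel_left]
  refine Finset.dvd_sum fun σ hσ => Dvd.dvd.mul_left ?_ _
  have hσ1 : σ ≠ 1 := Finset.ne_of_mem_erase hσ
  by_cases hall : ∀ y, σ y ≠ y → f y = some (σ y)
  · obtain ⟨x, hx⟩ : ∃ x, σ x ≠ x := by
      by_contra! h
      exact hσ1 (Equiv.ext h)
    have hmoved : ∀ i : ℕ, σ ((σ ^ i) x) ≠ (σ ^ i) x := by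
      intro i h
      apply hx
      have : (σ ^ i) (σ x) = (σ ^ i) x := by
        rw [← Equiv.Perm.mul_apply, ← pow_succ, pow_succ', Equiv.Perm.mul_apply, h]
      exact (σ ^ i).injective this
    have hcard : N ≤ σ.support.card := by
      have hinj : Set.InjOn (fun i : ℕ => (σ ^ i) x) (Finset.range N : Set ℕ) := by
        have aux : ∀ i j : ℕ, i < j → j < N → (σ ^ i) x ≠ (σ ^ j) x := by
          intro i j hij hj h
          have h2 : (σ ^ (j - i)) x = x := by
            apply (σ ^ i).injective
            rw [← Equiv.Perm.mul_apply, ← pow_add, Nat.add_sub_cancel' hij.le, h]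
          have := hf (fun i => (σ ^ i) x) (j - i) (by omega) (by omega)
            (fun i => by rw [pow_succ', Equiv.Perm.mul_apply]; exact hall _ (hmoved i))
            (by simpa using h2)
          exact hx (by simpa using this)
        intro i hi j hj hij
        have hi := Finset.mem_range.1 hi
        have hj := Finset.mem_range.1 hj
        rcases lt_trichotomy i j with h | h | h
        · exact absurd hij (aux i j h hj)
        · exact h
        · exact absurd hij.symm (aux j i h hi)
      rw [← Finset.card_range N, ← Finset.card_image_of_injOn hinj]
      refine Finset.card_le_card fun y hy => ?_
      obtain ⟨i, _, rfl⟩ := Finset.mem_image.1 hy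
      exact Equiv.Perm.mem_support.2 (hmoved i)
    rw [← Finset.prod_mul_prod_compl σ.support]
    refine Dvd.dvd.mul_right ((pow_dvd_pow a hcard).trans ?_) _
    rw [← Finset.prod_const]
    refine Finset.prod_dvd_prod_of_dvd _ _ fun y hy => ?_
    simp [Equiv.Perm.mem_support.1 hy]
  · push Not at hall
    obtain ⟨y, hy, hfy⟩ := hall
    rw [Finset.prod_eq_zero (Finset.mem_univ y)]
    · exact dvd_zero _
    · simp [monomialMatrix, hfy, hy]

/-- The determinant of `1 + aP` for a partially defined map with `Q ^ s - 1` points fixed by its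
`s`-th iterate, where `Q = 0` in `R`. -/
theorem pow_dvd_det_one_add_mul_sub_one (P : Matrix α α ℤ) (Q : ℤ) (hQ : (Q : R) = 0)
    (N : ℕ) (hP : ∀ s, 1 ≤ s → s ≤ N → (P ^ s).trace = Q ^ s - 1) (b : R) :
    b ^ (N + 1) ∣ (1 + b • P.map (Int.cast : ℤ → R)).det * (1 + b) - 1 := by
  -- At `X = -b` the reversed characteristic polynomial becomes the determinant of `1 + bP`, and `1
  -- - QX` becomes 1 since `Q = 0` in `R`.
  have h := map_dvd (Polynomial.aeval (R := ℤ) (-b)) (X_pow_dvd_charpolyRev P Q N hP)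
  have h1 : Polynomial.aeval (R := ℤ) (-b) P.charpolyRev =
      (1 + b • P.map (Int.cast : ℤ → R)).det := by
    rw [Matrix.charpolyRev, AlgHom.map_det]
    congr 1
    ext i j
    simp only [AlgHom.mapMatrix_apply, Matrix.map_apply, Matrix.sub_apply, Matrix.add_apply,
      Matrix.smul_apply, smul_eq_mul, map_sub, map_mul, Polynomial.aeval_X, Matrix.one_apply]
    split_ifs <;> simp
  rw [map_sub, map_mul, h1] at h
  simp only [map_sub, map_one, map_mul, map_pow, Polynomial.aeval_X, sub_neg_eq_add] at h
  simp only [eq_intCast, map_intCast, hQ, zero_mul, sub_zero, neg_pow b] at h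
  exact (Dvd.intro_left ((-1) ^ (N + 1)) rfl).trans h

end MonomialMatrix

end TraceFormula

namespace TraceFormula

/-! ### Induced endomorphisms of quotients -/

section Quotients

variable {k : Type*} [Field k] {V : Type*} [AddCommGroup V] [Module k V]

theorem quotEnd_mkQ {U : Submodule k V} {φ : Module.End k V} (h : U ≤ U.comap φ) (v : V) :
    quotEnd U φ (U.mkQ v) = U.mkQ (φ v) := by
  rw [quotEnd, dif_pos h]
  rfl

theorem quotSeries_mkQ {U : Submodule k V} {Φ : (Module.End k V)⟦X⟧} {n : ℕ}
    (h : U ≤ U.comap (coeff n Φ)) (v : V) :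
    U.mkQ (coeff n Φ v) = coeff n (quotSeries U Φ) (U.mkQ v) := by
  rw [quotSeries, coeff_mk, quotEnd_mkQ h]

/-- Stability of `U` is known only for coefficients below `N`, and `quotEnd` is zero by default on
unstable ones; so multiplicativity is available only modulo `X ^ N`. -/
theorem dvd_sdet_quotSeries_mul {U : Submodule k V} [FiniteDimensional k (V ⧸ U)]
    {Φ Ψ : (Module.End k V)⟦X⟧} {N : ℕ} (h : ∀ n < N, U ≤ U.comap (coeff n Φ))
    (h' : ∀ n < N, U ≤ U.comap (coeff n Ψ)) :
    (X : k⟦X⟧) ^ N ∣ sdet (quotSeries U (Φ * Ψ)) -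
      sdet (quotSeries U Φ) * sdet (quotSeries U Ψ) := by
  have hmul : ∀ n < N, U ≤ U.comap (coeff n (Φ * Ψ)) := by
    intro n hn v hv
    rw [Submodule.mem_comap, coeff_mul, LinearMap.sum_apply]
    refine sum_mem fun p hp => ?_
    have hp := Finset.HasAntidiagonal.mem_antidiagonal.1 hp
    exact h p.1 (by omega) (h' p.2 (by omega) hv)
  rw [← sdet_mul]
  refine dvd_sdet_sub_sdet fun n hn => ?_
  refine LinearMap.ext fun v => ?_
  obtain ⟨v, rfl⟩ := U.mkQ_surjective v
  rw [← quotSeries_mkQ (hmul n hn), coeff_mul, coeff_mul, LinearMap.sum_apply, LinearMap.sum_apply,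
    map_sum]
  refine Finset.sum_congr rfl fun p hp => ?_
  have hp := Finset.HasAntidiagonal.mem_antidiagonal.1 hp
  rw [Module.End.mul_apply, Module.End.mul_apply, quotSeries_mkQ (h p.1 (by omega)),
    quotSeries_mkQ (h' p.2 (by omega))]

theorem quotSeries_one (U : Submodule k V) : quotSeries U (1 : (Module.End k V)⟦X⟧) = 1 := by
  refine PowerSeries.ext fun n => LinearMap.ext fun v => ?_
  obtain ⟨v, rfl⟩ := U.mkQ_surjective v
  rw [← quotSeries_mkQ]
  · rw [coeff_one, coeff_one]
    split_ifs <;> simp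
  · intro v hv
    rw [Submodule.mem_comap, coeff_one]
    split_ifs
    · exact hv
    · exact zero_mem _

end Quotients

/-! ### The trace formula for Laurent polynomials -/

section Laurent

open scoped Nat

variable {k : Type*} [Field k] {ι : Type*}

/-- The endomorphism of a free module given by a partially defined map on the basis. -/
def monomialEnd {α : Type*} (f : α → Option α) : Module.End k (α →₀ k) :=
  Finsupp.linearCombination k fun x => (f x).elim 0 fun y => Finsupp.single y 1

theorem monomialEnd_single {α : Type*} (f : α → Option α) (x : α) :
    monomialEnd (k := k) f (Finsupp.single x 1) = (f x).elim 0 fun y => Finsupp.single y 1 := by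
  simp [monomialEnd]

/-- Reduction modulo `t^n - 1`. -/
def cycMap (k ι : Type*) [Field k] (n : ℕ) : (ι × ℤ →₀ k) →ₗ[k] (ι × ZMod n →₀ k) :=
  Finsupp.lmapDomain k k (Prod.map id ((↑) : ℤ → ZMod n))

theorem cycMap_single (n : ℕ) (x : ι × ℤ) :
    cycMap k ι n (Finsupp.single x 1) = Finsupp.single (x.1, (x.2 : ZMod n)) 1 := by
  rw [cycMap, Finsupp.lmapDomain_apply, Finsupp.mapDomain_single]
  rfl

theorem cycMap_surjective (n : ℕ) : Function.Surjective (cycMap k ι n) :=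
  Finsupp.mapDomain_surjective (Function.surjective_id.prodMap (ZMod.intCast_surjective))

theorem tailInj (J : ℕ) : Function.Injective fun x : ι × Fin (J + 1) => (x.1, -((x.2 : ℕ) : ℤ)) := by
  rintro ⟨a, b⟩ ⟨c, d⟩ h
  simp only [Prod.mk.injEq, neg_inj, Nat.cast_inj] at h
  exact Prod.ext h.1 (Fin.ext h.2)

/-- Restriction to the coefficients of `t^{-J}, …, t^0`. -/
def tailMap (k ι : Type*) [Field k] (J : ℕ) : (ι × ℤ →₀ k) →ₗ[k] (ι × Fin (J + 1) →₀ k) :=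
  Finsupp.lcomapDomain _ (tailInj (ι := ι) J)

theorem tailMap_apply (J : ℕ) (w : ι × ℤ →₀ k) (x : ι × Fin (J + 1)) :
    tailMap k ι J w x = w (x.1, -((x.2 : ℕ) : ℤ)) := rfl

theorem tailMap_surjective (J : ℕ) : Function.Surjective (tailMap k ι J) := by
  intro w
  refine ⟨Finsupp.mapDomain (fun x : ι × Fin (J + 1) => (x.1, -((x.2 : ℕ) : ℤ))) w, ?_⟩
  exact Finsupp.comapDomain_mapDomain _ (tailInj J) _

theorem tailMap_single (J : ℕ) (x : ι × ℤ) :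
    tailMap k ι J (Finsupp.single x 1) =
      if h : x.2 ≤ 0 ∧ -J ≤ x.2 then
        Finsupp.single (x.1, ⟨(-x.2).toNat, by omega⟩) 1 else 0 := by
  classical
  ext ⟨i, a⟩
  rw [tailMap_apply, Finsupp.single_apply]
  obtain ⟨x1, x2⟩ := x
  split_ifs with h1 h2 h2
  · rw [Finsupp.single_apply, if_pos]
    simp only [Prod.mk.injEq] at h1 h2 ⊢
    refine ⟨h1.1, Fin.ext ?_⟩
    simp only
    omega
  · simp only [Prod.mk.injEq] at h1 h2
    have := a.2
    omega
  · rw [Finsupp.single_apply, if_neg]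
    simp only [Prod.mk.injEq] at h1 h2 ⊢
    rintro ⟨h3, h4⟩
    apply h1
    refine ⟨h3, ?_⟩
    rw [← h4]
    simp only
    omega
  · rfl

instance [Finite ι] (n : ℕ) [NeZero n] :
    FiniteDimensional k ((ι × ℤ →₀ k) ⧸ LinearMap.ker (cycMap k ι n)) :=
  haveI := Fintype.ofFinite ι
  Module.Finite.equiv ((cycMap k ι n).quotKerEquivOfSurjective (cycMap_surjective n)).symm

instance [Finite ι] (J : ℕ) :
    FiniteDimensional k ((ι × ℤ →₀ k) ⧸ LinearMap.ker (tailMap k ι J)) :=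
  haveI := Fintype.ofFinite ι
  Module.Finite.equiv ((tailMap k ι J).quotKerEquivOfSurjective (tailMap_surjective J)).symm

variable [Fintype k] [DecidableEq ι]

/-- The operator `E_{ij} t^m τ^d` on the vectors of Laurent polynomials
(with basis the `t^n e_i`, indexed by the pairs `(i, n)`). -/
def laurentGen (i j : ι) (m d : ℕ) : Module.End k (ι × ℤ →₀ k) :=
  monomialEnd fun x => if x.1 = j then some (i, (Fintype.card k : ℤ) ^ d * x.2 + m) else none

theorem laurentGen_single (i j : ι) (m d : ℕ) (x : ι × ℤ) :
    laurentGen (k := k) i j m d (Finsupp.single x 1) =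
      if x.1 = j then Finsupp.single (i, (Fintype.card k : ℤ) ^ d * x.2 + m) 1 else 0 := by
  rw [laurentGen, monomialEnd_single]
  split_ifs <;> rfl

/-- The operators `∑ aᵢ τⁱ` with `i ≥ d` and matrices of polynomials `aᵢ`. -/
def laurentOps (k ι : Type*) [Field k] [Fintype k] [DecidableEq ι] (d : ℕ) :
    Submodule k (Module.End k (ι × ℤ →₀ k)) :=
  Submodule.span k {θ | ∃ i j m d', d ≤ d' ∧ θ = laurentGen i j m d'}

theorem laurentGen_mem {i j : ι} {m d d' : ℕ} (h : d ≤ d') :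
    laurentGen i j m d' ∈ laurentOps k ι d :=
  Submodule.subset_span ⟨i, j, m, d', h, rfl⟩

theorem laurentOps_mono {d d' : ℕ} (h : d ≤ d') : laurentOps k ι d' ≤ laurentOps k ι d := by
  refine Submodule.span_mono ?_
  rintro _ ⟨i, j, m, e, he, rfl⟩
  exact ⟨i, j, m, e, h.trans he, rfl⟩

/-- This is the commutation rule `τ^d t^m' = t^(q^d m') τ^d`. -/
theorem laurentGen_mul (i j i' j' : ι) (m m' d d' : ℕ) :
    laurentGen (k := k) i j m d * laurentGen i' j' m' d' =
      if i' = j then laurentGen i j' (Fintype.card k ^ d * m' + m) (d + d') else 0 := by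
  refine Finsupp.lhom_ext' fun x => LinearMap.ext_ring ?_
  simp only [LinearMap.comp_apply, Finsupp.lsingle_apply, Module.End.mul_apply]
  rw [laurentGen_single]
  split_ifs with h1 h2 h2
  · subst h1 h2
    rw [laurentGen_single, laurentGen_single, if_pos rfl, if_pos rfl]
    congr 2
    push_cast
    ring
  · subst h1
    rw [laurentGen_single, if_neg h2]
    simp
  · rw [map_zero, laurentGen_single, if_neg h1]
  · simp

theorem laurentOps_mul_mem {d d' : ℕ} {θ θ' : Module.End k (ι × ℤ →₀ k)}
    (h : θ ∈ laurentOps k ι d) (h' : θ' ∈ laurentOps k ι d') : θ * θ' ∈ laurentOps k ι (d + d') := by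
  have : laurentOps k ι d * laurentOps k ι d' ≤ laurentOps k ι (d + d') := by
    rw [laurentOps, laurentOps, Submodule.span_mul_span, Submodule.span_le]
    rintro _ ⟨_, ⟨i, j, m, e, he, rfl⟩, _, ⟨i', j', m', e', he', rfl⟩, rfl⟩
    simp only [laurentGen_mul]
    split_ifs
    · exact laurentGen_mem (add_le_add he he')
    · exact zero_mem _
  exact this (Submodule.mul_mem_mul h h')

/-- The map underlying `E_{ij} t^m τ^d` modulo `t^n - 1`. -/
def cycFun (q : ℕ) (i j : ι) (m d n : ℕ) (x : ι × ZMod n) : Option (ι × ZMod n) :=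
  if x.1 = j then some (i, (q : ZMod n) ^ d * x.2 + m) else none

/-- The map underlying `E_{ij} t^m τ^d` on the span of `t^{-J}, …, t^0`. -/
def tailFun (q : ℕ) (i j : ι) (m d J : ℕ) (x : ι × Fin (J + 1)) : Option (ι × Fin (J + 1)) :=
  if h : x.1 = j ∧ m ≤ q ^ d * x.2 ∧ q ^ d * x.2 - m < J + 1 then
    some (i, ⟨q ^ d * x.2 - m, h.2.2⟩) else none

theorem cycMap_laurentGen (i j : ι) (m d n : ℕ) (w : ι × ℤ →₀ k) :
    cycMap k ι n (laurentGen i j m d w) =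
      monomialEnd (cycFun (Fintype.card k) i j m d n) (cycMap k ι n w) := by
  suffices h : cycMap k ι n ∘ₗ laurentGen i j m d =
      monomialEnd (cycFun (Fintype.card k) i j m d n) ∘ₗ cycMap k ι n from
    LinearMap.congr_fun h w
  refine Finsupp.lhom_ext' fun x => LinearMap.ext_ring ?_
  simp only [LinearMap.comp_apply, Finsupp.lsingle_apply]
  rw [laurentGen_single, cycMap_single, monomialEnd_single, cycFun]
  split_ifs with h
  · rw [cycMap_single]
    simp
  · simp

/-- Exponents outside `[-J, 0]` stay outside: positive ones remain positive, and `x < -J` gives `q^d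
x + m ≤ 2x + J < -J`. So the operator descends to the coefficients of `t^(-J), …, t^0`. -/
theorem tailMap_laurentGen (i j : ι) (m d J : ℕ) (hd : 1 ≤ d) (hm : m ≤ J) (w : ι × ℤ →₀ k) :
    tailMap k ι J (laurentGen i j m d w) =
      monomialEnd (tailFun (Fintype.card k) i j m d J) (tailMap k ι J w) := by
  suffices h : tailMap k ι J ∘ₗ laurentGen i j m d =
      monomialEnd (tailFun (Fintype.card k) i j m d J) ∘ₗ tailMap k ι J from
    LinearMap.congr_fun h w
  refine Finsupp.lhom_ext' fun x => LinearMap.ext_ring ?_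
  simp only [LinearMap.comp_apply, Finsupp.lsingle_apply]
  obtain ⟨x1, x2⟩ := x
  have hq : 2 ≤ Fintype.card k ^ d :=
    (Fintype.one_lt_card (α := k)).trans_le (Nat.le_self_pow (by omega) _)
  rw [laurentGen_single, tailMap_single]
  generalize hQ : Fintype.card k ^ d = Q at *
  have hQ' : (Fintype.card k : ℤ) ^ d = Q := by rw [← hQ]; push_cast; rfl
  rw [hQ']
  simp only
  by_cases h1 : x1 = j
  · rw [if_pos h1, tailMap_single]
    by_cases h2 : x2 ≤ 0 ∧ -(J : ℤ) ≤ x2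
    · rw [dif_pos h2, monomialEnd_single, tailFun]
      simp only [hQ]
      obtain ⟨a, ha⟩ : ∃ a : ℕ, x2 = -a := ⟨(-x2).toNat, by omega⟩
      subst ha
      have ha : (-(-(a : ℤ))).toNat = a := by omega
      simp only [ha]
      have h3 : (Q : ℤ) * -a + m = m - (Q * a : ℕ) := by push_cast; ring
      rw [h3]
      by_cases h4 : m ≤ Q * a ∧ Q * a - m < J + 1
      · rw [dif_pos (by omega), dif_pos ⟨h1, h4⟩]
        simp only [Option.elim_some]
        congr 3
        omega
      · rw [dif_neg (by omega), dif_neg (fun h => h4 h.2)]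
        rfl
    · rw [dif_neg h2, map_zero, dif_neg]
      rintro ⟨h3, h4⟩
      rcases lt_or_ge 0 x2 with h5 | h5
      · have : 0 < (Q : ℤ) * x2 := by positivity
        omega
      · have h6 : x2 < -J := by
          by_contra h7
          exact h2 ⟨h5, by omega⟩
        have : (Q : ℤ) * x2 ≤ 2 * x2 := by nlinarith
        omega
  · rw [if_neg h1, map_zero]
    split_ifs with h2
    · rw [monomialEnd_single, tailFun, dif_neg (fun h => h1 h.1)]
      rfl
    · rw [map_zero]

theorem ker_cycMap_le_comap {θ : Module.End k (ι × ℤ →₀ k)} (hθ : θ ∈ laurentOps k ι 0) (n : ℕ) :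
    LinearMap.ker (cycMap k ι n) ≤ (LinearMap.ker (cycMap k ι n)).comap θ := by
  suffices h : laurentOps k ι 0 ≤
      Submodule.compatibleMaps (LinearMap.ker (cycMap k ι n)) (LinearMap.ker (cycMap k ι n)) from
    h hθ
  refine Submodule.span_le.2 ?_
  rintro _ ⟨i, j, m, d, _, rfl⟩ w hw
  rw [LinearMap.mem_ker] at hw
  rw [Submodule.mem_comap, LinearMap.mem_ker, cycMap_laurentGen, hw, map_zero]

/-- An operator is a finite combination of monomial ones; it suffices that `J` is at least every
power of `t` occurring in them. -/
theorem exists_ker_tailMap_le_comap {θ : Module.End k (ι × ℤ →₀ k)} (hθ : θ ∈ laurentOps k ι 1) :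
    ∃ J₀, ∀ J, J₀ ≤ J →
      LinearMap.ker (tailMap k ι J) ≤ (LinearMap.ker (tailMap k ι J)).comap θ := by
  induction hθ using Submodule.span_induction with
  | mem θ h =>
    obtain ⟨i, j, m, d, hd, rfl⟩ := h
    refine ⟨m, fun J hJ w hw => ?_⟩
    rw [LinearMap.mem_ker] at hw
    rw [Submodule.mem_comap, LinearMap.mem_ker, tailMap_laurentGen _ _ _ _ _ hd hJ, hw, map_zero]
  | zero => exact ⟨0, fun J _ => (Submodule.compatibleMaps _ _).zero_mem⟩
  | add x y _ _ hx hy =>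
    obtain ⟨a, ha⟩ := hx
    obtain ⟨b, hb⟩ := hy
    exact ⟨max a b, fun J hJ => (Submodule.compatibleMaps _ _).add_mem
      (ha J (le_of_max_le_left hJ)) (hb J (le_of_max_le_right hJ))⟩
  | smul c x _ hx =>
    obtain ⟨a, ha⟩ := hx
    exact ⟨a, fun J hJ => (Submodule.compatibleMaps _ _).smul_mem c (ha J hJ)⟩

end Laurent

end TraceFormula

namespace TraceFormula

/-! ### Determinants of monomial operators on the finite quotients of Laurent polynomials. -/

section LaurentDet

variable {k : Type*} [Field k] {ι : Type*}

theorem coeff_one_add_monomial {E : Type*} [Semiring E] {n : ℕ} (hn : 1 ≤ n) (a : E)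
    (m : ℕ) :
    coeff m (1 + monomial n a : E⟦X⟧) = if m = 0 then 1 else if m = n then a else 0 := by
  rw [map_add, coeff_one, coeff_monomial]
  by_cases h : m = 0
  · subst h
    rw [if_pos rfl, if_pos rfl, if_neg (by omega), add_zero]
  · rw [if_neg h, if_neg h, zero_add]

/-- In the basis of monomials the induced operator is a monomial matrix, so its determinant depends
only on the cycles of `f`. -/
theorem dvd_sdet_quotSeries_monomialEnd {V : Type*} [AddCommGroup V] [Module k V]
    {α : Type*} [Fintype α] [DecidableEq α] (π : V →ₗ[k] (α →₀ k)) (hπ : Function.Surjective π)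
    [FiniteDimensional k (V ⧸ LinearMap.ker π)] {θ : Module.End k V} {f : α → Option α}
    (hθ : ∀ v, π (θ v) = monomialEnd f (π v)) (c : k) {n : ℕ} (hn : 1 ≤ n) (N : ℕ) :
    (X : k⟦X⟧) ^ N ∣ sdet (quotSeries (LinearMap.ker π) (1 + monomial n (c • θ))) -
      (1 + (X : k⟦X⟧) ^ n • monomialMatrix f (C c)).det := by
  set Ψ : (Module.End k V)⟦X⟧ := 1 + monomial n (c • θ)
  set Φ : (Module.End k (α →₀ k))⟦X⟧ := 1 + monomial n (c • monomialEnd f)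
  have hint : ∀ m v, π (coeff m Ψ v) = coeff m Φ (π v) := by
    intro m v
    have h1 : coeff m Ψ = _ := coeff_one_add_monomial hn _ m
    have h2 : coeff m Φ = _ := coeff_one_add_monomial hn _ m
    rw [h1, h2]
    split_ifs <;> simp [hθ]
  have hker : ∀ m, LinearMap.ker π ≤ (LinearMap.ker π).comap (coeff m Ψ) := by
    intro m v hv
    rw [LinearMap.mem_ker] at hv
    rw [Submodule.mem_comap, LinearMap.mem_ker, hint, hv, map_zero]
  have h1 : (X : k⟦X⟧) ^ N ∣ sdet (quotSeries (LinearMap.ker π) Ψ) - sdet Φ :=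
    dvd_sdet_sub_sdet_of_ker_eq (LinearMap.ker π).mkQ π (Submodule.mkQ_surjective _) hπ
      (Submodule.ker_mkQ _) (fun m _ v => quotSeries_mkQ (hker m) v) (fun m _ v => hint m v)
  have h2 : sdet Φ = (1 + (X : k⟦X⟧) ^ n • monomialMatrix f (C c)).det := by
    rw [sdet_eq_det (Finsupp.basisSingleOne (R := k) (ι := α)), seriesMatrix_add, seriesMatrix_one]
    congr 2
    ext i j m
    rw [coeff_seriesMatrix, coeff_monomial, Matrix.smul_apply, smul_eq_mul, coeff_X_pow_mul',
      monomialMatrix, Matrix.of_apply]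
    split_ifs with h1 h2 h3 h3 h4
    · subst h1
      rw [Nat.sub_self]
      simp [LinearMap.toMatrix_apply, monomialEnd_single, h3]
    · subst h1
      simp only [LinearMap.toMatrix_apply, LinearMap.smul_apply, Finsupp.coe_basisSingleOne,
        monomialEnd_single]
      cases hfj : f j with
      | none => simp
      | some y =>
        have : y ≠ i := fun h => h3 (by rw [hfj, h])
        simp [this]
    · omega
    · rw [coeff_C, if_neg (by omega)]; simp
    · simp
    · simp
  rwa [h2] at h1

theorem affine_iterate {R : Type*} [CommRing R] {a b : R} {x : ℕ → R}
    (hx : ∀ i, x (i + 1) = a * x i + b) (s : ℕ) :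
    x s = a ^ s * x 0 + b * ∑ r ∈ Finset.range s, a ^ r := by
  induction s with
  | zero => simp
  | succ s ih => rw [hx, ih, geom_sum_succ]; ring

variable [Fintype k]

/-- The exponent `q ^ K! - 1`. -/
abbrev cycLen (k : Type*) [Fintype k] (K : ℕ) : ℕ := Fintype.card k ^ (Nat.factorial K) - 1

instance (K : ℕ) : NeZero (cycLen k K) :=
  ⟨Nat.sub_ne_zero_of_lt (Nat.one_lt_pow (Nat.factorial_ne_zero K) Fintype.one_lt_card)⟩

/-- The purpose of the factorial: all the numbers `q^(ds) - 1` with `ds ≤ K`, which count periodic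
points, divide one modulus. -/
theorem pow_mul_sub_one_dvd_cycLen {k : Type*} [Fintype k] {K d s : ℕ} (hd : 1 ≤ d) (hs : 1 ≤ s) (h : d * s ≤ K) :
    Fintype.card k ^ (d * s) - 1 ∣ cycLen k K :=
  Nat.pow_sub_one_dvd_pow_sub_one _ (Nat.dvd_factorial (Nat.mul_pos hd hs) h)

/-- Translation by `l` conjugates `z ↦ Qz + (Q - 1)l` to multiplication by `Q`. The fixed points of
its `s`-th power are the kernel of `Q^s - 1` on the cyclic group `ℤ/n`, of order `gcd(n, Q^s - 1)`.
-/
theorem card_fixed_affine {n Q l s : ℕ} [NeZero n] (hs : Q ^ s - 1 ∣ n) (hQ : 1 ≤ Q) :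
    Nat.card {z : ZMod n // (Q : ZMod n) ^ s * z +
      ((Q - 1) * l : ℕ) * ∑ r ∈ Finset.range s, (Q : ZMod n) ^ r = z} = Q ^ s - 1 := by
  have h1 := IsAddCyclic.card_nsmulAddMonoidHom_ker (G := ZMod n) (Q ^ s - 1)
  rw [Nat.card_zmod, Nat.gcd_eq_right hs] at h1
  rw [← h1]
  refine Nat.card_congr ((Equiv.addRight (l : ZMod n)).subtypeEquiv fun z => ?_)
  rw [AddMonoidHom.mem_ker, nsmulAddMonoidHom_apply, nsmul_eq_mul, Equiv.coe_addRight,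
    Nat.cast_sub (Nat.one_le_pow _ _ hQ)]
  have h2 := geom_sum_mul (Q : ZMod n) s
  rw [Nat.cast_mul, Nat.cast_sub hQ, ← sub_eq_zero]
  push_cast
  refine Eq.congr_left ?_
  linear_combination (l : ZMod n) * h2

variable [DecidableEq ι]

/-- The operators `∑ aᵢ τⁱ` without constant term, as an additive group. -/
def laurentPos (k ι : Type*) [Field k] [Fintype k] [DecidableEq ι] :
    AddSubgroup (Module.End k (ι × ℤ →₀ k)) where
  carrier := laurentOps k ι 1
  add_mem' := add_mem
  zero_mem' := zero_mem _
  neg_mem' {x} hx := by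
    have := (laurentOps k ι 1).smul_mem (-1 : k) hx
    have h : (-1 : k) • x = -x := LinearMap.ext fun v => by simp
    rwa [h] at this

theorem exists_ker_tailMap_le_comap_coeff {u : (Module.End k (ι × ℤ →₀ k))⟦X⟧}
    (hu : IsUnipotentSeries (fun _ => laurentPos k ι) u) (N : ℕ) :
    ∃ J₀, ∀ J, J₀ ≤ J → ∀ n < N,
      LinearMap.ker (tailMap k ι J) ≤ (LinearMap.ker (tailMap k ι J)).comap (coeff n u) := by
  induction N with
  | zero => exact ⟨0, fun _ _ _ h => absurd h (by omega)⟩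
  | succ N ih =>
    obtain ⟨a, ha⟩ := ih
    obtain ⟨b, hb⟩ : ∃ J₀, ∀ J, J₀ ≤ J → LinearMap.ker (tailMap k ι J) ≤
        (LinearMap.ker (tailMap k ι J)).comap (coeff N u) := by
      rcases Nat.eq_zero_or_pos N with rfl | hN
      · rw [hu.1]
        exact ⟨0, fun _ _ _ h => h⟩
      · exact exists_ker_tailMap_le_comap (hu.2 N hN)
    refine ⟨max a b, fun J hJ n hn => ?_⟩
    rcases Nat.lt_succ_iff_lt_or_eq.1 hn with h | rfl
    · exact ha J (le_of_max_le_left hJ) n h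
    · exact hb J (le_of_max_le_right hJ)

theorem ker_cycMap_le_comap_coeff {u : (Module.End k (ι × ℤ →₀ k))⟦X⟧}
    (hu : IsUnipotentSeries (fun _ => laurentPos k ι) u) (L n : ℕ) :
    LinearMap.ker (cycMap k ι L) ≤ (LinearMap.ker (cycMap k ι L)).comap (coeff n u) := by
  rcases Nat.eq_zero_or_pos n with rfl | hn
  · rw [hu.1]
    exact fun _ h => h
  · exact ker_cycMap_le_comap (laurentOps_mono zero_le_one (hu.2 n hn)) L

variable [Finite ι]

/-- A point of period `s ≤ N + 1` would force `i = j`, as its orbit continues, and `(Q^s - 1)z + m(1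
+ ⋯ + Q^(s-1)) = 0` modulo the modulus, where `Q = q^d`. Since `Q^s - 1` divides the modulus, `Q -
1` would divide `m`. Without short cycles the determinant is 1. -/
theorem dvd_sdet_cyc_of_not (i j : ι) {m d n N K : ℕ} (c : k) (hd : 1 ≤ d) (hn : 1 ≤ n)
    (hK : d * (N + 1) ≤ K) (h : ¬(i = j ∧ Fintype.card k ^ d - 1 ∣ m)) :
    (X : k⟦X⟧) ^ N ∣ sdet (quotSeries (LinearMap.ker (cycMap k ι (cycLen k K)))
      (1 + monomial n (c • laurentGen i j m d))) - 1 := by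
  classical
  have := Fintype.ofFinite ι
  set q := Fintype.card k with hq
  have hq1 : 1 ≤ q ^ d := Nat.one_le_pow _ _ Fintype.card_pos
  have key : ∀ (x : ℕ → ι × ZMod (cycLen k K)) (s : ℕ), 0 < s → s ≤ N + 1 →
      (∀ r, cycFun q i j m d (cycLen k K) (x r) = some (x (r + 1))) → x s ≠ x 0 := by
    intro x s hs hsN hx hxs
    apply h
    have hx1 : ∀ r, (x r).1 = j ∧ x (r + 1) =
        (i, (q : ZMod (cycLen k K)) ^ d * (x r).2 + m) := by
      intro r
      have := hx r
      rw [cycFun] at this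
      split_ifs at this with h1
      exact ⟨h1, (Option.some.inj this).symm⟩
    refine ⟨by rw [← (hx1 1).1, (hx1 0).2], ?_⟩
    have h2 := affine_iterate (x := fun r => (x r).2) (fun r => by rw [(hx1 r).2]) s
    rw [hxs] at h2
    obtain ⟨z, hz⟩ := ZMod.intCast_surjective (x 0).2
    rw [← hz] at h2
    have h3 : (((((q : ℤ) ^ d) ^ s - 1) * z + m * ∑ r ∈ Finset.range s, ((q : ℤ) ^ d) ^ r : ℤ) :
        ZMod (cycLen k K)) = 0 := by
      push_cast
      linear_combination -h2
    rw [ZMod.intCast_zmod_eq_zero_iff_dvd] at h3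
    have h4 : ((q : ℤ) ^ d) ^ s - 1 ∣ (cycLen k K : ℤ) := by
      have := Int.natCast_dvd_natCast.2 (pow_mul_sub_one_dvd_cycLen (k := k) hd hs
        ((Nat.mul_le_mul_left d hsN).trans hK))
      rwa [Nat.cast_sub (Nat.one_le_pow _ _ Fintype.card_pos), Nat.cast_pow, pow_mul,
        Nat.cast_one] at this
    have h5 := (dvd_add_right (Dvd.intro z rfl)).1 (h4.trans h3)
    rw [← geom_sum_mul ((q : ℤ) ^ d) s, mul_comm, mul_comm (m : ℤ)] at h5
    rw [mul_comm, mul_comm _ (m : ℤ)] at h5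
    have h6 : (0 : ℤ) < ∑ r ∈ Finset.range s, ((q : ℤ) ^ d) ^ r := by
      refine Finset.sum_pos (fun r _ => ?_) ⟨0, Finset.mem_range.2 hs⟩
      have : (0 : ℤ) < q := by exact_mod_cast Fintype.card_pos
      positivity
    have h7 : ((q : ℤ) ^ d - 1) ∣ m := by
      rw [mul_comm] at h5
      exact Int.dvd_of_mul_dvd_mul_right h6.ne' h5
    rw [← Int.natCast_dvd_natCast, Nat.cast_sub hq1]
    exact_mod_cast h7
  have h1 := dvd_sdet_quotSeries_monomialEnd (cycMap k ι (cycLen k K)) (cycMap_surjective _)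
    (cycMap_laurentGen i j m d _) c hn N
  refine dvd_sub_trans h1 ?_
  have h2 := pow_dvd_det_one_add_sub_prod (cycFun q i j m d (cycLen k K)) N
    (fun x s hs hsN hx hxs => absurd hxs (key x s hs (by omega) hx)) ((X : k⟦X⟧) ^ n) (C c)
  rw [← pow_mul] at h2
  have h3 := (pow_dvd_pow X (Nat.le_mul_of_pos_left N hn)).trans h2
  rwa [Finset.prod_eq_one] at h3
  intro x _
  rw [if_neg, add_zero]
  intro hx
  exact key (fun _ => x) 1 one_pos (by omega) (fun _ => hx) rfl

/-- The matrix `P` of the affine map has `tr P^s = Q^s - 1` with `Q = q^d` by `card_fixed_affine`.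
As `Q = 0` in `k`, these traces force the determinant to be inverse to `1 + c X^n`. -/
theorem dvd_sdet_cyc_of_dvd (i : ι) {l d n N K : ℕ} (c : k) (hd : 1 ≤ d) (hn : 1 ≤ n)
    (hK : d * (N + 1) ≤ K) :
    (X : k⟦X⟧) ^ N ∣ sdet (quotSeries (LinearMap.ker (cycMap k ι (cycLen k K)))
      (1 + monomial n (c • laurentGen i i ((Fintype.card k ^ d - 1) * l) d))) *
        (1 + X ^ n * C c) - 1 := by
  classical
  have := Fintype.ofFinite ι
  set q := Fintype.card k with hq
  set m := (q ^ d - 1) * l with hm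
  set L := cycLen k K with hL
  have hq1 : 1 ≤ q ^ d := Nat.one_le_pow _ _ Fintype.card_pos
  set f := cycFun q i i m d L with hf
  set P : Matrix (ι × ZMod L) (ι × ZMod L) ℤ := monomialMatrix f 1 with hP
  -- The entries of `P ^ s` describe the `s`-th iterate of the affine map, defined on the component
  -- `i` only.
  have hpow : ∀ s, 1 ≤ s → ∀ y x, (P ^ s) y x = if x.1 = i ∧ y = (i, ((q ^ d : ℕ) : ZMod L) ^ s * x.2 +
      (m : ZMod L) * ∑ r ∈ Finset.range s, ((q ^ d : ℕ) : ZMod L) ^ r) then 1 else 0 := by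
    intro s hs
    induction s, hs using Nat.le_induction with
    | base =>
      intro y x
      simp only [pow_one, hP, monomialMatrix, Matrix.of_apply, hf, cycFun, Finset.range_one,
        Finset.sum_singleton, pow_zero, mul_one, Nat.cast_pow]
      by_cases hx : x.1 = i
      · simp only [hx, if_true, true_and, Option.some_inj, eq_comm (a := y)]
      · simp [hx]
    | succ s hs ih =>
      intro y x
      rw [pow_succ, Matrix.mul_apply]
      by_cases hx : x.1 = i
      · rw [Finset.sum_eq_single (i, (q : ZMod L) ^ d * x.2 + m)]
        · rw [ih]
          simp only [hP, monomialMatrix, Matrix.of_apply, hf, cycFun, hx, if_true, true_and, mul_one]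
          have : ((q ^ d : ℕ) : ZMod L) ^ s * ((q : ZMod L) ^ d * x.2 + m) +
              (m : ZMod L) * ∑ r ∈ Finset.range s, ((q ^ d : ℕ) : ZMod L) ^ r =
              ((q ^ d : ℕ) : ZMod L) ^ (s + 1) * x.2 +
              (m : ZMod L) * ∑ r ∈ Finset.range (s + 1), ((q ^ d : ℕ) : ZMod L) ^ r := by
            rw [Finset.sum_range_succ]
            push_cast
            ring
          rw [this]
        · intro z _ hz
          simp only [hP, monomialMatrix, Matrix.of_apply, hf, cycFun, hx, if_true,
            Option.some_inj]
          rw [if_neg (Ne.symm hz), mul_zero]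
        · simp
      · rw [if_neg (fun h => hx h.1)]
        refine Finset.sum_eq_zero fun z _ => ?_
        simp [hP, monomialMatrix, hf, cycFun, hx]
  have htr : ∀ s, 1 ≤ s → s ≤ N → (P ^ s).trace = ((q ^ d : ℕ) : ℤ) ^ s - 1 := by
    intro s hs hsN
    have hdvd := pow_mul_sub_one_dvd_cycLen (k := k) hd hs
        ((Nat.mul_le_mul_left d (show s ≤ N + 1 by omega)).trans hK)
    rw [pow_mul] at hdvd
    have hc := card_fixed_affine (l := l) hdvd hq1
    rw [Matrix.trace, Fintype.sum_prod_type, Finset.sum_eq_single i]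
    · simp only [Matrix.diag_apply, hpow s hs, true_and, Prod.mk.injEq]
      rw [Finset.sum_boole, ← Fintype.card_subtype, ← Nat.card_eq_fintype_card]
      have : Nat.card {z : ZMod L // z = ((q ^ d : ℕ) : ZMod L) ^ s * z +
          (m : ZMod L) * ∑ r ∈ Finset.range s, ((q ^ d : ℕ) : ZMod L) ^ r} = (q ^ d) ^ s - 1 := by
        rw [← hc]
        exact Nat.card_congr (Equiv.subtypeEquivRight fun z => eq_comm)
      rw [this, Nat.cast_sub (Nat.one_le_pow _ _ hq1)]
      push_cast
      rfl
    · intro b _ hb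
      refine Finset.sum_eq_zero fun z _ => ?_
      rw [Matrix.diag_apply, hpow s hs, if_neg (fun h => hb h.1)]
    · simp
  have hQ : (((q ^ d : ℕ) : ℤ) : k⟦X⟧) = 0 := by
    have h1 : ((q : ℕ) : k⟦X⟧) = 0 := by
      have : ((q : ℕ) : k) = 0 := Nat.cast_card_eq_zero k
      rw [← map_natCast (C (R := k)), this, map_zero]
    rw [Int.cast_natCast, Nat.cast_pow, h1, zero_pow (by omega)]
  have h1 := dvd_sdet_quotSeries_monomialEnd (cycMap k ι L) (cycMap_surjective _)
    (cycMap_laurentGen i i m d _) c hn N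
  have h2 := pow_dvd_det_one_add_mul_sub_one P _ hQ N htr ((X : k⟦X⟧) ^ n * C c)
  have h3 : ((X : k⟦X⟧) ^ n * C c) • P.map (Int.cast : ℤ → k⟦X⟧) =
      (X : k⟦X⟧) ^ n • monomialMatrix f (C c) := by
    ext1 x y
    simp only [hP, monomialMatrix, Matrix.smul_apply, Matrix.map_apply, Matrix.of_apply,
      smul_eq_mul]
    split_ifs <;> simp
  rw [h3, mul_pow, ← pow_mul] at h2
  have h4 := (pow_dvd_pow (X : k⟦X⟧) (show N ≤ n * (N + 1) by nlinarith)).trans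
    ((Dvd.intro _ rfl).trans h2)
  refine dvd_sub_trans (dvd_sub_mul h1 ?_) h4
  rw [sub_self]
  exact dvd_zero _

/-- With `Q = q^d`, the index `a` of `t^(-a)` moves to `Qa - m`. This map is expanding, so a
periodic point solves `(Q - 1)a = m` and is fixed. There is one fixed point if `i = j` and `Q - 1`
divides `m`, and it is in range because `m ≤ J`. -/
theorem dvd_sdet_tail (i j : ι) {m d n N J : ℕ} (c : k) (hd : 1 ≤ d) (hn : 1 ≤ n) (hJ : m ≤ J) :
    (X : k⟦X⟧) ^ N ∣ sdet (quotSeries (LinearMap.ker (tailMap k ι J))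
      (1 + monomial n (c • laurentGen i j m d))) -
        (1 + if i = j ∧ Fintype.card k ^ d - 1 ∣ m then X ^ n * C c else 0) := by
  classical
  have := Fintype.ofFinite ι
  set q := Fintype.card k with hq
  set Q := q ^ d with hQdef
  have hQ : 2 ≤ Q := Fintype.one_lt_card.trans_le (Nat.le_self_pow (by omega) _)
  have hf : ∀ x y, tailFun q i j m d J x = some y ↔
      x.1 = j ∧ y.1 = i ∧ Q * (x.2 : ℕ) = m + y.2 := by
    intro x y
    simp only [tailFun, ← hQdef]
    split_ifs with h
    · rw [Option.some_inj, Prod.ext_iff, Fin.ext_iff]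
      simp only [h.1, true_and, eq_comm (a := i)]
      refine and_congr_right fun _ => ?_
      omega
    · simp only [false_iff, not_and]
      intro h1 h2 h3
      have := y.2.2
      exact h ⟨h1, by omega, by omega⟩
  have key : ∀ (x : ℕ → ι × Fin (J + 1)) (s : ℕ), 0 < s → s < N →
      (∀ r, tailFun q i j m d J (x r) = some (x (r + 1))) → x s = x 0 → x 1 = x 0 := by
    intro x s hs _ hx hxs
    have hx1 := fun r => (hf _ _).1 (hx r)
    have h2 := affine_iterate (R := ℤ) (x := fun r => (((x r).2 : ℕ) : ℤ)) (a := Q) (b := -m)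
      (fun r => by have := (hx1 r).2.2; push_cast [← @Nat.cast_inj ℤ] at this; linarith) s
    rw [hxs] at h2
    have h3 := geom_sum_mul (Q : ℤ) s
    have h6 : (0 : ℤ) < ∑ r ∈ Finset.range s, (Q : ℤ) ^ r :=
      Finset.sum_pos (fun r _ => by positivity) ⟨0, Finset.mem_range.2 hs⟩
    have h7 : (∑ r ∈ Finset.range s, (Q : ℤ) ^ r) * ((Q - 1) * ((x 0).2 : ℤ) - m) = 0 := by
      linear_combination ((x 0).2 : ℤ) * h3 - h2
    have h8 := (mul_eq_zero.1 h7).resolve_left h6.ne'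
    refine Prod.ext ?_ (Fin.ext ?_)
    · have h9 := (hx1 (s - 1)).2.1
      rw [show s - 1 + 1 = s by omega, hxs] at h9
      rw [(hx1 0).2.1, h9]
    · have h9 := (hx1 0).2.2
      rw [zero_add] at h9
      push_cast [← @Nat.cast_inj ℤ] at h9 ⊢
      linarith
  have h1 := dvd_sdet_quotSeries_monomialEnd (tailMap k ι J)
    (tailMap_surjective _) (fun w => tailMap_laurentGen i j m d J hd hJ w) c hn N
  refine dvd_sub_trans h1 ?_
  have h2 := pow_dvd_det_one_add_sub_prod _ N key ((X : k⟦X⟧) ^ n) (C c)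
  rw [← pow_mul] at h2
  have h3 := (pow_dvd_pow X (Nat.le_mul_of_pos_left N hn)).trans h2
  refine dvd_sub_trans h3 ?_
  have h4 : ∀ x, tailFun q i j m d J x = some x ↔
      (i = j ∧ Q - 1 ∣ m) ∧ x.1 = i ∧ (x.2 : ℕ) = m / (Q - 1) := by
    intro x
    rw [hf]
    have h5 : Q * (x.2 : ℕ) = m + x.2 ↔ (Q - 1) * (x.2 : ℕ) = m := by
      rw [Nat.sub_mul, one_mul]
      have : (x.2 : ℕ) ≤ Q * x.2 := Nat.le_mul_of_pos_left _ (by omega)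
      omega
    rw [h5]
    constructor
    · rintro ⟨ha, hb, hc⟩
      exact ⟨⟨by rw [← ha, hb], Dvd.intro _ hc⟩, hb,
        by rw [← hc, Nat.mul_div_cancel_left _ (by omega)]⟩
    · rintro ⟨⟨ha, hb⟩, hc, hd⟩
      exact ⟨by rw [← ha, hc], hc, by rw [hd, Nat.mul_div_cancel' hb]⟩
  simp only [h4]
  split_ifs with h5
  · have h6 : m / (Q - 1) < J + 1 := (Nat.div_le_self _ _).trans_lt (by omega)
    rw [Finset.prod_eq_single (i, ⟨m / (Q - 1), h6⟩)]
    · rw [if_pos ⟨h5, rfl, rfl⟩, sub_self]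
      exact dvd_zero _
    · intro x _ hx
      rw [if_neg, add_zero]
      rintro ⟨_, ha, hb⟩
      exact hx (Prod.ext ha (Fin.ext hb))
    · simp
  · rw [Finset.prod_eq_one, add_zero, sub_self]
    · exact dvd_zero _
    · intro x _
      rw [if_neg (fun h => h5 h.1), add_zero]

/-- The trace formula for vectors of Laurent polynomials. -/
theorem exists_dvd_sdet_cyc_mul_sdet_tail_sub_one {u : (Module.End k (ι × ℤ →₀ k))⟦X⟧}
    (hu : IsUnipotentSeries (fun _ => laurentPos k ι) u) (N : ℕ) :
    ∃ K₀ J₀, ∀ K J, K₀ ≤ K → J₀ ≤ J → (X : k⟦X⟧) ^ N ∣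
      sdet (quotSeries (LinearMap.ker (cycMap k ι (cycLen k K))) u) *
        sdet (quotSeries (LinearMap.ker (tailMap k ι J)) u) - 1 := by
  have hF : ∀ i j : ℕ, 1 ≤ i → 1 ≤ j → ∀ x ∈ laurentPos k ι,
      ∀ y ∈ laurentPos k ι, x * y ∈ laurentPos k ι :=
    fun _ _ _ _ x hx y hy => laurentOps_mono (by omega) (laurentOps_mul_mem hx hy)
  refine IsUnipotentSeries.induction (P := fun u => ∃ K₀ J₀, ∀ K J, K₀ ≤ K → J₀ ≤ J →
    (X : k⟦X⟧) ^ N ∣ sdet (quotSeries (LinearMap.ker (cycMap k ι (cycLen k K))) u) *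
        sdet (quotSeries (LinearMap.ker (tailMap k ι J)) u) - 1) hF
    (fun _ => {g | ∃ (c : k) (i j : ι) (m d : ℕ), 1 ≤ d ∧ g = c • laurentGen i j m d}) ?_ N
    ?_ ?_ ?_ hu
  · intro n _ x hx
    change x ∈ Submodule.span k _ at hx
    rw [← Submodule.mem_toAddSubmonoid, Submodule.span_eq_closure] at hx
    refine AddSubmonoid.closure_mono ?_ hx
    rintro _ ⟨c, _, _, ⟨i, j, m, d, hd, rfl⟩, rfl⟩
    exact ⟨c, i, j, m, d, hd, rfl⟩
  · intro u _ hu1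
    refine ⟨0, 0, fun K J _ _ => ?_⟩
    have aux : ∀ (U : Submodule k (ι × ℤ →₀ k)) [FiniteDimensional k ((ι × ℤ →₀ k) ⧸ U)],
        (X : k⟦X⟧) ^ N ∣ sdet (quotSeries U u) - 1 := by
      intro U _
      have h := sdet_one (k := k) (V := (ι × ℤ →₀ k) ⧸ U)
      rw [← quotSeries_one] at h
      rw [← h]
      refine dvd_sdet_sub_sdet fun n hn => ?_
      rw [quotSeries, quotSeries, coeff_mk, coeff_mk, hu1 n hn]
    simpa using dvd_sub_mul (aux (LinearMap.ker (cycMap k ι (cycLen k K))))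
      (aux (LinearMap.ker (tailMap k ι J)))
  -- Besides the bounds for both factors, `J` must be large enough for the kernel of `tailMap` to be
  -- stable under their coefficients, so that determinants on the quotient multiply.
  · rintro u v hu hv ⟨K₁, J₁, h₁⟩ ⟨K₂, J₂, h₂⟩
    obtain ⟨J₃, h₃⟩ := exists_ker_tailMap_le_comap_coeff hu N
    obtain ⟨J₄, h₄⟩ := exists_ker_tailMap_le_comap_coeff hv N
    refine ⟨max K₁ K₂, max (max J₁ J₂) (max J₃ J₄), fun K J hK hJ => ?_⟩
    simp only [max_le_iff] at hK hJ
    have h5 := dvd_sdet_quotSeries_mul (U := LinearMap.ker (cycMap k ι (cycLen k K)))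
      (fun n (_ : n < N) => ker_cycMap_le_comap_coeff hu _ n)
      (fun n _ => ker_cycMap_le_comap_coeff hv _ n)
    have h6 := dvd_sdet_quotSeries_mul (h₃ J hJ.2.1) (h₄ J hJ.2.2)
    refine dvd_sub_trans (dvd_sub_mul h5 h6) ?_
    have h7 := dvd_sub_mul (h₁ K J hK.1 hJ.1.1) (h₂ K J hK.2 hJ.1.2)
    rw [mul_one] at h7
    convert h7 using 2
    ring
  · rintro n hn hnN _ ⟨c, i, j, m, d, hd, rfl⟩
    have hmem : c • laurentGen i j m d ∈ laurentOps k ι 1 :=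
      Submodule.smul_mem _ c (laurentGen_mem hd)
    refine ⟨1 + monomial n (c • laurentGen i j m d), ⟨?_, fun r hr => ?_⟩, ?_, fun r hr => ?_, ?_⟩
    · rw [coeff_one_add_monomial hn, if_pos rfl]
    · rw [coeff_one_add_monomial hn, if_neg (by omega)]
      split_ifs
      · exact hmem
      · exact zero_mem _
    -- For a generator the two determinants are `1/(1 + c X^n)` and `1 + c X^n` if there is a fixed
    -- point, and both are 1 if not.
    · refine ⟨d * (N + 1), m, fun K J hK hJ => ?_⟩
      have h1 := dvd_sdet_tail (N := N) i j c hd hn hJ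
      by_cases h : i = j ∧ Fintype.card k ^ d - 1 ∣ m
      · rw [if_pos h] at h1
        obtain ⟨rfl, l, rfl⟩ := h
        refine dvd_sub_trans (dvd_sub_mul ?_ h1) (dvd_sdet_cyc_of_dvd i (l := l) c hd hn hK)
        rw [sub_self]
        exact dvd_zero _
      · rw [if_neg h, add_zero] at h1
        simpa using dvd_sub_mul (dvd_sdet_cyc_of_not i j c hd hn hK h) h1
    · rw [coeff_one_add_monomial hn, coeff_one]
      split_ifs with h1 h2
      · rfl
      · omega
      · rfl
    · rw [coeff_one_add_monomial hn, if_neg (by omega), if_pos rfl]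

end LaurentDet

end TraceFormula

namespace TraceFormula

/-! ### Determinants and shifted filtrations. -/

section Filtration

variable {k : Type*} [Field k] {V : Type*} [AddCommGroup V] [Module k V]
  {V' : Type*} [AddCommGroup V'] [Module k V'] [FiniteDimensional k V] [FiniteDimensional k V']

/-- A quotient map whose kernel has a finite filtration shifted by the `φₙ` does not change the
determinant of `1 + ∑ φₙ Xⁿ`. -/
theorem dvd_sdet_sub_sdet_of_filtration {N : ℕ} (π : V →ₗ[k] V') (hπ : Function.Surjective π)
    {Φ : (Module.End k V)⟦X⟧} {Φ' : (Module.End k V')⟦X⟧}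
    (h : ∀ n < N, ∀ v, π (coeff n Φ v) = coeff n Φ' (π v))
    (S : ℕ → Submodule k V) (L : ℕ) (h0 : S 0 = LinearMap.ker π) (h1 : S 1 ≤ S 0) (hL : S L = ⊥)
    (hS : ∀ i, ∀ n < N, ∀ v ∈ S i, coeff n Φ v ∈ S (i + 1)) :
    (X : k⟦X⟧) ^ N ∣ sdet (1 + Φ) - sdet (1 + Φ') := by
  have hinv : ∀ n < N, ∀ v ∈ LinearMap.ker π, coeff n Φ v ∈ LinearMap.ker π := by
    intro n hn v hv
    rw [← h0] at hv ⊢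
    exact h1 (hS 0 n hn v hv)
  set Ψ : (Module.End k (LinearMap.ker π))⟦X⟧ := PowerSeries.mk fun n =>
    if hn : n < N then (coeff n Φ).restrict (hinv n hn) else 0 with hΨ
  have hcoe : ∀ n < N, ∀ v, ((coeff n Ψ v : LinearMap.ker π) : V) = coeff n Φ v := by
    intro n hn v
    rw [hΨ, coeff_mk, dif_pos hn]
    rfl
  have hone : ∀ {E : Type _} [AddCommGroup E] [Module k E] (n : ℕ) (v : E),
      coeff n (1 : (Module.End k E)⟦X⟧) v = if n = 0 then v else 0 := by
    intro E _ _ n v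
    rw [coeff_one]
    split_ifs <;> rfl
  -- The determinant factors along `ker π → V → V'`; on the kernel the coefficients shift the
  -- filtration, so the factor there is 1.
  have e1 := dvd_sdet_exact (N := N) (LinearMap.ker π).subtype (Submodule.subtype_injective _) π hπ
    (fun v => by simp) (Φ' := 1 + Ψ) (Φ := 1 + Φ) (Φ'' := 1 + Φ')
    (fun n hn v => by
      rw [map_add, map_add, LinearMap.add_apply, LinearMap.add_apply, hone, map_add]
      congr 1
      · rw [coeff_one]
        split_ifs <;> simp
      · exact (hcoe n hn v).symm)
    (fun n hn v => by
      rw [map_add, map_add, LinearMap.add_apply, LinearMap.add_apply, hone, map_add, h n hn]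
      congr 1
      rw [coeff_one]
      split_ifs <;> simp)
  have e2 : (X : k⟦X⟧) ^ N ∣ sdet (1 + Ψ) - 1 := by
    refine dvd_sdet_one_add_sub_one (fun i => (S i).comap (LinearMap.ker π).subtype) L ?_ ?_ ?_
    · rw [h0]; simp
    · rw [hL, Submodule.comap_bot, Submodule.ker_subtype]
    · intro i n hn v hv
      rw [Submodule.mem_comap, Submodule.subtype_apply, hcoe n hn]
      exact hS i n hn _ hv
  refine dvd_sub_trans e1 ?_
  have := dvd_sub_mul e2 (show (X : k⟦X⟧) ^ N ∣ sdet (1 + Φ') - sdet (1 + Φ') by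
    rw [sub_self]; exact dvd_zero _)
  rwa [one_mul] at this

theorem sdet_of_subsingleton [Subsingleton V] (Φ : (Module.End k V)⟦X⟧) : sdet Φ = 1 := by
  rw [← sdet_one (k := k) (V := V)]
  congr 1
  ext n v
  exact Subsingleton.elim _ _

end Filtration

/-! ### Twisted polynomials acting on modules -/

section TwistedAction

variable {k : Type*} [Field k] [Fintype k] {R : Type*} [CommRing R] [Algebra k R]

theorem TwistedPoly.induction {P : TwistedPoly k R → Prop} (hC : ∀ r, P (TwistedPoly.C k R r))
    (htau : P (TwistedPoly.tau k R)) (hadd : ∀ x y, P x → P y → P (x + y))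
    (hmul : ∀ x y, P x → P y → P (x * y)) (x : TwistedPoly k R) : P x := by
  let := qAction k R
  have hpow : ∀ n, P ((TwistedPoly.tau k R) ^ n) := by
    intro n
    induction n with
    | zero =>
      have := hC 1
      rwa [map_one] at this
    | succ n ih =>
      rw [pow_succ]
      exact hmul _ _ ih htau
  have hmon : ∀ n r, P (SkewPolynomial.monomial n r : SkewPolynomial R) := by
    intro n r
    have h1 : (SkewPolynomial.monomial n r : SkewPolynomial R) =
        SkewPolynomial.C r * SkewPolynomial.X ^ n := by
      rw [← SkewPolynomial.monomial_one_right_eq_X_pow, SkewPolynomial.C_mul_monomial, mul_one]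
    rw [h1]
    exact hmul _ _ (hC r) (hpow n)
  refine SkewPolynomial.induction (R := R) x ?_ ?_
  · have := hC 0
    rwa [map_zero] at this
  · intro n r p _ _ hp
    exact hadd _ _ (hmon n r) hp

variable {V : Type*} [AddCommGroup V] [Module R V] [Module k V] [IsScalarTower k R V]

variable (k R V) in
/-- The sums of additive endomorphisms which are `q ^ d`-semilinear with `a ≤ d ≤ b`. -/
def semilinearOps (a b : ℕ) : AddSubgroup (Module.End k V) :=
  AddSubgroup.closure {φ | ∃ d, a ≤ d ∧ d ≤ b ∧
    ∀ (r : R) (v : V), φ (r • v) = r ^ Fintype.card k ^ d • φ v}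

theorem mem_semilinearOps {a b d : ℕ} {φ : Module.End k V} (h : a ≤ d) (h' : d ≤ b)
    (hφ : ∀ (r : R) (v : V), φ (r • v) = r ^ Fintype.card k ^ d • φ v) :
    φ ∈ semilinearOps k R V a b :=
  AddSubgroup.subset_closure ⟨d, h, h', hφ⟩

theorem semilinearOps_mono {a b a' b' : ℕ} (h : a' ≤ a) (h' : b ≤ b') :
    semilinearOps k R V a b ≤ semilinearOps k R V a' b' := by
  refine AddSubgroup.closure_mono ?_
  rintro φ ⟨d, h1, h2, h3⟩
  exact ⟨d, h.trans h1, h2.trans h', h3⟩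

theorem mul_mem_semilinearOps {a b a' b' : ℕ} {φ ψ : Module.End k V}
    (hφ : φ ∈ semilinearOps k R V a b) (hψ : ψ ∈ semilinearOps k R V a' b') :
    φ * ψ ∈ semilinearOps k R V (a + a') (b + b') := by
  induction hφ using AddSubgroup.closure_induction with
  | mem φ hφ =>
    obtain ⟨d, h1, h2, h3⟩ := hφ
    induction hψ using AddSubgroup.closure_induction with
    | mem ψ hψ =>
      obtain ⟨e, h4, h5, h6⟩ := hψ
      refine mem_semilinearOps (add_le_add h1 h4) (add_le_add h2 h5) fun r v => ?_
      rw [Module.End.mul_apply, h6, h3, ← pow_mul, ← pow_add, add_comm e, Module.End.mul_apply]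
    | zero => rw [mul_zero]; exact zero_mem _
    | add x y _ _ hx hy => rw [mul_add]; exact add_mem hx hy
    | neg x _ hx => rw [mul_neg]; exact neg_mem hx
  | zero => rw [zero_mul]; exact zero_mem _
  | add x y _ _ hx hy => rw [add_mul]; exact add_mem hx hy
  | neg x _ hx => rw [neg_mul]; exact neg_mem hx

theorem toModuleEnd_mem_semilinearOps (r : R) :
    Module.toModuleEnd k V r ∈ semilinearOps k R V 0 0 :=
  mem_semilinearOps le_rfl le_rfl fun s v => by
    rw [pow_zero, pow_one]
    exact smul_comm r s v

/-- The bound depends on the twisted polynomial alone and not on the module; this uniformity allows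
all `M / 𝔪M` to be treated at once. -/
theorem exists_twistedAction_mem (ψ : TwistedPoly k R) : ∃ B, ∀ (V : Type v) [AddCommGroup V]
    [Module R V] [Module k V] [IsScalarTower k R V] (τ : V →ₛₗ[qFrob k R] V),
    twistedAction τ ψ ∈ semilinearOps k R V 0 B := by
  induction ψ using TwistedPoly.induction with
  | hC r =>
    refine ⟨0, fun V _ _ _ _ τ => ?_⟩
    have : twistedAction τ (TwistedPoly.C k R r) = Module.toModuleEnd k V r :=
      LinearMap.ext fun v => twistedAction_C τ r v
    rw [this]
    exact toModuleEnd_mem_semilinearOps r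
  | htau =>
    refine ⟨1, fun V _ _ _ _ τ => mem_semilinearOps (d := 1) zero_le_one le_rfl fun r v => ?_⟩
    rw [twistedAction_tau, twistedAction_tau, pow_one]
    exact τ.map_smulₛₗ r v
  | hadd x y hx hy =>
    obtain ⟨a, ha⟩ := hx
    obtain ⟨b, hb⟩ := hy
    refine ⟨max a b, fun V _ _ _ _ τ => ?_⟩
    have h : twistedAction τ (x + y) = twistedAction τ x + twistedAction τ y :=
      RingHom.map_add _ x y
    rw [h]
    exact add_mem (semilinearOps_mono le_rfl (le_max_left a b) (ha V τ))
      (semilinearOps_mono le_rfl (le_max_right a b) (hb V τ))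
  | hmul x y hx hy =>
    obtain ⟨a, ha⟩ := hx
    obtain ⟨b, hb⟩ := hy
    refine ⟨a + b, fun V _ _ _ _ τ => ?_⟩
    have h : twistedAction τ (x * y) = twistedAction τ x * twistedAction τ y :=
      RingHom.map_mul _ x y
    rw [h]
    exact zero_add 0 ▸ mul_mem_semilinearOps (ha V τ) (hb V τ)

theorem exists_twistedAction_mul_tau_mem (ψ : TwistedPoly k R) : ∃ B, ∀ (V : Type v)
    [AddCommGroup V] [Module R V] [Module k V] [IsScalarTower k R V] (τ : V →ₛₗ[qFrob k R] V),
    twistedAction τ (ψ * TwistedPoly.tau k R) ∈ semilinearOps k R V 1 B := by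
  obtain ⟨B, hB⟩ := exists_twistedAction_mem.{v} ψ
  refine ⟨B + 1, fun V _ _ _ _ τ => ?_⟩
  have h : twistedAction τ (ψ * TwistedPoly.tau k R) =
      twistedAction τ ψ * twistedAction τ (TwistedPoly.tau k R) := RingHom.map_mul _ _ _
  rw [h]
  refine semilinearOps_mono (by omega) le_rfl (mul_mem_semilinearOps (a' := 1) (b' := 1) (hB V τ)
    (mem_semilinearOps (d := 1) le_rfl le_rfl fun r v => ?_))
  rw [twistedAction_tau, twistedAction_tau, pow_one]
  exact τ.map_smulₛₗ r v

theorem monomial_eq_C_mul_X_pow' {E : Type*} [Semiring E] (n : ℕ) (a : E) :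
    (monomial n a : E⟦X⟧) = C a * X ^ n := by
  ext m
  rw [coeff_monomial, coeff_C_mul, coeff_X_pow]
  split_ifs <;> simp

/-- On a finite-dimensional space on which `a ^ (q ^ d) - a` is invertible for many `d`, the
determinants of unipotent series of semilinear maps are `1`. -/
theorem dvd_sdet_sub_one_of_semilinear [FiniteDimensional k V] {B N : ℕ} {a : R}
    (ha : ∀ d, 1 ≤ d → d ≤ N * B → ∃ f : R, ∀ v : V, (f * (a ^ Fintype.card k ^ d - a)) • v = v)
    {u : (Module.End k V)⟦X⟧}
    (hu : IsUnipotentSeries (fun n => semilinearOps k R V 1 (n * B)) u) :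
    (X : k⟦X⟧) ^ N ∣ sdet u - 1 := by
  have hF : ∀ i j, 1 ≤ i → 1 ≤ j → ∀ x ∈ semilinearOps k R V 1 (i * B),
      ∀ y ∈ semilinearOps k R V 1 (j * B), x * y ∈ semilinearOps k R V 1 ((i + j) * B) := by
    intro i j _ _ x hx y hy
    rw [add_mul]
    exact semilinearOps_mono (by omega) le_rfl (mul_mem_semilinearOps hx hy)
  refine IsUnipotentSeries.induction (P := fun u => (X : k⟦X⟧) ^ N ∣ sdet u - 1) hF
    (fun n => {φ | ∃ d, 1 ≤ d ∧ d ≤ n * B ∧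
    ∀ (r : R) (v : V), φ (r • v) = r ^ Fintype.card k ^ d • φ v}) ?_ N ?_ ?_ ?_ hu
  · intro n _ x hx
    rw [semilinearOps, ← AddSubgroup.mem_toAddSubmonoid, AddSubgroup.closure_toAddSubmonoid] at hx
    refine AddSubmonoid.closure_mono (Set.union_subset subset_rfl ?_) hx
    rintro φ ⟨d, h1, h2, h3⟩
    refine ⟨d, h1, h2, fun r v => ?_⟩
    have := h3 r v
    rw [LinearMap.neg_apply, LinearMap.neg_apply, smul_neg] at this
    exact neg_injective this
  · intro u _ h
    rw [← sdet_one (k := k) (V := V)]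
    exact dvd_sdet_sub_sdet h
  · intro u v _ _ h1 h2
    rw [sdet_mul]
    simpa using dvd_sub_mul h1 h2
  · rintro n hn hnN φ ⟨d, hd, hdn, hφ⟩
    obtain ⟨f, hf⟩ := ha d hd (hdn.trans (Nat.mul_le_mul_right B hnN.le))
    set A : Module.End k V := Module.toModuleEnd k V a
    -- By semilinearity `FA - AF = f(a^(q^d) - a)φ = φ`. So `(1 + AF X^n)⁻¹(1 + FA X^n)` begins with
    -- `1 + φ X^n`, and its determinant is 1 since `1 + FA X^n` and `1 + AF X^n` have the same
    -- determinant.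
    set F : Module.End k V := Module.toModuleEnd k V f * φ
    have hA : A ∈ semilinearOps k R V 0 0 := toModuleEnd_mem_semilinearOps a
    have hFm : F ∈ semilinearOps k R V 1 (n * B) := by
      have := mul_mem_semilinearOps (toModuleEnd_mem_semilinearOps (k := k) (V := V) f)
        (mem_semilinearOps hd hdn hφ)
      rwa [zero_add, zero_add] at this
    have hFA : F * A ∈ semilinearOps k R V 1 (n * B) := by
      have := mul_mem_semilinearOps hFm hA
      rwa [add_zero, add_zero] at this
    have hAF : A * F ∈ semilinearOps k R V 1 (n * B) := by
      have := mul_mem_semilinearOps hA hFm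
      rwa [zero_add, zero_add] at this
    have hcomm : F * A - A * F = φ := by
      refine LinearMap.ext fun v => ?_
      change f • φ (a • v) - a • f • φ v = φ v
      rw [hφ, smul_smul, smul_smul, ← sub_smul, mul_comm a f, ← mul_sub, hf]
    have huni : ∀ y ∈ semilinearOps k R V 1 (n * B),
        IsUnipotentSeries (fun n => semilinearOps k R V 1 (n * B)) (1 + monomial n y) := by
      intro y hy
      refine ⟨by rw [coeff_one_add_monomial hn, if_pos rfl], fun m hm => ?_⟩
      rw [coeff_one_add_monomial hn, if_neg (by omega)]
      split_ifs with h
      · rw [h]; exact hy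
      · exact zero_mem _
    obtain ⟨w, hw, hvw⟩ := (huni _ hFA).exists_mul_eq hF (huni _ hAF)
    have hweq : w = 1 + monomial n (F * A) - monomial n (A * F) * w := by
      rw [← hvw, add_mul, one_mul, add_sub_cancel_right]
    have hcoef : ∀ m ≤ n, coeff m w = coeff m (1 + monomial n (F * A) : (Module.End k V)⟦X⟧) -
        if m = n then A * F else 0 := by
      intro m hm
      conv_lhs => rw [hweq]
      rw [map_sub]
      congr 1
      rw [monomial_eq_C_mul_X_pow', mul_assoc, coeff_C_mul, coeff_X_pow_mul']
      by_cases h : m = n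
      · subst h
        rw [if_pos le_rfl, if_pos rfl, Nat.sub_self, hw.1, mul_one]
      · rw [if_neg (by omega), if_neg h, mul_zero]
    refine ⟨w, hw, ?_, fun m hm => ?_, ?_⟩
    · have h1 : sdet (1 + monomial n (F * A) : (Module.End k V)⟦X⟧) =
          sdet (1 + monomial n (A * F) : (Module.End k V)⟦X⟧) := by
        have e1 : (monomial n (F * A) : (Module.End k V)⟦X⟧) = C F * monomial n A := by
          rw [monomial_eq_C_mul_X_pow', monomial_eq_C_mul_X_pow', ← mul_assoc, map_mul]
        have e2 : (monomial n (A * F) : (Module.End k V)⟦X⟧) = monomial n A * C F := by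
          ext m : 1
          rw [coeff_monomial, coeff_mul_C, coeff_monomial]
          split_ifs <;> simp
        rw [e1, e2, sdet_one_add_mul_comm]
      -- The series `1 + AF X^n` has a right inverse, so its determinant is nonzero and can be
      -- cancelled.
      obtain ⟨w', hw', hvw'⟩ := (IsUnipotentSeries.one).exists_mul_eq hF (huni _ hAF)
      have h2 := congrArg sdet hvw'
      rw [sdet_mul, sdet_one] at h2
      have h3 : sdet (1 + monomial n (A * F) : (Module.End k V)⟦X⟧) ≠ 0 := left_ne_zero_of_mul_eq_one h2
      have h4 := congrArg sdet hvw
      rw [sdet_mul, h1] at h4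
      rw [mul_left_cancel₀ h3 (h4.trans (mul_one _).symm), sub_self]
      exact dvd_zero _
    · rw [hcoef m hm.le, if_neg hm.ne, sub_zero, coeff_one_add_monomial hn, coeff_one, if_neg hm.ne]
    · rw [hcoef n le_rfl, if_pos rfl, coeff_one_add_monomial hn, if_neg (by omega), if_pos rfl,
        hcomm]

end TwistedAction

end TraceFormula

namespace TraceFormula

theorem coeff_one_apply {k V : Type*} [Field k] [AddCommGroup V] [Module k V] (n : ℕ) (v : V) :
    coeff n (1 : (Module.End k V)⟦X⟧) v = if n = 0 then v else 0 := by
  rw [coeff_one]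
  split_ifs <;> rfl

/-! ### Determinants on direct products. -/

section ProdSeries

variable {k : Type*} [Field k] {V : Type*} [AddCommGroup V] [Module k V]
  {V' : Type*} [AddCommGroup V'] [Module k V'] [FiniteDimensional k V] [FiniteDimensional k V']

theorem eq_of_forall_X_pow_dvd {a b : k⟦X⟧} (h : ∀ N, (X : k⟦X⟧) ^ N ∣ a - b) : a = b := by
  ext n
  exact dvd_sub_iff_coeff.1 (h (n + 1)) n (Nat.lt_succ_self n)

/-- The componentwise action of two series of endomorphisms on a product. -/
def prodSeries (Φ : (Module.End k V)⟦X⟧) (Φ' : (Module.End k V')⟦X⟧) :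
    (Module.End k (V × V'))⟦X⟧ :=
  PowerSeries.mk fun n => (coeff n Φ).prodMap (coeff n Φ')

theorem coeff_prodSeries (Φ : (Module.End k V)⟦X⟧) (Φ' : (Module.End k V')⟦X⟧) (n : ℕ)
    (v : V × V') : coeff n (prodSeries Φ Φ') v = (coeff n Φ v.1, coeff n Φ' v.2) := by
  rw [prodSeries, coeff_mk]
  rfl

theorem sdet_one_add_prodSeries (Φ : (Module.End k V)⟦X⟧) (Φ' : (Module.End k V')⟦X⟧) :
    sdet (1 + prodSeries Φ Φ') = sdet (1 + Φ) * sdet (1 + Φ') := by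
  refine eq_of_forall_X_pow_dvd fun N => ?_
  refine dvd_sdet_exact (LinearMap.inl k V V') LinearMap.inl_injective (LinearMap.snd k V V')
    LinearMap.snd_surjective (Function.Exact.inl_snd) (fun n _ v => ?_) (fun n _ v => ?_)
  · rw [map_add, map_add, LinearMap.add_apply, LinearMap.add_apply, coeff_one_apply,
      coeff_one_apply, coeff_prodSeries]
    split_ifs <;> simp
  · rw [map_add, map_add, LinearMap.add_apply, LinearMap.add_apply, coeff_one_apply,
      coeff_one_apply, coeff_prodSeries]
    split_ifs <;> simp

end ProdSeries

/-! ### Determinants on the quotients `M / I M`. -/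

section IdealDet

variable {k : Type*} [Field k] [Fintype k] {R : Type*} [CommRing R] [Algebra k R]
  {M : Type*} [AddCommGroup M] [Module R M] [Module k M] [IsScalarTower k R M]
  {M' : Type*} [AddCommGroup M'] [Module R M'] [Module k M'] [IsScalarTower k R M']

theorem twistedAction_add_apply (τ : M →ₛₗ[qFrob k R] M) (x y : TwistedPoly k R) (v : M) :
    twistedAction τ (x + y) v = twistedAction τ x v + twistedAction τ y v := by
  have h : twistedAction τ (x + y) = twistedAction τ x + twistedAction τ y :=
    RingHom.map_add _ x y
  rw [h, LinearMap.add_apply]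

theorem twistedAction_mul_apply (τ : M →ₛₗ[qFrob k R] M) (x y : TwistedPoly k R) (v : M) :
    twistedAction τ (x * y) v = twistedAction τ x (twistedAction τ y v) := by
  have h : twistedAction τ (x * y) = twistedAction τ x * twistedAction τ y :=
    RingHom.map_mul _ x y
  rw [h, Module.End.mul_apply]

theorem map_twistedAction {τ : M →ₛₗ[qFrob k R] M} {τ' : M' →ₛₗ[qFrob k R] M'} (f : M →ₗ[R] M')
    (h : ∀ v, f (τ v) = τ' (f v)) (θ : TwistedPoly k R) (v : M) :
    f (twistedAction τ θ v) = twistedAction τ' θ (f v) := by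
  induction θ using TwistedPoly.induction generalizing v with
  | hC r => rw [twistedAction_C, twistedAction_C, map_smul]
  | htau => rw [twistedAction_tau, twistedAction_tau, h]
  | hadd x y hx hy => rw [twistedAction_add_apply, twistedAction_add_apply, map_add, hx, hy]
  | hmul x y hx hy => rw [twistedAction_mul_apply, twistedAction_mul_apply, hx, hy]

theorem coeff_seriesAction (τ : M →ₛₗ[qFrob k R] M) (Θ : (TwistedPoly k R)⟦X⟧) (n : ℕ) :
    coeff n (seriesAction τ Θ) = twistedAction τ (coeff n Θ) :=
  coeff_map _ _ _

variable (τ : M →ₛₗ[qFrob k R] M)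

/-- `τ(r w) = r^q τ(w)`, and `q(i + 1) ≥ i + 2` because `q ≥ 2`. -/
theorem tau_mem_pow_smul_top (J : Ideal R) (i : ℕ) {v : M}
    (hv : v ∈ (J ^ (i + 1) • ⊤ : Submodule R M)) : τ v ∈ (J ^ (i + 2) • ⊤ : Submodule R M) := by
  refine Submodule.smul_induction_on hv (fun r hr w _ => ?_) fun x y hx hy => ?_
  · rw [τ.map_smulₛₗ]
    refine Submodule.smul_mem_smul ?_ trivial
    have h1 : r ^ Fintype.card k ∈ (J ^ (i + 1)) ^ Fintype.card k := Ideal.pow_mem_pow hr _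
    rw [← pow_mul] at h1
    have h2 : 2 ≤ Fintype.card k := Fintype.one_lt_card
    exact Ideal.pow_le_pow_right (by nlinarith) h1
  · rw [map_add]
    exact add_mem hx hy

theorem twistedAction_mem_smul_top (I : Ideal R) (θ : TwistedPoly k R) {v : M}
    (hv : v ∈ (I • ⊤ : Submodule R M)) : twistedAction τ θ v ∈ (I • ⊤ : Submodule R M) := by
  induction θ using TwistedPoly.induction generalizing v with
  | hC r => rw [twistedAction_C]; exact Submodule.smul_mem _ _ hv
  | htau =>
    rw [twistedAction_tau]
    refine Submodule.smul_induction_on hv (fun r hr w _ => ?_) fun x y hx hy => ?_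
    · rw [τ.map_smulₛₗ]
      exact Submodule.smul_mem_smul (I.pow_mem_of_mem hr _ Fintype.card_pos) trivial
    · rw [map_add]
      exact add_mem hx hy
  | hadd x y hx hy => rw [twistedAction_add_apply]; exact add_mem (hx hv) (hy hv)
  | hmul x y hx hy => rw [twistedAction_mul_apply]; exact hx (hy hv)

/-- The determinant of `1 + Θ` on `M / I M`. -/
def idealDet (Θ : (TwistedPoly k R)⟦X⟧) (I : Ideal R) : k⟦X⟧ :=
  finDet (seriesAction (tauModIdeal τ I) Θ)

variable (k M) in
theorem finiteDimensional_quot_smul_top [Module.Finite R M] (I : Ideal R) [Finite (R ⧸ I)] :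
    FiniteDimensional k (M ⧸ (I • ⊤ : Submodule R M)) := by
  have : Module.Finite (R ⧸ I) (M ⧸ (I • ⊤ : Submodule R M)) :=
    Module.Finite.of_restrictScalars_finite R _ _
  have : Finite (M ⧸ (I • ⊤ : Submodule R M)) := Module.finite_of_finite (R ⧸ I)
  exact Module.Finite.of_finite

theorem mkQ_tau (I : Ideal R) (v : M) :
    (I • ⊤ : Submodule R M).mkQ (τ v) = tauModIdeal τ I ((I • ⊤ : Submodule R M).mkQ v) :=
  rfl

theorem mkQ_twistedAction (I : Ideal R) (θ : TwistedPoly k R) (v : M) :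
    (I • ⊤ : Submodule R M).mkQ (twistedAction τ θ v) =
      twistedAction (tauModIdeal τ I) θ ((I • ⊤ : Submodule R M).mkQ v) :=
  map_twistedAction _ (mkQ_tau τ I) θ v

/-- The projection `M → M / I M` over the ground field. -/
def idealProj (k : Type*) [Field k] [Algebra k R] (M : Type*) [AddCommGroup M] [Module R M]
    [Module k M] [IsScalarTower k R M] (I : Ideal R) : M →ₗ[k] M ⧸ (I • ⊤ : Submodule R M) :=
  (I • ⊤ : Submodule R M).mkQ.restrictScalars k

theorem idealProj_surjective (I : Ideal R) : Function.Surjective (idealProj k M I) := by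
  intro x
  obtain ⟨v, hv⟩ := Submodule.mkQ_surjective (I • ⊤ : Submodule R M) x
  exact ⟨v, hv⟩

theorem mem_ker_idealProj {I : Ideal R} {v : M} :
    v ∈ LinearMap.ker (idealProj k M I) ↔ v ∈ (I • ⊤ : Submodule R M) := by
  rw [LinearMap.mem_ker]
  exact Submodule.Quotient.mk_eq_zero _

theorem idealProj_coeff (I : Ideal R) (Θ : (TwistedPoly k R)⟦X⟧) (n : ℕ) (v : M) :
    idealProj k M I (coeff n (seriesAction τ Θ) v) =
      coeff n (seriesAction (tauModIdeal τ I) Θ) (idealProj k M I v) := by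
  rw [coeff_seriesAction, coeff_seriesAction]
  exact mkQ_twistedAction τ I _ v

theorem map_coeff_one_add {E E' : Type*} [AddCommGroup E] [Module k E] [AddCommGroup E']
    [Module k E'] (f : E →ₗ[k] E') {Φ : (Module.End k E)⟦X⟧} {Φ' : (Module.End k E')⟦X⟧} {n : ℕ}
    {v : E} (h : f (coeff n Φ v) = coeff n Φ' (f v)) :
    f (coeff n (1 + Φ : (Module.End k E)⟦X⟧) v) = coeff n (1 + Φ' : (Module.End k E')⟦X⟧) (f v) := by
  rw [map_add, map_add, LinearMap.add_apply, LinearMap.add_apply, map_add, h, coeff_one_apply,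
    coeff_one_apply]
  split_ifs <;> simp

variable (Θ : (TwistedPoly k R)⟦X⟧)

theorem idealDet_top : idealDet τ Θ ⊤ = 1 := by
  have : Subsingleton (M ⧸ ((⊤ : Ideal R) • ⊤ : Submodule R M)) := by
    rw [Submodule.Quotient.subsingleton_iff]
    exact Submodule.top_smul ⊤
  rw [idealDet, finDet_eq_sdet, sdet_of_subsingleton]

/-- The Chinese remainder theorem for modules: writing `1 = e + f` with `e ∈ I` and `f ∈ J`
identifies `M / IJM` with `M / IM × M / JM`, compatibly with `τ`. -/
theorem idealDet_mul [Module.Finite R M] {I J : Ideal R} [Finite (R ⧸ I)] [Finite (R ⧸ J)]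
    (hIJ : IsCoprime I J) : idealDet τ Θ (I * J) = idealDet τ Θ I * idealDet τ Θ J := by
  obtain ⟨e, he, f, hf, hef⟩ := Ideal.isCoprime_iff_exists.1 hIJ
  have hdec : ∀ v : M, v = e • v + f • v := fun v => by rw [← add_smul, hef, one_smul]
  have hfI := finiteDimensional_quot_smul_top k M I
  have hfJ := finiteDimensional_quot_smul_top k M J
  let π : M →ₗ[k] (M ⧸ (I • ⊤ : Submodule R M)) × (M ⧸ (J • ⊤ : Submodule R M)) :=
    (idealProj k M I).prod (idealProj k M J)
  have hπ : Function.Surjective π := by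
    rintro ⟨x, y⟩
    obtain ⟨x, rfl⟩ := idealProj_surjective (k := k) I x
    obtain ⟨y, rfl⟩ := idealProj_surjective (k := k) J y
    refine ⟨f • x + e • y, ?_⟩
    refine Prod.ext ?_ ?_
    · change idealProj k M I (f • x + e • y) = idealProj k M I x
      rw [← sub_eq_zero, ← map_sub, ← LinearMap.mem_ker, mem_ker_idealProj]
      nth_rw 2 [hdec x]
      rw [show f • x + e • y - (e • x + f • x) = e • (y - x) by rw [smul_sub]; abel]
      exact Submodule.smul_mem_smul he trivial
    · change idealProj k M J (f • x + e • y) = idealProj k M J y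
      rw [← sub_eq_zero, ← map_sub, ← LinearMap.mem_ker, mem_ker_idealProj]
      nth_rw 2 [hdec y]
      rw [show f • x + e • y - (e • y + f • y) = f • (x - y) by rw [smul_sub]; abel]
      exact Submodule.smul_mem_smul hf trivial
  have hker : LinearMap.ker (idealProj k M (I * J)) = LinearMap.ker π := by
    ext v
    rw [mem_ker_idealProj, LinearMap.ker_prod, Submodule.mem_inf, mem_ker_idealProj,
      mem_ker_idealProj]
    have hl : (I * J : Ideal R) ≤ I := Ideal.mul_le_left
    have hr : (I * J : Ideal R) ≤ J := Ideal.mul_le_right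
    refine ⟨fun hv => ⟨(Submodule.smul_mono_left hl : _ ≤ I • (⊤ : Submodule R M)) hv,
      (Submodule.smul_mono_left hr : _ ≤ J • (⊤ : Submodule R M)) hv⟩, fun hv => ?_⟩
    rw [hdec v]
    refine add_mem ?_ ?_
    · rw [mul_smul]
      exact Submodule.smul_mem_smul he hv.2
    · rw [mul_comm, mul_smul]
      exact Submodule.smul_mem_smul hf hv.1
  let eqv := ((idealProj k M (I * J)).quotKerEquivOfSurjective (idealProj_surjective _)).symm.trans
    ((Submodule.quotEquivOfEq _ _ hker).trans (π.quotKerEquivOfSurjective hπ))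
  have hfIJ : FiniteDimensional k (M ⧸ ((I * J) • ⊤ : Submodule R M)) :=
    Module.Finite.equiv eqv.symm
  rw [idealDet, idealDet, idealDet, finDet_eq_sdet, finDet_eq_sdet, finDet_eq_sdet,
    ← sdet_one_add_prodSeries]
  refine eq_of_forall_X_pow_dvd fun N => ?_
  refine dvd_sdet_sub_sdet_of_ker_eq (Ψ := 1 + seriesAction τ Θ) (idealProj k M (I * J)) π
    (idealProj_surjective _) hπ hker (fun n _ v => map_coeff_one_add _ (idealProj_coeff τ _ Θ n v))
    (fun n _ v => map_coeff_one_add _ ?_)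
  rw [coeff_prodSeries]
  exact Prod.ext (idealProj_coeff τ I Θ n v) (idealProj_coeff τ J Θ n v)

theorem idealDet_prod [Module.Finite R M] {ι : Type*} (s : Finset ι) (I : ι → Ideal R)
    [∀ i, Finite (R ⧸ I i)] (hI : ∀ i ∈ s, ∀ j ∈ s, i ≠ j → IsCoprime (I i) (I j)) :
    Finite (R ⧸ ∏ i ∈ s, I i) ∧ idealDet τ Θ (∏ i ∈ s, I i) = ∏ i ∈ s, idealDet τ Θ (I i) := by
  classical
  induction s using Finset.induction_on with
  | empty =>
    rw [Finset.prod_empty, Finset.prod_empty, Ideal.one_eq_top]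
    refine ⟨?_, idealDet_top τ Θ⟩
    have : Subsingleton (R ⧸ (⊤ : Ideal R)) := Ideal.Quotient.subsingleton_iff.2 rfl
    infer_instance
  | insert i s hi ih =>
    obtain ⟨h1, h2⟩ := ih fun a ha b hb => hI a (Finset.mem_insert_of_mem ha) b
      (Finset.mem_insert_of_mem hb)
    have hc : IsCoprime (I i) (∏ i ∈ s, I i) := IsCoprime.prod_right fun j hj =>
      hI i (Finset.mem_insert_self _ _) j (Finset.mem_insert_of_mem hj) (by rintro rfl; exact hi hj)
    rw [Finset.prod_insert hi, Finset.prod_insert hi, idealDet_mul τ Θ hc, h2]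
    exact ⟨Finite.of_equiv _ (Ideal.quotientMulEquivQuotientProd _ _ hc).symm.toEquiv, rfl⟩

theorem mk_mem_smul_top_iff (I K : Ideal R) (v : M) :
    (I • ⊤ : Submodule R M).mkQ v ∈ (K • ⊤ : Submodule R (M ⧸ (I • ⊤ : Submodule R M))) ↔
      v ∈ (K • ⊤ : Submodule R M) ⊔ (I • ⊤ : Submodule R M) := by
  have h1 : (K • ⊤ : Submodule R (M ⧸ (I • ⊤ : Submodule R M))) =
      (K • ⊤ : Submodule R M).map (I • ⊤ : Submodule R M).mkQ := by
    rw [Submodule.map_smul'', Submodule.map_top, Submodule.range_mkQ]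
  rw [h1, sup_comm, ← Submodule.comap_map_mkQ, Submodule.mem_comap]

theorem smul_top_mono {I J : Ideal R} (h : I ≤ J) : (I • ⊤ : Submodule R M) ≤ J • ⊤ :=
  Submodule.smul_mono_left h

/-- The kernel `J M` carries the finite filtration by the `J^(i+1) M`, which the elements of `R{τ}τ`
shift. -/
theorem sdet_eq_of_ker_eq_smul_top [FiniteDimensional k M] [FiniteDimensional k M']
    {τ' : M' →ₛₗ[qFrob k R] M'} (π : M →ₗ[R] M') (hπ : Function.Surjective π)
    (hτ : ∀ v, π (τ v) = τ' (π v)) {J : Ideal R} {e : ℕ}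
    (hker : LinearMap.ker π = J • ⊤) (he : (J ^ (e + 1) • ⊤ : Submodule R M) = ⊥)
    (hΘ : ∀ n, ∃ ψ, coeff n Θ = ψ * TwistedPoly.tau k R) :
    sdet (1 + seriesAction τ Θ) = sdet (1 + seriesAction τ' Θ) := by
  refine eq_of_forall_X_pow_dvd fun N => ?_
  refine dvd_sdet_sub_sdet_of_filtration (π.restrictScalars k) hπ (fun n _ v => ?_)
    (fun i => (J ^ (i + 1) • ⊤ : Submodule R M).restrictScalars k) e ?_ ?_ ?_ (fun i n _ v hv => ?_)
  · rw [coeff_seriesAction, coeff_seriesAction]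
    exact map_twistedAction π hτ _ v
  · rw [zero_add, pow_one, ← hker]
    rfl
  · have hJ : J ^ (1 + 1) ≤ J ^ (0 + 1) := Ideal.pow_le_pow_right (by omega)
    exact smul_top_mono hJ
  · rw [he]
    rfl
  · rw [coeff_seriesAction]
    obtain ⟨ψ, hψ⟩ := hΘ n
    rw [hψ, twistedAction_mul_apply, twistedAction_tau]
    exact twistedAction_mem_smul_top _ _ _ (tau_mem_pow_smul_top _ _ _ hv)

theorem idealDet_eq_of_pow_le [Module.Finite R M] {I J : Ideal R} [Finite (R ⧸ I)] {e : ℕ}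
    (h : I ≤ J) (he : J ^ e ≤ I) (hΘ : ∀ n, ∃ ψ, coeff n Θ = ψ * TwistedPoly.tau k R) :
    idealDet τ Θ I = idealDet τ Θ J := by
  have hfJ : Finite (R ⧸ J) := Finite.of_surjective _ (Ideal.Quotient.factor_surjective h)
  have hfI := finiteDimensional_quot_smul_top k M I
  have hfJ := finiteDimensional_quot_smul_top k M J
  rw [idealDet, idealDet, finDet_eq_sdet, finDet_eq_sdet]
  have hJ : J ^ (e + 1) ≤ I := (Ideal.pow_le_pow_right (by omega)).trans he
  refine sdet_eq_of_ker_eq_smul_top (tauModIdeal τ I) Θ (τ' := tauModIdeal τ J) (J := J) (e := e)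
    (Submodule.factor (smul_top_mono h)) (Submodule.factor_surjective _) (fun v => ?_) ?_ ?_ hΘ
  · obtain ⟨v, rfl⟩ := Submodule.mkQ_surjective _ v
    rw [← mkQ_tau, Submodule.factor_mk, Submodule.factor_mk, mkQ_tau]
  · ext v
    obtain ⟨v, rfl⟩ := Submodule.mkQ_surjective _ v
    rw [mk_mem_smul_top_iff, sup_eq_left.2 (smul_top_mono h), LinearMap.mem_ker,
      Submodule.factor_mk, Submodule.mkQ_apply, Submodule.Quotient.mk_eq_zero]
  · ext v
    obtain ⟨v, rfl⟩ := Submodule.mkQ_surjective _ v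
    rw [mk_mem_smul_top_iff, sup_eq_right.2 (smul_top_mono hJ), Submodule.mem_bot,
      Submodule.mkQ_apply, Submodule.Quotient.mk_eq_zero]

/-- The determinant on `M / I M` is the product of the local factors at the maximal ideals
containing `I`. -/
theorem exists_idealDet_eq_prod [Module.Finite R M] [IsNoetherianRing R] (I : Ideal R)
    [Finite (R ⧸ I)] (hΘ : ∀ n, ∃ ψ, coeff n Θ = ψ * TwistedPoly.tau k R) :
    ∃ s : Finset (MaximalSpectrum R), (∀ m, m ∈ s ↔ I ≤ m.asIdeal) ∧
      idealDet τ Θ I = ∏ m ∈ s, idealDet τ Θ m.asIdeal := by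
  classical
  have hfin : {m : MaximalSpectrum R | I ≤ m.asIdeal}.Finite := by
    have : Finite (Ideal (R ⧸ I)) := Finite.of_injective _ SetLike.coe_injective
    refine Set.Finite.of_finite_image (f := fun m => m.asIdeal.map (Ideal.Quotient.mk I))
      (Set.toFinite _) fun m hm m' hm' h => ?_
    have h1 : ∀ m : MaximalSpectrum R, I ≤ m.asIdeal →
        (m.asIdeal.map (Ideal.Quotient.mk I)).comap (Ideal.Quotient.mk I) = m.asIdeal := by
      intro m hm
      rw [Ideal.comap_map_of_surjective _ Ideal.Quotient.mk_surjective, ← RingHom.ker_eq_comap_bot,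
        Ideal.mk_ker, sup_eq_left.2 hm]
    have h2 := congrArg (Ideal.comap (Ideal.Quotient.mk I)) h
    simp only at h2
    rw [h1 m hm, h1 m' hm'] at h2
    exact MaximalSpectrum.ext h2
  refine ⟨hfin.toFinset, fun m => by simp, ?_⟩
  have hI : ∀ m ∈ hfin.toFinset, I ≤ m.asIdeal := fun m hm => by simpa using hm
  set f : hfin.toFinset → Ideal R := fun m => m.1.asIdeal with hf
  have hq : ∀ m : hfin.toFinset, Finite (R ⧸ f m) := fun m =>
    Finite.of_surjective _ (Ideal.Quotient.factor_surjective (hI m.1 m.2))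
  have hcop : ∀ i ∈ (Finset.univ : Finset hfin.toFinset), ∀ j ∈ Finset.univ, i ≠ j →
      IsCoprime (f i) (f j) := by
    intro i _ j _ hij
    have := i.1.isMaximal
    have := j.1.isMaximal
    refine Ideal.isCoprime_of_isMaximal fun h => hij (Subtype.ext (MaximalSpectrum.ext h))
  obtain ⟨-, h2⟩ := idealDet_prod τ Θ Finset.univ f hcop
  rw [← Finset.prod_coe_sort hfin.toFinset fun m => idealDet τ Θ m.asIdeal]
  refine Eq.trans ?_ h2
  -- The product of the maximal ideals containing `I` lies between `I` and its radical: a prime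
  -- containing `I` has a finite quotient, hence is maximal. The difference is nilpotent and does
  -- not affect determinants.
  have hle : I ≤ ∏ m : hfin.toFinset, f m := by
    rw [Ideal.prod_eq_iInf_of_pairwise_isCoprime]
    · exact le_iInf₂ fun m _ => hI m.1 m.2
    · exact fun i hi j hj hij => hcop i hi j hj hij
  have hrad : ∏ m : hfin.toFinset, f m ≤ I.radical := by
    rw [Ideal.radical_eq_sInf]
    refine le_sInf fun p hp => ?_
    obtain ⟨hp, hprime⟩ := hp
    have : Finite (R ⧸ p) := Finite.of_surjective _ (Ideal.Quotient.factor_surjective hp)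
    have hmax : p.IsMaximal := Ideal.Quotient.maximal_of_isField _ (Finite.isField_of_domain _)
    have hm : (⟨p, hmax⟩ : MaximalSpectrum R) ∈ hfin.toFinset := by simpa using hp
    have hd : f ⟨_, hm⟩ ∣ ∏ m : hfin.toFinset, f m :=
      Finset.dvd_prod_of_mem f (Finset.mem_univ _)
    exact Ideal.le_of_dvd hd
  obtain ⟨e, he⟩ := Ideal.exists_pow_le_of_le_radical_of_fg hrad (IsNoetherian.noetherian _)
  exact idealDet_eq_of_pow_le τ Θ hle he hΘ

/-- Almost all local factors are trivial modulo `X ^ N`. -/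
theorem exists_dvd_idealDet_sub_one [Module.Finite R M] (h0 : coeff 0 Θ = 0)
    (hΘ : ∀ n, ∃ ψ, coeff n Θ = ψ * TwistedPoly.tau k R) (N : ℕ) :
    ∃ K₀, ∀ K, K₀ ≤ K → ∀ a : R, ∀ m : Ideal R, m.IsMaximal → Finite (R ⧸ m) →
      a ^ Fintype.card k ^ Nat.factorial K - a ∉ m → (X : k⟦X⟧) ^ N ∣ idealDet τ Θ m - 1 := by
  choose ψ hψ using hΘ
  choose B hB using fun n => exists_twistedAction_mul_tau_mem (ψ n)
  -- The commutator argument involves the degrees `d ≤ N B'` in `τ`; this bound makes all of them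
  -- divide `K!`.
  refine ⟨N * ∑ n ∈ Finset.range N, B n, fun K hK a m hm hfin ha => ?_⟩
  set B' := ∑ n ∈ Finset.range N, B n with hB'
  have hfd := finiteDimensional_quot_smul_top k M m
  rw [idealDet, finDet_eq_sdet]
  set Φ := 1 + seriesAction (tauModIdeal τ m) Θ with hΦ
  -- The coefficients from index `N` on are replaced by those of 1, as `B'` bounds the degrees of
  -- the first `N` only.
  set u : (Module.End k (M ⧸ (m • ⊤ : Submodule R M)))⟦X⟧ :=
    PowerSeries.mk fun n => if n < N then coeff n Φ else coeff n 1 with hu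
  refine dvd_sub_trans (b := sdet u) (dvd_sdet_sub_sdet fun n hn => ?_) ?_
  · rw [hu, coeff_mk, if_pos hn]
  refine dvd_sdet_sub_one_of_semilinear (B := B') (a := a) (R := R) ?_ ⟨?_, ?_⟩
  · intro d hd hdN
    have hdK : d ∣ Nat.factorial K := Nat.dvd_factorial hd (hdN.trans hK)
    -- If `a^(q^d) = a` in the residue field, the same holds for every multiple of `d`, in
    -- particular for `K!`.
    have hna : a ^ Fintype.card k ^ d - a ∉ m := by
      intro hmem
      refine ha ?_
      have hfld := Ideal.Quotient.field m
      obtain ⟨c, hc⟩ := hdK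
      have h1 : (Ideal.Quotient.mk m a) ^ Fintype.card k ^ d = Ideal.Quotient.mk m a := by
        rw [← sub_eq_zero, ← map_pow, ← map_sub]
        exact Ideal.Quotient.eq_zero_iff_mem.2 hmem
      have h2 : ∀ c, (Ideal.Quotient.mk m a) ^ Fintype.card k ^ (d * c) =
          Ideal.Quotient.mk m a := by
        intro c
        induction c with
        | zero => rw [mul_zero, pow_zero, pow_one]
        | succ c ih => rw [mul_add, mul_one, pow_add, pow_mul, ih, h1]
      rw [← Ideal.Quotient.eq_zero_iff_mem, map_sub, map_pow, hc, h2, sub_self]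
    obtain ⟨f, hf⟩ := Ideal.Quotient.exists_inv (I := m) (a := Ideal.Quotient.mk m
      (a ^ Fintype.card k ^ d - a)) (by rwa [Ne, Ideal.Quotient.eq_zero_iff_mem])
    obtain ⟨f, rfl⟩ := Ideal.Quotient.mk_surjective f
    refine ⟨f, fun v => ?_⟩
    obtain ⟨v, rfl⟩ := Submodule.mkQ_surjective _ v
    rw [← sub_eq_zero, ← map_smul, ← map_sub]
    refine (Submodule.Quotient.mk_eq_zero _).2 ?_
    nth_rw 2 [← one_smul R v]
    rw [← sub_smul]
    refine Submodule.smul_mem_smul ?_ trivial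
    rw [← Ideal.Quotient.eq_zero_iff_mem, map_sub, map_mul, mul_comm, hf, map_one, sub_self]
  · rw [hu, coeff_mk, hΦ, map_add, coeff_seriesAction, h0, map_zero, add_zero, ite_self,
      coeff_one, if_pos rfl]
  · intro n hn
    rw [hu, coeff_mk]
    split_ifs with h
    · rw [hΦ, map_add, coeff_one, if_neg (by omega), zero_add, coeff_seriesAction, hψ]
      refine semilinearOps_mono le_rfl ?_ (hB n _ (tauModIdeal τ m))
      have : B n ≤ B' := Finset.single_le_sum (fun _ _ => Nat.zero_le _) (Finset.mem_range.2 h)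
      nlinarith
    · rw [coeff_one, if_neg (by omega)]
      exact zero_mem _

end IdealDet

end TraceFormula

namespace TraceFormula

/-! ### Extension of the operators to vectors of Laurent polynomials. -/

section Coordinates

variable {k : Type*} [Field k] {M : Type*} [AddCommGroup M] [Module k M] {ι : Type*}

/-- Shifting the exponents of vectors of Laurent polynomials. -/
def laurentShift (k ι : Type*) [Field k] (s : ℤ) : Module.End k (ι × ℤ →₀ k) :=
  Finsupp.lmapDomain k k fun x => (x.1, x.2 + s)

theorem laurentShift_single (s : ℤ) (x : ι × ℤ) :
    laurentShift k ι s (Finsupp.single x 1) = Finsupp.single (x.1, x.2 + s) 1 := by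
  rw [laurentShift, Finsupp.lmapDomain_apply, Finsupp.mapDomain_single]

variable (B : Module.Basis (ι × ℕ) k M)

/-- The embedding of a free `k[t]`-module into the vectors of Laurent polynomials. -/
def coordMap : M →ₗ[k] (ι × ℤ →₀ k) :=
  B.constr k fun x => Finsupp.single (x.1, (x.2 : ℤ)) 1

theorem coordMap_basis (x : ι × ℕ) : coordMap B (B x) = Finsupp.single (x.1, (x.2 : ℤ)) 1 :=
  B.constr_basis k _ x

theorem coordMap_apply_natCast (m : M) (i : ι) (n : ℕ) : coordMap B m (i, (n : ℤ)) =
    B.repr m (i, n) := by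
  classical
  suffices h : Finsupp.lapply (i, (n : ℤ)) ∘ₗ coordMap B = Finsupp.lapply (i, n) ∘ₗ B.repr from
    LinearMap.congr_fun h m
  refine B.ext fun x => ?_
  simp [coordMap_basis, Finsupp.single_apply, Prod.ext_iff]

theorem coordMap_apply_of_neg (m : M) (i : ι) {n : ℤ} (hn : n < 0) : coordMap B m (i, n) = 0 := by
  classical
  suffices h : Finsupp.lapply (i, n) ∘ₗ coordMap B = 0 from LinearMap.congr_fun h m
  refine B.ext fun x => ?_
  simp only [LinearMap.comp_apply, coordMap_basis, Finsupp.lapply_apply, Finsupp.single_apply,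
    Prod.ext_iff]
  rw [if_neg]
  · rfl
  · rintro ⟨-, h⟩
    omega

variable [Fintype k] [DecidableEq ι]

/-- The operator on the vectors of Laurent polynomials which is the extension of a
`q ^ d`-semilinear map with given values on a basis. -/
def laurentLift (d : ℕ) (φ : ι → M) : Module.End k (ι × ℤ →₀ k) :=
  Finsupp.linearCombination k fun x =>
    laurentShift k ι ((Fintype.card k : ℤ) ^ d * x.2) (coordMap B (φ x.1))

theorem laurentLift_single (d : ℕ) (φ : ι → M) (x : ι × ℤ) :
    laurentLift B d φ (Finsupp.single x 1) =
      laurentShift k ι ((Fintype.card k : ℤ) ^ d * x.2) (coordMap B (φ x.1)) := by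
  rw [laurentLift, Finsupp.linearCombination_single, one_smul]

theorem laurentLift_mem [Finite ι] (d : ℕ) (φ : ι → M) : laurentLift B d φ ∈ laurentOps k ι d := by
  have := Fintype.ofFinite ι
  have h : laurentLift B d φ = ∑ j, ∑ y ∈ (B.repr (φ j)).support,
      B.repr (φ j) y • laurentGen y.1 j y.2 d := by
    refine Finsupp.lhom_ext' fun x => LinearMap.ext_ring ?_
    simp only [LinearMap.comp_apply, Finsupp.lsingle_apply, LinearMap.sum_apply,
      LinearMap.smul_apply, laurentGen_single]
    rw [Finset.sum_eq_single x.1]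
    · rw [laurentLift_single]
      conv_lhs => rw [← B.linearCombination_repr (φ x.1), Finsupp.linearCombination_apply,
        Finsupp.sum, map_sum, map_sum]
      refine Finset.sum_congr rfl fun y _ => ?_
      rw [map_smul, map_smul, coordMap_basis, laurentShift_single, if_pos rfl, add_comm]
    · intro j _ hj
      refine Finset.sum_eq_zero fun y _ => ?_
      rw [if_neg (Ne.symm hj), smul_zero]
    · simp
  rw [h]
  exact sum_mem fun j _ => sum_mem fun y _ => Submodule.smul_mem _ _ (laurentGen_mem le_rfl)

variable {R : Type*} [CommRing R] [Algebra k R] [Module R M] [IsScalarTower k R M] {t : R}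
  (hB : ∀ i n, t ^ n • B (i, 0) = B (i, n))
include hB

theorem coordMap_pow_smul (s : ℕ) (m : M) :
    coordMap B (t ^ s • m) = laurentShift k ι s (coordMap B m) := by
  suffices h : coordMap B ∘ₗ Module.toModuleEnd k M (t ^ s) = laurentShift k ι s ∘ₗ coordMap B from
    LinearMap.congr_fun h m
  refine B.ext fun x => ?_
  have h1 : Module.toModuleEnd k M (t ^ s) (B x) = B (x.1, s + x.2) := by
    change t ^ s • B x = _
    rw [← hB x.1 (s + x.2), pow_add, mul_smul, hB]
  rw [LinearMap.comp_apply, LinearMap.comp_apply, h1, coordMap_basis, coordMap_basis,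
    laurentShift_single]
  congr 2
  push_cast
  ring

/-- Both sides are semilinear under `t ↦ t^(q^d)` and agree on the `k[t]`-basis `B (i, 0)`. -/
theorem coordMap_semilinear {d : ℕ} {φ : M →+ M}
    (hφk : ∀ (c : k) (m : M), φ (c • m) = c • φ m)
    (hφ : ∀ (r : R) (m : M), φ (r • m) = r ^ Fintype.card k ^ d • φ m) (m : M) :
    laurentLift B d (fun i => φ (B (i, 0))) (coordMap B m) = coordMap B (φ m) := by
  let φ' : M →ₗ[k] M := { φ with map_smul' := hφk }
  suffices h : laurentLift B d (fun i => φ (B (i, 0))) ∘ₗ coordMap B = coordMap B ∘ₗ φ' from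
    LinearMap.congr_fun h m
  refine B.ext fun x => ?_
  rw [LinearMap.comp_apply, LinearMap.comp_apply, coordMap_basis, laurentLift_single]
  change _ = coordMap B (φ (B x))
  rw [← hB x.1 x.2, hφ, ← pow_mul, coordMap_pow_smul B hB]
  congr 2
  push_cast
  ring

variable {V : Type*} [AddCommGroup V] [Module R V] [Module k V] [IsScalarTower k R V]
  (β : ℤ → M →ₗ[R] V) (hβ : ∀ n m, β n (t • m) = β (n + 1) m)

omit hB [IsScalarTower k R M] [IsScalarTower k R V] [Fintype k] [DecidableEq ι] in
/-- The map from vectors of Laurent polynomials to a module in which the multiples of the elements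
of `M` by negative powers of `t` make sense. -/
def laurentEval : (ι × ℤ →₀ k) →ₗ[k] V :=
  Finsupp.linearCombination k fun x => β x.2 (B (x.1, 0))

omit hB in
theorem laurentEval_single (x : ι × ℤ) :
    laurentEval B β (Finsupp.single x 1) = β x.2 (B (x.1, 0)) := by
  rw [laurentEval, Finsupp.linearCombination_single, one_smul]

include hβ

omit hB [Fintype k] [Algebra k R] in
-- The element `β n m` is to be read as `t^n m` in `V`, for possibly negative `n`.
theorem apply_pow_smul (n : ℤ) (s : ℕ) (m : M) : β n (t ^ s • m) = β (n + s) m := by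
  induction s generalizing n with
  | zero => simp
  | succ s ih =>
    rw [pow_succ', mul_smul, hβ, ih]
    congr 2
    push_cast
    ring

theorem laurentEval_shift_coordMap (s : ℤ) (m : M) :
    laurentEval B β (laurentShift k ι s (coordMap B m)) = β s m := by
  suffices h : laurentEval B β ∘ₗ laurentShift k ι s ∘ₗ coordMap B = (β s).restrictScalars k from
    LinearMap.congr_fun h m
  refine B.ext fun x => ?_
  rw [LinearMap.comp_apply, LinearMap.comp_apply, coordMap_basis, laurentShift_single,
    laurentEval_single, LinearMap.restrictScalars_apply, ← hB x.1 x.2, apply_pow_smul β hβ,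
    add_comm]

theorem laurentEval_semilinear {d : ℕ} {φ : M →+ M} {φ' : Module.End k V}
    (hφ : ∀ n m, φ' (β n m) = β ((Fintype.card k : ℤ) ^ d * n) (φ m)) (w : ι × ℤ →₀ k) :
    laurentEval B β (laurentLift B d (fun i => φ (B (i, 0))) w) = φ' (laurentEval B β w) := by
  suffices h : laurentEval B β ∘ₗ laurentLift B d (fun i => φ (B (i, 0))) =
      φ' ∘ₗ laurentEval B β from LinearMap.congr_fun h w
  refine Finsupp.lhom_ext' fun x => LinearMap.ext_ring ?_
  simp only [LinearMap.comp_apply, Finsupp.lsingle_apply]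
  rw [laurentLift_single, laurentEval_shift_coordMap B hB β hβ, laurentEval_single, hφ]

variable {τ : M →ₛₗ[qFrob k R] M} {τV : V →ₛₗ[qFrob k R] V}
  (hτ : ∀ n m, τV (β n m) = β (Fintype.card k * n) (τ m)) [Finite ι]
include hτ

theorem exists_laurentOps_tau : ∃ θ₀ ∈ laurentOps k ι 1,
    (∀ m, θ₀ (coordMap B m) = coordMap B (τ m)) ∧
    ∀ w, laurentEval B β (θ₀ w) = τV (laurentEval B β w) := by
  refine ⟨laurentLift B 1 fun i => τ (B (i, 0)), laurentLift_mem B 1 _, fun m => ?_, fun w => ?_⟩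
  · refine coordMap_semilinear B hB (d := 1) (φ := (τ : M →+ M)) (tauEnd τ).map_smul
      (fun r m => ?_) m
    rw [pow_one]
    exact τ.map_smulₛₗ r m
  · refine laurentEval_semilinear B hB β hβ (d := 1) (φ := (τ : M →+ M)) (φ' := tauEnd τV)
      (fun n m => ?_) w
    rw [pow_one]
    exact hτ n m

/-- One operator on Laurent vectors covers the actions on `M` and on `V`: a semilinear map is
determined by its values on the basis `e_i`, and these prescribe its effect on every `t^n e_i` with
`n ∈ ℤ`. -/
theorem exists_laurentOps (θ : TwistedPoly k R) : ∃ θ₀ ∈ laurentOps k ι 0,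
    (∀ m, θ₀ (coordMap B m) = coordMap B (twistedAction τ θ m)) ∧
    ∀ w, laurentEval B β (θ₀ w) = twistedAction τV θ (laurentEval B β w) := by
  induction θ using TwistedPoly.induction with
  | hC r =>
    refine ⟨laurentLift B 0 fun i => r • B (i, 0), laurentLift_mem B 0 _, fun m => ?_, fun w => ?_⟩
    · rw [twistedAction_C]
      refine coordMap_semilinear B hB (d := 0)
        (φ := DistribSMul.toAddMonoidHom M r) (fun c m => smul_comm r c m) (fun s m => ?_) m
      rw [pow_zero, pow_one]
      exact smul_comm r s m
    · rw [twistedAction_C]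
      refine laurentEval_semilinear B hB β hβ (d := 0)
        (φ := DistribSMul.toAddMonoidHom M r) (φ' := Module.toModuleEnd k V r) (fun n m => ?_) w
      rw [pow_zero, one_mul]
      exact ((β n).map_smul r m).symm
  | htau =>
    obtain ⟨θ₀, h1, h2, h3⟩ := exists_laurentOps_tau B hB β hβ hτ
    refine ⟨θ₀, laurentOps_mono zero_le_one h1, fun m => ?_, fun w => ?_⟩
    · rw [twistedAction_tau, h2]
    · rw [twistedAction_tau, h3]
  | hadd x y hx hy =>
    obtain ⟨x₀, hx1, hx2, hx3⟩ := hx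
    obtain ⟨y₀, hy1, hy2, hy3⟩ := hy
    refine ⟨x₀ + y₀, add_mem hx1 hy1, fun m => ?_, fun w => ?_⟩
    · have h1 := (coordMap B).map_add (twistedAction τ x m) (twistedAction τ y m)
      rw [LinearMap.add_apply, twistedAction_add_apply, h1, hx2, hy2]
    · have h1 := (laurentEval B β).map_add (x₀ w) (y₀ w)
      rw [LinearMap.add_apply, twistedAction_add_apply, h1, hx3, hy3]
  | hmul x y hx hy =>
    obtain ⟨x₀, hx1, hx2, hx3⟩ := hx
    obtain ⟨y₀, hy1, hy2, hy3⟩ := hy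
    have hm := laurentOps_mul_mem hx1 hy1
    rw [add_zero] at hm
    refine ⟨x₀ * y₀, hm, fun m => ?_, fun w => ?_⟩
    · rw [twistedAction_mul_apply, ← hx2, ← hy2]
      rfl
    · rw [twistedAction_mul_apply, ← hy3, ← hx3]
      rfl

theorem exists_laurentOps_mul_tau (ψ : TwistedPoly k R) : ∃ θ₀ ∈ laurentOps k ι 1,
    (∀ m, θ₀ (coordMap B m) = coordMap B (twistedAction τ (ψ * TwistedPoly.tau k R) m)) ∧
    ∀ w, laurentEval B β (θ₀ w) =
      twistedAction τV (ψ * TwistedPoly.tau k R) (laurentEval B β w) := by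
  obtain ⟨x₀, hx1, hx2, hx3⟩ := exists_laurentOps B hB β hβ hτ ψ
  obtain ⟨y₀, hy1, hy2, hy3⟩ := exists_laurentOps_tau B hB β hβ hτ
  refine ⟨x₀ * y₀, by simpa using laurentOps_mul_mem hx1 hy1, fun m => ?_, fun w => ?_⟩
  · rw [Module.End.mul_apply, twistedAction_mul_apply, twistedAction_tau, hy2, hx2]
  · rw [Module.End.mul_apply, twistedAction_mul_apply, twistedAction_tau, hx3, hy3]

/-- The lift of a series of twisted polynomials to the vectors of Laurent polynomials. -/
theorem exists_laurentSeries {Θ : (TwistedPoly k R)⟦X⟧} (h0 : coeff 0 Θ = 0)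
    (hΘ : ∀ n, ∃ ψ, coeff n Θ = ψ * TwistedPoly.tau k R) :
    ∃ Φ : (Module.End k (ι × ℤ →₀ k))⟦X⟧,
      IsUnipotentSeries (fun _ => laurentPos k ι) (1 + Φ) ∧
      (∀ n m, coordMap B (coeff n (seriesAction τ Θ) m) = coeff n Φ (coordMap B m)) ∧
      ∀ n w, laurentEval B β (coeff n Φ w) = coeff n (seriesAction τV Θ) (laurentEval B β w) := by
  choose ψ hψ using hΘ
  choose θ h1 h2 h3 using fun n => exists_laurentOps_mul_tau B hB β hβ hτ (ψ n)
  -- The chosen lift of the zero coefficient need not vanish, so the coefficient of index 0 is set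
  -- to zero by hand.
  refine ⟨PowerSeries.mk fun n => if n = 0 then 0 else θ n, ⟨?_, fun n hn => ?_⟩, fun n m => ?_,
    fun n w => ?_⟩
  · rw [map_add, coeff_mk, if_pos rfl, add_zero, coeff_one, if_pos rfl]
  · rw [map_add, coeff_mk, if_neg (by omega), coeff_one, if_neg (by omega), zero_add]
    exact h1 n
  · rw [coeff_mk, coeff_seriesAction]
    split_ifs with h
    · rw [h, h0, map_zero, LinearMap.zero_apply, map_zero, LinearMap.zero_apply]
    · rw [hψ, h2]
  · rw [coeff_mk, coeff_seriesAction]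
    split_ifs with h
    · rw [h, h0, map_zero, LinearMap.zero_apply, map_zero, LinearMap.zero_apply]
    · rw [hψ, h3]

end Coordinates

/-! ### Comparison of `M`, `V` and the Laurent polynomials. -/

section Comparison

variable {k : Type*} [Field k] [Fintype k] {R : Type*} [CommRing R] [Algebra k R]
  {M : Type*} [AddCommGroup M] [Module R M] [Module k M] [IsScalarTower k R M]
  {ι : Type*} [Finite ι] [DecidableEq ι] (B : Module.Basis (ι × ℕ) k M) {t : R}
  (hB : ∀ i n, t ^ n • B (i, 0) = B (i, n))

include hB in
-- Modulo `t^L - 1` an exponent matters only through its residue. The map `ρ` recovers the class of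
-- `m` from its reduced coordinates, using the representatives of `ℤ/L` in `[0, L)`.
theorem ker_cycMap_comp_coordMap (L : ℕ) [NeZero L] (m : M) :
    cycMap k ι L (coordMap B m) = 0 ↔ m ∈ (Ideal.span {t ^ L - 1} • ⊤ : Submodule R M) := by
  set I : Ideal R := Ideal.span {t ^ L - 1}
  have hstep : ∀ (m : M) (a : ℕ), t ^ (L * a) • m - m ∈ (I • ⊤ : Submodule R M) := by
    intro m a
    have h1 : t ^ (L * a) - 1 ∈ I := by
      rw [Ideal.mem_span_singleton, pow_mul]
      exact sub_one_dvd_pow_sub_one _ _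
    have h2 := Submodule.smul_mem_smul h1 (Submodule.mem_top (x := m) (R := R))
    rwa [sub_smul, one_smul] at h2
  constructor
  · intro h
    let ρ : (ι × ZMod L →₀ k) →ₗ[k] M ⧸ (I • ⊤ : Submodule R M) :=
      Finsupp.linearCombination k fun x => idealProj k M I (B (x.1, x.2.val))
    have h1 : ρ ∘ₗ cycMap k ι L ∘ₗ coordMap B = idealProj k M I := by
      refine B.ext fun x => ?_
      rw [LinearMap.comp_apply, LinearMap.comp_apply, coordMap_basis, cycMap_single,
        Finsupp.linearCombination_single, one_smul]
      simp only [Int.cast_natCast, ZMod.val_natCast]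
      rw [← sub_eq_zero, ← map_sub, ← LinearMap.mem_ker, mem_ker_idealProj, ← neg_sub]
      refine neg_mem ?_
      have h2 : B x = t ^ (L * (x.2 / L)) • B (x.1, x.2 % L) := by
        rw [← hB x.1 (x.2 % L), smul_smul, ← pow_add, Nat.div_add_mod, hB]
      rw [h2]
      exact hstep _ _
    rw [← mem_ker_idealProj (k := k), LinearMap.mem_ker, ← h1, LinearMap.comp_apply,
      LinearMap.comp_apply, h, map_zero]
  · intro h
    refine Submodule.smul_induction_on h (fun r hr n _ => ?_) fun x y hx hy => ?_
    · obtain ⟨s, rfl⟩ := Ideal.mem_span_singleton'.1 hr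
      rw [mul_comm, mul_smul, sub_smul, one_smul, map_sub, map_sub, sub_eq_zero]
      generalize s • n = n
      rw [coordMap_pow_smul B hB]
      suffices h : cycMap k ι L ∘ₗ laurentShift k ι L = cycMap k ι L from
        LinearMap.congr_fun h _
      refine Finsupp.lhom_ext' fun x => LinearMap.ext_ring ?_
      simp only [LinearMap.comp_apply, Finsupp.lsingle_apply, laurentShift_single, cycMap_single]
      simp
    · rw [map_add, map_add, hx, hy, add_zero]

theorem cycMap_comp_coordMap_surjective (L : ℕ) [NeZero L] :
    Function.Surjective (cycMap k ι L ∘ₗ coordMap B) := by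
  intro w
  induction w using Finsupp.induction_linear with
  | zero => exact ⟨0, map_zero _⟩
  | add x y hx hy =>
    obtain ⟨a, rfl⟩ := hx
    obtain ⟨b, rfl⟩ := hy
    exact ⟨a + b, map_add _ _ _⟩
  | single x c =>
    refine ⟨c • B (x.1, x.2.val), ?_⟩
    rw [map_smul, LinearMap.comp_apply, coordMap_basis, cycMap_single]
    simp

include hB in
theorem mem_span_smul_top_iff (m : M) : m ∈ (Ideal.span {t} • ⊤ : Submodule R M) ↔
    ∀ i, coordMap B m (i, 0) = 0 := by
  constructor
  · intro h i
    refine Submodule.smul_induction_on h (fun r hr n _ => ?_) fun x y hx hy => ?_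
    · obtain ⟨s, rfl⟩ := Ideal.mem_span_singleton'.1 hr
      rw [mul_comm, mul_smul, ← pow_one t, coordMap_pow_smul B hB]
      generalize s • n = n
      have h1 : laurentShift k ι ((1 : ℕ) : ℤ) (coordMap B n) (i, 0) = coordMap B n (i, -1) := by
        have h2 := Finsupp.mapDomain_apply (f := fun x : ι × ℤ => (x.1, x.2 + ((1 : ℕ) : ℤ)))
          (fun x y h => by simpa [Prod.ext_iff] using h) (coordMap B n) (i, -1)
        simp only [Nat.cast_one, neg_add_cancel] at h2
        exact h2
      rw [h1, coordMap_apply_of_neg B _ _ (by norm_num)]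
    · rw [map_add, Finsupp.add_apply, hx, hy, add_zero]
  · intro h
    rw [← B.linearCombination_repr m, Finsupp.linearCombination_apply]
    refine sum_mem fun x hx => ?_
    obtain ⟨i, n⟩ := x
    rcases n with _ | n
    · have h1 := h i
      rw [← Nat.cast_zero, coordMap_apply_natCast] at h1
      exact absurd h1 (Finsupp.mem_support_iff.1 hx)
    · simp only
      rw [← hB, pow_succ', mul_smul, ← algebraMap_smul R (B.repr m (i, n + 1))]
      refine Submodule.smul_mem _ _ (Submodule.smul_mem_smul ?_ Submodule.mem_top)
      exact Ideal.mem_span_singleton_self t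

variable {V : Type*} [AddCommGroup V] [Module R V] [Module k V] [IsScalarTower k R V]
  (β : ℤ → M →ₗ[R] V) (τ : M →ₛₗ[qFrob k R] M) (τV : V →ₛₗ[qFrob k R] V)

include hB in
/-- The comparison of the determinants on `M / t M`, on a finite-dimensional quotient of `V`, and
on a space of Laurent polynomials. -/
theorem dvd_sdet_tail_sub_mul {N J : ℕ} {Φ : (Module.End k (ι × ℤ →₀ k))⟦X⟧}
    {Θ : (TwistedPoly k R)⟦X⟧}
    (hM : ∀ n m, coordMap B (coeff n (seriesAction τ Θ) m) = coeff n Φ (coordMap B m))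
    (hV : ∀ n w, laurentEval B β (coeff n Φ w) = coeff n (seriesAction τV Θ) (laurentEval B β w))
    (hJ : ∀ n < N, LinearMap.ker (tailMap k ι J) ≤
      (LinearMap.ker (tailMap k ι J)).comap (coeff n (1 + Φ)))
    [Finite (R ⧸ Ideal.span {t})] [Module.Finite R M] {U : Submodule k V}
    [FiniteDimensional k (V ⧸ U)]
    (hinv : ∀ n < N, U ≤ U.comap (coeff n (seriesAction τV Θ)))
    (hU : ∀ w, laurentEval B β w ∈ U ↔ ∀ i, ∀ n : ℤ, -J ≤ n → n ≤ -1 → w (i, n) = 0)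
    (hdense : ∀ v, ∃ w, v - laurentEval B β w ∈ U) :
    (X : k⟦X⟧) ^ N ∣ sdet (quotSeries (LinearMap.ker (tailMap k ι J)) (1 + Φ)) -
      idealDet τ Θ (Ideal.span {t}) * sdet (1 + quotSeries U (seriesAction τV Θ)) := by
  have := Fintype.ofFinite ι
  set I : Ideal R := Ideal.span {t} with hI
  have hfI := finiteDimensional_quot_smul_top k M I
  rw [idealDet, finDet_eq_sdet]
  have hker : LinearMap.ker (idealProj k M I) ≤
      (LinearMap.ker (tailMap k ι J)).comap (coordMap B) := by
    intro m hm
    rw [mem_ker_idealProj, mem_span_smul_top_iff B hB] at hm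
    rw [Submodule.mem_comap, LinearMap.mem_ker]
    ext ⟨i, a⟩
    rw [tailMap_apply, Finsupp.zero_apply]
    rcases Nat.eq_zero_or_pos (a : ℕ) with h | h
    · simp only [h, Nat.cast_zero, neg_zero]
      exact hm i
    · exact coordMap_apply_of_neg B _ _ (by simp only; omega)
  -- The exponent 0 of the tail accounts for `M / tM`, and the exponents `-J, …, -1` account for `V
  -- / U`.
  let i : (M ⧸ (I • ⊤ : Submodule R M)) →ₗ[k] (ι × ℤ →₀ k) ⧸ LinearMap.ker (tailMap k ι J) :=
    Submodule.mapQ _ _ (coordMap B) hker ∘ₗ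
      ((idealProj k M I).quotKerEquivOfSurjective (idealProj_surjective I)).symm.toLinearMap
  have hi : ∀ m, i (idealProj k M I m) = (LinearMap.ker (tailMap k ι J)).mkQ (coordMap B m) := by
    intro m
    have h1 : ((idealProj k M I).quotKerEquivOfSurjective (idealProj_surjective I)).symm
        (idealProj k M I m) = (LinearMap.ker (idealProj k M I)).mkQ m := by
      rw [LinearEquiv.symm_apply_eq]
      rfl
    change Submodule.mapQ _ _ (coordMap B) hker (LinearEquiv.symm _ _) = _
    rw [h1]
    rfl
  have hker' : LinearMap.ker (tailMap k ι J) ≤ LinearMap.ker (U.mkQ ∘ₗ laurentEval B β) := by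
    intro w hw
    rw [LinearMap.mem_ker, LinearMap.comp_apply, Submodule.mkQ_apply, Submodule.Quotient.mk_eq_zero,
      hU]
    intro i n h1 h2
    have h3 := DFunLike.congr_fun (LinearMap.mem_ker.1 hw) (i, ⟨(-n).toNat, by omega⟩)
    rw [tailMap_apply] at h3
    simp only [Finsupp.zero_apply] at h3
    rwa [show -(((-n).toNat : ℕ) : ℤ) = n by omega] at h3
  let π : (ι × ℤ →₀ k) ⧸ LinearMap.ker (tailMap k ι J) →ₗ[k] V ⧸ U :=
    Submodule.liftQ _ (U.mkQ ∘ₗ laurentEval B β) hker'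
  have hπ : ∀ w, π ((LinearMap.ker (tailMap k ι J)).mkQ w) = U.mkQ (laurentEval B β w) :=
    fun w => rfl
  refine dvd_sdet_exact i ?_ π ?_ ?_ (fun n hn v => ?_) (fun n hn v => ?_)
  · rw [← LinearMap.ker_eq_bot, eq_bot_iff]
    intro x hx
    obtain ⟨m, rfl⟩ := idealProj_surjective (k := k) I x
    rw [LinearMap.mem_ker, hi, Submodule.mkQ_apply, Submodule.Quotient.mk_eq_zero] at hx
    rw [Submodule.mem_bot, ← LinearMap.mem_ker, mem_ker_idealProj, mem_span_smul_top_iff B hB]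
    intro j
    exact DFunLike.congr_fun (LinearMap.mem_ker.1 hx) (j, 0)
  · intro x
    obtain ⟨v, rfl⟩ := U.mkQ_surjective x
    obtain ⟨w, hw⟩ := hdense v
    refine ⟨(LinearMap.ker (tailMap k ι J)).mkQ w, ?_⟩
    rw [hπ, eq_comm, ← sub_eq_zero, ← map_sub]
    exact (Submodule.Quotient.mk_eq_zero _).2 hw
  · intro x
    obtain ⟨w, rfl⟩ := Submodule.mkQ_surjective _ x
    rw [hπ, Submodule.mkQ_apply, Submodule.Quotient.mk_eq_zero, hU]
    constructor
    · intro h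
      -- The coefficients of `t^(-J), …, t^(-1)` vanish, and those of `t^0` form the constant vector
      -- used as witness.
      refine ⟨idealProj k M I (∑ j, w (j, 0) • B (j, 0)), ?_⟩
      rw [hi, ← sub_eq_zero, ← map_sub]
      refine (Submodule.Quotient.mk_eq_zero _).2 ?_
      rw [LinearMap.mem_ker]
      ext ⟨j, a⟩
      rw [tailMap_apply, Finsupp.zero_apply, Finsupp.sub_apply, sub_eq_zero]
      rcases Nat.eq_zero_or_pos (a : ℕ) with ha | ha
      · simp only [ha, Nat.cast_zero, neg_zero]
        rw [map_sum, Finsupp.finset_sum_apply, Finset.sum_eq_single j]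
        · rw [map_smul, coordMap_basis]
          simp
        · intro l _ hl
          rw [map_smul, coordMap_basis]
          simp [hl]
        · simp
      · rw [coordMap_apply_of_neg B _ _ (by simp only; omega)]
        exact (h j _ (by have := a.2; simp only; omega) (by simp only; omega)).symm
    · rintro ⟨y, hy⟩ j n h1 h2
      obtain ⟨m, rfl⟩ := idealProj_surjective (k := k) I y
      rw [hi, ← sub_eq_zero, ← map_sub] at hy
      have hy := (Submodule.Quotient.mk_eq_zero _).1 hy
      have h3 := DFunLike.congr_fun (LinearMap.mem_ker.1 hy) (j, ⟨(-n).toNat, by omega⟩)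
      rw [tailMap_apply] at h3
      simp only [Finsupp.zero_apply, Finsupp.sub_apply] at h3
      rw [show -(((-n).toNat : ℕ) : ℤ) = n by omega, coordMap_apply_of_neg B _ _ (by omega),
        zero_sub, neg_eq_zero] at h3
      exact h3
  · obtain ⟨m, rfl⟩ := idealProj_surjective (k := k) I v
    rw [hi, ← quotSeries_mkQ (hJ n hn), ← map_coeff_one_add _ (hM n m), ← hi,
      ← map_coeff_one_add _ (idealProj_coeff τ I Θ n m)]
  · obtain ⟨w, rfl⟩ := Submodule.mkQ_surjective _ v
    rw [← quotSeries_mkQ (hJ n hn), hπ, map_coeff_one_add _ (hV n w),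
      map_coeff_one_add _ (quotSeries_mkQ (hinv n hn) _), hπ]

include hB in
/-- The trace formula for `M / (t ^ n - 1) M` and `M / t M`. -/
theorem exists_dvd_idealDet_mul_sub_one [Module.Finite R M]
    (hβ : ∀ n m, β n (t • m) = β (n + 1) m)
    (hτ : ∀ n m, τV (β n m) = β (Fintype.card k * n) (τ m))
    {Θ : (TwistedPoly k R)⟦X⟧} (h0 : coeff 0 Θ = 0)
    (hΘ : ∀ n, ∃ ψ, coeff n Θ = ψ * TwistedPoly.tau k R) (N : ℕ) [Finite (R ⧸ Ideal.span {t})]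
    (hfin : ∀ K, Finite (R ⧸ Ideal.span {t ^ cycLen k K - 1})) :
    ∃ K₀ J₀ : ℕ, ∀ K J : ℕ, K₀ ≤ K → J₀ ≤ J → ∀ (U : Submodule k V) [FiniteDimensional k (V ⧸ U)],
      (∀ n < N, U ≤ U.comap (coeff n (seriesAction τV Θ))) →
      (∀ w, laurentEval B β w ∈ U ↔ ∀ i, ∀ n : ℤ, -J ≤ n → n ≤ -1 → w (i, n) = 0) →
      (∀ v, ∃ w, v - laurentEval B β w ∈ U) →
      (X : k⟦X⟧) ^ N ∣ idealDet τ Θ (Ideal.span {t ^ cycLen k K - 1}) *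
        (idealDet τ Θ (Ideal.span {t}) * sdet (1 + quotSeries U (seriesAction τV Θ))) - 1 := by
  obtain ⟨Φ, hΦ, hM, hV⟩ := exists_laurentSeries B hB β hβ hτ h0 hΘ
  obtain ⟨K₀, J₀, h⟩ := exists_dvd_sdet_cyc_mul_sdet_tail_sub_one hΦ N
  obtain ⟨J₁, hJ₁⟩ := exists_ker_tailMap_le_comap_coeff hΦ N
  refine ⟨K₀, max J₀ J₁, fun K J hK hJ U _ hinv hU hdense => ?_⟩
  have e1 := dvd_sdet_tail_sub_mul B hB β τ τV hM hV (hJ₁ J ((le_max_right _ _).trans hJ)) hinv hU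
    hdense
  refine dvd_sub_trans (dvd_sub_mul ?_ (dvd_sub_symm e1)) (h K J hK ((le_max_left _ _).trans hJ))
  have := hfin K
  have hfd := finiteDimensional_quot_smul_top k M (Ideal.span {t ^ cycLen k K - 1})
  rw [idealDet, finDet_eq_sdet]
  refine dvd_sdet_sub_sdet_of_ker_eq (Ψ := 1 + seriesAction τ Θ) (idealProj k M _)
    ((LinearMap.ker (cycMap k ι (cycLen k K))).mkQ ∘ₗ coordMap B) (idealProj_surjective _) ?_ ?_
    (fun n _ v => map_coeff_one_add _ (idealProj_coeff τ _ Θ n v)) (fun n _ v => ?_)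
  · intro x
    obtain ⟨w, rfl⟩ := Submodule.mkQ_surjective _ x
    obtain ⟨m, hm⟩ := cycMap_comp_coordMap_surjective B (cycLen k K) (cycMap k ι (cycLen k K) w)
    refine ⟨m, ?_⟩
    rw [LinearMap.comp_apply, ← sub_eq_zero, ← map_sub]
    refine (Submodule.Quotient.mk_eq_zero _).2 ?_
    rw [LinearMap.mem_ker, map_sub, sub_eq_zero]
    exact hm
  · ext m
    rw [mem_ker_idealProj, ← ker_cycMap_comp_coordMap B hB, LinearMap.mem_ker,
      LinearMap.comp_apply, Submodule.mkQ_apply, Submodule.Quotient.mk_eq_zero, LinearMap.mem_ker]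
  · rw [LinearMap.comp_apply, LinearMap.comp_apply,
      ← quotSeries_mkQ (ker_cycMap_le_comap_coeff hΦ _ n), map_coeff_one_add _ (hM n v)]

end Comparison

end TraceFormula

namespace TraceFormula

/-! ### Existence of the determinant of a nuclear series -/

section Fredholm

variable {k : Type*} [Field k] {V : Type*} [AddCommGroup V] [Module k V]

/-- Non-archimedean seminorms on a vector space over a trivially valued field. -/
structure IsUltraSeminorm (k : Type*) [Field k] {V : Type*} [AddCommGroup V] [Module k V]
    (ν : V → ℝ) : Prop where
  nonneg : ∀ v, 0 ≤ ν v
  zero : ν 0 = 0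
  add_le_max : ∀ v w, ν (v + w) ≤ max (ν v) (ν w)
  smul_le : ∀ (c : k) (v : V), ν (c • v) ≤ ν v

variable {ν : V → ℝ} (hν : IsUltraSeminorm k ν)

/-- The open balls around zero. -/
def IsUltraSeminorm.ball (hν : IsUltraSeminorm k ν) {ε : ℝ} (hε : 0 < ε) : Submodule k V where
  carrier := {v | ν v < ε}
  add_mem' {v w} hv hw := (hν.add_le_max v w).trans_lt (max_lt hv hw)
  zero_mem' := by simpa [hν.zero] using hε
  smul_mem' c v hv := (hν.smul_le c v).trans_lt hv

/-- The closed balls around zero. -/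
def IsUltraSeminorm.closedBall (hν : IsUltraSeminorm k ν) {ε : ℝ} (hε : 0 ≤ ε) :
    Submodule k V where
  carrier := {v | ν v ≤ ε}
  add_mem' {v w} hv hw := (hν.add_le_max v w).trans (max_le hv hw)
  zero_mem' := by simpa [hν.zero] using hε
  smul_mem' c v hv := (hν.smul_le c v).trans hv

include hν

theorem IsUltraSeminorm.sub_le_max (v w : V) : ν (v - w) ≤ max (ν v) (ν w) := by
  have h1 := hν.add_le_max v ((-1 : k) • w)
  rw [neg_one_smul, ← sub_eq_add_neg] at h1
  refine h1.trans (max_le_max le_rfl ?_)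
  rw [← neg_one_smul k w]
  exact hν.smul_le _ _

omit hν in
theorem IsOpenSubspace.mono {U U' : Submodule k V} (h : IsOpenSubspace ν U) (hU : U ≤ U') :
    IsOpenSubspace ν U' := by
  obtain ⟨ε, hε, hU'⟩ := h
  exact ⟨ε, hε, fun v hv => hU (hU' v hv)⟩

omit hν in
theorem IsOpenSubspace.inf {U U' : Submodule k V} (h : IsOpenSubspace ν U)
    (h' : IsOpenSubspace ν U') : IsOpenSubspace ν (U ⊓ U') := by
  obtain ⟨ε, hε, hU⟩ := h
  obtain ⟨ε', hε', hU'⟩ := h'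
  exact ⟨min ε ε', lt_min hε hε', fun v hv =>
    ⟨hU v (hv.trans_le (min_le_left _ _)), hU' v (hv.trans_le (min_le_right _ _))⟩⟩

theorem IsUltraSeminorm.isOpenSubspace_ball {ε : ℝ} (hε : 0 < ε) :
    IsOpenSubspace ν (hν.ball hε) :=
  ⟨ε, hε, fun _ hv => hv⟩

omit hν in
theorem exists_contraction_constant {Φ : (Module.End k V)⟦X⟧} {U : Submodule k V} (N : ℕ)
    (h : ∀ n < N, ContractsOn ν (coeff n Φ) U) (hn : ∀ v, 0 ≤ ν v) :
    ∃ c : ℝ, 0 < c ∧ c < 1 ∧ ∀ n < N, ∀ v ∈ U, ν (coeff n Φ v) ≤ c * ν v := by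
  induction N with
  | zero => exact ⟨1 / 2, by norm_num, by norm_num, fun n hn => absurd hn (by omega)⟩
  | succ N ih =>
    obtain ⟨c, hc, hc1, h1⟩ := ih fun n hn => h n (by omega)
    obtain ⟨d, hd, hd1, h2⟩ := h N (Nat.lt_succ_self N)
    refine ⟨max c d, lt_max_of_lt_left hc, max_lt hc1 hd1, fun n hnN v hv => ?_⟩
    rcases Nat.lt_succ_iff_lt_or_eq.1 hnN with h3 | rfl
    · exact (h1 n h3 v hv).trans (mul_le_mul_of_nonneg_right (le_max_left _ _) (hn v))
    · exact (h2 v hv).trans (mul_le_mul_of_nonneg_right (le_max_right _ _) (hn v))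

/-- Shrinking a common nucleus does not change the determinant on the quotient. -/
theorem dvd_sdet_quotSeries_sub_of_le [Finite k] {Φ : (Module.End k V)⟦X⟧} {N : ℕ}
    {U U' : Submodule k V} [FiniteDimensional k (V ⧸ U)] [FiniteDimensional k (V ⧸ U')]
    (hU : IsCommonNucleus ν Φ N U) (hle : U' ≤ U) (hopen : IsOpenSubspace ν U')
    (hinv : ∀ n < N, U' ≤ U'.comap (coeff n Φ)) :
    (X : k⟦X⟧) ^ N ∣ sdet (1 + quotSeries U' Φ) - sdet (1 + quotSeries U Φ) := by
  obtain ⟨c, hc, hc1, hcon⟩ := exists_contraction_constant N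
    (fun n hn => (hU.2 n hn).contracts) hν.nonneg
  -- Since `k` is finite, so is `V / U'`, and its elements have representatives of norm at most some
  -- `C`. The images of `U ∩ {ν ≤ c^i C}` filter `U / U'`: the first is everything, contraction
  -- shifts them, and they vanish once `c^i C < ε`, with `ε` the radius of a ball inside `U'`.
  have hfin : Finite (V ⧸ U') := Module.finite_of_finite k
  obtain ⟨C, hC0, hC⟩ : ∃ C, 0 ≤ C ∧ ∀ x : V ⧸ U', ν x.out ≤ C := by
    obtain ⟨C, hC⟩ := (Set.finite_range fun x : V ⧸ U' => ν x.out).bddAbove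
    exact ⟨C, (hν.nonneg _).trans (hC ⟨0, rfl⟩), fun x => hC ⟨x, rfl⟩⟩
  obtain ⟨ε, hε, hεU⟩ := hopen
  obtain ⟨L, hL⟩ : ∃ L : ℕ, c ^ L * C < ε := by
    have h1 := (tendsto_pow_atTop_nhds_zero_of_lt_one hc.le hc1).mul_const C
    rw [zero_mul] at h1
    exact (h1.eventually (gt_mem_nhds hε)).exists
  have hr : ∀ i : ℕ, 0 ≤ c ^ i * C := fun i => mul_nonneg (pow_nonneg hc.le _) hC0
  have hout : ∀ x : V ⧸ U', U'.mkQ x.out = x := fun x => Quotient.out_eq' x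
  refine dvd_sdet_sub_sdet_of_filtration (Submodule.factor hle) (Submodule.factor_surjective _)
    (fun n hn v => ?_) (fun i => (U ⊓ hν.closedBall (hr i)).map U'.mkQ) L ?_ ?_ ?_ ?_
  · obtain ⟨v, rfl⟩ := U'.mkQ_surjective v
    rw [← quotSeries_mkQ (hinv n hn), Submodule.factor_mk, Submodule.factor_mk,
      ← quotSeries_mkQ (hU.2 n hn).map_mem]
  · ext x
    have h1 : x ∈ LinearMap.ker ((Submodule.factor hle).restrictScalars k) ↔ x.out ∈ U := by
      conv_lhs => rw [← hout x]
      rw [LinearMap.mem_ker, LinearMap.restrictScalars_apply, Submodule.factor_mk]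
      exact Submodule.Quotient.mk_eq_zero _
    refine Iff.trans ?_ h1.symm
    nth_rw 1 [← hout x]
    constructor
    · rintro ⟨v, ⟨hv, -⟩, h⟩
      have h2 := hle ((Submodule.Quotient.eq _).1 h)
      have h3 := U.sub_mem hv h2
      rwa [sub_sub_cancel] at h3
    · intro h
      exact ⟨x.out, ⟨h, by simpa [IsUltraSeminorm.closedBall] using hC x⟩, rfl⟩
  · refine Submodule.map_mono (inf_le_inf_left _ fun v (hv : ν v ≤ _) => ?_)
    refine hv.trans (mul_le_mul_of_nonneg_right ?_ hC0)
    simpa using hc1.le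
  · rw [eq_bot_iff]
    rintro _ ⟨v, ⟨-, hv⟩, rfl⟩
    exact (Submodule.Quotient.mk_eq_zero _).2 (hεU v (lt_of_le_of_lt hv hL))
  · rintro i n hn _ ⟨v, ⟨hv, hv'⟩, rfl⟩
    rw [← quotSeries_mkQ (hinv n hn)]
    refine ⟨coeff n Φ v, ⟨(hU.2 n hn).map_mem v hv, (hcon n hn v hv).trans ?_⟩, rfl⟩
    rw [pow_succ', mul_assoc]
    exact mul_le_mul_of_nonneg_left hv' hc.le

/-- Two common nuclei are compared through their intersection, which is again open and stable. -/
theorem dvd_sdet_quotSeries_sub [Finite k] {Φ : (Module.End k V)⟦X⟧} {N : ℕ}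
    {U U' : Submodule k V} [FiniteDimensional k (V ⧸ U)] [FiniteDimensional k (V ⧸ U')]
    (hU : IsCommonNucleus ν Φ N U) (hU' : IsCommonNucleus ν Φ N U')
    (hfc : FiniteDimensional k (V ⧸ (U ⊓ U'))) :
    (X : k⟦X⟧) ^ N ∣ sdet (1 + quotSeries U Φ) - sdet (1 + quotSeries U' Φ) := by
  have hinv : ∀ n < N, U ⊓ U' ≤ (U ⊓ U').comap (coeff n Φ) := fun n hn v hv =>
    ⟨(hU.2 n hn).map_mem v hv.1, (hU'.2 n hn).map_mem v hv.2⟩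
  have h1 := dvd_sdet_quotSeries_sub_of_le hν hU inf_le_left (hU.1.inf hU'.1) hinv
  have h2 := dvd_sdet_quotSeries_sub_of_le hν hU' inf_le_right (hU.1.inf hU'.1) hinv
  exact dvd_sub_trans (dvd_sub_symm h1) h2

variable {Φ : (Module.End k V)⟦X⟧}
  (hΦ : ∀ n, ∃ δ : ℝ, 0 < δ ∧ ∀ v, ν v < δ → ν (coeff n Φ v) ≤ 1 / 2 * ν v)
include hΦ

omit hν in
theorem exists_common_radius (N : ℕ) :
    ∃ δ : ℝ, 0 < δ ∧ ∀ n < N, ∀ v, ν v < δ → ν (coeff n Φ v) ≤ 1 / 2 * ν v := by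
  induction N with
  | zero => exact ⟨1, one_pos, fun n hn => absurd hn (by omega)⟩
  | succ N ih =>
    obtain ⟨δ, hδ, h1⟩ := ih
    obtain ⟨δ', hδ', h2⟩ := hΦ N
    refine ⟨min δ δ', lt_min hδ hδ', fun n hn v hv => ?_⟩
    rcases Nat.lt_succ_iff_lt_or_eq.1 hn with h3 | rfl
    · exact h1 n h3 v (hv.trans_le (min_le_left _ _))
    · exact h2 v (hv.trans_le (min_le_right _ _))

omit hΦ in
theorem isCommonNucleus_of_le_ball {N : ℕ} {δ : ℝ} (hδ : 0 < δ)
    (h : ∀ n < N, ∀ v, ν v < δ → ν (coeff n Φ v) ≤ 1 / 2 * ν v) {U : Submodule k V}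
    (hU : U ≤ hν.ball hδ) (hopen : IsOpenSubspace ν U)
    (hinv : ∀ n < N, U ≤ U.comap (coeff n Φ)) : IsCommonNucleus ν Φ N U :=
  ⟨hopen, fun n hn => ⟨hopen, ⟨1 / 2, by norm_num, by norm_num, fun v hv => h n hn v (hU hv)⟩,
    hinv n hn⟩⟩

omit hΦ in
theorem ball_le_comap {N : ℕ} {δ δ' : ℝ} (hδ' : 0 < δ') (hle : δ' ≤ δ)
    (h : ∀ n < N, ∀ v, ν v < δ → ν (coeff n Φ v) ≤ 1 / 2 * ν v) :
    ∀ n < N, hν.ball hδ' ≤ (hν.ball hδ').comap (coeff n Φ) := by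
  intro n hn v (hv : ν v < δ')
  have h1 := h n hn v (hv.trans_le hle)
  have h2 := hν.nonneg v
  change ν (coeff n Φ v) < δ'
  linarith

theorem isNuclear_of_half : IsNuclear ν Φ := by
  intro n
  obtain ⟨δ, hδ, h⟩ := hΦ n
  refine ⟨fun v ε hε => ⟨min δ ε, lt_min hδ hε, fun w hw => ?_⟩, hν.ball hδ,
    hν.isOpenSubspace_ball hδ, 1 / 2, by norm_num, by norm_num, fun v hv => h v hv⟩
  rw [← map_sub]
  have h1 := h _ (hw.trans_le (min_le_left _ _))
  have h2 := hν.nonneg (w - v)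
  have h3 := hw.trans_le (min_le_right _ _)
  linarith

/-- A series of endomorphisms whose coefficients are strictly contracting near zero has a
determinant, which can be computed on the quotient by any common nucleus. -/
theorem exists_isFredholmDet [Finite k]
    (hfc : ∀ U : Submodule k V, IsOpenSubspace ν U → FiniteDimensional k (V ⧸ U)) :
    ∃ D : k⟦X⟧, IsFredholmDet ν Φ D ∧
      ∀ N (U : Submodule k V) [FiniteDimensional k (V ⧸ U)], IsCommonNucleus ν Φ N U →
        (X : k⟦X⟧) ^ N ∣ D - sdet (1 + quotSeries U Φ) := by
  choose δ hδ h using exists_common_radius hΦ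
  have hU : ∀ N, IsCommonNucleus ν Φ N (hν.ball (hδ N)) := fun N =>
    isCommonNucleus_of_le_ball hν (hδ N) (h N) le_rfl (hν.isOpenSubspace_ball _)
      (ball_le_comap hν _ le_rfl (h N))
  have hfcU : ∀ N, FiniteDimensional k (V ⧸ hν.ball (hδ N)) := fun N => hfc _ (hU N).1
  -- The coefficient of index `n` of the determinant is read off from a nucleus common to the first
  -- `n + 1` coefficients of `Φ`; the comparison of nuclei makes it independent of that choice.
  let d : ℕ → k⟦X⟧ := fun N => sdet (1 + quotSeries (hν.ball (hδ N)) Φ)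
  have hmono : ∀ {N N'} (U : Submodule k V), N ≤ N' → IsCommonNucleus ν Φ N' U →
      IsCommonNucleus ν Φ N U := fun U hN hU => ⟨hU.1, fun n hn => hU.2 n (by omega)⟩
  have hD : ∀ N (U : Submodule k V) [FiniteDimensional k (V ⧸ U)], IsCommonNucleus ν Φ N U →
      (X : k⟦X⟧) ^ N ∣ (PowerSeries.mk fun n => coeff n (d (n + 1))) -
        sdet (1 + quotSeries U Φ) := by
    intro N U _ hUN
    refine dvd_sub_iff_coeff.2 fun n hn => ?_
    rw [coeff_mk]
    have h1 := dvd_sdet_quotSeries_sub hν (hU (n + 1)) (hmono U hn hUN)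
      (hfc _ ((hU (n + 1)).1.inf hUN.1))
    exact dvd_sub_iff_coeff.1 h1 n (Nat.lt_succ_self n)
  refine ⟨_, ⟨isNuclear_of_half hν hΦ, fun N => ⟨_, hU N⟩, fun N U hUN => hfc U hUN.1,
    fun N U hUN => ?_⟩, hD⟩
  have := hfc U hUN.1
  exact dvd_sub_trans (hD N U hUN) (dvd_sub_symm (dvd_truncDet_sub_sdet N _))

end Fredholm

/-! ### The determinant on `V` in terms of Laurent polynomials. -/

section FredholmTrace

variable {k : Type*} [Field k] [Fintype k] {R : Type*} [CommRing R] [Algebra k R]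
  {M : Type*} [AddCommGroup M] [Module R M] [Module k M] [IsScalarTower k R M]
  {ι : Type*} [Finite ι] (B : Module.Basis (ι × ℕ) k M) {t : R}
  {V : Type*} [AddCommGroup V] [Module R V] [Module k V] [IsScalarTower k R V]
  (β : ℤ → M →ₗ[R] V) {ν : V → ℝ} (hν : IsUltraSeminorm k ν)
  (hβ : ∀ n m, β n (t • m) = β (n + 1) m) (hβ0 : ∀ m, β 0 m = 0)
  (hsmall : ∀ ε : ℝ, 0 < ε → ∃ J : ℕ, ∀ j, ∀ n : ℤ, n < -J → ν (β n (B (j, 0))) < ε)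
  (hdense : ∀ v, ∀ ε : ℝ, 0 < ε → ∃ w, ν (v - laurentEval B β w) < ε)

include hν hβ hβ0 hsmall in
-- The kernel of `tailMap` involves only positive exponents and exponents below `-J`. The former die
-- in `V` because `M` does, and the latter are small by `hsmall`.
theorem exists_map_ker_tailMap_le_ball {ε : ℝ} (hε : 0 < ε) : ∃ J₀ : ℕ, ∀ J, J₀ ≤ J →
    (LinearMap.ker (tailMap k ι J)).map (laurentEval B β) ≤ hν.ball hε := by
  obtain ⟨J₀, hJ₀⟩ := hsmall ε hε
  refine ⟨J₀, fun J hJ => ?_⟩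
  rintro _ ⟨w, hw, rfl⟩
  rw [laurentEval, Finsupp.linearCombination_apply]
  refine sum_mem fun x hx => Submodule.smul_mem _ _ ?_
  obtain ⟨i, n⟩ := x
  rcases le_or_gt 0 n with h | h
  · obtain ⟨a, rfl⟩ := Int.eq_ofNat_of_zero_le h
    have h1 := apply_pow_smul (t := t) β hβ 0 a (B (i, 0))
    rw [hβ0, zero_add] at h1
    simp only
    rw [← h1]
    exact zero_mem _
  · refine hJ₀ i n ?_
    by_contra h2
    have h3 := DFunLike.congr_fun (LinearMap.mem_ker.1 hw) (i, ⟨(-n).toNat, by omega⟩)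
    rw [tailMap_apply] at h3
    simp only [Finsupp.zero_apply] at h3
    rw [show -(((-n).toNat : ℕ) : ℤ) = n by omega] at h3
    exact Finsupp.mem_support_iff.1 hx h3

omit [Fintype k] [Algebra k R] [IsScalarTower k R M] [IsScalarTower k R V] in
theorem finiteDimensional_quot_of_ker_tailMap {J : ℕ} {U : Submodule k V}
    (hU : (LinearMap.ker (tailMap k ι J)).map (laurentEval B β) ≤ U)
    (hd : ∀ v, ∃ w, v - laurentEval B β w ∈ U) : FiniteDimensional k (V ⧸ U) := by
  have hle : LinearMap.ker (tailMap k ι J) ≤ LinearMap.ker (U.mkQ ∘ₗ laurentEval B β) := by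
    intro w hw
    exact (Submodule.Quotient.mk_eq_zero _).2 (hU ⟨w, hw, rfl⟩)
  refine Module.Finite.of_surjective (Submodule.liftQ _ (U.mkQ ∘ₗ laurentEval B β) hle) fun x => ?_
  obtain ⟨v, rfl⟩ := U.mkQ_surjective x
  obtain ⟨w, hw⟩ := hd v
  refine ⟨(LinearMap.ker (tailMap k ι J)).mkQ w, ?_⟩
  change U.mkQ (laurentEval B β w) = U.mkQ v
  rw [eq_comm, ← sub_eq_zero, ← map_sub]
  exact (Submodule.Quotient.mk_eq_zero _).2 hw

include hν hβ hβ0 hsmall hdense in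
theorem finiteDimensional_quot_of_isOpenSubspace (U : Submodule k V) (hU : IsOpenSubspace ν U) :
    FiniteDimensional k (V ⧸ U) := by
  obtain ⟨ε, hε, hεU⟩ := hU
  obtain ⟨J, hJ⟩ := exists_map_ker_tailMap_le_ball B β hν hβ hβ0 hsmall hε
  refine finiteDimensional_quot_of_ker_tailMap B β (J := J) ((hJ J le_rfl).trans hεU) fun v => ?_
  obtain ⟨w, hw⟩ := hdense v ε hε
  exact ⟨w, hεU _ hw⟩

variable (hB : ∀ i n, t ^ n • B (i, 0) = B (i, n))
  (hsep : ∀ J : ℕ, ∃ ε : ℝ, 0 < ε ∧ ∀ w, ν (laurentEval B β w) < ε →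
    ∀ i, ∀ n : ℤ, -J ≤ n → n ≤ -1 → w (i, n) = 0)
  {τ : M →ₛₗ[qFrob k R] M} {τV : V →ₛₗ[qFrob k R] V}
  (hτ : ∀ n m, τV (β n m) = β (Fintype.card k * n) (τ m))
  {Θ : (TwistedPoly k R)⟦X⟧} (h0 : coeff 0 Θ = 0)
  (hΘ : ∀ n, ∃ ψ, coeff n Θ = ψ * TwistedPoly.tau k R)
  (hcontr : ∀ n, ∃ δ : ℝ, 0 < δ ∧
    ∀ v, ν v < δ → ν (coeff n (seriesAction τV Θ) v) ≤ 1 / 2 * ν v)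
  [Module.Finite R M] [Finite (R ⧸ Ideal.span {t})]
  (hfin : ∀ K, Finite (R ⧸ Ideal.span {t ^ cycLen k K - 1}))

include hν hβ hβ0 hsmall hdense hB hsep hτ h0 hΘ hcontr hfin

/-- The determinant of a series of twisted polynomials on `V` is the inverse of the product of the
determinants on `M / t M` and on `M / (t ^ n - 1) M` for large `n = q ^ K! - 1`. -/
theorem exists_isFredholmDet_twisted : ∃ D : k⟦X⟧, IsFredholmDet ν (seriesAction τV Θ) D ∧
    IsUnit D ∧ ∀ N, ∃ K₀, ∀ K, K₀ ≤ K →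
      (X : k⟦X⟧) ^ N ∣ idealDet τ Θ (Ideal.span {t ^ cycLen k K - 1}) *
        (idealDet τ Θ (Ideal.span {t}) * D) - 1 := by
  classical
  have := Fintype.ofFinite ι
  have hfc := finiteDimensional_quot_of_isOpenSubspace B β hν hβ hβ0 hsmall hdense
  obtain ⟨D, hD, hDet⟩ := exists_isFredholmDet hν hcontr hfc
  refine ⟨D, hD, ?_, fun N => ?_⟩
  -- `Θ` has no constant coefficient, so `D` has constant coefficient 1.
  · obtain ⟨U, hU⟩ := hD.exists_nucleus 1
    have hfcU := hfc U hU.1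
    have h1 := hDet 1 U hU
    have h2 : (X : k⟦X⟧) ^ 1 ∣ sdet (1 + quotSeries U (seriesAction τV Θ)) - 1 := by
      rw [← sdet_one (k := k) (V := V ⧸ U)]
      refine dvd_sdet_sub_sdet fun n hn => ?_
      obtain rfl : n = 0 := by omega
      refine LinearMap.ext fun v => ?_
      obtain ⟨v, rfl⟩ := U.mkQ_surjective v
      rw [map_add, LinearMap.add_apply, ← quotSeries_mkQ (hU.2 0 one_pos).map_mem,
        coeff_seriesAction, h0, map_zero, LinearMap.zero_apply, map_zero, add_zero]
    have h3 := dvd_sub_iff_coeff.1 (dvd_sub_trans h1 h2) 0 one_pos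
    rw [PowerSeries.isUnit_iff_constantCoeff, ← coeff_zero_eq_constantCoeff_apply, h3, coeff_one,
      if_pos rfl]
    exact isUnit_one
  · obtain ⟨K₀, J₀, hmain⟩ := exists_dvd_idealDet_mul_sub_one B hB β τ τV hβ hτ h0 hΘ N hfin
    obtain ⟨δ, hδ, hδN⟩ := exists_common_radius hcontr N
    obtain ⟨J₁, hJ₁⟩ := exists_map_ker_tailMap_le_ball B β hν hβ hβ0 hsmall hδ
    obtain ⟨Φ, hΦ, hM, hV⟩ := exists_laurentSeries B hB β hβ hτ h0 hΘ
    obtain ⟨J₂, hJ₂⟩ := exists_ker_tailMap_le_comap_coeff hΦ N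
    refine ⟨K₀, fun K hK => ?_⟩
    set J := max J₀ (max J₁ J₂)
    obtain ⟨ε, hε, hεJ⟩ := hsep J
    have hm : 0 < min δ ε := lt_min hδ hε
    -- A nucleus adapted to Laurent coordinates. Radius at most `δ` makes it contracted; radius at
    -- most `ε` ensures, by `hsep`, that a Laurent vector lands in `U` exactly when its coefficients
    -- at `-J, …, -1` vanish.
    set U : Submodule k V := (LinearMap.ker (tailMap k ι J)).map (laurentEval B β) ⊔ hν.ball hm
      with hUdef
    have hopen : IsOpenSubspace ν U := (hν.isOpenSubspace_ball hm).mono le_sup_right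
    have hfcU := hfc U hopen
    have hinv : ∀ n < N, U ≤ U.comap (coeff n (seriesAction τV Θ)) := by
      intro n hn
      refine sup_le ?_ ?_
      · rintro _ ⟨w, hw, rfl⟩
        have h1 := hJ₂ J ((le_max_right _ _).trans (le_max_right _ _)) n hn hw
        have h2 : coeff n Φ w ∈ LinearMap.ker (tailMap k ι J) := by
          rw [Submodule.mem_comap, map_add, LinearMap.add_apply, coeff_one_apply] at h1
          have h3 := Submodule.sub_mem _ h1 (y := if n = 0 then w else 0) (by
            split_ifs
            · exact hw
            · exact zero_mem _)
          rwa [add_sub_cancel_left] at h3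
        rw [Submodule.mem_comap, ← hV]
        exact Submodule.mem_sup_left ⟨_, h2, rfl⟩
      · intro v hv
        exact Submodule.mem_sup_right (ball_le_comap hν hm (min_le_left _ _) hδN n hn hv)
    have hnuc : IsCommonNucleus ν (seriesAction τV Θ) N U := by
      refine isCommonNucleus_of_le_ball hν hδ hδN (sup_le ?_ ?_) hopen hinv
      · exact hJ₁ J ((le_max_left _ _).trans (le_max_right _ _))
      · exact fun v (hv : ν v < _) => lt_of_lt_of_le hv (min_le_left _ _)
    have hker : ∀ w ∈ LinearMap.ker (tailMap k ι J), ∀ i, ∀ n : ℤ, -J ≤ n → n ≤ -1 →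
        w (i, n) = 0 := by
      intro w hw i n h1 h2
      have h3 := DFunLike.congr_fun (LinearMap.mem_ker.1 hw) (i, ⟨(-n).toNat, by omega⟩)
      rw [tailMap_apply] at h3
      simp only [Finsupp.zero_apply] at h3
      rwa [show -(((-n).toNat : ℕ) : ℤ) = n by omega] at h3
    refine dvd_sub_trans (dvd_sub_mul ?_ (dvd_sub_mul ?_ (hDet N U hnuc)))
      (hmain K J hK (le_max_left _ _) U hinv (fun w => ⟨fun hw => ?_, fun hw => ?_⟩) fun v => ?_)
    · rw [sub_self]; exact dvd_zero _
    · rw [sub_self]; exact dvd_zero _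
    · obtain ⟨_, ⟨w', hw', rfl⟩, b, hb, hwb⟩ := Submodule.mem_sup.1 hw
      have h1 : ν (laurentEval B β (w - w')) < ε := by
        rw [map_sub, ← hwb, add_sub_cancel_left]
        exact lt_of_lt_of_le hb (min_le_right _ _)
      intro i n h2 h3
      have h4 := hεJ _ h1 i n h2 h3
      rw [Finsupp.sub_apply, hker w' hw' i n h2 h3, sub_zero] at h4
      exact h4
    -- Constant coefficients can be removed without changing the image in `V`, by `hβ0`.
    · set m := ∑ j, w (j, 0) • B (j, 0)
      have h1 : laurentEval B β w = laurentEval B β (w - coordMap B m) := by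
        have h2 := laurentEval_shift_coordMap B hB β hβ 0 m
        have h3 : laurentShift k ι 0 (coordMap B m) = coordMap B m := by
          have h4 := coordMap_pow_smul B hB 0 m
          rw [pow_zero, one_smul] at h4
          exact h4.symm
        rw [h3, hβ0] at h2
        rw [map_sub, h2, sub_zero]
      rw [h1]
      refine Submodule.mem_sup_left ⟨_, ?_, rfl⟩
      refine LinearMap.mem_ker.2 (Finsupp.ext fun x => ?_)
      obtain ⟨j, a⟩ := x
      rw [tailMap_apply, Finsupp.zero_apply, Finsupp.sub_apply, sub_eq_zero]
      rcases Nat.eq_zero_or_pos (a : ℕ) with ha | ha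
      · simp only [ha, Nat.cast_zero, neg_zero]
        rw [map_sum, Finsupp.finset_sum_apply, Finset.sum_eq_single j]
        · rw [map_smul, coordMap_basis]
          simp
        · intro l _ hl
          rw [map_smul, coordMap_basis]
          simp [hl]
        · simp
      · rw [coordMap_apply_of_neg B _ _ (by simp only; omega)]
        exact hw j _ (by have := a.2; simp only; omega) (by simp only; omega)
    · obtain ⟨w, hw⟩ := hdense v _ hm
      exact ⟨w, Submodule.mem_sup_right hw⟩

end FredholmTrace

end TraceFormula

namespace TraceFormula

open Filter Topology

/-! ### Norms over products of local fields -/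

/-- A norm on a finite-dimensional space over a local field is bounded below on a closed cone on
which it does not vanish. -/
theorem exists_coord_le_mul {F : Type*} [Field F] [TopologicalSpace F] [IsTopologicalRing F]
    (a : AbsoluteValue F ℝ) (hcont : Continuous a) (hcpt : IsCompact {x | a x ≤ 1})
    {ι : Type*} [Finite ι] {n : (ι → F) → ℝ} (hnonneg : ∀ f, 0 ≤ n f)
    (hadd : ∀ f g, n (f + g) ≤ max (n f) (n g)) (hsmul : ∀ (c : F) f, n (c • f) ≤ a c * n f)
    {D : ℝ} (hD : ∀ f (r : ℝ), 0 ≤ r → (∀ i, a (f i) ≤ r) → n f ≤ D * r) {Z : Set (ι → F)}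
    (hZ : IsClosed Z) (hZs : ∀ c : F, ∀ f ∈ Z, c • f ∈ Z) (hZ0 : ∀ f ∈ Z, n f = 0 → f = 0) :
    ∃ C : ℝ, 0 ≤ C ∧ ∀ f ∈ Z, ∀ i, a (f i) ≤ C * n f := by
  have := Fintype.ofFinite ι
  -- The vectors of the cone whose largest coordinate has absolute value 1. This set is compact and
  -- contains a multiple of every nonzero vector of the cone, so a positive minimum of `n` on it
  -- gives the bound.
  set S : Set (ι → F) := {f | (∀ i, a (f i) ≤ 1) ∧ (∃ i, a (f i) = 1) ∧ f ∈ Z} with hS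
  have hScpt : IsCompact S := by
    have h1 : IsCompact (Set.univ.pi fun _ : ι => {x : F | a x ≤ 1}) :=
      isCompact_univ_pi fun _ => hcpt
    have h2 : S = (Set.univ.pi fun _ : ι => {x : F | a x ≤ 1}) ∩
        ((⋃ i : ι, {f : ι → F | a (f i) = 1}) ∩ Z) := by
      ext f
      simp [hS]
    rw [h2]
    refine h1.inter_right (IsClosed.inter (isClosed_iUnion_of_finite fun i => ?_) hZ)
    exact isClosed_eq (hcont.comp (continuous_apply i)) continuous_const
  have hneg : ∀ f, n (-f) ≤ n f := fun f => by
    have h1 := hsmul (-1) f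
    rwa [neg_one_smul, a.map_neg, a.map_one, one_mul] at h1
  -- By `hD` the function `n` is small near zero, and the ultrametric inequality carries continuity
  -- to all points.
  have hncont : Continuous n := by
    rw [continuous_iff_continuousAt]
    intro f
    have hlim : Tendsto (fun g : ι → F => D * ∑ i, a (g i - f i)) (𝓝 f) (𝓝 0) := by
      have h1 : Continuous fun g : ι → F => D * ∑ i, a (g i - f i) :=
        continuous_const.mul (continuous_finset_sum _ fun i _ =>
          hcont.comp ((continuous_apply i).sub continuous_const))
      have h2 := h1.tendsto f
      simpa using h2
    refine tendsto_iff_norm_sub_tendsto_zero.2 (squeeze_zero (fun _ => norm_nonneg _) (fun g => ?_)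
      hlim)
    have h1 : n (g - f) ≤ D * ∑ i, a (g i - f i) :=
      hD _ _ (Finset.sum_nonneg fun i _ => a.nonneg _) fun i =>
        Finset.single_le_sum (f := fun i => a (g i - f i)) (fun i _ => a.nonneg _)
          (Finset.mem_univ i)
    have h2 := hadd (g - f) f
    have h3 := hadd (-(g - f)) g
    rw [sub_add_cancel] at h2
    rw [neg_sub, sub_add_cancel] at h3
    have h4 := hneg (g - f)
    rw [neg_sub] at h4
    rw [Real.norm_eq_abs, abs_le]
    have h5 := hnonneg f
    have h6 := hnonneg g
    have h7 := hnonneg (g - f)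
    have h8 := hnonneg (f - g)
    constructor
    · rcases max_cases (n (f - g)) (n g) with h | h <;> linarith [h.1]
    · rcases max_cases (n (g - f)) (n f) with h | h <;> linarith [h.1]
  have hscale : ∀ f ∈ Z, f ≠ 0 → ∃ i, (∀ j, a (f j) ≤ a (f i)) ∧ a (f i) ≠ 0 ∧
      (f i)⁻¹ • f ∈ S := by
    intro f hf hf0
    obtain ⟨l, hl⟩ := Function.ne_iff.1 hf0
    have : Nonempty ι := ⟨l⟩
    obtain ⟨i, hi⟩ := Finite.exists_max fun i => a (f i)
    have hi0 : 0 < a (f i) := (a.pos hl).trans_le (hi l)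
    have hi1 : f i ≠ 0 := a.pos_iff.1 hi0
    refine ⟨i, hi, hi0.ne', fun j => ?_, ⟨i, ?_⟩, hZs _ _ hf⟩
    · rw [Pi.smul_apply, smul_eq_mul, map_mul, map_inv₀, inv_mul_le_iff₀ hi0, mul_one]
      exact hi j
    · rw [Pi.smul_apply, smul_eq_mul, inv_mul_cancel₀ hi1, a.map_one]
  rcases S.eq_empty_or_nonempty with hE | hE
  · refine ⟨0, le_rfl, fun f hf i => ?_⟩
    have : f = 0 := by
      by_contra h
      obtain ⟨i, -, -, h1⟩ := hscale f hf h
      rw [hE] at h1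
      exact h1
    rw [this, Pi.zero_apply, a.map_zero, zero_mul]
  · obtain ⟨g, hg, hmin⟩ := hScpt.exists_isMinOn hE hncont.continuousOn
    have hg0 : 0 < n g := by
      refine lt_of_le_of_ne (hnonneg g) fun h => ?_
      have h1 := hZ0 g hg.2.2 h.symm
      obtain ⟨i, hi⟩ := hg.2.1
      rw [h1, Pi.zero_apply, a.map_zero] at hi
      exact zero_ne_one hi
    refine ⟨(n g)⁻¹, inv_nonneg.2 hg0.le, fun f hf i => ?_⟩
    by_cases hf0 : f = 0
    · rw [hf0, Pi.zero_apply, a.map_zero]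
      exact mul_nonneg (inv_nonneg.2 hg0.le) (hnonneg _)
    · obtain ⟨i0, h1, h2, h3⟩ := hscale f hf hf0
      have h4 : n g ≤ n ((f i0)⁻¹ • f) := hmin h3
      have h5 := h4.trans (hsmul _ _)
      have h6 : 0 < a (f i0) := lt_of_le_of_ne (a.nonneg _) h2.symm
      rw [map_inv₀, le_inv_mul_iff₀ h6] at h5
      rw [le_inv_mul_iff₀ hg0]
      refine le_trans ?_ h5
      rw [mul_comm]
      exact mul_le_mul_of_nonneg_right (h1 i) hg0.le

/-- An identification of a ring with a product of locally compact non-archimedean fields. -/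
structure LocalFields (B : Type*) [CommRing B] (P : Type*) (F : P → Type*) [∀ p, Field (F p)]
    [∀ p, TopologicalSpace (F p)] where
  /-- The components. -/
  ev : B ≃+* ∀ p, F p
  /-- The absolute values. -/
  a : ∀ p, AbsoluteValue (F p) ℝ
  ultra : ∀ p x y, a p (x + y) ≤ max (a p x) (a p y)
  cont : ∀ p, Continuous (a p)
  cpt : ∀ p, IsCompact {x | a p x ≤ 1}

namespace LocalFields

variable {B : Type*} [CommRing B] {P : Type*} [Finite P] {F : P → Type*} [∀ p, Field (F p)]
  [∀ p, TopologicalSpace (F p)] (L : LocalFields B P F)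

/-- The absolute value of a component. -/
def absAt (p : P) (g : B) : ℝ := L.a p (L.ev g p)

/-- The maximum of the absolute values of the components. -/
def abs (g : B) : ℝ := ⨆ p, L.absAt p g

omit [Finite P] in
theorem absAt_nonneg (p : P) (g : B) : 0 ≤ L.absAt p g := (L.a p).nonneg _

omit [Finite P] in
theorem absAt_mul (p : P) (g h : B) : L.absAt p (g * h) = L.absAt p g * L.absAt p h := by
  rw [absAt, map_mul, Pi.mul_apply, map_mul]
  rfl

omit [Finite P] in
theorem absAt_one (p : P) : L.absAt p 1 = 1 := by
  rw [absAt, map_one, Pi.one_apply, map_one]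

omit [Finite P] in
theorem absAt_pow (p : P) (g : B) (n : ℕ) : L.absAt p (g ^ n) = L.absAt p g ^ n := by
  rw [absAt, map_pow, Pi.pow_apply, map_pow]
  rfl

theorem absAt_le_abs (p : P) (g : B) : L.absAt p g ≤ L.abs g :=
  le_ciSup (f := fun p => L.absAt p g) (Set.finite_range _).bddAbove p

omit [Finite P] in
theorem abs_nonneg (g : B) : 0 ≤ L.abs g := Real.iSup_nonneg fun p => L.absAt_nonneg p g

omit [Finite P] in
theorem abs_le {g : B} {C : ℝ} (hC : 0 ≤ C) (h : ∀ p, L.absAt p g ≤ C) : L.abs g ≤ C :=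
  Real.iSup_le h hC

theorem abs_pow_le (g : B) (n : ℕ) : L.abs (g ^ n) ≤ L.abs g ^ n :=
  L.abs_le (pow_nonneg (L.abs_nonneg g) _) fun p => by
    rw [absAt_pow]
    exact pow_le_pow_left₀ (L.absAt_nonneg _ _) (L.absAt_le_abs _ _) _

/-- The elements supported on a single component. -/
def incl [DecidableEq P] (p : P) (c : F p) : B := L.ev.symm (Pi.single p c)

omit [Finite P]

theorem ev_incl [DecidableEq P] (p : P) (c : F p) : L.ev (L.incl p c) = Pi.single p c :=
  L.ev.apply_symm_apply _

theorem incl_mul [DecidableEq P] (p : P) (c : F p) (b : B) :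
    L.incl p c * b = L.incl p (c * L.ev b p) := by
  refine L.ev.injective ?_
  rw [map_mul, ev_incl, ev_incl, Pi.single_mul_left]

theorem incl_add [DecidableEq P] (p : P) (c d : F p) :
    L.incl p (c + d) = L.incl p c + L.incl p d := by
  refine L.ev.injective ?_
  rw [map_add, ev_incl, ev_incl, ev_incl, Pi.single_add]

theorem abs_incl_le [DecidableEq P] (p : P) (c : F p) : L.abs (L.incl p c) ≤ L.a p c := by
  refine L.abs_le ((L.a p).nonneg _) fun p' => ?_
  rw [absAt, ev_incl]
  by_cases h : p' = p
  · subst h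
    rw [Pi.single_eq_same]
  · rw [Pi.single_eq_of_ne h, map_zero]
    exact (L.a p).nonneg _

/-- The relation `c^q = c` rules out absolute values greater than 1. -/
theorem abs_algebraMap_le {k : Type*} [Field k] [Fintype k] [Algebra k B] (c : k) :
    L.abs (algebraMap k B c) ≤ 1 := by
  refine L.abs_le zero_le_one fun p => ?_
  by_contra! h
  have h1 := L.absAt_pow p (algebraMap k B c) (Fintype.card k)
  rw [← map_pow, FiniteField.pow_card] at h1
  have h2 : (1 : ℝ) < Fintype.card k := by exact_mod_cast Fintype.one_lt_card
  have h3 := pow_lt_pow_right₀ h (Fintype.one_lt_card (α := k))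
  rw [pow_one] at h3
  exact h3.ne h1

end LocalFields

/-! ### Norms on `M ⊗ B` and coordinates. -/

section TensorNorm

variable {k : Type*} [Field k] [Fintype k] {R : Type*} [CommRing R] [Algebra k R]
  {M : Type*} [AddCommGroup M] [Module R M] [Module k M] [IsScalarTower k R M]
  {B : Type*} [CommRing B] [Algebra R B] {P : Type*} [Finite P] {F : P → Type*} [∀ p, Field (F p)]
  [∀ p, TopologicalSpace (F p)] (L : LocalFields B P F)

theorem mulTensor_tmul (b f : B) (m : M) : mulTensor b (m ⊗ₜ[R] f) = m ⊗ₜ[R] (b * f) := rfl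

theorem mulTensor_algebraMap (r : R) (x : M ⊗[R] B) : mulTensor (algebraMap R B r) x = r • x := by
  induction x with
  | zero => simp
  | add x y hx hy => rw [map_add, hx, hy, smul_add]
  | tmul m f => rw [mulTensor_tmul, ← Algebra.smul_def, TensorProduct.tmul_smul]

/-- The coordinates on `M ⊗ B` given by linear forms on `M`. -/
def coordTensor (l : M →ₗ[R] R) : M ⊗[R] B →ₗ[R] B :=
  (TensorProduct.lid R B).toLinearMap ∘ₗ LinearMap.rTensor B l

theorem coordTensor_tmul (l : M →ₗ[R] R) (m : M) (f : B) :
    coordTensor l (m ⊗ₜ[R] f) = algebraMap R B (l m) * f := by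
  rw [← Algebra.smul_def]
  rfl

theorem coordTensor_mulTensor (l : M →ₗ[R] R) (b : B) (x : M ⊗[R] B) :
    coordTensor l (mulTensor b x) = b * coordTensor l x := by
  induction x with
  | zero => simp
  | add x y hx hy => rw [map_add, map_add, map_add, hx, hy, mul_add]
  | tmul m f => rw [mulTensor_tmul, coordTensor_tmul, coordTensor_tmul, mul_left_comm]

theorem sum_tmul_coordTensor {s : ℕ} {e : Fin s → M} {l : Fin s → M →ₗ[R] R}
    (hel : ∀ m, ∑ i, l i m • e i = m) (x : M ⊗[R] B) :
    ∑ i, e i ⊗ₜ[R] coordTensor (l i) x = x := by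
  induction x with
  | zero => simp
  | add x y hx hy =>
    conv_rhs => rw [← hx, ← hy]
    rw [← Finset.sum_add_distrib]
    exact Finset.sum_congr rfl fun i _ => by rw [map_add, TensorProduct.tmul_add]
  | tmul m f =>
    conv_rhs => rw [← hel m, TensorProduct.sum_tmul]
    refine Finset.sum_congr rfl fun i _ => ?_
    rw [coordTensor_tmul, ← Algebra.smul_def, TensorProduct.smul_tmul]

variable (R M) in
theorem exists_dual_basis [Module.Finite R M] [Module.Projective R M] :
    ∃ (s : ℕ) (e : Fin s → M) (l : Fin s → M →ₗ[R] R), ∀ m, ∑ i, l i m • e i = m := by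
  obtain ⟨s, f, g, -, -, hfg⟩ := Module.Finite.exists_comp_eq_id_of_projective R M
  refine ⟨s, fun i => f (Pi.single i 1), fun i => LinearMap.proj i ∘ₗ g, fun m => ?_⟩
  have h1 := LinearMap.congr_fun hfg m
  rw [LinearMap.comp_apply, LinearMap.id_apply] at h1
  conv_rhs => rw [← h1, ← Finset.univ_sum_single (g m), map_sum]
  refine Finset.sum_congr rfl fun i _ => ?_
  rw [← map_smul, ← Pi.single_smul, smul_eq_mul, mul_one]
  rfl

variable {N : M ⊗[R] B → ℝ} (hN : IsTensorNorm L.abs N)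
include hN

omit [Finite P] in
theorem IsTensorNorm.smul_le_of_le {b : B} {C : ℝ} (hb : L.abs b ≤ C) (x : M ⊗[R] B) :
    N (mulTensor b x) ≤ C * N x :=
  (hN.smul_le b x).trans (mul_le_mul_of_nonneg_right hb (hN.nonneg x))

omit [Finite P] in
theorem IsTensorNorm.isUltraSeminorm : IsUltraSeminorm k N where
  nonneg := hN.nonneg
  zero := (hN.eq_zero_iff 0).2 rfl
  add_le_max := hN.add_le_max
  smul_le c v := by
    let : Algebra k B := Algebra.compHom B (algebraMap k R)
    rw [← algebraMap_smul R, ← mulTensor_algebraMap]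
    have h1 := IsTensorNorm.smul_le_of_le L hN (L.abs_algebraMap_le c) v
    rwa [one_mul] at h1

omit [Finite P] in
theorem IsTensorNorm.sum_le {α : Type*} (s : Finset α) (f : α → M ⊗[R] B) {C : ℝ} (hC : 0 ≤ C)
    (h : ∀ x ∈ s, N (f x) ≤ C) : N (∑ x ∈ s, f x) ≤ C := by
  classical
  induction s using Finset.induction_on with
  | empty => rw [Finset.sum_empty, (hN.eq_zero_iff 0).2 rfl]; exact hC
  | insert a s ha ih =>
    rw [Finset.sum_insert ha]
    exact (hN.add_le_max _ _).trans (max_le (h a (Finset.mem_insert_self _ _))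
      (ih fun x hx => h x (Finset.mem_insert_of_mem hx)))

/-- The coordinates are bounded by the norm. -/
theorem IsTensorNorm.exists_coordTensor_le [∀ p, IsTopologicalRing (F p)] {s : ℕ} {e : Fin s → M}
    {l : Fin s → M →ₗ[R] R} (hel : ∀ m, ∑ i, l i m • e i = m) :
    ∃ C : ℝ, 0 ≤ C ∧ ∀ x i, L.abs (coordTensor (l i) x) ≤ C * N x := by
  classical
  have key : ∀ p, ∃ C : ℝ, 0 ≤ C ∧ ∀ x i, L.absAt p (coordTensor (l i) x) ≤ C * N x := by
    intro p
    -- The dual basis makes `M` a direct summand of `R^s`. At `p`, the coordinate vectors of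
    -- elements of `M ⊗ B` lie in the closed cone `Z` of vectors fixed by the matrix `E`; on this
    -- cone the pulled back norm `n` vanishes only at zero.
    set E : Fin s → Fin s → F p := fun j i => L.ev (algebraMap R B (l j (e i))) p with hE
    set Z : Set (Fin s → F p) := {f | ∀ j, ∑ i, E j i * f i = f j} with hZ
    let n : (Fin s → F p) → ℝ := fun f => N (∑ i, e i ⊗ₜ[R] L.incl p (f i))
    obtain ⟨D, hD0, hD⟩ : ∃ D, 0 ≤ D ∧ ∀ i, N (e i ⊗ₜ[R] 1) ≤ D := by
      refine ⟨∑ i, N (e i ⊗ₜ[R] 1), Finset.sum_nonneg fun i _ => hN.nonneg _, fun i => ?_⟩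
      exact Finset.single_le_sum (f := fun i => N (e i ⊗ₜ[R] 1)) (fun i _ => hN.nonneg _)
        (Finset.mem_univ i)
    have hcoord : ∀ (f : Fin s → F p) j,
        coordTensor (l j) (∑ i, e i ⊗ₜ[R] L.incl p (f i)) = L.incl p (∑ i, E j i * f i) := by
      intro f j
      have h1 : ∀ (t : Finset (Fin s)) (g : Fin s → F p),
          ∑ i ∈ t, L.incl p (g i) = L.incl p (∑ i ∈ t, g i) := by
        intro t g
        exact (map_sum (AddMonoidHom.mk' (L.incl p) (L.incl_add p)) g t).symm
      rw [map_sum, ← h1]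
      refine Finset.sum_congr rfl fun i _ => ?_
      rw [coordTensor_tmul, mul_comm, L.incl_mul, mul_comm]
    have hlow : ∃ C : ℝ, 0 ≤ C ∧ ∀ f ∈ Z, ∀ i, L.a p (f i) ≤ C * n f := by
      refine exists_coord_le_mul (L.a p) (L.cont p) (L.cpt p) (n := n) (D := D)
        (fun f => hN.nonneg _) (fun f g => ?_) (fun c f => ?_) (fun f r hr hf => ?_) ?_
        (fun c f hf j => ?_) (fun f hf h0 => ?_)
      · refine le_trans (le_of_eq ?_) (hN.add_le_max _ _)
        rw [← Finset.sum_add_distrib]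
        refine congrArg N (Finset.sum_congr rfl fun i _ => ?_)
        rw [Pi.add_apply, L.incl_add, TensorProduct.tmul_add]
      · refine le_trans (le_of_eq ?_)
          (IsTensorNorm.smul_le_of_le L hN (L.abs_incl_le p c) (∑ i, e i ⊗ₜ[R] L.incl p (f i)))
        rw [map_sum]
        refine congrArg N (Finset.sum_congr rfl fun i _ => ?_)
        rw [mulTensor_tmul, L.incl_mul, L.ev_incl, Pi.single_eq_same]
        rfl
      · refine IsTensorNorm.sum_le L hN _ _ (mul_nonneg hD0 hr) fun i _ => ?_
        have h1 := IsTensorNorm.smul_le_of_le L hN ((L.abs_incl_le p (f i)).trans (hf i))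
          (e i ⊗ₜ[R] (1 : B))
        rw [mulTensor_tmul, mul_one, mul_comm] at h1
        exact h1.trans (mul_le_mul_of_nonneg_right (hD i) hr)
      · have h1 : Z = ⋂ j, {f | ∑ i, E j i * f i = f j} := by
          ext f
          simp [hZ]
        rw [h1]
        refine isClosed_iInter fun j => ?_
        -- Separation is not part of `LocalFields`; it follows from the continuous ultrametric
        -- absolute value.
        have : T2Space (F p) := by
          refine ⟨fun x y hxy => ?_⟩
          have h0 : 0 < L.a p (x - y) := (L.a p).pos (sub_ne_zero.2 hxy)
          refine ⟨{z | L.a p (z - x) < L.a p (x - y)}, {z | L.a p (z - y) < L.a p (x - y)},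
            isOpen_lt ((L.cont p).comp (continuous_id.sub continuous_const)) continuous_const,
            isOpen_lt ((L.cont p).comp (continuous_id.sub continuous_const)) continuous_const, ?_, ?_,
            Set.disjoint_left.2 fun z hz hz' => ?_⟩
          · simpa using h0
          · simpa using h0
          · have h2 := L.ultra p (x - z) (z - y)
            rw [sub_add_sub_cancel, (L.a p).map_sub x z] at h2
            exact absurd (h2.trans_lt (max_lt hz hz')) (lt_irrefl _)
        exact isClosed_eq (continuous_finset_sum _ fun i _ =>
          continuous_const.mul (continuous_apply i)) (continuous_apply j)
      · have h1 := hf j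
        simp only [Pi.smul_apply, smul_eq_mul]
        rw [← h1, Finset.mul_sum]
        exact Finset.sum_congr rfl fun i _ => by ring
      · have h1 := (hN.eq_zero_iff _).1 h0
        funext j
        have h2 := hcoord f j
        rw [h1, map_zero, hf j] at h2
        have h3 := congrFun (congrArg L.ev h2) p
        rw [L.ev_incl, Pi.single_eq_same, map_zero] at h3
        exact h3.symm
    obtain ⟨C, hC0, hC⟩ := hlow
    refine ⟨C, hC0, fun x i => ?_⟩
    -- Projection to the component at `p` does not increase the norm, since the idempotent has
    -- absolute value at most 1.
    have h1 : mulTensor (L.incl p 1) x =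
        ∑ i, e i ⊗ₜ[R] L.incl p (L.ev (coordTensor (l i) x) p) := by
      conv_lhs => rw [← sum_tmul_coordTensor hel x, map_sum]
      refine Finset.sum_congr rfl fun i _ => ?_
      rw [mulTensor_tmul, L.incl_mul, one_mul]
    have h2 : (fun i => L.ev (coordTensor (l i) x) p) ∈ Z := by
      intro j
      have h3 := congrArg (coordTensor (l j)) h1
      rw [hcoord, coordTensor_mulTensor, L.incl_mul, one_mul] at h3
      have h4 := congrFun (congrArg L.ev h3) p
      rw [L.ev_incl, L.ev_incl, Pi.single_eq_same, Pi.single_eq_same] at h4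
      exact h4.symm
    refine (hC _ h2 i).trans (mul_le_mul_of_nonneg_left ?_ hC0)
    change N (∑ i, e i ⊗ₜ[R] L.incl p (L.ev (coordTensor (l i) x) p)) ≤ N x
    rw [← h1]
    have h5 := IsTensorNorm.smul_le_of_le L hN (L.abs_incl_le p 1) x
    rwa [map_one, one_mul] at h5
  choose C hC0 hC using key
  have := Fintype.ofFinite P
  refine ⟨∑ p, C p, Finset.sum_nonneg fun p _ => hC0 p, fun x i => ?_⟩
  refine L.abs_le (mul_nonneg (Finset.sum_nonneg fun p _ => hC0 p) (hN.nonneg x)) fun p => ?_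
  refine (hC p x i).trans (mul_le_mul_of_nonneg_right ?_ (hN.nonneg x))
  exact Finset.single_le_sum (f := C) (fun p _ => hC0 p) (Finset.mem_univ p)

end TensorNorm

end TraceFormula

namespace TraceFormula

open Filter Topology

/-! ### The quotient norm and contraction by `τ`. -/

section QuotientNorm

variable {k : Type*} [Field k] [Fintype k] {R : Type*} [CommRing R] [Algebra k R]
  {M : Type*} [AddCommGroup M] [Module R M] [Module k M] [IsScalarTower k R M]
  {B : Type*} [CommRing B] [Algebra R B] {P : Type*} [Finite P] {F : P → Type*} [∀ p, Field (F p)]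
  [∀ p, TopologicalSpace (F p)] (L : LocalFields B P F)

variable (R M B) in
/-- The projection `M ⊗ B → M ⊗ B / R`. -/
def cokerProj : M ⊗[R] B →ₗ[R] M ⊗[R] Coker R B :=
  LinearMap.lTensor M (Submodule.mkQ (LinearMap.range (Algebra.linearMap R B)))

variable (R M B) in
theorem cokerProj_surjective : Function.Surjective (cokerProj R M B) :=
  LinearMap.lTensor_surjective M (Submodule.mkQ_surjective _)

theorem cokerProj_tmul (m : M) (f : B) :
    cokerProj R M B (m ⊗ₜ f) = m ⊗ₜ (LinearMap.range (Algebra.linearMap R B)).mkQ f := rfl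

theorem exists_of_cokerProj_eq_zero {x : M ⊗[R] B} (hx : cokerProj R M B x = 0) :
    ∃ m : M, x = m ⊗ₜ 1 := by
  have hex : Function.Exact (Algebra.linearMap R B)
      (LinearMap.range (Algebra.linearMap R B)).mkQ := by
    rw [LinearMap.exact_iff, Submodule.ker_mkQ]
  obtain ⟨y, rfl⟩ := (lTensor_exact M hex (Submodule.mkQ_surjective _) x).1 hx
  obtain ⟨m, rfl⟩ := (TensorProduct.rid R M).symm.surjective y
  refine ⟨m, ?_⟩
  rw [TensorProduct.rid_symm_apply, LinearMap.lTensor_tmul, Algebra.linearMap_apply, map_one]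

variable {N : M ⊗[R] B → ℝ} (hN : IsTensorNorm L.abs N)
include hN

omit [Finite P]

theorem quotientNorm_le (x : M ⊗[R] B) : quotientNorm N (cokerProj R M B x) ≤ N x :=
  csInf_le ⟨0, by rintro _ ⟨y, _, rfl⟩; exact hN.nonneg y⟩ ⟨x, rfl, rfl⟩

theorem quotientNorm_lt_iff {w : M ⊗[R] Coker R B} {ε : ℝ} :
    quotientNorm N w < ε ↔ ∃ x, cokerProj R M B x = w ∧ N x < ε := by
  obtain ⟨y, hy⟩ := cokerProj_surjective R M B w
  constructor
  · intro h
    obtain ⟨_, ⟨x, hx, rfl⟩, h1⟩ := exists_lt_of_csInf_lt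
      (⟨N y, y, hy, rfl⟩ : (N '' {v | cokerProj R M B v = w}).Nonempty) h
    exact ⟨x, hx, h1⟩
  · rintro ⟨x, rfl, h⟩
    exact (quotientNorm_le L hN x).trans_lt h

theorem quotientNorm_nonneg (w : M ⊗[R] Coker R B) : 0 ≤ quotientNorm N w :=
  Real.sInf_nonneg (by rintro _ ⟨y, _, rfl⟩; exact hN.nonneg y)

/-- Bounds in terms of the norms of all lifts hold for the quotient norm. -/
theorem le_of_forall_lift {w : M ⊗[R] Coker R B} {y : ℝ} {f : ℝ → ℝ} (hf : Continuous f)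
    (h : ∀ x, cokerProj R M B x = w → y ≤ f (N x)) : y ≤ f (quotientNorm N w) := by
  by_contra! hlt
  obtain ⟨δ, hδ, h1⟩ := Metric.eventually_nhds_iff.1
    ((hf.tendsto (quotientNorm N w)).eventually (gt_mem_nhds hlt))
  obtain ⟨x, hx, hxδ⟩ := (quotientNorm_lt_iff L hN).1
    (lt_add_of_pos_right (quotientNorm N w) hδ)
  have h2 := quotientNorm_le L hN x
  rw [hx] at h2
  have h3 : dist (N x) (quotientNorm N w) < δ := by
    rw [Real.dist_eq, abs_of_nonneg (sub_nonneg.2 h2)]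
    linarith
  exact absurd (h1 h3) (not_lt.2 (h x hx))

theorem isUltraSeminorm_quotientNorm : IsUltraSeminorm k (quotientNorm N) where
  nonneg := quotientNorm_nonneg L hN
  zero := by
    refine le_antisymm ?_ (quotientNorm_nonneg L hN 0)
    have h1 := quotientNorm_le L hN 0
    rwa [map_zero, (hN.eq_zero_iff 0).2 rfl] at h1
  add_le_max v w := by
    refine le_of_forall_gt fun ε hε => ?_
    obtain ⟨hv, hw⟩ := max_lt_iff.1 hε
    obtain ⟨x, rfl, hx⟩ := (quotientNorm_lt_iff L hN).1 hv
    obtain ⟨y, rfl, hy⟩ := (quotientNorm_lt_iff L hN).1 hw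
    rw [← map_add]
    exact (quotientNorm_le L hN _).trans_lt ((hN.add_le_max x y).trans_lt (max_lt hx hy))
  smul_le c v := by
    refine le_of_forall_lift L hN continuous_id fun x hx => ?_
    rw [← hx, ← algebraMap_smul R, ← map_smul, algebraMap_smul]
    exact (quotientNorm_le L hN _).trans ((IsTensorNorm.isUltraSeminorm (k := k) L hN).smul_le c x)

theorem quotientNorm_smul_le (r : R) (v : M ⊗[R] Coker R B) :
    quotientNorm N (r • v) ≤ L.abs (algebraMap R B r) * quotientNorm N v := by
  refine le_of_forall_lift L hN (f := fun s => L.abs (algebraMap R B r) * s)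
    (continuous_const.mul continuous_id) fun x hx => ?_
  rw [← hx, ← map_smul, ← mulTensor_algebraMap]
  exact (quotientNorm_le L hN _).trans (hN.smul_le _ _)

omit hN in
/-- The map `m ⊗ f ↦ τ(m) ⊗ f ^ q` on `M ⊗ B`. -/
def tauTensor (B : Type*) [CommRing B] [Algebra R B] (τ : M →ₛₗ[qFrob k R] M) :
    (M ⊗[R] B) →ₛₗ[qFrob k R] (M ⊗[R] B) :=
  TensorProduct.map τ (algFrob k R B)

omit hN [IsScalarTower k R M] [Module k M] in
theorem tauTensor_tmul (τ : M →ₛₗ[qFrob k R] M) (m : M) (f : B) :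
    tauTensor B τ (m ⊗ₜ f) = τ m ⊗ₜ (f ^ Fintype.card k) := rfl

omit hN [IsScalarTower k R M] [Module k M] in
theorem cokerProj_tauTensor (τ : M →ₛₗ[qFrob k R] M) (x : M ⊗[R] B) :
    cokerProj R M B (tauTensor B τ x) = tauCoker B τ (cokerProj R M B x) := by
  induction x with
  | zero => rw [map_zero, map_zero, map_zero]
  | add x y hx hy => rw [map_add, map_add, map_add, map_add, hx, hy]
  | tmul m f => rfl

variable [Finite P] [∀ p, IsTopologicalRing (F p)] [Module.Finite R M] [Module.Projective R M]

/-- In coordinates `τ` sends `∑ e_i ⊗ x_i` to `∑ τ(e_i) ⊗ x_i^q`, and the `x_i` are bounded by the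
norm. -/
theorem exists_tauTensor_le (τ : M →ₛₗ[qFrob k R] M) :
    ∃ C : ℝ, 0 ≤ C ∧ ∀ x, N (tauTensor B τ x) ≤ C * N x ^ Fintype.card k := by
  obtain ⟨s, e, l, hel⟩ := exists_dual_basis R M
  obtain ⟨C, hC0, hC⟩ := IsTensorNorm.exists_coordTensor_le L hN hel
  set q := Fintype.card k
  set D := ∑ i, N (τ (e i) ⊗ₜ[R] (1 : B))
  have hD0 : 0 ≤ D := Finset.sum_nonneg fun i _ => hN.nonneg _
  refine ⟨C ^ q * D, mul_nonneg (pow_nonneg hC0 _) hD0, fun x => ?_⟩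
  have hx0 := hN.nonneg x
  conv_lhs => rw [← sum_tmul_coordTensor hel x, map_sum]
  refine IsTensorNorm.sum_le L hN _ _ (by positivity) fun i _ => ?_
  rw [tauTensor_tmul, ← mul_one (coordTensor (l i) x ^ _), ← mulTensor_tmul]
  have h1 : L.abs (coordTensor (l i) x ^ q) ≤ (C * N x) ^ q :=
    (L.abs_pow_le _ _).trans (pow_le_pow_left₀ (L.abs_nonneg _) (hC x i) _)
  refine (IsTensorNorm.smul_le_of_le L hN h1 _).trans ?_
  have h2 : N (τ (e i) ⊗ₜ[R] (1 : B)) ≤ D :=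
    Finset.single_le_sum (f := fun i => N (τ (e i) ⊗ₜ[R] (1 : B))) (fun i _ => hN.nonneg _)
      (Finset.mem_univ i)
  rw [mul_pow]
  calc C ^ q * N x ^ q * N (τ (e i) ⊗ₜ[R] 1) ≤ C ^ q * N x ^ q * D :=
        mul_le_mul_of_nonneg_left h2 (by positivity)
    _ = C ^ q * D * N x ^ q := by ring

/-- A bound by the `q`-th power of the norm, with `q ≥ 2`, beats any linear bound near zero. -/
theorem exists_quotientNorm_tauCoker_le (τ : M →ₛₗ[qFrob k R] M) (c : ℝ) (hc : 0 < c) :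
    ∃ δ : ℝ, 0 < δ ∧ ∀ v, quotientNorm N v < δ →
      quotientNorm N (tauCoker B τ v) ≤ c * quotientNorm N v := by
  obtain ⟨C, hC0, hC⟩ := exists_tauTensor_le L hN τ
  have h1 : ∀ v, quotientNorm N (tauCoker B τ v) ≤ C * quotientNorm N v ^ Fintype.card k := by
    intro v
    refine le_of_forall_lift L hN (f := fun s => C * s ^ Fintype.card k)
      (continuous_const.mul (continuous_pow _)) fun x hx => ?_
    rw [← hx, ← cokerProj_tauTensor]
    exact (quotientNorm_le L hN _).trans (hC x)
  have hC1 : 0 < C + 1 := by linarith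
  refine ⟨min 1 (c / (C + 1)), lt_min one_pos (div_pos hc hC1), fun v hv => (h1 v).trans ?_⟩
  have h2 := quotientNorm_nonneg L hN v
  have h3 : quotientNorm N v ≤ 1 := (hv.trans_le (min_le_left _ _)).le
  have h4 : quotientNorm N v ≤ c / (C + 1) := (hv.trans_le (min_le_right _ _)).le
  rw [le_div_iff₀ hC1] at h4
  have h5 : quotientNorm N v ^ Fintype.card k ≤ quotientNorm N v ^ 2 :=
    pow_le_pow_of_le_one h2 h3 Fintype.one_lt_card
  calc C * quotientNorm N v ^ Fintype.card k ≤ C * quotientNorm N v ^ 2 :=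
        mul_le_mul_of_nonneg_left h5 hC0
    _ ≤ c * quotientNorm N v := by nlinarith

/-- Scalars are bounded and `τ` contracts near zero, so a twisted polynomial satisfies a linear
bound near zero, though in general not a contracting one. -/
theorem exists_quotientNorm_twistedAction_le (τ : M →ₛₗ[qFrob k R] M) (θ : TwistedPoly k R) :
    ∃ C : ℝ, 0 ≤ C ∧ ∃ δ : ℝ, 0 < δ ∧ ∀ v, quotientNorm N v < δ →
      quotientNorm N (twistedAction (tauCoker B τ) θ v) ≤ C * quotientNorm N v := by
  induction θ using TwistedPoly.induction with
  | hC r =>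
    refine ⟨_, L.abs_nonneg (algebraMap R B r), 1, one_pos, fun v _ => ?_⟩
    rw [twistedAction_C]
    exact quotientNorm_smul_le L hN r v
  | htau =>
    obtain ⟨δ, hδ, h⟩ := exists_quotientNorm_tauCoker_le L hN τ 1 one_pos
    refine ⟨1, zero_le_one, δ, hδ, fun v hv => ?_⟩
    rw [twistedAction_tau]
    exact h v hv
  | hadd x y hx hy =>
    obtain ⟨C, hC, δ, hδ, h⟩ := hx
    obtain ⟨C', hC', δ', hδ', h'⟩ := hy
    refine ⟨max C C', hC.trans (le_max_left _ _), min δ δ', lt_min hδ hδ', fun v hv => ?_⟩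
    have h0 := quotientNorm_nonneg L hN v
    rw [twistedAction_add_apply]
    refine ((isUltraSeminorm_quotientNorm (k := k) L hN).add_le_max _ _).trans (max_le ?_ ?_)
    · exact (h v (hv.trans_le (min_le_left _ _))).trans
        (mul_le_mul_of_nonneg_right (le_max_left _ _) h0)
    · exact (h' v (hv.trans_le (min_le_right _ _))).trans
        (mul_le_mul_of_nonneg_right (le_max_right _ _) h0)
  | hmul x y hx hy =>
    obtain ⟨C, hC, δ, hδ, h⟩ := hx
    obtain ⟨C', hC', δ', hδ', h'⟩ := hy
    have hC1 : 0 < C' + 1 := by linarith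
    -- The radius makes the inner operator land in the ball of radius `δ`; adding 1 avoids division
    -- by zero.
    refine ⟨C * C', mul_nonneg hC hC', min δ' (δ / (C' + 1)), lt_min hδ' (div_pos hδ hC1),
      fun v hv => ?_⟩
    have h0 := quotientNorm_nonneg L hN v
    have h1 := h' v (hv.trans_le (min_le_left _ _))
    have h2 := hv.trans_le (min_le_right _ _)
    rw [lt_div_iff₀ hC1] at h2
    rw [twistedAction_mul_apply]
    refine (h _ (by nlinarith)).trans ?_
    rw [mul_assoc]
    exact mul_le_mul_of_nonneg_left h1 hC

/-- The elements of `R{τ} τ` act by maps which are strictly contracting near zero. -/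
theorem exists_quotientNorm_twistedAction_mul_tau_le (τ : M →ₛₗ[qFrob k R] M)
    (ψ : TwistedPoly k R) : ∃ δ : ℝ, 0 < δ ∧ ∀ v, quotientNorm N v < δ →
      quotientNorm N (twistedAction (tauCoker B τ) (ψ * TwistedPoly.tau k R) v) ≤
        1 / 2 * quotientNorm N v := by
  obtain ⟨C, hC, δ, hδ, h⟩ := exists_quotientNorm_twistedAction_le L hN τ ψ
  have hC1 : 0 < C + 1 := by linarith
  -- The contraction factor of `τ` is chosen to absorb the constant `C` of `ψ` and leave `1/2`.
  obtain ⟨δ', hδ', h'⟩ := exists_quotientNorm_tauCoker_le L hN τ (1 / (2 * (C + 1))) (by positivity)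
  refine ⟨min δ δ', lt_min hδ hδ', fun v hv => ?_⟩
  have h0 := quotientNorm_nonneg L hN v
  have h1 := h' v (hv.trans_le (min_le_right _ _))
  rw [twistedAction_mul_apply, twistedAction_tau]
  have h2 : quotientNorm N (tauCoker B τ v) ≤ quotientNorm N v := by
    refine h1.trans ?_
    have : 1 / (2 * (C + 1)) ≤ 1 := by
      rw [div_le_one (by positivity)]
      linarith
    nlinarith
  refine (h _ (h2.trans_lt (hv.trans_le (min_le_left _ _)))).trans ?_
  calc C * quotientNorm N (tauCoker B τ v) ≤ C * (1 / (2 * (C + 1)) * quotientNorm N v) :=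
        mul_le_mul_of_nonneg_left h1 hC
    _ ≤ (C + 1) * (1 / (2 * (C + 1)) * quotientNorm N v) := by
        refine mul_le_mul_of_nonneg_right (by linarith) ?_
        positivity
    _ = 1 / 2 * quotientNorm N v := by
        field_simp

end QuotientNorm

/-! ### Laurent vectors in `M ⊗ B` and in `M ⊗ B / R`. -/

section LaurentNorm

variable {k : Type*} [Field k] [Fintype k] {R : Type*} [CommRing R] [Algebra k R]
  {M : Type*} [AddCommGroup M] [Module R M] [Module k M] [IsScalarTower k R M]
  {B : Type*} [CommRing B] [Algebra R B] {P : Type*} [Finite P] {F : P → Type*} [∀ p, Field (F p)]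
  [∀ p, TopologicalSpace (F p)] (L : LocalFields B P F)

/-- The map `m ↦ m ⊗ t ^ n`. -/
def tmulPow (R : Type*) [CommRing R] [Algebra R B] (M : Type*) [AddCommGroup M] [Module R M] (T : Bˣ) (n : ℤ) : M →ₗ[R] M ⊗[R] B :=
  (TensorProduct.mk R M B).flip ((T ^ n : Bˣ) : B)

theorem tmulPow_apply (T : Bˣ) (n : ℤ) (m : M) :
    tmulPow R M T n m = m ⊗ₜ[R] ((T ^ n : Bˣ) : B) := rfl

/-- The map `m ↦ m ⊗ [t ^ n]` to `M ⊗ B / R`. -/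
def tmulPowCoker (R : Type*) [CommRing R] [Algebra R B] (M : Type*) [AddCommGroup M] [Module R M] (T : Bˣ) (n : ℤ) :
    M →ₗ[R] M ⊗[R] Coker R B :=
  cokerProj R M B ∘ₗ tmulPow R M T n

theorem tmulPowCoker_apply (T : Bˣ) (n : ℤ) (m : M) :
    tmulPowCoker R M T n m = cokerProj R M B (tmulPow R M T n m) := rfl

variable {t : R} {T : Bˣ} (hT : (T : B) = algebraMap R B t)

include hT in
theorem tmulPow_smul (n : ℤ) (m : M) : tmulPow R M T n (t • m) = tmulPow R M T (n + 1) m := by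
  rw [tmulPow_apply, tmulPow_apply, TensorProduct.smul_tmul, Algebra.smul_def, ← hT,
    zpow_add_one, Units.val_mul, mul_comm]

include hT in
theorem tmulPowCoker_smul (n : ℤ) (m : M) :
    tmulPowCoker R M T n (t • m) = tmulPowCoker R M T (n + 1) m :=
  congrArg (cokerProj R M B) (tmulPow_smul hT n m)

theorem tmulPowCoker_zero (m : M) : tmulPowCoker R M T 0 m = 0 := by
  rw [tmulPowCoker_apply, tmulPow_apply, zpow_zero, Units.val_one, cokerProj_tmul]
  have : (LinearMap.range (Algebra.linearMap R B)).mkQ 1 = 0 :=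
    (Submodule.Quotient.mk_eq_zero _).2 ⟨1, map_one (algebraMap R B)⟩
  rw [this, TensorProduct.tmul_zero]

theorem tauCoker_tmulPowCoker (τ : M →ₛₗ[qFrob k R] M) (n : ℤ) (m : M) :
    tauCoker B τ (tmulPowCoker R M T n m) = tmulPowCoker R M T (Fintype.card k * n) (τ m) := by
  rw [tmulPowCoker_apply, ← cokerProj_tauTensor, tmulPowCoker_apply, tmulPow_apply, tauTensor_tmul,
    tmulPow_apply, mul_comm, zpow_mul, zpow_natCast, Units.val_pow_eq_pow_val]

theorem mulTensor_tmulPow (s n : ℤ) (m : M) :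
    mulTensor ((T ^ s : Bˣ) : B) (tmulPow R M T n m) = tmulPow R M T (n + s) m := by
  rw [tmulPow_apply, mulTensor_tmul, tmulPow_apply, zpow_add, Units.val_mul, mul_comm]

variable {ι : Type*} [Finite ι] [DecidableEq ι] (b : Module.Basis (ι × ℕ) k M)

theorem laurentEval_tmulPowCoker (w : ι × ℤ →₀ k) :
    laurentEval b (tmulPowCoker R M T) w = cokerProj R M B (laurentEval b (tmulPow R M T) w) := by
  suffices h : laurentEval b (tmulPowCoker R M T) =
      (cokerProj R M B).restrictScalars k ∘ₗ laurentEval b (tmulPow R M T) from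
    LinearMap.congr_fun h w
  refine Finsupp.lhom_ext' fun x => LinearMap.ext_ring ?_
  simp only [LinearMap.comp_apply, Finsupp.lsingle_apply, laurentEval_single]
  rfl

theorem laurentEval_tmulPow_shift (s : ℤ) (w : ι × ℤ →₀ k) :
    laurentEval b (tmulPow R M T) (laurentShift k ι s w) =
      mulTensor ((T ^ s : Bˣ) : B) (laurentEval b (tmulPow R M T) w) := by
  suffices h : laurentEval b (tmulPow R M T) ∘ₗ laurentShift k ι s =
      (mulTensor ((T ^ s : Bˣ) : B)).restrictScalars k ∘ₗ laurentEval b (tmulPow R M T) from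
    LinearMap.congr_fun h w
  refine Finsupp.lhom_ext' fun x => LinearMap.ext_ring ?_
  simp only [LinearMap.comp_apply, Finsupp.lsingle_apply, laurentEval_single, laurentShift_single,
    LinearMap.restrictScalars_apply, mulTensor_tmulPow]

variable (hlt : ∀ p, 1 < L.absAt p (T : B))
include hlt

omit [Finite P] in
theorem absAt_inv_lt_one (p : P) : L.absAt p ((T⁻¹ : Bˣ) : B) < 1 := by
  have h1 := L.absAt_mul p (T : B) ((T⁻¹ : Bˣ) : B)
  rw [Units.mul_inv, L.absAt_one] at h1
  have h2 := hlt p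
  have h3 := L.absAt_nonneg p ((T⁻¹ : Bˣ) : B)
  by_contra! h4
  nlinarith

theorem abs_inv_lt_one : L.abs ((T⁻¹ : Bˣ) : B) < 1 := by
  rcases isEmpty_or_nonempty P with h | h
  · refine (L.abs_le le_rfl fun p => h.elim p).trans_lt one_pos
  · obtain ⟨p, hp⟩ := Finite.exists_max fun p => L.absAt p ((T⁻¹ : Bˣ) : B)
    exact (L.abs_le (L.absAt_nonneg p _) hp).trans_lt (absAt_inv_lt_one L hlt p)

theorem abs_zpow_neg_le (n : ℕ) :
    L.abs ((T ^ (-(n : ℤ)) : Bˣ) : B) ≤ L.abs ((T⁻¹ : Bˣ) : B) ^ n := by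
  rw [← inv_zpow', zpow_natCast, Units.val_pow_eq_pow_val]
  exact L.abs_pow_le _ _

variable {N : M ⊗[R] B → ℝ} (hN : IsTensorNorm L.abs N)
include hN

omit [Finite P] hlt [Fintype k] [Algebra k R] [IsScalarTower k R M] in
theorem exists_basis_bound : ∃ D : ℝ, 1 ≤ D ∧ ∀ j, N (b (j, 0) ⊗ₜ[R] (1 : B)) ≤ D := by
  obtain ⟨D, hD⟩ := (Set.finite_range fun j => N (b (j, 0) ⊗ₜ[R] (1 : B))).bddAbove
  exact ⟨max 1 D, le_max_left _ _, fun j => (hD ⟨j, rfl⟩).trans (le_max_right _ _)⟩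

/-- `t` has absolute value greater than 1 in every component, so its negative powers tend to zero.
-/
theorem exists_quotientNorm_tmulPowCoker_lt (ε : ℝ) (hε : 0 < ε) :
    ∃ J : ℕ, ∀ j, ∀ n : ℤ, n < -J → quotientNorm N (tmulPowCoker R M T n (b (j, 0))) < ε := by
  obtain ⟨D, hD1, hD⟩ := exists_basis_bound L b hN
  set ρ := L.abs ((T⁻¹ : Bˣ) : B)
  have hρ0 : 0 ≤ ρ := L.abs_nonneg _
  have hρ1 : ρ < 1 := abs_inv_lt_one L hlt
  have h1 := (tendsto_pow_atTop_nhds_zero_of_lt_one hρ0 hρ1).mul_const D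
  rw [zero_mul] at h1
  obtain ⟨J, hJ⟩ := (h1.eventually (gt_mem_nhds hε)).exists
  refine ⟨J, fun j n hn => ?_⟩
  obtain ⟨a, rfl⟩ : ∃ a : ℕ, n = -(a : ℤ) := ⟨(-n).toNat, by omega⟩
  rw [tmulPowCoker_apply]
  refine (quotientNorm_le L hN _).trans_lt (lt_of_le_of_lt ?_ hJ)
  rw [tmulPow_apply, ← mul_one ((T ^ (-(a : ℤ)) : Bˣ) : B), ← mulTensor_tmul]
  have h2 : L.abs ((T ^ (-(a : ℤ)) : Bˣ) : B) ≤ ρ ^ J :=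
    (abs_zpow_neg_le L hlt a).trans (pow_le_pow_of_le_one hρ0 hρ1.le (by omega))
  exact (IsTensorNorm.smul_le_of_le L hN h2 _).trans
    (mul_le_mul_of_nonneg_left (hD j) (pow_nonneg hρ0 _))

omit [Finite P] hlt in
include hT in
-- If `g` is close to `t^(-n) r`, then `m ⊗ g` is close to `rm ⊗ t^(-n)`, the image of a shifted
-- element of `M`.
theorem exists_quotientNorm_sub_laurentEval_lt (hb : ∀ i n, t ^ n • b (i, 0) = b (i, n))
    (hdens : ∀ g : B, ∀ ε : ℝ, 0 < ε → ∃ (r : R) (n : ℕ),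
      L.abs (g - ((T ^ (-(n : ℤ)) : Bˣ) : B) * algebraMap R B r) < ε)
    (v : M ⊗[R] Coker R B) (ε : ℝ) (hε : 0 < ε) :
    ∃ w, quotientNorm N (v - laurentEval b (tmulPowCoker R M T) w) < ε := by
  have hν := isUltraSeminorm_quotientNorm (k := k) L hN
  induction v with
  | zero => exact ⟨0, by rwa [map_zero, sub_zero, hν.zero]⟩
  | add x y hx hy =>
    obtain ⟨w, hw⟩ := hx
    obtain ⟨w', hw'⟩ := hy
    refine ⟨w + w', ?_⟩
    rw [map_add, add_sub_add_comm]
    exact (hν.add_le_max _ _).trans_lt (max_lt hw hw')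
  | tmul m f =>
    obtain ⟨g, rfl⟩ := Submodule.mkQ_surjective _ f
    have h0 := hN.nonneg (m ⊗ₜ[R] (1 : B))
    have h1 : 0 < N (m ⊗ₜ[R] (1 : B)) + 1 := by linarith
    obtain ⟨r, n, hrn⟩ := hdens g _ (div_pos hε h1)
    refine ⟨laurentShift k ι (-(n : ℤ)) (coordMap b (r • m)), ?_⟩
    rw [laurentEval_shift_coordMap b hb _ (tmulPowCoker_smul hT), tmulPowCoker_apply,
      ← cokerProj_tmul, ← map_sub]
    refine (quotientNorm_le L hN _).trans_lt ?_
    have h2 : m ⊗ₜ[R] g - tmulPow R M T (-(n : ℤ)) (r • m) =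
        mulTensor (g - ((T ^ (-(n : ℤ)) : Bˣ) : B) * algebraMap R B r) (m ⊗ₜ[R] (1 : B)) := by
      rw [mulTensor_tmul, mul_one, TensorProduct.tmul_sub, tmulPow_apply, TensorProduct.smul_tmul,
        Algebra.smul_def, mul_comm]
    rw [h2]
    refine (IsTensorNorm.smul_le_of_le L hN hrn.le _).trans_lt ?_
    rw [div_mul_eq_mul_div, div_lt_iff₀ h1]
    nlinarith

variable [∀ p, IsTopologicalRing (F p)] [Module.Finite R M] [Module.Projective R M]

omit hlt [Module k M] [IsScalarTower k R M] [Fintype k] [Algebra k R] in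
-- `M` inherits discreteness from `R`: an element is determined by its coordinates in `R`, and these
-- are bounded in terms of its norm.
theorem finite_tmul_one_le (hfin : ∀ C : ℝ, {y : R | L.abs (algebraMap R B y) ≤ C}.Finite) (C : ℝ) :
    {m : M | N (m ⊗ₜ[R] (1 : B)) ≤ C}.Finite := by
  obtain ⟨s, e, l, hel⟩ := exists_dual_basis R M
  obtain ⟨C', hC0, hC'⟩ := IsTensorNorm.exists_coordTensor_le L hN hel
  refine Set.Finite.of_finite_image (f := fun m i => l i m)
    ((Set.Finite.pi' fun _ : Fin s => hfin (C' * C)).subset ?_) fun m _ m' _ h => ?_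
  · rintro _ ⟨m, hm, rfl⟩ i
    have h1 := hC' (m ⊗ₜ[R] (1 : B)) i
    rw [coordTensor_tmul, mul_one] at h1
    exact h1.trans (mul_le_mul_of_nonneg_left hm hC0)
  · rw [← hel m, ← hel m']
    exact Finset.sum_congr rfl fun i _ => congrArg (· • e i) (congrFun h i)

include hT in
-- If the class of `w` is small, then `w + m` is small in `M ⊗ B` for some `m ∈ M`. Multiplied by
-- `t^s` it still has bounded norm, and so has its polynomial part `m'`, as the negative powers of
-- `t` contribute only bounded terms. By discreteness `m'` is one of finitely many elements, hence
-- of `t`-degree below some `A`. With `s = J + A` the coefficients of `w + m` at exponents `≥ -J`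
-- vanish, and at negative exponents these are the coefficients of `w`.
theorem exists_forall_quotientNorm_lt_imp (hb : ∀ i n, t ^ n • b (i, 0) = b (i, n))
    (hfin : ∀ C : ℝ, {y : R | L.abs (algebraMap R B y) ≤ C}.Finite) (J : ℕ) :
    ∃ ε : ℝ, 0 < ε ∧ ∀ w, quotientNorm N (laurentEval b (tmulPowCoker R M T) w) < ε →
      ∀ i, ∀ n : ℤ, -J ≤ n → n ≤ -1 → w (i, n) = 0 := by
  have hNu := IsTensorNorm.isUltraSeminorm (k := k) L hN
  obtain ⟨D, hD1, hD⟩ := exists_basis_bound L b hN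
  have hD0 : 0 ≤ D := zero_le_one.trans hD1
  obtain ⟨A, hA⟩ : ∃ A : ℕ, ∀ m : M, N (m ⊗ₜ[R] (1 : B)) ≤ D → ∀ i n, A ≤ n →
      b.repr m (i, n) = 0 := by
    have h1 : (⋃ m ∈ {m : M | N (m ⊗ₜ[R] (1 : B)) ≤ D},
        ((b.repr m).support : Set (ι × ℕ))).Finite :=
      (finite_tmul_one_le L hN hfin D).biUnion fun m _ => Finset.finite_toSet _
    obtain ⟨A, hA⟩ := (h1.image Prod.snd).bddAbove
    refine ⟨A + 1, fun m hm i n hn => ?_⟩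
    by_contra h
    have h2 := hA ⟨(i, n), Set.mem_biUnion hm (Finsupp.mem_support_iff.2 h), rfl⟩
    simp only at h2
    omega
  set s : ℕ := J + A with hs
  set C := L.abs ((T ^ (s : ℤ) : Bˣ) : B)
  have hC0 : 0 ≤ C := L.abs_nonneg _
  -- Multiplication by `t^s` enlarges norms by at most the factor `C`, so this radius keeps the
  -- shifted vector of norm at most `1 ≤ D`.
  refine ⟨1 / (C + 1), by positivity, fun w hw i n h1 h2 => ?_⟩
  obtain ⟨x, hx, hxε⟩ := (quotientNorm_lt_iff L hN).1 hw
  rw [laurentEval_tmulPowCoker, ← sub_eq_zero, ← map_sub] at hx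
  obtain ⟨m, hm⟩ := exists_of_cokerProj_eq_zero hx
  have hshift : ∀ m, laurentEval b (tmulPow R M T) (coordMap b m) = m ⊗ₜ[R] (1 : B) := by
    intro m
    have h3 := laurentEval_shift_coordMap b hb (tmulPow R M T) (tmulPow_smul hT) 0 m
    have h4 := coordMap_pow_smul b hb 0 m
    rw [pow_zero, one_smul, Nat.cast_zero] at h4
    rw [← h4, tmulPow_apply, zpow_zero, Units.val_one] at h3
    exact h3
  have hx2 : x = laurentEval b (tmulPow R M T) (w + coordMap b m) := by
    rw [map_add, hshift, ← hm, add_sub_cancel]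
  set w' := laurentShift k ι (s : ℤ) (w + coordMap b m) with hw'
  have hNw' : N (laurentEval b (tmulPow R M T) w') ≤ D := by
    rw [hw', laurentEval_tmulPow_shift, ← hx2]
    refine (hN.smul_le _ _).trans (le_trans ?_ hD1)
    have h3 := hN.nonneg x
    have h5 : N x * (C + 1) < 1 := by rwa [lt_div_iff₀ (by linarith)] at hxε
    change C * N x ≤ 1
    nlinarith
  have hinj : Function.Injective fun x : ι × ℕ => (x.1, (x.2 : ℤ)) := by
    rintro ⟨a, c⟩ ⟨a', c'⟩ h
    simpa [Prod.ext_iff] using h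
  set m' := b.repr.symm (Finsupp.comapDomain (fun x : ι × ℕ => (x.1, (x.2 : ℤ))) w' hinj.injOn)
  have hm' : ∀ i (n : ℕ), b.repr m' (i, n) = w' (i, n) := by
    intro i n
    rw [LinearEquiv.apply_symm_apply]
    rfl
  have hNm' : N (m' ⊗ₜ[R] (1 : B)) ≤ D := by
    rw [← hshift, ← sub_sub_cancel (laurentEval b (tmulPow R M T) w')
      (laurentEval b (tmulPow R M T) (coordMap b m')), ← map_sub]
    refine (hNu.sub_le_max _ _).trans (max_le hNw' ?_)
    rw [laurentEval, Finsupp.linearCombination_apply]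
    refine (Submodule.sum_mem (hNu.closedBall hD0) (fun y hy => ?_) : _ ∈ hNu.closedBall hD0)
    refine Submodule.smul_mem _ _ ?_
    obtain ⟨j, l⟩ := y
    have hl : l < 0 := by
      by_contra! hl
      obtain ⟨l, rfl⟩ := Int.eq_ofNat_of_zero_le hl
      refine Finsupp.mem_support_iff.1 hy ?_
      rw [Finsupp.sub_apply, coordMap_apply_natCast, hm', sub_self]
    obtain ⟨c, rfl⟩ : ∃ c : ℕ, l = -(c : ℤ) := ⟨(-l).toNat, by omega⟩
    change N (tmulPow R M T (-(c : ℤ)) (b (j, 0))) ≤ D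
    rw [tmulPow_apply, ← mul_one ((T ^ (-(c : ℤ)) : Bˣ) : B), ← mulTensor_tmul]
    have h3 : L.abs ((T ^ (-(c : ℤ)) : Bˣ) : B) ≤ 1 :=
      (abs_zpow_neg_le L hlt c).trans (pow_le_one₀ (L.abs_nonneg _) (abs_inv_lt_one L hlt).le)
    have h4 := IsTensorNorm.smul_le_of_le L hN h3 (b (j, 0) ⊗ₜ[R] (1 : B))
    rw [one_mul] at h4
    exact h4.trans (hD j)
  obtain ⟨a, ha⟩ : ∃ a : ℕ, n + s = a := ⟨(n + s).toNat, by omega⟩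
  have h3 := hA m' hNm' i a (by omega)
  rw [hm', ← ha, hw'] at h3
  have h4 := Finsupp.mapDomain_apply (f := fun x : ι × ℤ => (x.1, x.2 + (s : ℤ)))
    (fun x y h => by simpa [Prod.ext_iff] using h) (w + coordMap b m) (i, n)
  have h5 : (w + coordMap b m) (i, n) = 0 := h4.symm.trans h3
  rwa [Finsupp.add_apply, coordMap_apply_of_neg b _ _ (by omega), add_zero] at h5

end LaurentNorm

end TraceFormula

namespace TraceFormula

open Filter Topology

/-! ### Normalized absolute values -/

section NormAbs

variable {K : Type*} [Field K] (A : ValuationSubring K) [IsDiscreteValuationRing A]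

theorem valuation_le_one_iff_mem (x : K) :
    (IsDiscreteValuationRing.maximalIdeal A).valuation K x ≤ 1 ↔ x ∈ A := by
  constructor
  · intro h
    obtain ⟨a, rfl⟩ := IsDiscreteValuationRing.exists_lift_of_le_one h
    exact a.2
  · intro h
    exact (IsDiscreteValuationRing.maximalIdeal A).valuation_le_one (K := K) ⟨x, h⟩

variable [Finite (IsLocalRing.ResidueField A)]

theorem one_lt_card_residueField :
    (1 : NNReal) < (Nat.card (IsLocalRing.ResidueField A) : NNReal) := by
  exact_mod_cast Finite.one_lt_card

theorem normAbs_eq_toNNReal (f : Completion A) :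
    normAbs A f = WithZeroMulInt.toNNReal (one_lt_card_residueField A).ne_zero (Valued.v f) := by
  unfold normAbs
  split_ifs with h
  · simp [h]
  · have h1 : Valued.v f ≠ 0 := (Valuation.ne_zero_iff _).2 h
    rw [WithZeroMulInt.toNNReal_neg_apply _ h1]
    simp only [NNReal.coe_zpow, NNReal.coe_natCast]
    congr 1
    generalize Valued.v f = y at h1
    cases y
    · exact absurd rfl h1
    · rfl

theorem normAbs_le_normAbs_iff (f g : Completion A) :
    normAbs A f ≤ normAbs A g ↔ Valued.v f ≤ Valued.v g := by
  rw [normAbs_eq_toNNReal, normAbs_eq_toNNReal, NNReal.coe_le_coe,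
    (WithZeroMulInt.toNNReal_strictMono (one_lt_card_residueField A)).le_iff_le]

theorem normAbs_le_one_iff (f : Completion A) : normAbs A f ≤ 1 ↔ Valued.v f ≤ 1 := by
  have h := normAbs_le_normAbs_iff A f 1
  rwa [map_one, normAbs_eq_toNNReal A 1, map_one, map_one, NNReal.coe_one] at h

/-- The normalized absolute value. -/
def normAbsHom : AbsoluteValue (Completion A) ℝ where
  toFun := normAbs A
  map_mul' f g := by
    rw [normAbs_eq_toNNReal, normAbs_eq_toNNReal, normAbs_eq_toNNReal, map_mul, map_mul,
      NNReal.coe_mul]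
  nonneg' f := by
    rw [normAbs_eq_toNNReal]
    exact NNReal.coe_nonneg _
  eq_zero' f := by
    rw [normAbs_eq_toNNReal, NNReal.coe_eq_zero, _root_.map_eq_zero]
    exact Valuation.zero_iff _
  add_le' f g := by
    rcases le_total (Valued.v f) (Valued.v g) with h | h
    · refine ((normAbs_le_normAbs_iff A (f + g) g).2
        (Valuation.map_add_le _ h le_rfl)).trans (le_add_of_nonneg_left ?_)
      rw [normAbs_eq_toNNReal]
      exact NNReal.coe_nonneg _
    · refine ((normAbs_le_normAbs_iff A (f + g) f).2
        (Valuation.map_add_le _ le_rfl h)).trans (le_add_of_nonneg_right ?_)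
      rw [normAbs_eq_toNNReal]
      exact NNReal.coe_nonneg _

theorem normAbsHom_apply (f : Completion A) : normAbsHom A f = normAbs A f := rfl

theorem normAbsHom_add_le (f g : Completion A) :
    normAbsHom A (f + g) ≤ max (normAbsHom A f) (normAbsHom A g) := by
  rcases le_total (Valued.v f) (Valued.v g) with h | h
  · exact ((normAbs_le_normAbs_iff A (f + g) g).2
      (Valuation.map_add_le _ h le_rfl)).trans (le_max_right _ _)
  · exact ((normAbs_le_normAbs_iff A (f + g) f).2
      (Valuation.map_add_le _ le_rfl h)).trans (le_max_left _ _)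

/-- Neighbourhoods of zero are defined by units of the value group of the restricted valuation; this
translates such a radius into some `exp (-n)`. -/
theorem exp_lt_of_restrict_lt (γ : (MonoidWithZeroHom.ValueGroup₀ (.ofClass
    (Valued.v : Valuation (Completion A) (WithZero (Multiplicative ℤ)))))ˣ) :
    ∃ n : ℕ, ∀ x : Completion A, Valued.v x ≤ WithZero.exp (-(n : ℤ)) →
      (Valued.v : Valuation (Completion A) (WithZero (Multiplicative ℤ))).restrict x < γ.1 := by
  have h0 : MonoidWithZeroHom.ValueGroup₀.embedding γ.1 ≠ 0 :=
    (map_ne_zero _).2 γ.ne_zero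
  set z := MonoidWithZeroHom.ValueGroup₀.embedding γ.1 with hz
  refine ⟨(1 - WithZero.log z).toNat, fun x hx => ?_⟩
  rw [Valuation.restrict_lt_iff_lt_embedding]
  refine hx.trans_lt ?_
  rw [← hz]
  refine lt_of_lt_of_eq ?_ (WithZero.exp_log h0)
  rw [WithZero.exp_lt_exp]
  have := Int.self_le_toNat (1 - WithZero.log z)
  lia

theorem mem_nhds_zero_of_valued_le {s : Set (Completion A)} :
    s ∈ 𝓝 0 ↔ ∃ n : ℕ, ∀ x : Completion A, Valued.v x ≤ WithZero.exp (-(n : ℤ)) → x ∈ s := by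
  rw [Valued.mem_nhds_zero]
  constructor
  · rintro ⟨γ, hγ⟩
    obtain ⟨n, hn⟩ := exp_lt_of_restrict_lt A γ
    exact ⟨n, fun x hx => hγ (hn x hx)⟩
  · rintro ⟨n, hn⟩
    obtain ⟨y, hy⟩ := IsDedekindDomain.HeightOneSpectrum.valuedAdicCompletion_surjective K
      (IsDiscreteValuationRing.maximalIdeal A) (WithZero.exp (-(n : ℤ)))
    have hy0 : (Valued.v : Valuation (Completion A) (WithZero (Multiplicative ℤ))).restrict y ≠ 0 :=
      by
        rw [Valuation.ne_zero_iff]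
        rintro rfl
        rw [map_zero] at hy
        exact WithZero.exp_ne_zero hy.symm
    refine ⟨Units.mk0 _ hy0, fun x hx => hn x ?_⟩
    have h1 := (Valuation.restrict_lt_iff _).1 hx
    rw [← hy]
    exact h1.le

theorem normAbs_tendsto : Tendsto (normAbs A) (𝓝 0) (𝓝 0) := by
  rw [Metric.tendsto_nhds]
  intro ε hε
  have hq := one_lt_card_residueField A
  obtain ⟨n, hn⟩ := exists_pow_lt_of_lt_one (NNReal.coe_pos.2 (show 0 < (⟨ε, hε.le⟩ : NNReal) from hε))
    (NNReal.coe_lt_coe.2 (inv_lt_one_of_one_lt₀ hq))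
  refine (mem_nhds_zero_of_valued_le A).2 ⟨n, fun x hx => ?_⟩
  change dist (normAbs A x) 0 < ε
  rw [Real.dist_0_eq_abs, ← normAbsHom_apply, abs_of_nonneg ((normAbsHom A).nonneg x), normAbsHom_apply,
    normAbs_eq_toNNReal]
  refine lt_of_le_of_lt (NNReal.coe_le_coe.2
    ((WithZeroMulInt.toNNReal_strictMono hq).monotone hx)) (lt_of_eq_of_lt ?_ hn)
  rw [WithZeroMulInt.toNNReal_neg_apply _ WithZero.exp_ne_zero]
  rw [show (WithZero.unzero (WithZero.exp_ne_zero (a := -(n : ℤ)))).toAdd = -(n : ℤ) from rfl,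
    zpow_neg, zpow_natCast]
  push_cast
  rw [inv_pow]

theorem continuous_normAbsHom : Continuous (normAbsHom A) := by
  rw [continuous_iff_continuousAt]
  intro f
  have h1 : Tendsto (fun g => normAbsHom A (g - f)) (𝓝 f) (𝓝 0) := by
    have h2 : Tendsto (fun g : Completion A => g - f) (𝓝 f) (𝓝 0) := by
      have := (continuous_id.sub (continuous_const (y := f))).tendsto f
      rwa [Pi.sub_apply, id, sub_self] at this
    exact (normAbs_tendsto A).comp h2
  refine tendsto_iff_norm_sub_tendsto_zero.2
    (squeeze_zero (fun _ => norm_nonneg _) (fun g => ?_) h1)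
  exact (normAbsHom A).abs_abv_sub_le_abv_sub g f

/-- `K` is dense in its completion, and an element of `K` that is integral there lies in `A`; so
lifts of the finitely many residue classes suffice. -/
theorem exists_sub_valued_lt_one :
    ∃ S : Set (Completion A), S.Finite ∧ ∀ x : Completion A, Valued.v x ≤ 1 →
      ∃ y ∈ S, Valued.v (x - y) < 1 := by
  classical
  let g : IsLocalRing.ResidueField A → Completion A := fun r =>
    algebraMap K (Completion A) (Function.surjInv (IsLocalRing.residue_surjective (R := A)) r : A)
  refine ⟨Set.range g, Set.finite_range g, fun x hx => ?_⟩
  have hopen : {y : Completion A | Valued.v (x - y) < 1} ∈ 𝓝 x := by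
    have h1 : {z : Completion A | Valued.v z < 1} ∈ 𝓝 0 := by
      refine (mem_nhds_zero_of_valued_le A).2 ⟨1, fun z hz => hz.trans_lt ?_⟩
      rw [← WithZero.exp_zero, WithZero.exp_lt_exp]
      norm_num
    have h2 : Tendsto (fun y : Completion A => x - y) (𝓝 x) (𝓝 0) := by
      have := ((continuous_const (y := x)).sub continuous_id).tendsto x
      rwa [Pi.sub_apply, id, sub_self] at this
    exact h2 h1
  obtain ⟨_, hy, ⟨a, rfl⟩⟩ := mem_closure_iff_nhds.1
    ((IsDedekindDomain.HeightOneSpectrum.denseRange_algebraMap K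
      (IsDiscreteValuationRing.maximalIdeal A)) x) _ hopen
  have hy' : Valued.v (x - algebraMap K (Completion A) a) < 1 := hy
  have ha : a ∈ A := by
    rw [← valuation_le_one_iff_mem,
      ← IsDedekindDomain.HeightOneSpectrum.valuedAdicCompletion_eq_valuation']
    have h3 := Valuation.map_sub_le _ hx hy'.le
    rwa [sub_sub_cancel] at h3
  refine ⟨g (IsLocalRing.residue A ⟨a, ha⟩), ⟨_, rfl⟩, ?_⟩
  have h4 : Valued.v (algebraMap K (Completion A) a - g (IsLocalRing.residue A ⟨a, ha⟩)) < 1 := by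
    change Valued.v (algebraMap K (Completion A) a - algebraMap K (Completion A) _) < 1
    rw [← map_sub]
    refine lt_of_eq_of_lt
      (IsDedekindDomain.HeightOneSpectrum.valuedAdicCompletion_eq_valuation'
        (v := IsDiscreteValuationRing.maximalIdeal A) _) ?_
    set b : A := Function.surjInv (IsLocalRing.residue_surjective (R := A))
      (IsLocalRing.residue A ⟨a, ha⟩) with hb
    have h5 : IsLocalRing.residue A b = IsLocalRing.residue A ⟨a, ha⟩ :=
      Function.surjInv_eq IsLocalRing.residue_surjective _
    refine ((IsDiscreteValuationRing.maximalIdeal A).valuation_lt_one_iff_mem (K := K)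
      (⟨a, ha⟩ - b)).2 ?_
    change _ ∈ IsLocalRing.maximalIdeal A
    rw [← Ideal.Quotient.eq]
    exact h5.symm
  have h6 := Valuation.map_add_lt _ hy' h4
  rwa [sub_add_sub_cancel] at h6

/-- Expansion digit by digit: the remainder after `n` digits is an element `π` of value `exp (-n)`
times an integral element, whose residue class supplies the next digit. -/
theorem exists_sub_valued_le_exp (n : ℕ) :
    ∃ S : Set (Completion A), S.Finite ∧ ∀ x : Completion A, Valued.v x ≤ 1 →
      ∃ y ∈ S, Valued.v (x - y) ≤ WithZero.exp (-(n : ℤ)) := by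
  induction n with
  | zero => exact ⟨{0}, Set.finite_singleton 0, fun x hx => ⟨0, rfl, by simpa using hx⟩⟩
  | succ n ih =>
    obtain ⟨S, hS, h⟩ := ih
    obtain ⟨S', hS', h'⟩ := exists_sub_valued_lt_one A
    obtain ⟨π, hπ⟩ := IsDedekindDomain.HeightOneSpectrum.valuedAdicCompletion_surjective K
      (IsDiscreteValuationRing.maximalIdeal A) (WithZero.exp (-(n : ℤ)))
    have hπ0 : π ≠ 0 := by
      rintro rfl
      rw [map_zero] at hπ
      exact WithZero.exp_ne_zero hπ.symm
    refine ⟨Set.image2 (fun a b => a + π * b) S S', hS.image2 _ hS', fun x hx => ?_⟩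
    obtain ⟨y, hy, hxy⟩ := h x hx
    obtain ⟨z, hz, hxz⟩ := h' (π⁻¹ * (x - y)) (by
      rw [map_mul, map_inv₀, hπ]
      exact inv_mul_le_one_of_le₀ hxy zero_le')
    refine ⟨_, ⟨y, hy, z, hz, rfl⟩, ?_⟩
    have h1 : x - (y + π * z) = π * (π⁻¹ * (x - y) - z) := by
      rw [mul_sub, mul_inv_cancel_left₀ hπ0]
      ring
    change Valued.v (x - (y + π * z)) ≤ _
    rw [h1, map_mul, hπ]
    have h2 : Valued.v (π⁻¹ * (x - y) - z) ≤ WithZero.exp (-1 : ℤ) := by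
      generalize Valued.v (π⁻¹ * (x - y) - z) = w at hxz
      rcases eq_or_ne w 0 with rfl | hw
      · exact zero_le'
      · rw [← WithZero.exp_log hw, WithZero.exp_le_exp]
        rw [← WithZero.exp_log hw, ← WithZero.exp_zero, WithZero.exp_lt_exp] at hxz
        lia
    refine (mul_le_mul_right h2 _).trans ?_
    rw [← WithZero.exp_add, WithZero.exp_le_exp]
    push_cast
    lia

/-- Finite sets of digits give total boundedness, and a closed subset of the completion is complete.
-/
theorem isCompact_normAbsHom_le_one : IsCompact {f : Completion A | normAbsHom A f ≤ 1} := by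
  rw [isCompact_iff_totallyBounded_isComplete]
  constructor
  · rw [totallyBounded_iff_subset_finite_iUnion_nhds_zero]
    intro U hU
    obtain ⟨n, hn⟩ := (mem_nhds_zero_of_valued_le A).1 hU
    obtain ⟨S, hS, h⟩ := exists_sub_valued_le_exp A n
    refine ⟨S, hS, fun x hx => ?_⟩
    obtain ⟨y, hy, hxy⟩ := h x ((normAbs_le_one_iff A x).1 hx)
    exact Set.mem_iUnion₂.2 ⟨y, hy, x - y, hn _ hxy, add_sub_cancel y x⟩
  · exact (isClosed_le (continuous_normAbsHom A) continuous_const).isComplete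

end NormAbs

end TraceFormula

namespace TraceFormula

/-! ### Valuation rings of function fields of curves -/

section ValuationRings

variable {K : Type*} [Field K]

theorem mem_valuationSubring_of_isIntegralElem (B : ValuationSubring K) {S : Type*} [CommRing S]
    (φ : S →+* K) (hφ : ∀ s, φ s ∈ B) {x : K} (hx : φ.IsIntegralElem x) : x ∈ B := by
  obtain ⟨p, hp, hpx⟩ := hx
  have h1 : IsIntegral B x := by
    refine ⟨p.map (φ.codRestrict B.toSubring hφ), hp.map _, ?_⟩
    rw [Polynomial.eval₂_map]
    exact hpx
  obtain ⟨y, rfl⟩ := IsIntegrallyClosed.isIntegral_iff.1 h1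
  exact y.2

variable {k : Type*} [Field k] [Finite k]

/-- A nonzero element of a finite field is a root of unity, hence a power of its own inverse. -/
theorem map_mem_valuationSubring (B : ValuationSubring K) (ψ : k →+* K) (c : k) : ψ c ∈ B := by
  rcases B.mem_or_inv_mem (ψ c) with h | h
  · exact h
  · rcases eq_or_ne c 0 with rfl | hc
    · rw [map_zero]
      exact B.zero_mem
    · obtain ⟨n, hn, h1⟩ := isOfFinOrder_iff_pow_eq_one.1 (isOfFinOrder_of_finite (Units.mk0 c hc))
      have h2 : c ^ n = 1 := by
        have := congrArg Units.val h1
        simpa using this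
      have h3 : ψ c = (ψ c)⁻¹ ^ (n - 1) := by
        have h4 : (c⁻¹) ^ (n - 1) = c := by
          have h5 : c⁻¹ ^ (n - 1) * c ^ (n - 1) = c * c ^ (n - 1) := by
            rw [← mul_pow, inv_mul_cancel₀ hc, one_pow, ← pow_succ', Nat.sub_add_cancel hn, h2]
          exact mul_right_cancel₀ (pow_ne_zero _ hc) h5
        rw [← map_inv₀, ← map_pow, h4]
      rw [h3]
      exact pow_mem h _

theorem polynomial_map_mem (B : ValuationSubring K) (φ : Polynomial k →+* K)
    (hX : φ Polynomial.X ∈ B) (p : Polynomial k) : φ p ∈ B := by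
  induction p using Polynomial.induction_on with
  | C a => exact map_mem_valuationSubring B (φ.comp Polynomial.C) a
  | add p q hp hq =>
    rw [map_add]
    exact B.add_mem _ _ hp hq
  | monomial n a _ =>
    rw [map_mul, map_pow]
    exact B.mul_mem _ _ (map_mem_valuationSubring B (φ.comp Polynomial.C) a) (pow_mem hX _)

/-- As `y` is transcendental, `y⁻¹` generates a proper ideal of `k[y⁻¹]`. Some valuation ring has
this ideal among its nonunits, so it cannot contain `y`. -/
theorem exists_valuationSubring_notMem (ψ : k →+* K) {y : K} (hy0 : y ≠ 0)
    (hy : ∀ p : Polynomial k, p.eval₂ ψ y = 0 → p = 0) : ∃ B : ValuationSubring K, y ∉ B := by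
  set g : Polynomial k →+* K := Polynomial.eval₂RingHom ψ y⁻¹ with hg
  have hX : g Polynomial.X = y⁻¹ := Polynomial.eval₂_X _ _
  set I : Ideal g.range := Ideal.span {⟨y⁻¹, Polynomial.X, hX⟩} with hI
  have hI1 : I ≠ ⊤ := by
    intro h
    obtain ⟨⟨_, ⟨p, rfl⟩⟩, h1⟩ := Ideal.mem_span_singleton.1
      ((Ideal.eq_top_iff_one _).1 h)
    have h2 : 1 = y⁻¹ * g p := congrArg Subtype.val h1
    have h3 : y = p.eval₂ ψ y⁻¹ := by
      rw [eq_inv_mul_iff_mul_eq₀ hy0, mul_one] at h2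
      exact h2
    let : Invertible y := invertibleOfNonzero hy0
    let : Invertible y⁻¹ := invertibleOfNonzero (inv_ne_zero hy0)
    have h4 := Polynomial.eval₂_reverse_mul_pow ψ y⁻¹ p
    rw [invOf_eq_inv, inv_inv, ← h3, inv_pow, mul_inv_eq_iff_eq_mul₀ (pow_ne_zero _ hy0),
      ← pow_succ'] at h4
    -- From `y = p(y⁻¹)` one gets `y^(d+1) = p.reverse(y)`, where `d` is the degree of `p`. This
    -- relation is nontrivial because `p.reverse` has degree at most `d`.
    have h5 := hy (Polynomial.X ^ (p.natDegree + 1) - p.reverse) (by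
      rw [Polynomial.eval₂_sub, Polynomial.eval₂_X_pow, h4, sub_self])
    have h6 := congrArg (fun q => Polynomial.coeff q (p.natDegree + 1)) h5
    simp only [Polynomial.coeff_sub, Polynomial.coeff_X_pow, if_true, Polynomial.coeff_zero] at h6
    rw [Polynomial.coeff_eq_zero_of_natDegree_lt
      (lt_of_le_of_lt (Polynomial.reverse_natDegree_le p) (Nat.lt_succ_self _)), sub_zero] at h6
    exact one_ne_zero h6
  obtain ⟨B, -, hB⟩ := Ideal.image_subset_nonunits_valuationSubring I hI1
  refine ⟨B, fun h => ?_⟩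
  have h1 : y⁻¹ ∈ B.nonunits := hB ⟨_, Ideal.subset_span rfl, rfl⟩
  rw [B.mem_nonunits_iff, map_inv₀, inv_lt_one₀] at h1
  · exact absurd ((B.valuation_le_one_iff _).2 h) (not_le.2 h1)
  · rw [zero_lt_iff]
    exact (Valuation.ne_zero_iff _).2 hy0

theorem inv_mem_valuationSubring_of_eval₂_eq_zero (B : ValuationSubring K) (ψ : k →+* K) {y : K}
    {p : Polynomial k} (hp : p ≠ 0) (hy : p.eval₂ ψ y = 0) : y⁻¹ ∈ B := by
  let : Algebra k K := ψ.toAlgebra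
  have h1 : IsAlgebraic k y := ⟨p, hp, hy⟩
  have h2 : IsIntegral k y⁻¹ := h1.inv.isIntegral
  exact mem_valuationSubring_of_isIntegralElem B ψ (map_mem_valuationSubring B ψ) h2

/-- The expansion at infinity: `p X^(-d)` is the coefficient of degree `d` plus `X⁻¹` times a
polynomial in `X⁻¹`. -/
theorem exists_map_mul_inv_pow_eq (B : ValuationSubring K) (φ : Polynomial k →+* K)
    (h0 : φ Polynomial.X ≠ 0) (hX : (φ Polynomial.X)⁻¹ ∈ B) (d : ℕ) (p : Polynomial k)
    (hp : p.natDegree ≤ d) :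
    ∃ b ∈ B, φ p * (φ Polynomial.X)⁻¹ ^ d =
      φ (Polynomial.C (p.coeff d)) + (φ Polynomial.X)⁻¹ * b := by
  set u := (φ Polynomial.X)⁻¹ with hu
  refine ⟨∑ i ∈ Finset.range d, φ (Polynomial.C (p.coeff i)) * u ^ (d - 1 - i),
    B.toSubring.sum_mem fun i _ => B.mul_mem _ _
      (map_mem_valuationSubring B (φ.comp Polynomial.C) _) (pow_mem hX _), ?_⟩
  have h1 := p.as_sum_range' (d + 1) (Nat.lt_succ_of_le hp)
  have h2 : ∀ i ≤ d, φ (Polynomial.monomial i (p.coeff i)) * u ^ d =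
      φ (Polynomial.C (p.coeff i)) * u ^ (d - i) := by
    intro i hi
    rw [← Polynomial.C_mul_X_pow_eq_monomial, map_mul, map_pow, mul_assoc]
    congr 1
    have h3 : u ^ d = u ^ i * u ^ (d - i) := by rw [← pow_add, Nat.add_sub_cancel' hi]
    rw [h3, ← mul_assoc, ← mul_pow, hu, mul_inv_cancel₀ h0, one_pow, one_mul]
  rw [Finset.mul_sum]
  conv_lhs => rw [h1]
  rw [map_sum, Finset.sum_mul, Finset.sum_range_succ, h2 d le_rfl, Nat.sub_self, pow_zero, mul_one,
    add_comm]
  congr 1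
  refine Finset.sum_congr rfl fun i hi => ?_
  have hi' := Finset.mem_range.1 hi
  rw [h2 i hi'.le, mul_left_comm, ← pow_succ']
  congr 2
  lia

end ValuationRings

/-! ### Places of the fraction field that do not contain `R`. -/

section Curves

variable {k : Type*} [Field k] [Finite k] {R : Type*} [CommRing R] [IsDomain R]
  [Algebra (Polynomial k) R] [Module.Finite (Polynomial k) R]
  {K : Type*} [Field K] [Algebra R K] [IsFractionRing R K]

variable (k R K) in
/-- The homomorphism from the polynomial ring to the fraction field. -/
def polyToField : Polynomial k →+* K := (algebraMap R K).comp (algebraMap (Polynomial k) R)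

omit [Finite k] [IsDomain R] [Module.Finite (Polynomial k) R] in
theorem polyToField_injective (hinj : Function.Injective (algebraMap (Polynomial k) R)) :
    Function.Injective (polyToField k R K) :=
  (IsFractionRing.injective R K).comp hinj

omit [IsFractionRing R K] [IsDomain R] in
-- Otherwise `B` would contain `k[X]`, and with it `R`, which is integral over `k[X]`.
theorem polyToField_X_notMem (B : ValuationSubring K) (hB : ∃ r : R, algebraMap R K r ∉ B) :
    polyToField k R K Polynomial.X ∉ B := by
  intro h
  obtain ⟨r, hr⟩ := hB
  refine hr (mem_valuationSubring_of_isIntegralElem B (polyToField k R K)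
    (polynomial_map_mem B _ h) ?_)
  obtain ⟨p, hp, hpr⟩ := Algebra.IsIntegral.isIntegral (R := Polynomial k) r
  refine ⟨p, hp, ?_⟩
  rw [polyToField, ← Polynomial.hom_eval₂, hpr, map_zero]

omit [Finite k] in
-- Clearing denominators moves an independent family into `R`, of finite rank over `k[X]`.
theorem card_le_finrank_of_independent {ι : Type*} [Fintype ι] (v : ι → K)
    (hv : ∀ c : ι → Polynomial k, ∑ i, polyToField k R K (c i) * v i = 0 → c = 0) :
    Fintype.card ι ≤ Module.finrank (Polynomial k) R := by
  obtain ⟨b, hb⟩ := IsLocalization.exist_integer_multiples_of_finite (nonZeroDivisors R) v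
  choose w hw using hb
  have h1 : LinearIndependent (Polynomial k) w := by
    rw [Fintype.linearIndependent_iff]
    intro c hc i
    refine congrFun (hv c ?_) i
    have hb0 : algebraMap R K b ≠ 0 :=
      (map_ne_zero_iff _ (IsFractionRing.injective R K)).2 (nonZeroDivisors.coe_ne_zero b)
    refine (mul_eq_zero.1 ?_).resolve_left hb0
    have h2 := congrArg (algebraMap R K) hc
    rw [map_zero, map_sum] at h2
    rw [← h2, Finset.mul_sum]
    refine Finset.sum_congr rfl fun i _ => ?_
    rw [Algebra.smul_def, map_mul, hw, Algebra.smul_def, mul_left_comm]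
    rfl
  exact h1.fintype_card_le_finrank

/-- A family of elements which is independent in leading terms is independent. -/
theorem independent_of_leading {ι : Type*} [Fintype ι] (v : ι → K)
    (hinj : Function.Injective (algebraMap (Polynomial k) R))
    (hv : ∀ (a : ι → k) (i : ι), a i ≠ 0 → ∃ B : ValuationSubring K,
      (∃ r : R, algebraMap R K r ∉ B) ∧ ∀ b : ι → K, (∀ i, b i ∈ B) →
        ∑ i, (polyToField k R K (Polynomial.C (a i)) +
          (polyToField k R K Polynomial.X)⁻¹ * b i) * v i ≠ 0)
    (c : ι → Polynomial k) (hc : ∑ i, polyToField k R K (c i) * v i = 0) : c = 0 := by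
  classical
  by_contra hne
  obtain ⟨j, hj⟩ := Function.ne_iff.1 hne
  have hX0 : polyToField k R K Polynomial.X ≠ 0 :=
    (map_ne_zero_iff _ (polyToField_injective hinj)).2 Polynomial.X_ne_zero
  -- Dividing a relation by `X^d`, with `d` the maximal degree, turns each coefficient into a
  -- constant plus `X⁻¹` times an element of `B`; the constant at `i` is nonzero.
  obtain ⟨i, hi, hmax⟩ := Finset.exists_max_image (Finset.univ.filter fun i => c i ≠ 0)
    (fun i => (c i).natDegree) ⟨j, Finset.mem_filter.2 ⟨Finset.mem_univ _, hj⟩⟩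
  have hdeg : ∀ l, (c l).natDegree ≤ (c i).natDegree := by
    intro l
    by_cases hl : c l = 0
    · rw [hl, Polynomial.natDegree_zero]
      exact Nat.zero_le _
    · exact hmax l (Finset.mem_filter.2 ⟨Finset.mem_univ _, hl⟩)
  set d := (c i).natDegree with hd
  obtain ⟨B, hB, h⟩ := hv (fun l => (c l).coeff d) i
    (Polynomial.leadingCoeff_ne_zero.2 (Finset.mem_filter.1 hi).2)
  have hu : (polyToField k R K Polynomial.X)⁻¹ ∈ B :=
    (B.mem_or_inv_mem _).resolve_left (polyToField_X_notMem B hB)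
  choose b hbB hb using fun l => exists_map_mul_inv_pow_eq B (polyToField k R K) hX0 hu d (c l)
    (hdeg l)
  refine h b hbB ?_
  simp_rw [← hb, mul_right_comm _ (_ ^ d) _]
  rw [← Finset.sum_mul, hc, zero_mul]

/-- `X⁻¹` reduces to zero, so lifts of residue classes independent over `k` are independent over
`k[X]`. The degree of the residue field is therefore at most the rank of `R`. -/
theorem finite_residueField_of_notMem
    (hinj : Function.Injective (algebraMap (Polynomial k) R)) (B : ValuationSubring K)
    (hB : ∃ r : R, algebraMap R K r ∉ B) : Finite (IsLocalRing.ResidueField B) := by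
  set ψ : k →+* B := ((polyToField k R K).comp Polynomial.C).codRestrict B.toSubring
    (map_mem_valuationSubring B _) with hψ
  let : Algebra k (IsLocalRing.ResidueField B) := ((IsLocalRing.residue B).comp ψ).toAlgebra
  suffices h : Module.Finite k (IsLocalRing.ResidueField B) from Module.finite_of_finite k
  rw [← Module.rank_lt_aleph0_iff]
  refine lt_of_not_ge fun hge => ?_
  have h1 : ((Module.finrank (Polynomial k) R + 1 : ℕ) : Cardinal) ≤
      Module.rank k (IsLocalRing.ResidueField B) :=
    (Cardinal.natCast_lt_aleph0.le).trans hge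
  obtain ⟨s, hs, hli⟩ := le_rank_iff_exists_linearIndependent_finset.1 h1
  choose g hg using IsLocalRing.residue_surjective (R := B)
  have h2 : Fintype.card s ≤ Module.finrank (Polynomial k) R := by
    refine card_le_finrank_of_independent (fun x : s => ((g x.1 : B) : K))
      (independent_of_leading _ hinj fun a i hai => ⟨B, hB, fun b hb h3 => hai ?_⟩)
    have hX : polyToField k R K Polynomial.X ∉ B := polyToField_X_notMem B hB
    have hu : (polyToField k R K Polynomial.X)⁻¹ ∈ B := (B.mem_or_inv_mem _).resolve_left hX
    have h4 : (∑ x : s, (ψ (a x) + ⟨_, hu⟩ * ⟨b x, hb x⟩) * g x.1 : B) = 0 := by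
      refine Subtype.ext ?_
      exact (map_sum B.subtype _ _).trans h3
    have hres : IsLocalRing.residue B ⟨_, hu⟩ = 0 := by
      rw [IsLocalRing.residue_eq_zero_iff, B.valuation_lt_one_iff]
      change B.valuation (polyToField k R K Polynomial.X)⁻¹ < 1
      rw [← B.valuation_le_one_iff, not_le] at hX
      rw [map_inv₀]
      exact inv_lt_one_of_one_lt₀ hX
    have h5 := congrArg (IsLocalRing.residue B) h4
    rw [map_zero, map_sum] at h5
    refine Fintype.linearIndependent_iff.1 hli a ?_ i
    rw [← h5]
    refine Finset.sum_congr rfl fun x _ => ?_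
    rw [map_mul, map_add, map_mul, hres, zero_mul, add_zero, hg]
    rfl
  rw [Fintype.card_coe, hs] at h2
  lia

/-! ### The absolute value of a place on the field itself. -/

section Places

variable {F : Type*} [Field F] (A : ValuationSubring F) [IsDiscreteValuationRing A]
  [Finite (IsLocalRing.ResidueField A)]

/-- The normalized absolute value on the field itself. -/
def placeAbs : AbsoluteValue F ℝ :=
  (normAbsHom A).comp (f := algebraMap F (Completion A)) (RingHom.injective _)

theorem placeAbs_apply (x : F) : placeAbs A x = normAbs A (algebraMap F (Completion A) x) := rfl

theorem placeAbs_le_one_iff (x : F) : placeAbs A x ≤ 1 ↔ x ∈ A := by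
  rw [placeAbs_apply, normAbs_le_one_iff, ← valuation_le_one_iff_mem,
    ← IsDedekindDomain.HeightOneSpectrum.valuedAdicCompletion_eq_valuation']
  rfl

theorem placeAbs_add_le (x y : F) :
    placeAbs A (x + y) ≤ max (placeAbs A x) (placeAbs A y) := by
  have h := normAbsHom_add_le A (algebraMap F (Completion A) x) (algebraMap F (Completion A) y)
  rwa [← map_add] at h

theorem one_lt_placeAbs_iff (x : F) : 1 < placeAbs A x ↔ x ∉ A := by
  rw [← placeAbs_le_one_iff, not_le]

theorem placeAbs_sum_le {ι : Type*} (s : Finset ι) (g : ι → F) {C : ℝ} (hC : 0 ≤ C)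
    (h : ∀ i ∈ s, placeAbs A (g i) ≤ C) : placeAbs A (∑ i ∈ s, g i) ≤ C := by
  classical
  induction s using Finset.induction_on with
  | empty => simpa using hC
  | insert i s hi ih =>
    rw [Finset.sum_insert hi]
    exact (placeAbs_add_le A _ _).trans (max_le (h i (Finset.mem_insert_self _ _))
      (ih fun j hj => h j (Finset.mem_insert_of_mem hj)))

theorem placeAbs_add_eq_one {x y : F} (hx : placeAbs A x = 1) (hy : placeAbs A y < 1) :
    placeAbs A (x + y) = 1 := by
  refine le_antisymm ((placeAbs_add_le A x y).trans (max_le hx.le hy.le)) ?_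
  by_contra h
  have h1 := placeAbs_add_le A (x + y) (-y)
  rw [add_neg_cancel_right, hx, AbsoluteValue.map_neg] at h1
  exact absurd h1 (not_le.2 (max_lt (not_le.1 h) hy))

omit [Field F] A [IsDiscreteValuationRing A] [Finite (IsLocalRing.ResidueField A)] in
-- The valuation ring is the unit ball of its absolute value, which equivalent absolute values
-- share.
theorem not_isEquiv_placeAbs [Field F] (A B : ValuationSubring F) [IsDiscreteValuationRing A]
    [Finite (IsLocalRing.ResidueField A)] [IsDiscreteValuationRing B]
    [Finite (IsLocalRing.ResidueField B)] (h : A ≠ B) :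
    ¬ (placeAbs A).IsEquiv (placeAbs B) := by
  intro he
  refine h (SetLike.ext fun x => ?_)
  rw [← placeAbs_le_one_iff, ← placeAbs_le_one_iff]
  simpa using he x 1

end Places

theorem isNontrivial_placeAbs (A : ValuationSubring K) [IsDiscreteValuationRing A]
    [Finite (IsLocalRing.ResidueField A)] (hA : ∃ r : R, algebraMap R K r ∉ A) :
    (placeAbs A).IsNontrivial := by
  obtain ⟨r, hr⟩ := hA
  refine ⟨algebraMap R K r, ?_, ?_⟩
  · intro h
    rw [h] at hr
    exact hr A.zero_mem
  · exact ((one_lt_placeAbs_iff A _).2 hr).ne'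

theorem placeAbs_map_eq_one (A : ValuationSubring K) [IsDiscreteValuationRing A]
    [Finite (IsLocalRing.ResidueField A)] (ψ : k →+* K) {c : k} (hc : c ≠ 0) :
    placeAbs A (ψ c) = 1 := by
  refine le_antisymm ((placeAbs_le_one_iff A _).2 (map_mem_valuationSubring A ψ c)) ?_
  have h1 := (placeAbs_le_one_iff A _).2 (map_mem_valuationSubring A ψ c⁻¹)
  rw [map_inv₀, map_inv₀] at h1
  exact (inv_le_one₀ ((placeAbs A).pos ((map_ne_zero ψ).2 hc))).1 h1

/-- For inequivalent absolute values there are functions large at one place and small at the others.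
The dominant term makes such functions independent over `k[X]`, so there cannot be more places than
the rank of `R`. -/
theorem finite_of_injective_places (hinj : Function.Injective (algebraMap (Polynomial k) R))
    {P : Type*} (A : P → ValuationSubring K) [∀ p, IsDiscreteValuationRing (A p)]
    (hA : Function.Injective A) (hR : ∀ p, ∃ r : R, algebraMap R K r ∉ A p) : Finite P := by
  have hfin := fun p => finite_residueField_of_notMem (k := k) hinj (A p) (hR p)
  by_contra hinf
  rw [not_finite_iff_infinite] at hinf
  set n := Module.finrank (Polynomial k) R
  let e : Fin (n + 1) → P := fun i => Infinite.natEmbedding P i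
  have he : Function.Injective e := (Infinite.natEmbedding P).injective.comp Fin.val_injective
  have h0 := AbsoluteValue.exists_one_lt_lt_one_pi_of_not_isEquiv
    (v := fun i : Fin (n + 1) => placeAbs (A (e i)))
    (fun i => isNontrivial_placeAbs (A (e i)) (hR (e i)))
    (fun i j hij => not_isEquiv_placeAbs _ _ fun h => hij (he (hA h)))
  choose h h1 h2 using h0
  have h3 : Fintype.card (Fin (n + 1)) ≤ n := by
    refine card_le_finrank_of_independent (k := k) (R := R) h (independent_of_leading _ hinj
      fun a i hai => ⟨A (e i), hR (e i), fun b hb hsum => ?_⟩)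
    have hX : polyToField k R K Polynomial.X ∉ A (e i) := polyToField_X_notMem _ (hR (e i))
    have hu : placeAbs (A (e i)) (polyToField k R K Polynomial.X)⁻¹ < 1 := by
      rw [map_inv₀]
      exact inv_lt_one_of_one_lt₀ ((one_lt_placeAbs_iff _ _).2 hX)
    have hub : ∀ l, placeAbs (A (e i)) ((polyToField k R K Polynomial.X)⁻¹ * b l) < 1 := by
      intro l
      rw [map_mul]
      exact mul_lt_one_of_nonneg_of_lt_one_left ((placeAbs _).nonneg _) hu
        ((placeAbs_le_one_iff _ _).2 (hb l))
    rw [← Finset.add_sum_erase _ _ (Finset.mem_univ i), add_eq_zero_iff_eq_neg] at hsum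
    have h4 := congrArg (placeAbs (A (e i))) hsum
    have h5 : placeAbs (A (e i)) (polyToField k R K (Polynomial.C (a i))) = 1 :=
      placeAbs_map_eq_one (A (e i)) ((polyToField k R K).comp Polynomial.C) hai
    rw [AbsoluteValue.map_neg, map_mul, placeAbs_add_eq_one _ h5 (hub i), one_mul] at h4
    refine absurd (h1 i) (not_lt.2 (h4.trans_le (placeAbs_sum_le _ _ _ zero_le_one
      fun l hl => ?_)))
    rw [map_mul]
    refine mul_le_one₀ ?_ ((placeAbs _).nonneg _) (h2 l i (Finset.ne_of_mem_erase hl).symm).le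
    exact (placeAbs_add_le _ _ _).trans (max_le ((placeAbs_le_one_iff _ _).2
      (map_mem_valuationSubring _ ((polyToField k R K).comp Polynomial.C) _)) (hub l).le)
  rw [Fintype.card_fin] at h3
  lia

variable {P : Type*} (A : P → ValuationSubring K) [∀ p, IsDiscreteValuationRing (A p)]
  [∀ p, Finite (IsLocalRing.ResidueField (A p))]

/-- `X` is transcendental over `k`, so some valuation ring omits it. -/
theorem nonempty_places (hinj : Function.Injective (algebraMap (Polynomial k) R))
    (hA : ∀ B : ValuationSubring K, (∃ r : R, algebraMap R K r ∉ B) → ∃ p, A p = B) :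
    Nonempty P := by
  have h0 := polyToField_injective (K := K) hinj
  obtain ⟨B, hB⟩ := exists_valuationSubring_notMem ((polyToField k R K).comp Polynomial.C)
    (y := polyToField k R K Polynomial.X) ((map_ne_zero_iff _ h0).2 Polynomial.X_ne_zero)
    (fun p hp => by
      rw [← Polynomial.hom_eval₂, Polynomial.eval₂_C_X] at hp
      exact (map_eq_zero_iff _ h0).1 hp)
  obtain ⟨p, -⟩ := hA B ⟨_, hB⟩
  exact ⟨p⟩

/-- A function with zeros at all places at infinity vanishes. -/
theorem eq_zero_of_placeAbs_lt_one (hinj : Function.Injective (algebraMap (Polynomial k) R))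
    (hA : ∀ B : ValuationSubring K, (∃ r : R, algebraMap R K r ∉ B) → ∃ p, A p = B) (y : R)
    (hy : ∀ p, placeAbs (A p) (algebraMap R K y) < 1) : y = 0 := by
  by_contra hy0
  have hy1 : algebraMap R K y ≠ 0 :=
    (map_ne_zero_iff _ (IsFractionRing.injective R K)).2 hy0
  set ψ := (polyToField k R K).comp Polynomial.C with hψ
  -- A transcendental `y` is omitted by some valuation ring, which is then a place at infinity as `y
  -- ∈ R`. If `y ≠ 0` is algebraic, its inverse is integral at every place.
  by_cases h : ∀ p : Polynomial k, p.eval₂ ψ (algebraMap R K y) = 0 → p = 0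
  · obtain ⟨B, hB⟩ := exists_valuationSubring_notMem ψ hy1 h
    obtain ⟨p, hp⟩ := hA B ⟨_, hB⟩
    rw [← hp] at hB
    exact absurd (hy p) (not_lt.2 ((one_lt_placeAbs_iff _ _).2 hB).le)
  · push Not at h
    obtain ⟨q, hq, hq0⟩ := h
    obtain ⟨p⟩ := nonempty_places A hinj hA
    have h1 := (placeAbs_le_one_iff (A p) _).2
      (inv_mem_valuationSubring_of_eval₂_eq_zero (A p) ψ hq0 hq)
    rw [map_inv₀, inv_le_one₀ ((placeAbs (A p)).pos hy1)] at h1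
    exact absurd (hy p) (not_lt.2 h1)

end Curves

end TraceFormula

namespace TraceFormula

open Filter Topology

/-! ### The completions at infinity -/

section Completions

variable {K : Type*} [Field K] {P : Type*} (A : P → ValuationSubring K)
  [∀ p, IsDiscreteValuationRing (A p)] [∀ p, Finite (IsLocalRing.ResidueField (A p))]
  {B : Type*} [CommRing B] (e : B ≃+* ∀ p, Completion (A p))

/-- The product of the completions at a family of places. -/
def completionFields : LocalFields B P fun p => Completion (A p) where
  ev := e
  a p := normAbsHom (A p)
  ultra p := normAbsHom_add_le (A p)
  cont p := continuous_normAbsHom (A p)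
  cpt p := isCompact_normAbsHom_le_one (A p)

theorem completionFields_absAt (p : P) (g : B) :
    (completionFields A e).absAt p g = normAbs (A p) (e g p) := rfl

variable {R : Type*} [CommRing R] [Algebra R K] [Algebra R B]
  (he : ∀ r p, e (algebraMap R B r) p = algebraMap K (Completion (A p)) (algebraMap R K r))

include he in
theorem absAt_algebraMap_eq (p : P) (r : R) :
    (completionFields A e).absAt p (algebraMap R B r) = placeAbs (A p) (algebraMap R K r) := by
  rw [completionFields_absAt, he, placeAbs_apply]

include he in
theorem isUnit_algebraMap_of_ne_zero {r : R} (hr : algebraMap R K r ≠ 0) :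
    IsUnit (algebraMap R B r) := by
  rw [← MulEquiv.isUnit_map e.toMulEquiv, Pi.isUnit_iff]
  intro p
  change IsUnit (e (algebraMap R B r) p)
  rw [he]
  exact (IsUnit.mk0 _ hr).map _

include he in
theorem ev_zpow_neg_mul (T : Bˣ) {t : R} (hT : (T : B) = algebraMap R B t)
    (n : ℕ) (r : R) (p : P) :
    e (((T ^ (-(n : ℤ)) : Bˣ) : B) * algebraMap R B r) p =
      algebraMap K (Completion (A p)) ((algebraMap R K t)⁻¹ ^ n * algebraMap R K r) := by
  have h1 : e ((T ^ (-(n : ℤ)) : Bˣ) : B) p * e (algebraMap R B t ^ n) p = 1 := by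
    rw [← Pi.mul_apply, ← map_mul, ← hT, ← Units.val_pow_eq_pow_val, ← Units.val_mul, zpow_neg,
      zpow_natCast, inv_mul_cancel, Units.val_one, map_one, Pi.one_apply]
  rw [map_mul, Pi.mul_apply, map_mul, he, eq_inv_of_mul_eq_one_left h1, map_pow, Pi.pow_apply, he,
    ← map_pow, ← map_inv₀, inv_pow]

variable [Finite P]

include he in
/-- A subring in which every element has a component of absolute value at least `1` has finite
intersection with balls. -/
theorem finite_setOf_abs_le
    (hdisc : ∀ r : R, (∀ p, placeAbs (A p) (algebraMap R K r) < 1) → r = 0) {t : R}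
    (ht : ∀ p, 1 < placeAbs (A p) (algebraMap R K t)) (C : ℝ) :
    {y : R | (completionFields A e).abs (algebraMap R B y) ≤ C}.Finite := by
  set a := fun p => normAbsHom (A p) with ha
  let ty : ∀ p, Completion (A p) := fun p => algebraMap K (Completion (A p)) (algebraMap R K t)
  have hty : ∀ p, 1 < a p (ty p) := ht
  -- The ball lies in `t^n` times the product of the closed unit balls. That set is compact, hence
  -- covered by finitely many open balls of radius 1, and by `hdisc` each of these contains the
  -- image of at most one element of `R`.
  obtain ⟨n, hn⟩ : ∃ n : ℕ, ∀ p, C ≤ a p (ty p) ^ n := by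
    have h1 : ∀ p, ∀ᶠ n : ℕ in atTop, C ≤ a p (ty p) ^ n := fun p =>
      (tendsto_pow_atTop_atTop_of_one_lt (hty p)).eventually_ge_atTop C
    exact (eventually_all.2 h1).exists
  have hcpt : IsCompact (Set.univ.pi fun p => (fun x => ty p ^ n * x) '' {x | a p x ≤ 1}) :=
    isCompact_univ_pi fun p => (isCompact_normAbsHom_le_one (A p)).image
      (continuous_const.mul continuous_id)
  have hmem : ∀ y : R, (completionFields A e).abs (algebraMap R B y) ≤ C →
      e (algebraMap R B y) ∈
        Set.univ.pi fun p => (fun x => ty p ^ n * x) '' {x | a p x ≤ 1} := by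
    intro y hy p _
    have h0 : ty p ≠ 0 := (a p).pos_iff.1 (zero_lt_one.trans (hty p))
    refine ⟨(ty p ^ n)⁻¹ * e (algebraMap R B y) p, ?_, mul_inv_cancel_left₀ (pow_ne_zero _ h0) _⟩
    have h1 : a p (e (algebraMap R B y) p) ≤ C :=
      ((completionFields A e).absAt_le_abs p (algebraMap R B y)).trans hy
    change a p _ ≤ 1
    rw [map_mul, map_inv₀, map_pow]
    exact inv_mul_le_one_of_le₀ (h1.trans (hn p)) (pow_nonneg ((a p).nonneg _) _)
  let U : (∀ p, Completion (A p)) → Set (∀ p, Completion (A p)) := fun g =>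
    {h | ∀ p, a p (h p - g p) < 1}
  have hUopen : ∀ g, IsOpen (U g) := fun g => by
    have h1 : U g = ⋂ p, {h | a p (h p - g p) < 1} := by
      ext h
      simp [U]
    rw [h1]
    exact isOpen_iInter_of_finite fun p => isOpen_lt
      ((continuous_normAbsHom (A p)).comp ((continuous_apply p).sub continuous_const))
      continuous_const
  obtain ⟨s, hs⟩ := hcpt.elim_finite_subcover U hUopen fun g _ => Set.mem_iUnion.2
    ⟨g, fun p => by rw [sub_self, AbsoluteValue.map_zero]; exact zero_lt_one⟩
  refine Set.Finite.subset (s.finite_toSet.biUnion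
    (t := fun g => {y : R | e (algebraMap R B y) ∈ U g}) fun g _ => ?_) fun y hy => ?_
  · refine Set.Subsingleton.finite fun y hy y' hy' => ?_
    refine sub_eq_zero.1 (hdisc _ fun p => ?_)
    rw [← absAt_algebraMap_eq A e he, completionFields_absAt, map_sub, map_sub, Pi.sub_apply,
      ← normAbsHom_apply]
    have h1 : e (algebraMap R B y) p - e (algebraMap R B y') p =
        (e (algebraMap R B y) p - g p) + -(e (algebraMap R B y') p - g p) := by ring
    rw [h1]
    refine (normAbsHom_add_le (A p) _ _).trans_lt (max_lt (hy p) ?_)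
    rw [AbsoluteValue.map_neg]
    exact hy' p
  · obtain ⟨g, hg, hy'⟩ := Set.mem_iUnion₂.1 (hs (hmem y hy))
    exact Set.mem_iUnion₂.2 ⟨g, hg, hy'⟩

/-- Simultaneous approximation. -/
theorem exists_placeAbs_sub_lt (hnt : ∀ p, (placeAbs (A p)).IsNontrivial)
    (hA : Function.Injective A) (g : ∀ p, Completion (A p)) {ε : ℝ} (hε : 0 < ε) :
    ∃ x : K, ∀ p, normAbs (A p) (g p - algebraMap K (Completion (A p)) x) < ε := by
  have h1 : ∀ p, ∃ x : K, normAbs (A p) (g p - algebraMap K (Completion (A p)) x) < ε := by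
    intro p
    have hopen : {y : Completion (A p) | normAbs (A p) (g p - y) < ε} ∈ 𝓝 (g p) := by
      have h2 : Continuous fun y : Completion (A p) => normAbsHom (A p) (g p - y) :=
        (continuous_normAbsHom (A p)).comp (continuous_const.sub continuous_id)
      refine (isOpen_lt h2 continuous_const).mem_nhds ?_
      change normAbsHom (A p) (g p - g p) < ε
      rw [sub_self, AbsoluteValue.map_zero]
      exact hε
    obtain ⟨_, hy, ⟨x, rfl⟩⟩ := mem_closure_iff_nhds.1
      ((IsDedekindDomain.HeightOneSpectrum.denseRange_algebraMap K
        (IsDiscreteValuationRing.maximalIdeal (A p))) (g p)) _ hopen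
    exact ⟨x, hy⟩
  choose x hx using h1
  have := Fintype.ofFinite P
  -- Weak approximation for pairwise inequivalent absolute values.
  have hd := AbsoluteValue.denseRange_algebraMap_pi (v := fun p => placeAbs (A p)) hnt
    fun p p' h => not_isEquiv_placeAbs _ _ fun h' => h (hA h')
  obtain ⟨y, hy⟩ := hd.exists_dist_lt (fun p => WithAbs.toAbs (placeAbs (A p)) (x p)) hε
  refine ⟨y, fun p => ?_⟩
  have h2 := (dist_le_pi_dist _ _ p).trans_lt hy
  have h3 : placeAbs (A p) (x p - y) < ε := by
    rw [dist_eq_norm] at h2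
    exact h2
  have h4 : g p - algebraMap K (Completion (A p)) y =
      (g p - algebraMap K (Completion (A p)) (x p)) +
        algebraMap K (Completion (A p)) (x p - y) := by
    rw [map_sub]
    ring
  rw [h4, ← normAbsHom_apply]
  exact (normAbsHom_add_le (A p) _ _).trans_lt (max_lt (hx p) h3)

end Completions

/-! ### Density of `R[1/t]` in the product of the completions. -/

section Density

variable {k : Type*} [Field k] [Finite k] {R : Type*} [CommRing R] [IsDomain R]
  [Algebra (Polynomial k) R] [Module.Finite (Polynomial k) R]
  {K : Type*} [Field K] [Algebra R K] [IsFractionRing R K]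
  {P : Type*} [Finite P] (A : P → ValuationSubring K) [∀ p, IsDiscreteValuationRing (A p)]
  [∀ p, Finite (IsLocalRing.ResidueField (A p))]

omit [Finite k] in
-- Since `R` is integral over `k[X]`, denominators can be taken in `k[X]`.
theorem exists_eq_div_polyToField (x : K) : ∃ (r : R) (p : Polynomial k), p ≠ 0 ∧
      x * polyToField k R K p = algebraMap R K r := by
  obtain ⟨r, s, hs, rfl⟩ := IsFractionRing.div_surjective (A := R) x
  have h1 : IsAlgebraic (Polynomial k) s :=
    (Algebra.IsIntegral.isIntegral s).isAlgebraic
  obtain ⟨p, hp, s', hs'⟩ := h1.exists_nonzero_dvd hs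
  refine ⟨r * s', p, hp, ?_⟩
  have hs0 : algebraMap R K s ≠ 0 :=
    (map_ne_zero_iff _ (IsFractionRing.injective R K)).2 (nonZeroDivisors.ne_zero hs)
  change algebraMap R K r / algebraMap R K s * algebraMap R K (algebraMap (Polynomial k) R p) = _
  rw [hs', map_mul, map_mul]
  field_simp

omit [IsDomain R] [Module.Finite (Polynomial k) R] [Finite k] [IsFractionRing R K] in
theorem exists_eq_inv_pow_mul_of_mem_adjoin {t : R} (ht : algebraMap R K t ≠ 0) {x : K}
    (hx : x ∈ Algebra.adjoin R {(algebraMap R K t)⁻¹}) :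
    ∃ (r : R) (n : ℕ), x = (algebraMap R K t)⁻¹ ^ n * algebraMap R K r := by
  induction hx using Algebra.adjoin_induction with
  | mem x hx =>
    rw [Set.mem_singleton_iff] at hx
    exact ⟨1, 1, by rw [hx, pow_one, map_one, mul_one]⟩
  | algebraMap r => exact ⟨r, 0, by rw [pow_zero, one_mul]⟩
  | add x y _ _ hx hy =>
    obtain ⟨r, n, rfl⟩ := hx
    obtain ⟨s, m, rfl⟩ := hy
    refine ⟨t ^ m * r + t ^ n * s, n + m, ?_⟩
    rw [map_add, map_mul, map_mul, map_pow, map_pow, pow_add, inv_pow, inv_pow]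
    have h1 := pow_ne_zero n ht
    have h2 := pow_ne_zero m ht
    field_simp
  | mul x y _ _ hx hy =>
    obtain ⟨r, n, rfl⟩ := hx
    obtain ⟨s, m, rfl⟩ := hy
    refine ⟨r * s, n + m, ?_⟩
    rw [map_mul, pow_add]
    ring

/-- Write `x p = r` with `p ∈ k[X]` of degree `d` and leading coefficient `a`. Then `a⁻¹ p X^(-d) =
1 - z` with `|z| < 1` at all places. As `1 - z` divides `1 - z^m`, the element `x(1 - z^m)` lies in
`R[X⁻¹]`, and the error `x z^m` tends to zero. -/
theorem exists_placeAbs_sub_inv_pow_mul_lt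
    (hinj : Function.Injective (algebraMap (Polynomial k) R))
    (hA : ∀ p, ∃ r : R, algebraMap R K r ∉ A p) (x : K) {ε : ℝ} (hε : 0 < ε) :
    ∃ (r : R) (n : ℕ), ∀ p, placeAbs (A p) (x - (polyToField k R K Polynomial.X)⁻¹ ^ n *
      algebraMap R K r) < ε := by
  set φ := polyToField k R K with hφ
  set u := (φ Polynomial.X)⁻¹ with hu
  have hX0 : φ Polynomial.X ≠ 0 :=
    (map_ne_zero_iff _ (polyToField_injective hinj)).2 Polynomial.X_ne_zero
  obtain ⟨r, p, hp, hx⟩ := exists_eq_div_polyToField (k := k) (R := R) x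
  set d := p.natDegree with hd
  set a := p.coeff d with ha
  have ha0 : a ≠ 0 := Polynomial.leadingCoeff_ne_zero.2 hp
  set z : K := 1 - φ (Polynomial.C a⁻¹) * (φ p * u ^ d) with hz
  have hφa : φ (Polynomial.C a⁻¹) * φ (Polynomial.C a) = 1 := by
    rw [← map_mul, ← map_mul, inv_mul_cancel₀ ha0, map_one, map_one]
  have hz1 : ∀ i, placeAbs (A i) z < 1 := by
    intro i
    have hX : φ Polynomial.X ∉ A i := polyToField_X_notMem _ (hA i)
    have huA : u ∈ A i := ((A i).mem_or_inv_mem _).resolve_left hX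
    obtain ⟨b, hb, h⟩ := exists_map_mul_inv_pow_eq (A i) φ hX0 huA d p le_rfl
    have h1 : z = -(φ (Polynomial.C a⁻¹) * (u * b)) := by
      rw [hz, h, mul_add, hφa]
      ring
    rw [h1, AbsoluteValue.map_neg, map_mul, map_mul]
    have h2 : placeAbs (A i) (φ (Polynomial.C a⁻¹)) = 1 :=
      placeAbs_map_eq_one (A i) (φ.comp Polynomial.C) (inv_ne_zero ha0)
    rw [h2, one_mul]
    refine mul_lt_one_of_nonneg_of_lt_one_left ((placeAbs _).nonneg _) ?_
      ((placeAbs_le_one_iff _ _).2 hb)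
    rw [hu, map_inv₀]
    exact inv_lt_one_of_one_lt₀ ((one_lt_placeAbs_iff _ _).2 hX)
  obtain ⟨m, hm⟩ : ∃ m : ℕ, ∀ i, placeAbs (A i) x * placeAbs (A i) z ^ m < ε := by
    have h1 : ∀ i, ∀ᶠ m : ℕ in atTop, placeAbs (A i) x * placeAbs (A i) z ^ m < ε := by
      intro i
      have h2 := (tendsto_pow_atTop_nhds_zero_of_lt_one ((placeAbs (A i)).nonneg z)
        (hz1 i)).const_mul (placeAbs (A i) x)
      rw [mul_zero] at h2
      exact h2.eventually_lt_const hε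
    exact (eventually_all.2 h1).exists
  have hmem : ∀ q : Polynomial k, φ q ∈ Algebra.adjoin R {u} := fun q =>
    Subalgebra.algebraMap_mem _ (algebraMap (Polynomial k) R q)
  have humem : u ∈ Algebra.adjoin R {u} := Algebra.subset_adjoin rfl
  have hzmem : z ∈ Algebra.adjoin R {u} :=
    sub_mem (one_mem _) (mul_mem (hmem _) (mul_mem (hmem _) (pow_mem humem _)))
  have hxm : x * (1 - z ^ m) ∈ Algebra.adjoin R {u} := by
    have h1 : x * (1 - z ^ m) =
        algebraMap R K r * (φ (Polynomial.C a⁻¹) * u ^ d * ∑ i ∈ Finset.range m, z ^ i) := by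
      rw [← hx, ← mul_neg_geom_sum z m, hz]
      ring
    rw [h1]
    exact mul_mem (Subalgebra.algebraMap_mem _ _) (mul_mem (mul_mem (hmem _) (pow_mem humem _))
      (sum_mem fun i _ => pow_mem hzmem _))
  obtain ⟨r', n, hr⟩ := exists_eq_inv_pow_mul_of_mem_adjoin
    (t := algebraMap (Polynomial k) R Polynomial.X) hX0 hxm
  refine ⟨r', n, fun i => ?_⟩
  have h1 : x - u ^ n * algebraMap R K r' = x * z ^ m := by
    have h2 : x * (1 - z ^ m) = u ^ n * algebraMap R K r' := hr
    rw [← h2]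
    ring
  rw [h1, map_mul, map_pow]
  exact hm i

/-- Approximate first by an element of `K` at all places, then that element by some `t^(-n) r`. -/
theorem exists_abs_sub_zpow_mul_lt (hinj : Function.Injective (algebraMap (Polynomial k) R))
    (hAinj : Function.Injective A) (hA : ∀ p, ∃ r : R, algebraMap R K r ∉ A p)
    {B : Type*} [CommRing B] [Algebra R B] (e : B ≃+* ∀ p, Completion (A p))
    (he : ∀ r p, e (algebraMap R B r) p = algebraMap K (Completion (A p)) (algebraMap R K r))
    (T : Bˣ) (hT : (T : B) = algebraMap R B (algebraMap (Polynomial k) R Polynomial.X))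
    (g : B) {ε : ℝ} (hε : 0 < ε) :
    ∃ (r : R) (n : ℕ), (completionFields A e).abs
      (g - ((T ^ (-(n : ℤ)) : Bˣ) : B) * algebraMap R B r) < ε := by
  have hX0 : polyToField k R K Polynomial.X ≠ 0 :=
    (map_ne_zero_iff _ (polyToField_injective hinj)).2 Polynomial.X_ne_zero
  obtain ⟨x, hx⟩ := exists_placeAbs_sub_lt A (fun p => isNontrivial_placeAbs (A p) (hA p)) hAinj
    (e g) (half_pos hε)
  obtain ⟨r, n, hr⟩ := exists_placeAbs_sub_inv_pow_mul_lt (k := k) A hinj hA x (half_pos hε)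
  refine ⟨r, n, lt_of_le_of_lt ((completionFields A e).abs_le (half_pos hε).le fun p => ?_)
    (half_lt_self hε)⟩
  rw [completionFields_absAt, map_sub, Pi.sub_apply, ev_zpow_neg_mul A e he T hT]
  have h1 := normAbsHom_add_le (A p) (e g p - algebraMap K (Completion (A p)) x)
    (algebraMap K (Completion (A p)) (x - (polyToField k R K Polynomial.X)⁻¹ ^ n *
      algebraMap R K r))
  rw [map_sub, sub_add_sub_cancel] at h1
  refine h1.trans (max_le (hx p).le ?_)
  rw [← map_sub]
  exact (hr p).le

end Density

/-! ### Freeness and finite quotients over `k[t]`. -/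

section Basis

variable {k : Type*} [Field k] {R : Type*} [CommRing R] [IsDomain R] [Algebra k R]
  [Algebra (Polynomial k) R] [IsScalarTower k (Polynomial k) R] [Module.Finite (Polynomial k) R]

/-- A finite projective module over the domain `R` is torsion-free over the principal ideal domain
`k[X]`, hence free; a `k[X]`-basis times the powers of `X` is a `k`-basis. -/
theorem exists_basis_pow_smul (hinj : Function.Injective (algebraMap (Polynomial k) R))
    (M : Type*) [AddCommGroup M] [Module R M] [Module k M] [IsScalarTower k R M]
    [Module.Finite R M] [Module.Projective R M] :
    ∃ (d : ℕ) (b : Module.Basis (Fin d × ℕ) k M),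
      ∀ i n, algebraMap (Polynomial k) R Polynomial.X ^ n • b (i, 0) = b (i, n) := by
  let : Module (Polynomial k) M := Module.compHom M (algebraMap (Polynomial k) R)
  have hsmul : ∀ (p : Polynomial k) (m : M), p • m = algebraMap (Polynomial k) R p • m :=
    fun _ _ => rfl
  have h1 : IsScalarTower (Polynomial k) R M := ⟨fun p r m => by
    rw [Algebra.smul_def, mul_smul, hsmul]⟩
  have h2 : IsScalarTower k (Polynomial k) M := ⟨fun c p m => by
    rw [hsmul, hsmul, Algebra.smul_def, map_mul, mul_smul,
      ← IsScalarTower.algebraMap_apply k (Polynomial k) R, algebraMap_smul]⟩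
  have h3 : Module.Finite (Polynomial k) M := Module.Finite.trans R M
  have h4 : Module.IsTorsionFree R M := inferInstance
  have h5 : Module.IsTorsionFree (Polynomial k) M := by
    refine Module.IsTorsionFree.of_smul_eq_zero fun p m h => ?_
    rw [hsmul, smul_eq_zero] at h
    exact h.imp (fun h => (map_eq_zero_iff _ hinj).1 h) id
  have h6 : Module.Free (Polynomial k) M := inferInstance
  let c := Module.finBasis (Polynomial k) M
  refine ⟨_, ((Polynomial.basisMonomials k).smulTower c).reindex (Equiv.prodComm _ _),
    fun i n => ?_⟩
  rw [Module.Basis.reindex_apply, Module.Basis.reindex_apply]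
  simp only [Equiv.prodComm_symm, Equiv.prodComm_apply, Prod.swap_prod_mk,
    Module.Basis.smulTower_apply, Polynomial.coe_basisMonomials]
  rw [← map_pow, ← hsmul, smul_smul, Polynomial.X_pow_mul, Polynomial.monomial_mul_X_pow, zero_add]

theorem finite_quotient_span_algebraMap [Finite k] {p : Polynomial k} (hp : p ≠ 0) :
    Finite (R ⧸ Ideal.span {algebraMap (Polynomial k) R p}) := by
  have := Fintype.ofFinite k
  have h1 : Module.Finite k (AdjoinRoot p) := (AdjoinRoot.powerBasis hp).finite
  have h2 : Finite (Polynomial k ⧸ Ideal.span {p}) :=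
    Module.finite_of_finite k (M := AdjoinRoot p)
  have h3 : FiniteDimensional k (R ⧸ (Ideal.span {p} • ⊤ : Submodule (Polynomial k) R)) :=
    finiteDimensional_quot_smul_top k R (Ideal.span {p})
  have h4 : Finite (R ⧸ (Ideal.span {p} • ⊤ : Submodule (Polynomial k) R)) :=
    Module.finite_of_finite k
  have h5 : (Ideal.span {p} • ⊤ : Submodule (Polynomial k) R) ≤
      (Ideal.span {algebraMap (Polynomial k) R p}).restrictScalars (Polynomial k) := by
    rw [Submodule.ideal_span_singleton_smul]
    rintro _ ⟨r, -, rfl⟩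
    refine Ideal.mem_span_singleton.2 ⟨r, ?_⟩
    exact Algebra.smul_def p r
  exact Finite.of_surjective (Submodule.factor h5) (Submodule.factor_surjective h5)

end Basis

end TraceFormula

namespace TraceFormula

/-! ### The trace formula for a ring with places at infinity -/

theorem hasProd_of_forall_exists_finset_dvd {k : Type*} [Field k] {α : Type*} (f : α → k⟦X⟧)
    (D : k⟦X⟧) (h : ∀ N : ℕ, ∃ s₀ : Finset α, ∀ s, s₀ ⊆ s → X ^ N ∣ ∏ i ∈ s, f i - D) :
    letI : TopologicalSpace k := ⊥
    HasProd f D := by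
  let : TopologicalSpace k := ⊥
  have : DiscreteTopology k := ⟨rfl⟩
  change Filter.Tendsto _ _ _
  rw [SummationFilter.unconditional_filter, PowerSeries.WithPiTopology.tendsto_iff_coeff_tendsto]
  intro d
  obtain ⟨s₀, hs₀⟩ := h (d + 1)
  refine tendsto_nhds_of_eventually_eq ?_
  filter_upwards [Filter.eventually_ge_atTop s₀] with s hs
  have h1 := (X_pow_dvd_iff.1 (hs₀ s hs)) d (Nat.lt_succ_self d)
  rwa [map_sub, sub_eq_zero] at h1

theorem dvd_prod_sub_one {A : Type*} [CommRing A] {ι : Type*} (c : A) (s : Finset ι) (f : ι → A)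
    (h : ∀ i ∈ s, c ∣ f i - 1) : c ∣ ∏ i ∈ s, f i - 1 := by
  classical
  induction s using Finset.induction_on with
  | empty => simp
  | insert i s hi ih =>
    rw [Finset.prod_insert hi]
    have h1 : f i * ∏ j ∈ s, f j - 1 = (f i - 1) * ∏ j ∈ s, f j + (∏ j ∈ s, f j - 1) := by ring
    rw [h1]
    exact dvd_add (Dvd.dvd.mul_right (h i (Finset.mem_insert_self _ _)) _)
      (ih fun j hj => h j (Finset.mem_insert_of_mem hj))

theorem finite_quotient_of_isMaximal (k : Type*) [Field k] [Finite k] {R : Type*} [CommRing R]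
    [Algebra k R] [Algebra.FiniteType k R] (m : Ideal R) [m.IsMaximal] : Finite (R ⧸ m) := by
  let : Field (R ⧸ m) := Ideal.Quotient.field m
  have h2 : Algebra.FiniteType k (R ⧸ m) :=
    Algebra.FiniteType.of_surjective (Ideal.Quotient.mkₐ k m) Ideal.Quotient.mk_surjective
  have h3 : Module.Finite k (R ⧸ m) := finite_of_finite_type_of_isJacobsonRing k (R ⧸ m)
  exact Module.finite_of_finite k

variable {k : Type*} [Field k] [Fintype k] {R : Type*} [CommRing R] [IsDomain R] [Algebra k R]
  [Algebra (Polynomial k) R] [IsScalarTower k (Polynomial k) R] [Module.Finite (Polynomial k) R]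

variable {K : Type*} [Field K] [Algebra R K] [IsFractionRing R K]
  {P : Type*} (A : P → ValuationSubring K) [∀ p, IsDiscreteValuationRing (A p)]
  {B : Type*} [CommRing B] [Algebra R B]
  {M : Type*} [AddCommGroup M] [Module R M] [Module k M] [IsScalarTower k R M]
  [Module.Finite R M] [Module.Projective R M]

/-- Density and discreteness supply the hypotheses of `exists_isFredholmDet_twisted`. The coprime
ideals `(t)` and `(t^L - 1)` with `L = q^(j!) - 1` have product `(t^(q^(j!)) - t)`, so the two
finite determinants there assemble the local factors at the maximal ideals containing this element;
the remaining factors are trivial modulo `X ^ n`. -/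
theorem exists_isFredholmDet_hasProd (hinj : Function.Injective (algebraMap (Polynomial k) R))
    (hAinj : Function.Injective A) (hA : ∀ p, ∃ r : R, algebraMap R K r ∉ A p)
    (hA' : ∀ W : ValuationSubring K, (∃ r : R, algebraMap R K r ∉ W) → ∃ p, A p = W)
    (e : B ≃+* ∀ p, Completion (A p))
    (he : ∀ r p, e (algebraMap R B r) p = algebraMap K (Completion (A p)) (algebraMap R K r))
    (τ : M →ₛₗ[qFrob k R] M) (N : M ⊗[R] B → ℝ)
    (hN : IsTensorNorm (fun g => ⨆ p, normAbs (A p) (e g p)) N)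
    (Ψ Θ : (TwistedPoly k R)⟦X⟧) (hΘ : Θ = Ψ * PowerSeries.C (TwistedPoly.tau k R) * X) :
    ∃ D : k⟦X⟧, IsFredholmDet (quotientNorm N) (seriesAction (tauCoker B τ) Θ) D ∧ IsUnit D ∧
      letI : TopologicalSpace k := ⊥
      HasProd (fun m : MaximalSpectrum R => idealDet τ Θ m.asIdeal) D⁻¹ := by
  classical
  have hres := fun p => finite_residueField_of_notMem (k := k) hinj (A p) (hA p)
  have hP : Finite P := finite_of_injective_places hinj A hAinj hA
  have hNoeth : IsNoetherianRing R := IsNoetherianRing.of_finite (Polynomial k) R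
  have hft : Algebra.FiniteType k R :=
    Algebra.FiniteType.trans (S := Polynomial k) inferInstance inferInstance
  set L := completionFields A e with hL
  replace hN : IsTensorNorm L.abs N := hN
  set t : R := algebraMap (Polynomial k) R Polynomial.X with ht
  have ht0 : algebraMap R K t ≠ 0 :=
    (map_ne_zero_iff _ (polyToField_injective (K := K) hinj)).2 Polynomial.X_ne_zero
  obtain ⟨T, hT⟩ := isUnit_algebraMap_of_ne_zero A e he ht0
  have htp : ∀ p, 1 < placeAbs (A p) (algebraMap R K t) := fun p =>
    (one_lt_placeAbs_iff _ _).2 (polyToField_X_notMem (k := k) (A p) (hA p))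
  have hlt : ∀ p, 1 < L.absAt p (T : B) := fun p => by
    rw [hT, absAt_algebraMap_eq A e he]
    exact htp p
  have h0 : coeff 0 Θ = 0 := by
    rw [hΘ]
    exact coeff_zero_mul_X _
  have hΘ' : ∀ n, ∃ ψ, coeff n Θ = ψ * TwistedPoly.tau k R := by
    rintro (_ | n)
    · exact ⟨0, by rw [h0, zero_mul]⟩
    · exact ⟨coeff n Ψ, by rw [hΘ, coeff_succ_mul_X, coeff_mul_C]⟩
  obtain ⟨d, b, hb⟩ := exists_basis_pow_smul (k := k) hinj M
  have hXfin : Finite (R ⧸ Ideal.span {t}) := finite_quotient_span_algebraMap Polynomial.X_ne_zero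
  have hcyc : ∀ j, Finite (R ⧸ Ideal.span {t ^ cycLen k j - 1}) := fun j => by
    have h1 : t ^ cycLen k j - 1 =
        algebraMap (Polynomial k) R (Polynomial.X ^ cycLen k j - Polynomial.C 1) := by
      rw [map_sub, map_pow, map_one, map_one]
    rw [h1]
    exact finite_quotient_span_algebraMap
      (Polynomial.X_pow_sub_C_ne_zero (Nat.pos_of_ne_zero (NeZero.ne _)) 1)
  have hballs := finite_setOf_abs_le A e he (eq_zero_of_placeAbs_lt_one (k := k) A hinj hA') htp
  obtain ⟨D, hD, hDu, hcong⟩ := exists_isFredholmDet_twisted b (t := t) (tmulPowCoker R M T)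
    (isUltraSeminorm_quotientNorm (k := k) L hN) (tmulPowCoker_smul hT) tmulPowCoker_zero
    (exists_quotientNorm_tmulPowCoker_lt L b hlt hN)
    (exists_quotientNorm_sub_laurentEval_lt L hT b hN hb fun g ε hε =>
      exists_abs_sub_zpow_mul_lt A hinj hAinj hA e he T hT g hε) hb
    (exists_forall_quotientNorm_lt_imp L hT b hlt hN hb hballs)
    (tauCoker_tmulPowCoker τ) h0 hΘ'
    (fun n => by
      obtain ⟨ψ, hψ⟩ := hΘ' n
      obtain ⟨δ, hδ, h⟩ := exists_quotientNorm_twistedAction_mul_tau_le L hN τ ψ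
      refine ⟨δ, hδ, fun v hv => ?_⟩
      have h1 : coeff n (seriesAction (tauCoker B τ) Θ) =
          twistedAction (tauCoker B τ) (ψ * TwistedPoly.tau k R) := by
        rw [← hψ]
        exact coeff_map _ _ _
      rw [h1]
      exact h v hv) hcyc
  refine ⟨D, hD, hDu, hasProd_of_forall_exists_finset_dvd _ _ fun n => ?_⟩
  obtain ⟨K₀, hK₀⟩ := hcong n
  obtain ⟨K₁, hK₁⟩ := exists_dvd_idealDet_sub_one τ Θ h0 hΘ' n
  set j := max K₀ K₁
  have hcop : IsCoprime (Ideal.span {t}) (Ideal.span {t ^ cycLen k j - 1}) := by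
    rw [Ideal.isCoprime_span_singleton_iff]
    refine ⟨t ^ (cycLen k j - 1), -1, ?_⟩
    rw [← pow_succ, Nat.sub_add_cancel (Nat.pos_of_ne_zero (NeZero.ne _))]
    ring
  have hspan : Ideal.span {t} * Ideal.span {t ^ cycLen k j - 1} =
      Ideal.span {t ^ Fintype.card k ^ Nat.factorial j - t} := by
    rw [Ideal.span_singleton_mul_span_singleton, mul_sub, mul_one, ← pow_succ', cycLen,
      Nat.sub_add_cancel (Nat.pos_of_ne_zero (pow_ne_zero _ Fintype.card_ne_zero))]
  have hfin : Finite (R ⧸ Ideal.span {t ^ Fintype.card k ^ Nat.factorial j - t}) := by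
    have h1 : t ^ Fintype.card k ^ Nat.factorial j - t = algebraMap (Polynomial k) R
        (Polynomial.X ^ Fintype.card k ^ Nat.factorial j - Polynomial.X) := by
      rw [map_sub, map_pow]
    rw [h1]
    refine finite_quotient_span_algebraMap ?_
    exact FiniteField.X_pow_card_pow_sub_X_ne_zero k (Nat.factorial_ne_zero _) Fintype.one_lt_card
  obtain ⟨s₀, hs₀, hprod⟩ := exists_idealDet_eq_prod τ Θ
    (Ideal.span {t ^ Fintype.card k ^ Nat.factorial j - t}) hΘ'
  rw [← hspan, idealDet_mul τ Θ hcop] at hprod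
  refine ⟨s₀, fun s hs => ?_⟩
  have h1 : X ^ n ∣ ∏ m ∈ s \ s₀, idealDet τ Θ m.asIdeal - 1 := by
    refine dvd_prod_sub_one _ _ _ fun m hm => ?_
    have hm' := m.isMaximal
    refine hK₁ j (le_max_right _ _) t m.asIdeal m.isMaximal
      (finite_quotient_of_isMaximal k m.asIdeal) fun h => ?_
    exact (Finset.mem_sdiff.1 hm).2 ((hs₀ m).2 ((Ideal.span_singleton_le_iff_mem _).2 h))
  have h2 := hK₀ j (le_max_left _ _)
  have hDD : D * D⁻¹ = 1 :=
    PowerSeries.mul_inv_cancel D (isUnit_constantCoeff D hDu).ne_zero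
  rw [← Finset.prod_sdiff hs, ← hprod]
  set x := ∏ m ∈ s \ s₀, idealDet τ Θ m.asIdeal
  set y := idealDet τ Θ (Ideal.span {t})
  set z := idealDet τ Θ (Ideal.span {t ^ cycLen k j - 1})
  -- Modulo `X ^ n`, the factors outside `s₀` collected in `x` give 1, and `y z` is inverse to `D`.
  have h3 : x * (y * z) - D⁻¹ = (x - 1) * (y * z) + (z * (y * D) - 1) * D⁻¹ := by
    linear_combination (-(y * z)) * hDD
  rw [h3]
  exact dvd_add (Dvd.dvd.mul_right h1 _) (Dvd.dvd.mul_right h2 _)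

end TraceFormula

namespace TraceFormula

/-! ### Local rings of smooth curves -/

/-- An ideal whose cotangent module embeds into a cyclic module over the residue field is
principal. -/
theorem isPrincipal_of_injective_cotangent {L : Type*} [CommRing L] [IsLocalRing L]
    [IsNoetherianRing L] {J : Ideal L} (hJ : J = IsLocalRing.maximalIdeal L) {N : Type*}
    [AddCommGroup N] [Module L N] {ω : N} (hω : ∀ n : N, ∃ c : L, n = c • ω)
    (hJω : ∀ c ∈ J, c • ω = 0) (f : J.Cotangent →ₗ[L] N) (hf : Function.Injective f) :
    (IsLocalRing.maximalIdeal L).IsPrincipal := by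
  rw [← hJ]
  suffices h : ∃ x₀ : J, ∀ y : J, ∃ c : L, J.toCotangent y = c • J.toCotangent x₀ by
    obtain ⟨x₀, h⟩ := h
    refine ⟨(x₀ : L), le_antisymm ?_ ?_⟩
    · refine Submodule.le_of_le_smul_of_le_jacobson_bot (I := J) (IsNoetherian.noetherian _)
        (hJ.trans (IsLocalRing.jacobson_eq_maximalIdeal ⊥ bot_ne_top).symm).le fun y hy => ?_
      obtain ⟨c, hc⟩ := h ⟨y, hy⟩
      rw [← map_smul, Ideal.toCotangent_eq] at hc
      have h1 : y = c * x₀ + (y - c * x₀) := by ring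
      rw [h1]
      refine Submodule.add_mem_sup
        (Submodule.smul_mem _ c (Submodule.subset_span (Set.mem_singleton _))) ?_
      rw [smul_eq_mul, ← pow_two]
      exact hc
    · rw [Submodule.span_singleton_le_iff_mem]
      exact x₀.2
  -- A nonzero image in `N` has a unit coefficient with respect to `ω`, since `J` kills `ω`; so it
  -- generates the cotangent module. If all images vanish, that module is zero.
  by_cases h0 : ∃ x₀ : J, f (J.toCotangent x₀) ≠ 0
  · obtain ⟨x₀, hx₀⟩ := h0
    refine ⟨x₀, fun y => ?_⟩
    obtain ⟨c, hc⟩ := hω (f (J.toCotangent x₀))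
    obtain ⟨d, hd⟩ := hω (f (J.toCotangent y))
    have hcu : IsUnit c := by
      by_contra hcu
      exact hx₀ (hc.trans (hJω c (hJ ▸ (IsLocalRing.mem_maximalIdeal c).2 hcu)))
    obtain ⟨u, rfl⟩ := hcu
    refine ⟨d * (u⁻¹ : Lˣ), hf ?_⟩
    rw [map_smul, hd, hc, smul_smul, mul_assoc, Units.inv_mul, mul_one]
  · push Not at h0
    refine ⟨0, fun y => ⟨0, hf ?_⟩⟩
    rw [h0, zero_smul, map_zero]

section Smooth

variable {k : Type*} [Field k] [PerfectField k] {S : Type*} [CommRing S] [Algebra k S]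

omit [PerfectField k] in
theorem exists_kaehlerDifferential_generator
    [Algebra.IsStandardSmoothOfRelativeDimension 1 k S] [Nontrivial S] :
    ∃ ω : KaehlerDifferential k S, ∀ η, ∃ s : S, η = s • ω := by
  have := Algebra.IsStandardSmoothOfRelativeDimension.isStandardSmooth 1 (R := k) (S := S)
  have h0 := Algebra.IsStandardSmoothOfRelativeDimension.rank_kaehlerDifferential
    (R := k) (S := S) 1
  have h1 : Module.finrank S (KaehlerDifferential k S) = 1 := Module.finrank_eq_of_rank_eq h0
  have h2 : Module.Finite S (KaehlerDifferential k S) := inferInstance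
  let b := Module.finBasisOfFinrankEq S (KaehlerDifferential k S) h1
  refine ⟨b 0, fun η => ⟨b.repr η 0, ?_⟩⟩
  conv_lhs => rw [← b.sum_repr η]
  rw [Fin.sum_univ_one]

variable (k) in
-- The residue field is formally smooth over the perfect field `k`, so the conormal map from the
-- cotangent space to `κ ⊗ Ω_{L/k}` is split injective. Its target is cyclic: `Ω_{S/k}` has rank 1
-- and a localization adds no differentials.
theorem isPrincipal_maximalIdeal_of_smooth [Algebra.IsStandardSmoothOfRelativeDimension 1 k S]
    (p : Ideal S) [p.IsPrime] (L : Type*) [CommRing L]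
    [Algebra S L] [IsLocalization.AtPrime L p] [IsLocalRing L] :
    IsNoetherianRing L ∧ (IsLocalRing.maximalIdeal L).IsPrincipal := by
  have := Algebra.IsStandardSmoothOfRelativeDimension.isStandardSmooth 1 (R := k) (S := S)
  have hS : Algebra.FiniteType k S := inferInstance
  have hNS : IsNoetherianRing S := Algebra.FiniteType.isNoetherianRing k S
  have hNL : IsNoetherianRing L := IsLocalization.isNoetherianRing p.primeCompl L inferInstance
  have hSnt : Nontrivial S := (algebraMap S L).domain_nontrivial
  refine ⟨hNL, ?_⟩
  let : Algebra k L := ((algebraMap S L).comp (algebraMap k S)).toAlgebra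
  have hst : IsScalarTower k S L := IsScalarTower.of_algebraMap_eq fun _ => rfl
  have hfs : Algebra.FormallySmooth S L := Algebra.FormallySmooth.of_isLocalization p.primeCompl
  have hfu : Algebra.FormallyUnramified S L :=
    Algebra.FormallyUnramified.of_isLocalization p.primeCompl
  have hfL : Algebra.FormallySmooth k L := Algebra.FormallySmooth.comp k S L
  have he1 : Algebra.EssFiniteType S L := Algebra.EssFiniteType.of_isLocalization L p.primeCompl
  have he2 : Algebra.EssFiniteType k L := Algebra.EssFiniteType.comp k S L
  set κ := IsLocalRing.ResidueField L
  have he3 : Algebra.EssFiniteType k κ := Algebra.EssFiniteType.comp k L κ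
  have hκ : Algebra.FormallySmooth k κ := inferInstance
  have hsurj : Function.Surjective (algebraMap L κ) := IsLocalRing.residue_surjective
  obtain ⟨l, hl⟩ := (Algebra.FormallySmooth.iff_split_injection hsurj).1 hκ
  obtain ⟨ω, hω⟩ := exists_kaehlerDifferential_generator (k := k) (S := S)
  have hsub : Subsingleton (KaehlerDifferential S L) := inferInstance
  have h1 : ∀ η : KaehlerDifferential k L, ∃ c : L,
      η = c • KaehlerDifferential.map k k S L ω := by
    intro η
    obtain ⟨x, rfl⟩ := ((KaehlerDifferential.exact_mapBaseChange_map k S L) η).1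
      (Subsingleton.elim _ _)
    induction x using TensorProduct.induction_on with
    | zero => exact ⟨0, by rw [map_zero, zero_smul]⟩
    | tmul a b =>
      obtain ⟨s, rfl⟩ := hω b
      refine ⟨a * algebraMap S L s, ?_⟩
      rw [KaehlerDifferential.mapBaseChange_tmul, map_smul, mul_smul, algebraMap_smul]
    | add x y hx hy =>
      obtain ⟨c, hc⟩ := hx
      obtain ⟨d, hd⟩ := hy
      exact ⟨c + d, by rw [map_add, hc, hd, add_smul]⟩
  refine isPrincipal_of_injective_cotangent (J := RingHom.ker (algebraMap L κ))
    IsLocalRing.ker_residue (ω := (1 : κ) ⊗ₜ[L] KaehlerDifferential.map k k S L ω) (fun x => ?_)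
    (fun c hc => ?_) (KaehlerDifferential.kerCotangentToTensor k L κ)
    (Function.LeftInverse.injective (LinearMap.congr_fun hl))
  · induction x using TensorProduct.induction_on with
    | zero => exact ⟨0, by rw [zero_smul]⟩
    | tmul a b =>
      obtain ⟨c, hc⟩ := hsurj a
      obtain ⟨d, rfl⟩ := h1 b
      refine ⟨c * d, ?_⟩
      rw [mul_smul, ← TensorProduct.tmul_smul, TensorProduct.smul_tmul', Algebra.smul_def, hc,
        mul_one]
    | add x y hx hy =>
      obtain ⟨c, hc⟩ := hx
      obtain ⟨d, hd⟩ := hy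
      exact ⟨c + d, by rw [hc, hd, add_smul]⟩
  · rw [TensorProduct.smul_tmul', Algebra.smul_def, (RingHom.mem_ker).1 hc, zero_mul,
      TensorProduct.zero_tmul]

variable (k S) in
-- A domain integral over the perfect field `k` is a separable field extension; its differentials
-- would vanish instead of having rank 1.
theorem not_isIntegral_of_smooth [Algebra.IsStandardSmoothOfRelativeDimension 1 k S] [IsDomain S] : ¬ Algebra.IsIntegral k S := by
  intro h
  let : Field S := (isField_of_isIntegral_of_isField' (Field.toIsField k)).toField
  have h1 : Algebra.IsAlgebraic k S := inferInstance
  have h2 : Algebra.IsSeparable k S := inferInstance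
  have h3 : Algebra.FormallyUnramified k S := Algebra.FormallyUnramified.of_isSeparable k S
  have h4 : Subsingleton (KaehlerDifferential k S) := inferInstance
  have h5 := Algebra.IsStandardSmoothOfRelativeDimension.rank_kaehlerDifferential
    (R := k) (S := S) 1
  rw [rank_subsingleton'] at h5
  simp at h5

end Smooth

/-- Noether normalization in `s` variables. The case `s = 0` contradicts `hint`; for two or more
variables, a prime of `R` lying over a nonzero non-maximal prime contradicts `hdim`. -/
theorem exists_polynomial_finite_injective (k : Type*) [Field k] (R : Type*) [CommRing R]
    [IsDomain R] [Algebra k R] [Algebra.FiniteType k R]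
    (hdim : ∀ p : Ideal R, p ≠ ⊥ → p.IsPrime → p.IsMaximal) (hint : ¬ Algebra.IsIntegral k R) :
    ∃ g : Polynomial k →ₐ[k] R, Function.Injective g ∧ g.Finite := by
  obtain ⟨s, g, hg, hfin⟩ := exists_finite_inj_algHom_of_fg k R
  have hs : s = 1 := by
    rcases s with _ | _ | s
    · refine absurd ⟨fun r => ?_⟩ hint
      have h1 : g.IsIntegral := hfin.to_isIntegral
      have h2 : (g.comp (Algebra.ofId k (MvPolynomial (Fin 0) k))).toRingHom.IsIntegral := by
        refine RingHom.IsIntegral.trans (algebraMap k (MvPolynomial (Fin 0) k)) _ ?_ h1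
        exact RingHom.isIntegral_of_surjective _ (MvPolynomial.C_surjective (Fin 0))
      have h3 := h2 r
      rwa [Subsingleton.elim (g.comp (Algebra.ofId k (MvPolynomial (Fin 0) k)))
        (Algebra.ofId k R)] at h3
    · rfl
    · exfalso
      let : Algebra (MvPolynomial (Fin (s + 2)) k) R := g.toRingHom.toAlgebra
      have hint' : Algebra.IsIntegral (MvPolynomial (Fin (s + 2)) k) R :=
        ⟨hfin.to_isIntegral⟩
      -- Killing `X 0` makes the kernel nonzero, and sending `X 1` to the non-unit `X` keeps it from
      -- being maximal.
      set φ : MvPolynomial (Fin (s + 2)) k →ₐ[k] Polynomial k :=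
        MvPolynomial.aeval fun i => if i = 0 then 0 else Polynomial.X
      have hker : (RingHom.ker φ).IsPrime := RingHom.ker_isPrime φ
      obtain ⟨Q, hQ, hQφ⟩ := Ideal.exists_ideal_over_prime_of_isIntegral_of_isDomain (S := R)
        (RingHom.ker φ) (by
          rw [(RingHom.injective_iff_ker_eq_bot _).1
            (show Function.Injective (algebraMap (MvPolynomial (Fin (s + 2)) k) R) from hg)]
          exact bot_le)
      have h0 : MvPolynomial.X 0 ∈ RingHom.ker φ := by
        rw [RingHom.mem_ker, MvPolynomial.aeval_X, if_pos rfl]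
      have hQ0 : Q ≠ ⊥ := by
        rintro rfl
        rw [← hQφ, Ideal.mem_comap, Ideal.mem_bot] at h0
        exact MvPolynomial.X_ne_zero (R := k) (0 : Fin (s + 2))
          (hg (h0.trans (map_zero g).symm))
      have hQm := hdim Q hQ0 hQ
      have h1 : (RingHom.ker φ).IsMaximal := by
        rw [← hQφ]
        exact Ideal.isMaximal_comap_of_isIntegral_of_isMaximal Q
      have h2 : MvPolynomial.X 1 ∉ RingHom.ker φ := by
        rw [RingHom.mem_ker, MvPolynomial.aeval_X, if_neg (by simp)]
        exact Polynomial.X_ne_zero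
      obtain ⟨y, hy⟩ := h1.exists_inv h2
      obtain ⟨i, hi, h3⟩ := hy
      have h4 := congrArg φ h3
      rw [map_add, map_mul, (RingHom.mem_ker).1 hi, add_zero, map_one, MvPolynomial.aeval_X,
        if_neg (by simp)] at h4
      exact Polynomial.not_isUnit_X (.of_mul_eq_one _ ((mul_comm _ _).trans h4))
  subst hs
  let e : Polynomial k ≃ₐ[k] MvPolynomial (Fin 1) k :=
    (MvPolynomial.uniqueAlgEquiv k (Fin 1)).symm
  refine ⟨g.comp e.toAlgHom, hg.comp e.injective, ?_⟩
  exact RingHom.Finite.comp hfin (RingHom.Finite.of_surjective _ e.surjective)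

/-- A noetherian local domain with principal maximal ideal is a principal ideal ring. -/
theorem isPrincipalIdealRing_of_isPrincipal_maximalIdeal (L : Type*) [CommRing L] [IsLocalRing L]
    [IsNoetherianRing L] [IsDomain L] (h : (IsLocalRing.maximalIdeal L).IsPrincipal) :
    IsPrincipalIdealRing L :=
  ((tfae_of_isNoetherianRing_of_isLocalRing_of_isDomain L).out 0 4).2 h

/-- The Krull dimension is bounded by the heights of the maximal ideals, that is, by the dimensions
of the local rings. -/
theorem isMaximal_of_isPrincipalIdealRing_localization {R : Type*} [CommRing R] [IsDomain R]
    (h : ∀ m : Ideal R, ∀ _ : m.IsMaximal, IsPrincipalIdealRing (Localization.AtPrime m))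
    (p : Ideal R) (hp0 : p ≠ ⊥) (hp : p.IsPrime) : p.IsMaximal := by
  have h1 : ringKrullDim R ≤ 1 := by
    rw [ringKrullDim_le_iff_isMaximal_height_le]
    intro m hm
    have hm' := hm.isPrime
    rw [← IsLocalization.AtPrime.ringKrullDim_eq_height m (Localization.AtPrime m)]
    have := h m hm
    have h2 : Ring.KrullDimLE 1 (Localization.AtPrime m) := inferInstance
    exact_mod_cast Ring.krullDimLE_iff.1 h2
  have h3 : Ring.KrullDimLE 1 R := Ring.krullDimLE_iff.2 (by exact_mod_cast h1)
  exact Ring.krullDimLE_one_iff_of_noZeroDivisors.1 h3 p hp0 hp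

end TraceFormula

namespace TraceFormula

/-! ### Smooth proper curves -/

section Curves

open IsLocalRing

variable {k : Type u} [Field k] {X : Scheme.{u}} (f : X ⟶ Spec (.of k))

theorem algebraMap_coordRing (U : X.Opens) :
    algebraMap k (CoordRing f U) =
      ((Scheme.ΓSpecIso (.of k)).inv ≫ f.appLE ⊤ U le_top).hom := rfl

theorem exists_isStandardSmooth_coordRing [SmoothOfRelativeDimension 1 f] (x : X) :
    ∃ V : X.Opens, IsAffineOpen V ∧ x ∈ V ∧
      Algebra.IsStandardSmoothOfRelativeDimension 1 k (CoordRing f V) := by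
  obtain ⟨U, hU, V, hV, hx, e, hs⟩ :=
    SmoothOfRelativeDimension.exists_isStandardSmoothOfRelativeDimension (n := 1) (f := f) x
  -- `Spec k` has only one point.
  have hUt : U = ⊤ := by
    ext z
    simp only [SetLike.mem_coe, TopologicalSpace.Opens.coe_top, Set.mem_univ, iff_true]
    exact (Subsingleton.elim (α := PrimeSpectrum k) (f x) z) ▸ e hx
  subst hUt
  refine ⟨V, hV, hx, ?_⟩
  rw [← RingHom.isStandardSmoothOfRelativeDimension_algebraMap, algebraMap_coordRing]
  exact RingHom.isStandardSmoothOfRelativeDimension_respectsIso.2 _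
    (Scheme.ΓSpecIso (.of k)).symm.commRingCatIsoToRingEquiv hs

theorem finiteType_coordRing [LocallyOfFiniteType f] {Y : X.Opens} (hY : IsAffineOpen Y) :
    Algebra.FiniteType k (CoordRing f Y) := by
  rw [← RingHom.finiteType_algebraMap, algebraMap_coordRing]
  exact RingHom.finiteType_respectsIso.2 _
    (Scheme.ΓSpecIso (.of k)).symm.commRingCatIsoToRingEquiv
    (f.finiteType_appLE (isAffineOpen_top _) hY le_top)

variable [AlgebraicGeometry.IsIntegral X]

instance (Y : X.Opens) [Nonempty Y] : IsDomain (CoordRing f Y) :=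
  inferInstanceAs (IsDomain Γ(X, Y))

theorem isFractionRing_coordRing {Y : X.Opens} [Nonempty Y] (hY : IsAffineOpen Y) :
    IsFractionRing (CoordRing f Y) X.functionField :=
  functionField_isFractionRing_of_isAffineOpen X Y hY

theorem algebraMap_coordRing_functionField_eq (U V : X.Opens) [Nonempty U] [Nonempty V] (c : k) :
    algebraMap (CoordRing f U) X.functionField (algebraMap k _ c) =
      algebraMap (CoordRing f V) X.functionField (algebraMap k _ c) := by
  have h (W : X.Opens) [Nonempty W] :
      (Scheme.ΓSpecIso (.of k)).inv ≫ f.appLE ⊤ W le_top ≫ X.germToFunctionField W =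
        (Scheme.ΓSpecIso (.of k)).inv ≫ f.app ⊤ ≫ X.presheaf.germ _ (genericPoint X) trivial :=
    congr(_ ≫ f.app ⊤ ≫ $(X.presheaf.germ_res (homOfLE (le_top : W ≤ ⊤)) (genericPoint X) _))
  exact congr($((h U).trans (h V).symm) c)

theorem isPrincipalIdealRing_stalk [PerfectField k] [SmoothOfRelativeDimension 1 f] (x : X) :
    IsPrincipalIdealRing (X.presheaf.stalk x) := by
  obtain ⟨V, hV, hx, hs⟩ := exists_isStandardSmooth_coordRing f x
  have : Nonempty V := ⟨⟨x, hx⟩⟩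
  let : Algebra (CoordRing f V) (X.presheaf.stalk x) :=
    TopCat.Presheaf.algebra_section_stalk X.presheaf (⟨x, hx⟩ : V)
  let p : Ideal (CoordRing f V) := (hV.primeIdealOf ⟨x, hx⟩).asIdeal
  have hp : p.IsPrime := (hV.primeIdealOf ⟨x, hx⟩).isPrime
  have hl : IsLocalization.AtPrime (X.presheaf.stalk x) p := hV.isLocalization_stalk ⟨x, hx⟩
  have h := isPrincipal_maximalIdeal_of_smooth k p (X.presheaf.stalk x)
  have := h.1
  exact isPrincipalIdealRing_of_isPrincipal_maximalIdeal _ h.2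

theorem isMaximal_of_ne_bot_coordRing [PerfectField k] [SmoothOfRelativeDimension 1 f]
    {Y : X.Opens} [Nonempty Y] (hY : IsAffineOpen Y) (p : Ideal (CoordRing f Y)) (hp0 : p ≠ ⊥)
    (hp : p.IsPrime) : p.IsMaximal := by
  refine isMaximal_of_isPrincipalIdealRing_localization (fun m hm => ?_) p hp0 hp
  let y : PrimeSpectrum Γ(X, Y) := ⟨m, hm.isPrime⟩
  have hy : hY.fromSpec y ∈ Y := hY.range_fromSpec.le ⟨y, rfl⟩
  let : Algebra (CoordRing f Y) (X.presheaf.stalk (hY.fromSpec y)) :=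
    TopCat.Presheaf.algebra_section_stalk X.presheaf (⟨hY.fromSpec y, hy⟩ : Y)
  have hl : IsLocalization.AtPrime (R := CoordRing f Y) (X.presheaf.stalk (hY.fromSpec y)) m :=
    hY.isLocalization_stalk' y hy
  have := isPrincipalIdealRing_stalk f (hY.fromSpec y)
  let e := IsLocalization.algEquiv m.primeCompl (X.presheaf.stalk (hY.fromSpec y))
    (Localization.AtPrime m)
  exact IsPrincipalIdealRing.of_surjective e.toRingEquiv.toRingHom e.surjective

/-- If integral over `k`, the ring would be a field and equal to the function field; then every
standard smooth chart would be integral over `k` too. -/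
theorem not_isIntegral_coordRing [PerfectField k] [SmoothOfRelativeDimension 1 f]
    {Y : X.Opens} [Nonempty Y] (hY : IsAffineOpen Y) :
    ¬ Algebra.IsIntegral k (CoordRing f Y) := by
  intro h
  obtain ⟨V, hV, hx, hs⟩ := exists_isStandardSmooth_coordRing f (genericPoint X)
  have : Nonempty V := ⟨⟨_, hx⟩⟩
  have hf : IsField (CoordRing f Y) :=
    isField_of_isIntegral_of_isField' (Field.toIsField k)
  have := isFractionRing_coordRing f hY
  have hsurj := IsFractionRing.surjective_iff_isField (R := CoordRing f Y)
    (K := X.functionField) |>.2 hf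
  let : Algebra k X.functionField :=
    ((algebraMap (CoordRing f Y) X.functionField).comp (algebraMap k _)).toAlgebra
  have : IsScalarTower k (CoordRing f Y) X.functionField :=
    IsScalarTower.of_algebraMap_eq fun _ => rfl
  have : IsScalarTower k (CoordRing f V) X.functionField :=
    IsScalarTower.of_algebraMap_eq fun c => algebraMap_coordRing_functionField_eq f Y V c
  refine not_isIntegral_of_smooth k (CoordRing f V) ⟨fun s => ?_⟩
  obtain ⟨r, hr⟩ := hsurj (algebraMap (CoordRing f V) X.functionField s)
  rw [← isIntegral_algebraMap_iff (A := CoordRing f V) (B := X.functionField)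
    (X.germToFunctionField_injective V : Function.Injective (algebraMap (CoordRing f V) _)), ← hr]
  exact (h.isIntegral r).algebraMap

/-! ### Points outside `Y` and the valuative criteria. -/

section Valuative

variable {f}

/-- Two morphisms from the spectrum of a valuation ring of the function field which extend the
generic point agree. -/
theorem eq_of_comp_eq_fromSpecStalk [IsSeparated f] (A : ValuationSubring X.functionField)
    (l₁ l₂ : Spec (.of A) ⟶ X)
    (h₁ : Spec.map (CommRingCat.ofHom (algebraMap A X.functionField)) ≫ l₁ =
      X.fromSpecStalk (genericPoint X))
    (h₂ : Spec.map (CommRingCat.ofHom (algebraMap A X.functionField)) ≫ l₂ =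
      X.fromSpecStalk (genericPoint X)) : l₁ = l₂ := by
  obtain ⟨φ₁, hφ₁⟩ := Spec.map_surjective (l₁ ≫ f)
  obtain ⟨φ₂, hφ₂⟩ := Spec.map_surjective (l₂ ≫ f)
  have hφ : φ₁ = φ₂ := by
    have h : φ₁ ≫ CommRingCat.ofHom (algebraMap A X.functionField) =
        φ₂ ≫ CommRingCat.ofHom (algebraMap A X.functionField) := by
      apply Spec.map_injective
      rw [Spec.map_comp, Spec.map_comp, hφ₁, hφ₂, reassoc_of% h₁, reassoc_of% h₂]
    ext c
    exact congr($h c)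
  have h : l₁ ≫ f = l₂ ≫ f := by rw [← hφ₁, ← hφ₂, hφ]
  let S : ValuativeCommSq f :=
    { R := A
      K := X.functionField
      i₁ := X.fromSpecStalk (genericPoint X)
      i₂ := l₁ ≫ f
      commSq := ⟨by rw [reassoc_of% h₁]⟩ }
  have := IsSeparated.valuativeCriterion f S
  let s₁ : S.commSq.LiftStruct := ⟨l₁, h₁, rfl⟩
  let s₂ : S.commSq.LiftStruct := ⟨l₂, h₂, h.symm⟩
  exact congrArg CommSq.LiftStruct.l (Subsingleton.elim s₁ s₂)

/-- If `A` contained the functions on `Y`, then `Spec A` would map to `X` both through the local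
ring at `x` and through `Y`. By separatedness the two maps agree, yet the closed point goes to `x`
under the first and into `Y` under the second. -/
theorem exists_notMem_of_range_stalk_eq [IsSeparated f] {Y : X.Opens} [Nonempty Y]
    (hY : IsAffineOpen Y) (A : ValuationSubring X.functionField) (x : X) (hx : x ∉ Y)
    (hA : (A : Set X.functionField) =
      Set.range (algebraMap (X.presheaf.stalk x) X.functionField)) :
    ∃ r : CoordRing f Y, algebraMap (CoordRing f Y) X.functionField r ∉ A := by
  by_contra! h
  have hη : genericPoint X ∈ Y :=
    ((genericPoint_spec X).mem_open_set_iff Y.isOpen).mpr (by simpa using ‹Nonempty Y›)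
  have hmem (z : X.presheaf.stalk x) :
      algebraMap (X.presheaf.stalk x) X.functionField z ∈ A.toSubring :=
    hA.ge ⟨z, rfl⟩
  let α : X.presheaf.stalk x ⟶ .of A :=
    CommRingCat.ofHom ((algebraMap (X.presheaf.stalk x) X.functionField).codRestrict A.toSubring hmem)
  let β : Γ(X, Y) ⟶ .of A :=
    CommRingCat.ofHom ((algebraMap Γ(X, Y) X.functionField).codRestrict A.toSubring h)
  have hα : IsLocalHom α.hom := by
    refine ⟨fun z hz => ?_⟩
    obtain ⟨w, hw⟩ := hz.exists_right_inv
    obtain ⟨z', hz'⟩ := hA.le w.2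
    refine .of_mul_eq_one z' (IsFractionRing.injective (X.presheaf.stalk x) X.functionField ?_)
    rw [map_mul, hz', map_one]
    exact congrArg Subtype.val hw
  have h₁ : Spec.map (CommRingCat.ofHom (algebraMap A X.functionField)) ≫
      (Spec.map α ≫ X.fromSpecStalk x) = X.fromSpecStalk (genericPoint X) := by
    rw [← Spec.map_comp_assoc, ← Scheme.SpecMap_stalkSpecializes_fromSpecStalk
      ((genericPoint_spec X).specializes (Set.mem_univ x))]
    rfl
  have h₂ : Spec.map (CommRingCat.ofHom (algebraMap A X.functionField)) ≫
      (Spec.map β ≫ hY.fromSpec) = X.fromSpecStalk (genericPoint X) := by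
    rw [← Spec.map_comp_assoc, ← hY.fromSpecStalk_eq_fromSpecStalk hη]
    rfl
  have h3 := eq_of_comp_eq_fromSpecStalk (f := f) A _ _ h₁ h₂
  apply hx
  let a : Spec (.of A) := closedPoint A
  have h4 : (Spec.map α ≫ X.fromSpecStalk x) a = x := by
    rw [Scheme.Hom.comp_apply]
    exact congr(X.fromSpecStalk x $(comap_closedPoint α.hom)).trans X.fromSpecStalk_closedPoint
  rw [← h4, h3, Scheme.Hom.comp_apply]
  exact hY.range_fromSpec.le ⟨_, rfl⟩

/-- A valuation ring of the function field that contains the constants dominates the local ring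
at a point of a proper curve. -/
theorem exists_isLocalHom_stalk [UniversallyClosed f] (W : ValuationSubring X.functionField)
    {Y : X.Opens} [Nonempty Y] (hY : IsAffineOpen Y)
    (hW : ∀ c : k, algebraMap (CoordRing f Y) X.functionField (algebraMap k _ c) ∈ W) :
    ∃ (x : X) (α : X.presheaf.stalk x →+* W), IsLocalHom α ∧
      W.subtype.comp α = algebraMap (X.presheaf.stalk x) X.functionField := by
  have hη : genericPoint X ∈ Y :=
    ((genericPoint_spec X).mem_open_set_iff Y.isOpen).mpr (by simpa using ‹Nonempty Y›)
  let ψ : CommRingCat.of k ⟶ .of W := CommRingCat.ofHom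
    (((algebraMap (CoordRing f Y) X.functionField).comp (algebraMap k _)).codRestrict
      W.toSubring hW)
  have hψ : X.fromSpecStalk (genericPoint X) ≫ f =
      Spec.map (CommRingCat.ofHom (algebraMap W X.functionField)) ≫ Spec.map ψ := by
    rw [← hY.fromSpecStalk_eq_fromSpecStalk hη, IsAffineOpen.fromSpecStalk, Category.assoc,
      ← IsAffineOpen.SpecMap_appLE_fromSpec f (isAffineOpen_top _) hY le_top,
      IsAffineOpen.fromSpec_top, Scheme.isoSpec_Spec_inv, ← Spec.map_comp, ← Spec.map_comp,
      ← Spec.map_comp]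
    rfl
  let S : ValuativeCommSq f :=
    { R := W
      K := X.functionField
      i₁ := X.fromSpecStalk (genericPoint X)
      i₂ := Spec.map ψ
      commSq := ⟨hψ⟩ }
  have hex : ValuativeCriterion.Existence f :=
    ((UniversallyClosed.eq_valuativeCriterion.le _ _ f ‹UniversallyClosed f›).1 :)
  obtain ⟨l, hl, -⟩ := (hex S).exists_lift
  have hloc : IsLocalRing (CommRingCat.of W) := inferInstanceAs (IsLocalRing W)
  let l' : Spec (.of W) ⟶ X := l
  refine ⟨l' (closedPoint (CommRingCat.of W)), (Scheme.stalkClosedPointTo l').hom,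
    Scheme.isLocalHom_stalkClosedPointTo l', ?_⟩
  have h : Scheme.stalkClosedPointTo l' ≫ CommRingCat.ofHom (algebraMap W X.functionField) =
      X.presheaf.stalkSpecializes ((genericPoint_spec X).specializes trivial) := by
    apply Spec.map_injective
    rw [← cancel_mono (X.fromSpecStalk _), Spec.map_comp, Category.assoc,
      Scheme.Spec_stalkClosedPointTo_fromSpecStalk,
      Scheme.SpecMap_stalkSpecializes_fromSpecStalk]
    exact hl
  exact congrArg CommRingCat.Hom.hom h

/-- By properness `W` dominates the local ring at some point `x`. This point is outside `Y` because
some function on `Y` is not in `W`, and the local ring is a discrete valuation ring by smoothness.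
-/
theorem exists_place_eq [Finite k] [PerfectField k] [IsProper f] [SmoothOfRelativeDimension 1 f]
    {Y : X.Opens} [Nonempty Y] (hY : IsAffineOpen Y) (W : ValuationSubring X.functionField)
    (hW : ∃ r : CoordRing f Y, algebraMap (CoordRing f Y) X.functionField r ∉ W) :
    ∃ p : PlacesOutside Y, p.1 = W := by
  have hk (c : k) : algebraMap (CoordRing f Y) X.functionField (algebraMap k _ c) ∈ W :=
    map_mem_valuationSubring W ((algebraMap (CoordRing f Y) X.functionField).comp
      (algebraMap k _)) c
  obtain ⟨x, α, hα, hαW⟩ := exists_isLocalHom_stalk (f := f) W hY hk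
  obtain ⟨r, hr⟩ := hW
  have hx : x ∉ Y := by
    intro hx
    refine hr ?_
    have h1 : algebraMap (CoordRing f Y) X.functionField r =
        algebraMap (X.presheaf.stalk x) X.functionField (X.presheaf.germ Y x hx r) :=
      (Scheme.algebraMap_germ_eq_germToFunctionField X hx r).symm
    rw [h1, ← hαW]
    exact (α _).2
  have hpir := isPrincipalIdealRing_stalk f x
  -- A local ring that is a field would be the whole function field, and `W` would contain `r`.
  have hnf : ¬ IsField (X.presheaf.stalk x) := by
    intro hF
    obtain ⟨z, hz⟩ := (IsFractionRing.surjective_iff_isField (R := X.presheaf.stalk x)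
      (K := X.functionField)).2 hF (algebraMap (CoordRing f Y) X.functionField r)
    refine hr ?_
    rw [← hz, ← hαW]
    exact (α z).2
  have hdvr : IsDiscreteValuationRing (X.presheaf.stalk x) :=
    { not_a_field' := fun h => hnf (IsLocalRing.isField_iff_maximalIdeal_eq.2 h) }
  -- Valuation rings are maximal under domination, so `W` is equal to the local ring at `x`.
  have hb := bijective_rangeRestrict_comp_of_valuationRing (K := X.functionField) α W.subtype hαW
  have hbij : Function.Bijective α := by
    refine ⟨fun a b hab => hb.1 ?_, fun w => ?_⟩
    · rw [RingHom.comp_apply, RingHom.comp_apply, hab]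
    · obtain ⟨z, hz⟩ := hb.2 ⟨_, w, rfl⟩
      exact ⟨z, Subtype.ext congr(($hz : X.functionField))⟩
  refine ⟨⟨W, ?_, x, hx, ?_⟩, rfl⟩
  · exact IsDiscreteValuationRing.RingEquivClass.isDiscreteValuationRing (RingEquiv.ofBijective α hbij)
  · ext z
    constructor
    · intro hz
      obtain ⟨y, hy⟩ := hbij.2 ⟨z, hz⟩
      exact ⟨y, by rw [← hαW, RingHom.comp_apply, hy]; rfl⟩
    · rintro ⟨y, rfl⟩
      rw [← hαW]
      exact (α y).2

end Valuative

end Curves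

end TraceFormula

end

/-! ### The trace formula for curves. -/

theorem mainTheorem2 {k : Type u} [Field k] [Fintype k] {X : Scheme.{u}}
    (f : X ⟶ Spec (.of k)) [AlgebraicGeometry.IsIntegral X] [IsProper f]
    [SmoothOfRelativeDimension 1 f]
    (Y : X.Opens) [Nonempty Y] (hY : IsAffineOpen Y)
    (M : Type v) [AddCommGroup M] [Module (TraceFormula.CoordRing f Y) M]
    [Module k M] [IsScalarTower k (TraceFormula.CoordRing f Y) M]
    [Module.Finite (TraceFormula.CoordRing f Y) M]
    [Module.Projective (TraceFormula.CoordRing f Y) M]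
    (τ : M →ₛₗ[TraceFormula.qFrob k (TraceFormula.CoordRing f Y)] M)
    (N : M ⊗[TraceFormula.CoordRing f Y] TraceFormula.KInfty Y → ℝ)
    (hN : TraceFormula.IsTensorNorm (TraceFormula.absKInfty Y) N)
    (Ψ Θ : (TraceFormula.TwistedPoly k (TraceFormula.CoordRing f Y))⟦X⟧)
    (hΘ : Θ = Ψ * PowerSeries.C (TraceFormula.TwistedPoly.tau k (TraceFormula.CoordRing f Y)) *
      PowerSeries.X) :
    ∃ D : k⟦X⟧,
      TraceFormula.IsFredholmDet (TraceFormula.quotientNorm N)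
        (TraceFormula.seriesAction (TraceFormula.tauCoker (TraceFormula.KInfty Y) τ) Θ) D ∧
      IsUnit D ∧
      letI : TopologicalSpace k := ⊥
      HasProd (fun m : MaximalSpectrum (TraceFormula.CoordRing f Y) =>
        TraceFormula.finDet
          (TraceFormula.seriesAction (TraceFormula.tauModIdeal τ m.asIdeal) Θ)) D⁻¹ := by
  have hint := TraceFormula.not_isIntegral_coordRing f hY
  have hft := TraceFormula.finiteType_coordRing f hY
  have hfrac := TraceFormula.isFractionRing_coordRing f hY
  -- Noether normalization: the image of the variable under `g` is the function `t` over which `R`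
  -- is finite.
  obtain ⟨g, hg, hgf⟩ := TraceFormula.exists_polynomial_finite_injective k
    (TraceFormula.CoordRing f Y) (TraceFormula.isMaximal_of_ne_bot_coordRing f hY) hint
  let : Algebra (Polynomial k) (TraceFormula.CoordRing f Y) := g.toRingHom.toAlgebra
  have : IsScalarTower k (Polynomial k) (TraceFormula.CoordRing f Y) :=
    IsScalarTower.of_algebraMap_eq fun c => (g.commutes c).symm
  have : Module.Finite (Polynomial k) (TraceFormula.CoordRing f Y) := hgf
  refine TraceFormula.exists_isFredholmDet_hasProd (K := X.functionField)
    (fun p : TraceFormula.PlacesOutside Y => p.1) hg Subtype.val_injective (fun p => ?_)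
    (fun W hW => TraceFormula.exists_place_eq hY W hW) (RingEquiv.refl _) (fun r p => rfl)
    τ N hN Ψ Θ hΘ
  obtain ⟨x, hx, hA⟩ := p.2.2
  exact TraceFormula.exists_notMem_of_range_stalk_eq hY p.1 x hx hA
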